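/- **Notation.** On $\mathbb R^{1+3}$ with points $(t,x)$, $\partial$ denotes the spatial derivatives $\partial_1,\partial_2,\partial_3$, $\pmb\partial$ the space-time derivatives $\partial_0=\partial_t,\partial_1,\partial_2,\partial_3$, and $\Sigma_t=\{t\}\times\mathbb R^3$. For $s\ge 0$ let $\|F\|_{H^s(\Sigma_t)}=\|(1+|\xi|^2)^{s/2}\hat F(\xi)\|_{L^2}$, where $\hat F(\xi)=\int e^{-2\pi i x\cdot\xi}F(x)\,dx$; the norm of an array is the sum of the norms of its components, and $\pmb\partial^k$ is the array of all space-time derivatives of order $k$. Fix a smooth radial $\chi:\mathbb R^3\to[0,1]$ supported in $\{1/2\le|\xi|\le 2\}$ with $\sum_{k\in\mathbb Z}\chi(2^k\xi)=1$ for $\xi\ne0$, and let $P_\nu F(x)=\int e^{2\pi i x\cdot\xi}\chi(\nu^{-1}\xi)\hat F(\xi)\,d\xi$. **System.** Let $c_1>c_2>0$, and let $$\mathbf g^{-1}=-\partial_t\otimes\partial_t+\sum_{j,k}\big(c_1^2\delta^{jk}+f_{\mathbf g}^{jk}(\partial\vec\phi,\partial\vec\psi)\big)\partial_j\otimes\partial_k,\qquad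 \mathbf h^{-1}=-\partial_t\otimes\partial_t+\sum_{j,k}\big(c_2^2\delta^{jk}+f_{\mathbf h}^{jk}(\partial\vec\psi)\big)\partial_j\otimes\partial_k,$$ where $f_{\mathbf g},f_{\mathbf h}$ are smooth and symmetric in $(j,k)$. Let $\hat\square_{\mathbf g}=(\mathbf g^{-1})^{\alpha\beta}\partial_\alpha\partial_\beta$ and $\square_{\mathbf h}u=|\det\mathbf h|^{-1/2}\partial_\alpha(|\det\mathbf h|^{1/2}(\mathbf h^{-1})^{\alpha\beta}\partial_\beta u)$. Vector fields $\vec\phi,\vec\psi:[0,T_*]\times\mathbb R^3\to\mathbb R^3$ solve the system if $$\hat\square_{\mathbf g}(\operatorname{div}\vec\phi)=f_1(\partial\vec\phi,\partial\vec\psi)\cdot(\partial^2\vec\phi,\partial^2\vec\psi)\cdot(\partial^2\vec\phi,\partial^2\vec\psi)+f_2(\partial\vec\phi,\partial\vec\psi)\cdot(\partial\vec\phi,\partial\vec\psi)\cdot\partial^3\vec\psi,\qquad \operatorname{curl}\vec\phi=0,$$ $$\square_{\mathbf h}(\operatorname{curl}\vec\psi)^i=f_3^i(\partial\vec\psi)\cdot\partial^2\vec\psi\cdot\partial^2\vec\psi\quad(i=1,2,3),\qquad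 \operatorname{div}\vec\psi=0,$$ where $f_1,f_2,f_3^i$ are arrays of smooth coefficient functions. A solution is called smooth if $\vec\phi,\vec\psi$ are $C^\infty$ on $[0,T_*]\times\mathbb R^3$ and every space-time derivative of $\partial\vec\phi$ and of $\partial\vec\psi$ is bounded in $L^2(\Sigma_t)$ uniformly for $t\in[0,T_*]$. **Hyperbolicity.** Let $\mathcal R\subset\mathbb R^{18}$ be the set of values of $(\partial\vec\phi,\partial\vec\psi)$ at which the metrics $g,h$ induced on $\Sigma_t$ by $\mathbf g,\mathbf h$ are Riemannian and $g-h$ is elliptic, i.e. for some $c>0$ and all $\xi\in\mathbb R^3$, $c^{-1}|\xi|^2\le(g^{-1}-h^{-1})^{ij}\xi_i\xi_j\le c|\xi|^2$ and $-c|\xi|^2\le(g-h)_{ij}\xi^i\xi^j\le-c^{-1}|\xi|^2$. **Proposition.** Let $3<N<7/2$, $\delta_0=\big(\tfrac{N-3}{10}\big)^2$, and let $\breve{\mathcal R}\subset\operatorname{int}\mathcal R$ be compact. There is a constant $C>0$, depending only on the system, $\chi$, $N$ and $\breve{\mathcal R}$, such that for every $D>0$ there is $T_0>0$ (depending on the same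 objects and on $D$) with the following property. Let $0<T_*\le T_0$, and let $(\vec\phi,\vec\psi)$ be a smooth solution on $[0,T_*]\times\mathbb R^3$ that satisfies 1. (data) for $i=1,2,3$: $\sum_{k=0}^2\|\pmb\partial^k\partial\phi^i\|_{H^{N-k-1}(\Sigma_0)}\le D$ and $\sum_{l=0}^3\|\pmb\partial^l\partial\psi^i\|_{H^{N-l}(\Sigma_0)}\le D$, and $(\partial\vec\phi,\partial\vec\psi)(\Sigma_0)\subset\operatorname{int}\breve{\mathcal R}$; 2. (bootstrap) $(\partial\vec\phi,\partial\vec\psi)\in\mathcal R$ on $[0,T_*]\times\mathbb R^3$, and $$\|\pmb\partial\partial\vec\phi\|^2_{L^2_tL^\infty_x([0,T_*]\times\mathbb R^3)}+\sum_{\nu\ge2\text{ dyadic}}\nu^{2\delta_0}\|P_\nu\pmb\partial\partial\vec\phi\|^2_{L^2_tL^\infty_x([0,T_*]\times\mathbb R^3)}\le1 .$$ Then for every $t\in[0,T_*]$, $$\sum_{k=0}^2\|\pmb\partial^k\partial\vec\phi\|_{H^{N-k-1}(\Sigma_t)}\le C(D+1).$$ -/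

import Mathlib

open MeasureTheory Set
open scoped ENNReal ContDiff FourierTransform

noncomputable section

namespace ElasticWave

/-! ### Space-time and partial derivatives -/

/-- Euclidean space `ℝ³`. -/
abbrev Space := EuclideanSpace ℝ (Fin 3)

/-- Space-time `ℝ^{1+3}`, with points `(t, x)`. -/
abbrev Spacetime := ℝ × Space

/-- The coordinate directions: `dir 0` is the time direction, `dir j.succ` the `j`-th spatial
direction. -/
def dir : Fin 4 → Spacetime :=
  Fin.cons ((1 : ℝ), (0 : Space)) fun j : Fin 3 => ((0 : ℝ), EuclideanSpace.single j (1 : ℝ))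

/-- The space-time partial derivative `∂_α u`. -/
def pd (α : Fin 4) (u : Spacetime → ℝ) : Spacetime → ℝ := fun p => fderiv ℝ u p (dir α)

/-- The spatial partial derivative `∂_j u`. -/
def sd (j : Fin 3) (u : Spacetime → ℝ) : Spacetime → ℝ := pd j.succ u

/-- The iterated space-time derivative `∂_{α 0} ⋯ ∂_{α (k-1)} u`. -/
def pdIter {k : ℕ} (α : Fin k → Fin 4) (u : Spacetime → ℝ) : Spacetime → ℝ :=
  (List.ofFn α).foldr pd u

/-- The restriction of `u` to the slice `Σ_t = {t} × ℝ³`. -/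
def slice (t : ℝ) (u : Spacetime → ℝ) : Space → ℝ := fun x => u (t, x)

/-- Values of the spatial gradient of a vector field, `(∂_j V^i)_{j,i}`. -/
abbrev Grad := Fin 3 → Fin 3 → ℝ

/-- Values of the second spatial derivatives of a vector field, `(∂_j ∂_k V^i)_{j,k,i}`. -/
abbrev Hess := Fin 3 → Fin 3 → Fin 3 → ℝ

/-- Values of the third spatial derivatives of a vector field, `(∂_j ∂_k ∂_l V^i)_{j,k,l,i}`. -/
abbrev Third := Fin 3 → Fin 3 → Fin 3 → Fin 3 → ℝ

/-- A time-dependent vector field on `ℝ³`, by its components. -/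
abbrev Field := Fin 3 → Spacetime → ℝ

def grad (V : Field) (p : Spacetime) : Grad := fun j i => sd j (V i) p

def hess (V : Field) (p : Spacetime) : Hess := fun j k i => sd j (sd k (V i)) p

def third (V : Field) (p : Spacetime) : Third := fun j k l i => sd j (sd k (sd l (V i))) p

def div (V : Field) : Spacetime → ℝ := fun p => ∑ i, sd i (V i) p

/-- `(curl V)^i = ε_{iab} ∂_a V^b`; the index arithmetic is cyclic in `Fin 3`. -/
def curl (V : Field) : Field :=
  fun i p => sd (i + 1) (V (i + 2)) p - sd (i + 2) (V (i + 1)) p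

/-! ### Wave operators -/

/-- The inverse metric `-∂_t ⊗ ∂_t + ∑ A^{jk} ∂_j ⊗ ∂_k`. -/
def lorentz (A : Matrix (Fin 3) (Fin 3) ℝ) : Matrix (Fin 4) (Fin 4) ℝ :=
  Matrix.of (Fin.cons (Fin.cons (-1) fun _ => 0) fun j => Fin.cons 0 fun k => A j k)

/-- The reduced wave operator `(g⁻¹)^{αβ} ∂_α ∂_β u`; `gi` is the field of inverse metrics. -/
def reducedBox (gi : Spacetime → Matrix (Fin 4) (Fin 4) ℝ) (u : Spacetime → ℝ) :
    Spacetime → ℝ :=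
  fun p => ∑ α, ∑ β, gi p α β * pd α (pd β u) p

/-- The volume density `√|det g|` of the metric whose inverse is `gi`. -/
def density (gi : Spacetime → Matrix (Fin 4) (Fin 4) ℝ) : Spacetime → ℝ :=
  fun p => √|((gi p)⁻¹).det|

/-- The Laplace-Beltrami operator `|det g|^{-1/2} ∂_α (|det g|^{1/2} (g⁻¹)^{αβ} ∂_β u)`. -/
def geometricBox (gi : Spacetime → Matrix (Fin 4) (Fin 4) ℝ) (u : Spacetime → ℝ) :
    Spacetime → ℝ :=
  fun p => (density gi p)⁻¹ *
    ∑ α, pd α (fun q => density gi q * ∑ β, gi q α β * pd β u q) p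

/-! ### The system -/

/-- The data that specify a faster-wave / slower-wave system: the two speeds and the smooth
coefficient functions of the two metrics and of the inhomogeneous terms. A coefficient array that
is contracted with two arrays `B`, `C` is a bilinear form in `(B, C)`. -/
structure WaveSystem where
  c₁ : ℝ
  c₂ : ℝ
  c₂_pos : 0 < c₂
  c₂_lt_c₁ : c₂ < c₁
  /-- perturbation of the faster metric, a function of `(∂φ, ∂ψ)` -/
  fg : Grad × Grad → Grad
  fg_smooth : ContDiff ℝ ∞ fg
  fg_symm : ∀ P j k, fg P j k = fg P k j
  /-- perturbation of the slower metric, a function of `∂ψ` -/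
  fh : Grad → Grad
  fh_smooth : ContDiff ℝ ∞ fh
  fh_symm : ∀ P j k, fh P j k = fh P k j
  /-- coefficients of `(∂²φ, ∂²ψ) · (∂²φ, ∂²ψ)` in the faster-wave equation -/
  quadDiv : Grad × Grad → (Hess × Hess) →L[ℝ] (Hess × Hess) →L[ℝ] ℝ
  quadDiv_smooth : ContDiff ℝ ∞ quadDiv
  /-- coefficients of `(∂φ, ∂ψ) · ∂³ψ` in the faster-wave equation -/
  linDiv : Grad × Grad → (Grad × Grad) →L[ℝ] Third →L[ℝ] ℝ
  linDiv_smooth : ContDiff ℝ ∞ linDiv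
  /-- coefficients of `∂²ψ · ∂²ψ` in the `i`-th slower-wave equation -/
  quadCurl : Fin 3 → Grad → Hess →L[ℝ] Hess →L[ℝ] ℝ
  quadCurl_smooth : ∀ i, ContDiff ℝ ∞ (quadCurl i)

namespace WaveSystem

variable (S : WaveSystem)

/-- Spatial block `c₁² δ^{jk} + f^{jk}(∂φ, ∂ψ)` of the inverse of the faster metric; this is the
inverse of the metric `g` induced on `Σ_t`. -/
def gInv (P : Grad × Grad) : Matrix (Fin 3) (Fin 3) ℝ :=
  Matrix.of fun j k => (if j = k then S.c₁ ^ 2 else 0) + S.fg P j k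

/-- Spatial block `c₂² δ^{jk} + f^{jk}(∂ψ)` of the inverse of the slower metric; this is the
inverse of the metric `h` induced on `Σ_t`. -/
def hInv (P : Grad) : Matrix (Fin 3) (Fin 3) ℝ :=
  Matrix.of fun j k => (if j = k then S.c₂ ^ 2 else 0) + S.fh P j k

end WaveSystem

/-- `g - h` is elliptic, where `A = g⁻¹` and `B = h⁻¹` are inverses of Riemannian metrics (that is,
the corresponding space-time metrics are Lorentzian). -/
def IsEllipticDiff (A B : Matrix (Fin 3) (Fin 3) ℝ) : Prop :=
  A.PosDef ∧ B.PosDef ∧ ∃ C : ℝ, 0 < C ∧ ∀ ξ : Fin 3 → ℝ,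
    C⁻¹ * (ξ ⬝ᵥ ξ) ≤ ξ ⬝ᵥ ((A - B).mulVec ξ) ∧
    ξ ⬝ᵥ ((A - B).mulVec ξ) ≤ C * (ξ ⬝ᵥ ξ) ∧
    -C * (ξ ⬝ᵥ ξ) ≤ ξ ⬝ᵥ ((A⁻¹ - B⁻¹).mulVec ξ) ∧
    ξ ⬝ᵥ ((A⁻¹ - B⁻¹).mulVec ξ) ≤ -C⁻¹ * (ξ ⬝ᵥ ξ)

/-- The regime of hyperbolicity `ℛ ⊆ ℝ¹⁸`. -/
def WaveSystem.regime (S : WaveSystem) : Set (Grad × Grad) :=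
  {P | IsEllipticDiff (S.gInv P) (S.hInv P.2)}

/-- `V` is smooth on `[0,T] × ℝ³`, up to the boundary (so it is given with a smooth extension to
`ℝ × ℝ³`), and all space-time derivatives of `∂V` are bounded in `L²(Σ_t)` for `t ∈ [0,T]`. -/
def IsSmoothField (T : ℝ) (V : Field) : Prop :=
  (∀ i, ContDiff ℝ ∞ (V i)) ∧
  ∀ (k : ℕ) (α : Fin k → Fin 4) (j i : Fin 3), ∃ M : ℝ, ∀ t ∈ Icc 0 T,
    eLpNorm (slice t (pdIter α (sd j (V i)))) 2 volume ≤ ENNReal.ofReal M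

/-- `φ` is a smooth solution on `[0,T] × ℝ³` of the faster-wave system and `ψ` one of the
slower-wave system. -/
structure IsSolution (S : WaveSystem) (T : ℝ) (φ ψ : Field) : Prop where
  smooth_div : IsSmoothField T φ
  smooth_curl : IsSmoothField T ψ
  faster : ∀ p : Spacetime, p.1 ∈ Icc 0 T →
    reducedBox (fun q => lorentz (S.gInv (grad φ q, grad ψ q))) (div φ) p =
      S.quadDiv (grad φ p, grad ψ p) (hess φ p, hess ψ p) (hess φ p, hess ψ p) +
      S.linDiv (grad φ p, grad ψ p) (grad φ p, grad ψ p) (third ψ p)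
  curl_eq_zero : ∀ p : Spacetime, p.1 ∈ Icc 0 T → ∀ i, curl φ i p = 0
  slower : ∀ p : Spacetime, p.1 ∈ Icc 0 T → ∀ i,
    geometricBox (fun q => lorentz (S.hInv (grad ψ q))) (curl ψ i) p =
      S.quadCurl i (grad ψ p) (hess ψ p) (hess ψ p)
  div_eq_zero : ∀ p : Spacetime, p.1 ∈ Icc 0 T → div ψ p = 0

/-! ### Norms and Littlewood-Paley projections -/

open Classical in
/-- The Fourier transform `∫ e^{-2πi x·ξ} F(x) dx` of `F ∈ L²(ℝ³)`, in the sense of Plancherel. -/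
def fourierL2 (F : Space → ℝ) : Space → ℂ :=
  if hF : MemLp (fun x => (F x : ℂ)) 2 volume then
    ((𝓕 (hF.toLp (fun x => (F x : ℂ))) : Lp ℂ 2 (volume : Measure Space)) : Space → ℂ)
  else 0

open Classical in
/-- The Sobolev norm `‖⟨ξ⟩^s F̂‖_{L²}` for `s ≥ 0`; it is `∞` if `F ∉ L²`. -/
def sobolevNorm (s : ℝ) (F : Space → ℝ) : ℝ≥0∞ :=
  if MemLp F 2 volume then
    eLpNorm (fun ξ : Space => (((1 + ‖ξ‖ ^ 2) ^ (s / 2) : ℝ) : ℂ) * fourierL2 F ξ) 2 volume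
  else ⊤

/-- `‖∂^k ∂u‖_{H^s(Σ_t)}`: the sum over all components, `k` space-time derivatives and one spatial
derivative. -/
def derivSobolev (k : ℕ) (s : ℝ) (u : Spacetime → ℝ) (t : ℝ) : ℝ≥0∞ :=
  ∑ α : Fin k → Fin 4, ∑ j : Fin 3, sobolevNorm s (slice t (pdIter α (sd j u)))

/-- `∑_{k=0}^{2} ‖∂^k ∂u‖_{H^{N-k-1}(Σ_t)}`. -/
def divNorm (N : ℝ) (u : Spacetime → ℝ) (t : ℝ) : ℝ≥0∞ :=
  ∑ k ∈ Finset.range 3, derivSobolev k (N - k - 1) u t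

/-- `∑_{l=0}^{3} ‖∂^l ∂u‖_{H^{N-l}(Σ_t)}`. -/
def curlNorm (N : ℝ) (u : Spacetime → ℝ) (t : ℝ) : ℝ≥0∞ :=
  ∑ l ∈ Finset.range 4, derivSobolev l (N - l) u t

/-- A radial Littlewood-Paley cutoff. -/
structure LPCutoff where
  χ : Space → ℝ
  smooth : ContDiff ℝ ∞ χ
  radial : ∀ ξ η : Space, ‖ξ‖ = ‖η‖ → χ ξ = χ η
  mem_Icc : ∀ ξ, χ ξ ∈ Icc (0 : ℝ) 1
  support_subset : ∀ ξ, χ ξ ≠ 0 → 1 / 2 ≤ ‖ξ‖ ∧ ‖ξ‖ ≤ 2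
  partition : ∀ ξ, ξ ≠ 0 → HasSum (fun k : ℤ => χ ((2 : ℝ) ^ k • ξ)) 1

/-- The projection `P_ν F(x) = ∫ e^{2πi x·ξ} χ(ν⁻¹ξ) F̂(ξ) dξ`. -/
def LPCutoff.proj (X : LPCutoff) (ν : ℝ) (F : Space → ℝ) : Space → ℂ :=
  𝓕⁻ (fun ξ : Space => ((X.χ (ν⁻¹ • ξ) : ℝ) : ℂ) * fourierL2 F ξ)

/-- The norm `‖F‖_{L²_t L^∞_x([0,T] × ℝ³)}`. -/
def normL2Linf {E : Type*} [NormedAddCommGroup E] (T : ℝ) (F : ℝ → Space → E) : ℝ≥0∞ :=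
  (∫⁻ τ in Icc 0 T, eLpNorm (F τ) ∞ volume ^ 2) ^ (1 / 2 : ℝ)

/-! ### Assumptions -/

/-- The assumptions along `Σ_0`: the Sobolev bounds by `D`, and the data take values in the
interior of `K`. -/
structure DataAssumptions (N D : ℝ) (K : Set (Grad × Grad)) (φ ψ : Field) : Prop where
  div_le : ∀ i, divNorm N (φ i) 0 ≤ ENNReal.ofReal D
  curl_le : ∀ i, curlNorm N (ψ i) 0 ≤ ENNReal.ofReal D
  mem : ∀ x : Space, (grad φ (0, x), grad ψ (0, x)) ∈ interior K

/-- The parameter `δ₀ = ε₀²`, where `ε₀ = (N - 3) / 10`. -/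
def delta₀ (N : ℝ) : ℝ := ((N - 3) / 10) ^ 2

/-- The bootstrap assumptions on `[0,T] × ℝ³`; the dyadic frequencies `ν ≥ 2` are `2 ^ (n + 1)`. -/
structure BootstrapAssumptions (S : WaveSystem) (X : LPCutoff) (N T : ℝ) (φ ψ : Field) :
    Prop where
  mem_regime : ∀ p : Spacetime, p.1 ∈ Icc 0 T → (grad φ p, grad ψ p) ∈ S.regime
  strichartz :
    (∑ α : Fin 4, ∑ j : Fin 3, ∑ i : Fin 3,
        normL2Linf T (fun τ => slice τ (pd α (sd j (φ i))))) ^ 2 +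
      ∑' n : ℕ, ENNReal.ofReal (((2 : ℝ) ^ (n + 1)) ^ (2 * delta₀ N)) *
        (∑ α : Fin 4, ∑ j : Fin 3, ∑ i : Fin 3,
          normL2Linf T (fun τ => X.proj ((2 : ℝ) ^ (n + 1)) (slice τ (pd α (sd j (φ i)))))) ^ 2
      ≤ 1

end ElasticWave

end

open MeasureTheory Set
open scoped ENNReal ContDiff FourierTransform NNReal

noncomputable section

namespace ElasticWave

section

/-! ### The Fourier transform on `L²` -/

open SchwartzMap

lemma fourierL2_eq {F : Space → ℝ} (hF : MemLp F 2 volume) :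
    fourierL2 F = ((𝓕 (hF.ofReal.toLp (fun x => (F x : ℂ))) :
      Lp ℂ 2 (volume : Measure Space)) : Space → ℂ) := by
  have h : MemLp (fun x => (F x : ℂ)) 2 volume := hF.ofReal
  unfold fourierL2
  exact dif_pos h

lemma memLp_fourierL2 {F : Space → ℝ} (hF : MemLp F 2 volume) :
    MemLp (fourierL2 F) 2 volume := by
  rw [fourierL2_eq hF]; exact Lp.memLp _

lemma fourierL2_pairing {F : Space → ℝ} (hF : MemLp F 2 volume) (η : 𝓢(Space, ℂ)) :
    ∫ ξ, η ξ * fourierL2 F ξ = ∫ x, (𝓕 η) x * (F x : ℂ) := by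
  have h := Lp.fourier_toTemperedDistribution_eq (hF.ofReal.toLp (fun x => (F x : ℂ)))
  have h' := congrArg (fun d : TemperedDistribution Space ℂ => d η) h
  simp only [TemperedDistribution.fourier_apply, Lp.toTemperedDistribution_apply, smul_eq_mul]
    at h'
  rw [fourierL2_eq hF]
  refine h'.symm.trans (integral_congr_ae ?_)
  filter_upwards [hF.ofReal.coeFn_toLp (f := fun x => (F x : ℂ))] with x hx
  rw [hx]

lemma fourierL2_unique {F : Space → ℝ} (hF : MemLp F 2 volume) {g : Space → ℂ}
    (hg : LocallyIntegrable g volume)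
    (h : ∀ η : 𝓢(Space, ℂ), HasCompactSupport η →
      ∫ ξ, η ξ * g ξ = ∫ x, (𝓕 η) x * (F x : ℂ)) :
    g =ᵐ[volume] fourierL2 F := by
  refine ae_eq_of_integral_contDiff_smul_eq hg
    ((memLp_fourierL2 hF).locallyIntegrable (by norm_num)) fun η h1 h2 => ?_
  have hg₁ : HasCompactSupport (Complex.ofRealCLM ∘ η) := h2.comp_left rfl
  have hg₂ : ContDiff ℝ ∞ (Complex.ofRealCLM ∘ η) := by fun_prop
  have := h (hg₁.toSchwartzMap hg₂) hg₁
  rw [← fourierL2_pairing hF] at this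
  simpa using this

lemma eLpNorm_fourierL2 {F : Space → ℝ} (hF : MemLp F 2 volume) :
    eLpNorm (fourierL2 F) 2 volume = eLpNorm F 2 volume := by
  rw [fourierL2_eq hF]
  have h1 := Lp.norm_fourier_eq (hF.ofReal.toLp (fun x => (F x : ℂ)))
  rw [Lp.norm_def, Lp.norm_def, ENNReal.toReal_eq_toReal_iff' (Lp.eLpNorm_ne_top _)
    (Lp.eLpNorm_ne_top _)] at h1
  refine h1.trans ((eLpNorm_congr_ae hF.ofReal.coeFn_toLp).trans ?_)
  exact eLpNorm_congr_norm_ae (Filter.Eventually.of_forall fun x => by simp)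

lemma fourierL2_add {F G : Space → ℝ} (hF : MemLp F 2 volume) (hG : MemLp G 2 volume) :
    fourierL2 (fun x => F x + G x) =ᵐ[volume] fun ξ => fourierL2 F ξ + fourierL2 G ξ := by
  have hFG : MemLp (fun x => F x + G x) 2 volume := hF.add hG
  rw [fourierL2_eq hF, fourierL2_eq hG, fourierL2_eq hFG]
  have : hFG.ofReal.toLp (fun x => ((F x + G x : ℝ) : ℂ)) =
      hF.ofReal.toLp (fun x => (F x : ℂ)) + hG.ofReal.toLp (fun x => (G x : ℂ)) := by
    rw [← MemLp.toLp_add]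
    exact MemLp.toLp_congr _ _ (Filter.Eventually.of_forall fun x => by simp)
  erw [this]
  rw [FourierTransform.fourier_add]
  exact Lp.coeFn_add _ _

lemma fourierL2_const_mul {F : Space → ℝ} (hF : MemLp F 2 volume) (c : ℝ) :
    fourierL2 (fun x => c * F x) =ᵐ[volume] fun ξ => (c : ℂ) * fourierL2 F ξ := by
  have hc : MemLp (fun x => c * F x) 2 volume := hF.const_mul c
  rw [fourierL2_eq hF, fourierL2_eq hc]
  have : hc.ofReal.toLp (fun x => ((c * F x : ℝ) : ℂ)) =
      (c : ℂ) • hF.ofReal.toLp (fun x => (F x : ℂ)) := by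
    rw [← MemLp.toLp_const_smul]
    exact MemLp.toLp_congr _ _ (Filter.Eventually.of_forall fun x => by simp)
  erw [this]
  rw [FourierTransform.fourier_smul]
  exact Lp.coeFn_smul _ _

/-- The phase `e^{2πi h·ξ}` of the translation by `h`. -/
def phase (h ξ : Space) : ℂ := Complex.exp ((2 * Real.pi * inner ℝ h ξ : ℝ) * Complex.I)

lemma norm_phase (h ξ : Space) : ‖phase h ξ‖ = 1 := Complex.norm_exp_ofReal_mul_I _

lemma contDiff_phase (h : Space) : ContDiff ℝ ∞ (phase h) := by
  unfold phase
  have : ContDiff ℝ ∞ (fun ξ : Space => ((2 * Real.pi * inner ℝ h ξ : ℝ) : ℂ)) :=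
    Complex.ofRealCLM.contDiff.comp (contDiff_const.mul (contDiff_const.inner ℝ contDiff_id))
  exact (this.mul contDiff_const).cexp

lemma memLp_translate {F : Space → ℝ} (hF : MemLp F 2 volume) (h : Space) :
    MemLp (fun x => F (x + h)) 2 volume :=
  hF.comp_measurePreserving (measurePreserving_add_right volume h)

lemma eLpNorm_translate {F : Space → ℝ} (hF : AEStronglyMeasurable F volume) (h : Space)
    (p : ℝ≥0∞) :
    eLpNorm (fun x => F (x + h)) p volume = eLpNorm F p volume :=
  eLpNorm_comp_measurePreserving hF (measurePreserving_add_right volume h)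

lemma fourierL2_translate {F : Space → ℝ} (hF : MemLp F 2 volume) (h : Space) :
    fourierL2 (fun x => F (x + h)) =ᵐ[volume] fun ξ => phase h ξ * fourierL2 F ξ := by
  refine (fourierL2_unique (memLp_translate hF h) ?_ fun η hη => ?_).symm
  · refine MemLp.locallyIntegrable (p := 2) ?_ (by norm_num)
    refine (memLp_fourierL2 hF).of_le
      (((contDiff_phase h).continuous.aestronglyMeasurable).mul
        (memLp_fourierL2 hF).aestronglyMeasurable) (Filter.Eventually.of_forall fun ξ => ?_)
    simp [norm_phase]
  · have hs : HasCompactSupport (fun ξ => phase h ξ * η ξ) := hη.mul_left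
    have hd : ContDiff ℝ ∞ (fun ξ => phase h ξ * η ξ) := (contDiff_phase h).mul η.smooth'
    have key := fourierL2_pairing hF (hs.toSchwartzMap hd)
    have e1 : ∫ ξ, η ξ * (phase h ξ * fourierL2 F ξ) =
        ∫ ξ, (hs.toSchwartzMap hd) ξ * fourierL2 F ξ := by
      refine integral_congr_ae (Filter.Eventually.of_forall fun ξ => ?_)
      simp only [HasCompactSupport.toSchwartzMap_toFun]
      ring
    have e2 : ∀ x, (𝓕 (hs.toSchwartzMap hd)) x = (𝓕 η) (x - h) := by
      intro x
      rw [SchwartzMap.fourier_coe, SchwartzMap.fourier_coe, Real.fourier_eq', Real.fourier_eq']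
      refine integral_congr_ae (Filter.Eventually.of_forall fun ξ => ?_)
      simp only [HasCompactSupport.toSchwartzMap_toFun, phase, smul_eq_mul]
      rw [← mul_assoc, ← Complex.exp_add]
      congr 2
      rw [inner_sub_right, real_inner_comm ξ h]
      push_cast
      ring
    rw [e1, key]
    simp_rw [e2]
    rw [← integral_add_right_eq_self _ h]
    simp

lemma fourierL2_deriv {F : Space → ℝ} (hF : MemLp F 2 volume) (hd : Differentiable ℝ F) (v : Space)
    (hF' : MemLp (fun x => fderiv ℝ F x v) 2 volume) :
    fourierL2 (fun x => fderiv ℝ F x v) =ᵐ[volume]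
      fun ξ => (2 * Real.pi * Complex.I * (inner ℝ ξ v : ℝ)) * fourierL2 F ξ := by
  refine (fourierL2_unique hF' ?_ fun η hη => ?_).symm
  · have := (memLp_fourierL2 hF).locallyIntegrable (by norm_num)
    refine LocallyIntegrable.mono (f := fun ξ => (‖ξ‖ * ‖v‖ * (2 * Real.pi)) • fourierL2 F ξ) ?_ ?_ ?_
    · rw [← locallyIntegrableOn_univ] at this ⊢
      exact LocallyIntegrableOn.continuousOn_smul (𝕜 := ℝ) isOpen_univ.isLocallyClosed this
        (by fun_prop)
    · refine AEStronglyMeasurable.mul ?_ (memLp_fourierL2 hF).aestronglyMeasurable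
      have : Continuous fun ξ : Space =>
          (2 * Real.pi * Complex.I * ((inner ℝ ξ v : ℝ) : ℂ)) := by fun_prop
      exact this.aestronglyMeasurable
    · refine Filter.Eventually.of_forall fun ξ => ?_
      rw [norm_mul, norm_smul]
      gcongr
      rw [norm_mul, Complex.norm_real, norm_mul, norm_mul, Complex.norm_I, Complex.norm_ofNat,
        Complex.norm_real, mul_one, Real.norm_eq_abs, Real.norm_eq_abs, Real.norm_eq_abs,
        abs_of_pos Real.pi_pos, abs_of_nonneg (a := _ * _ * (2 * Real.pi)) (by positivity)]
      have := abs_real_inner_le_norm ξ v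
      nlinarith [Real.pi_pos]
  · have hT : (fun x : Space => (inner ℝ x v : ℝ)).HasTemperateGrowth :=
      ((innerSL ℝ).flip v).hasTemperateGrowth
    have key := fourierL2_pairing hF ((2 * Real.pi * Complex.I) • smulLeftCLM ℂ (inner ℝ · v) η)
    have e1 : ∫ ξ, η ξ * ((2 * Real.pi * Complex.I * (inner ℝ ξ v : ℝ)) * fourierL2 F ξ) =
        ∫ ξ, ((2 * Real.pi * Complex.I) • smulLeftCLM ℂ (inner ℝ · v) η) ξ * fourierL2 F ξ := by
      refine integral_congr_ae (Filter.Eventually.of_forall fun ξ => ?_)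
      simp only [smul_apply, smulLeftCLM_apply_apply hT, smul_eq_mul, Complex.real_smul]
      ring
    rw [e1, key]
    have e2 : 𝓕 ((2 * Real.pi * Complex.I) • smulLeftCLM ℂ (inner ℝ · v) η) =
        - LineDeriv.lineDerivOp v (𝓕 η) := by
      rw [SchwartzMap.lineDerivOp_fourier_eq, neg_smul, FourierTransform.fourier_neg, neg_neg]
    rw [e2]
    have hL : ∀ x, fderiv ℝ (fun x => (F x : ℂ)) x v = ((fderiv ℝ F x v : ℝ) : ℂ) := by
      intro x
      have := (Complex.ofRealCLM.hasFDerivAt (x := F x)).comp x (hd x).hasFDerivAt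
      have h2 : fderiv ℝ (fun x => (F x : ℂ)) x = Complex.ofRealCLM.comp (fderiv ℝ F x) :=
        this.fderiv
      rw [h2]; rfl
    have ibp := integral_mul_fderiv_eq_neg_fderiv_mul_of_integrable (μ := (volume : Measure Space))
      (f := (𝓕 η : 𝓢(Space, ℂ))) (g := fun x => (F x : ℂ)) (v := v) ?_ ?_ ?_ ?_ ?_
    · simp_rw [hL] at ibp
      rw [ibp, ← integral_neg]
      refine integral_congr_ae (Filter.Eventually.of_forall fun ξ => ?_)
      simp only [neg_apply, SchwartzMap.lineDerivOp_apply_eq_fderiv]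
      ring
    · have h1 : MemLp (fun x => fderiv ℝ (𝓕 η : 𝓢(Space, ℂ)) x v) 2 volume := by
        have := (LineDeriv.lineDerivOp v (𝓕 η) : 𝓢(Space, ℂ)).memLp 2 volume
        refine this.congr_norm ?_ (Filter.Eventually.of_forall fun x => ?_)
        · have h3 := ((𝓕 η : 𝓢(Space, ℂ)).smooth ⊤).continuous_fderiv (by simp)
          exact (h3.clm_apply continuous_const).aestronglyMeasurable
        · rw [SchwartzMap.lineDerivOp_apply_eq_fderiv]
      exact h1.integrable_mul hF.ofReal
    · simp_rw [hL]
      exact ((𝓕 η : 𝓢(Space, ℂ)).memLp 2 volume).integrable_mul hF'.ofReal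
    · exact ((𝓕 η : 𝓢(Space, ℂ)).memLp 2 volume).integrable_mul hF.ofReal
    · exact fun x _ => (𝓕 η : 𝓢(Space, ℂ)).differentiableAt
    · exact fun x _ => Complex.ofRealCLM.differentiableAt.comp x (hd x)

lemma abs_le_integral_fourierL2 {F : Space → ℝ} (hF : MemLp F 2 volume) (hc : Continuous F)
    (hi : Integrable (fourierL2 F) volume) (x : Space) :
    |F x| ≤ ∫ ξ, ‖fourierL2 F ξ‖ := by
  set c := ∫ ξ, ‖fourierL2 F ξ‖ with hcdef
  set G : Space → ℂ := 𝓕 (fun ξ => fourierL2 F (-ξ)) with hG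
  have hi' : Integrable (fun ξ => fourierL2 F (-ξ)) volume := hi.comp_neg
  have hGc : Continuous G := VectorFourier.fourierIntegral_continuous Real.continuous_fourierChar
    (by simpa using continuous_inner) hi'
  have hGb : ∀ y, ‖G y‖ ≤ c := by
    intro y
    refine (VectorFourier.norm_fourierIntegral_le_integral_norm _ _ _ _ _).trans (le_of_eq ?_)
    exact integral_neg_eq_self (fun ξ => ‖fourierL2 F ξ‖) volume
  have hFG : ∀ᵐ y ∂(volume : Measure Space), (F y : ℂ) = G y := by
    refine ae_eq_of_integral_contDiff_smul_eq
      (hF.ofReal.locallyIntegrable (by norm_num)) hGc.locallyIntegrable fun g g1 g2 => ?_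
    have hg₁ : HasCompactSupport (Complex.ofRealCLM ∘ g) := g2.comp_left rfl
    have hg₂ : ContDiff ℝ ∞ (Complex.ofRealCLM ∘ g) := by fun_prop
    set η := hg₁.toSchwartzMap hg₂ with hη
    have key := fourierL2_pairing hF (𝓕⁻ η)
    rw [FourierTransform.fourier_fourierInv_eq] at key
    have e3 : ∫ ξ, (𝓕⁻ η) ξ * fourierL2 F ξ = ∫ ξ, (𝓕 η) ξ * fourierL2 F (-ξ) := by
      rw [← integral_neg_eq_self]
      refine integral_congr_ae (Filter.Eventually.of_forall fun ξ => ?_)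
      simp only
      rw [SchwartzMap.fourierInv_coe, SchwartzMap.fourier_coe, Real.fourierInv_eq_fourier_neg, neg_neg]
    have e4 := VectorFourier.integral_fourierIntegral_smul_eq_flip (L := innerₗ Space)
      (μ := (volume : Measure Space)) (ν := (volume : Measure Space)) (f := η)
      (g := fun ξ => fourierL2 F (-ξ))
      Real.continuous_fourierChar (by simpa using continuous_inner) η.integrable hi'
    have e5 : ∀ x, g x • (F x : ℂ) = η x * (F x : ℂ) := fun x => by simp [hη]
    have e6 : ∀ x, g x • G x = η x * G x := fun x => by simp [hη]
    simp_rw [e5, e6]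
    rw [← key, e3]
    rw [flip_innerₗ] at e4
    exact e4
  have hae : ∀ᵐ y ∂(volume : Measure Space), |F y| ≤ c := by
    filter_upwards [hFG] with y hy
    have := hGb y
    rw [← hy] at this
    simpa using this
  have hcl : IsClosed {y : Space | |F y| ≤ c} := isClosed_le hc.abs continuous_const
  have hdense : Dense {y : Space | |F y| ≤ c} := Measure.dense_of_ae hae
  exact (hcl.closure_eq ▸ hdense x : _)

end

section

/-! ### Differences, weighted sums and Sobolev norms -/

/-- The `k`-th standard basis vector of `ℝ³`. -/
def bas (k : Fin 3) : Space := EuclideanSpace.single k (1 : ℝ)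

/-- The first difference `F(x + h) - F(x)`. -/
def dif (h : Space) (F : Space → ℝ) : Space → ℝ := fun x => F (x + h) - F x

/-- The dyadic length `2⁻ⁿ`. -/
def rad (n : ℕ) : ℝ := (1 / 2 : ℝ) ^ n

/-- The displacement `2⁻ⁿ e_k`. -/
def step (n : ℕ) (k : Fin 3) : Space := rad n • bas k

/-- The spatial derivative `∂_k F`. -/
def der (k : Fin 3) (F : Space → ℝ) : Space → ℝ := fun x => fderiv ℝ F x (bas k)

/-- The norm of `L²(ℝ³)`. -/
def nrm (F : Space → ℝ) : ℝ≥0∞ := eLpNorm F 2 volume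

/-- The weighted sum `∑ 4^{ns} a_n²`. -/
def wsum (s : ℝ) (a : ℕ → ℝ≥0∞) : ℝ≥0∞ := ∑' n : ℕ, ENNReal.ofReal ((4 : ℝ) ^ (n * s)) * a n ^ 2

lemma rad_pos (n : ℕ) : 0 < rad n := by unfold rad; positivity

lemma rad_le_one (n : ℕ) : rad n ≤ 1 := by
  unfold rad; exact pow_le_one₀ (by norm_num) (by norm_num)

lemma four_rpow_eq (n : ℕ) (s : ℝ) : (4 : ℝ) ^ (n * s) = rad n ^ (-2 * s) := by
  unfold rad
  rw [← Real.rpow_natCast, ← Real.rpow_mul (by norm_num), one_div,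
    Real.inv_rpow (by norm_num), ← Real.rpow_neg (by norm_num),
    show (4 : ℝ) = 2 ^ (2 : ℝ) by norm_num, ← Real.rpow_mul (by norm_num)]
  ring_nf

lemma sq_eLpNorm_two {E : Type*} [NormedAddCommGroup E] (F : Space → E) :
    eLpNorm F 2 volume ^ 2 = ∫⁻ x, ‖F x‖ₑ ^ 2 := by
  have h := eLpNorm_nnreal_pow_eq_lintegral (f := F) (μ := (volume : Measure Space)) (p := 2)
    (by norm_num)
  simpa using h

lemma sq_nrm (F : Space → ℝ) : nrm F ^ 2 = ∫⁻ x, ‖F x‖ₑ ^ 2 := sq_eLpNorm_two F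

lemma sq_nrm_fourier {F : Space → ℝ} (hF : MemLp F 2 volume) :
    nrm F ^ 2 = ∫⁻ ξ, ‖fourierL2 F ξ‖ₑ ^ 2 := by
  rw [nrm, ← eLpNorm_fourierL2 hF, sq_eLpNorm_two]

/-- The square of the Japanese bracket to the power `s`. -/
def jap (s : ℝ) (ξ : Space) : ℝ≥0∞ := ENNReal.ofReal ((1 + ‖ξ‖ ^ 2) ^ s)

lemma measurable_jap (s : ℝ) : Measurable (jap s) := by unfold jap; fun_prop

lemma sq_sobolevNorm {F : Space → ℝ} (hF : MemLp F 2 volume) (s : ℝ) :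
    sobolevNorm s F ^ 2 = ∫⁻ ξ, jap s ξ * ‖fourierL2 F ξ‖ₑ ^ 2 := by
  unfold sobolevNorm
  rw [if_pos hF, sq_eLpNorm_two]
  refine lintegral_congr fun ξ => ?_
  rw [enorm_mul, mul_pow]
  congr 1
  rw [jap, ← ofReal_norm, Complex.norm_real, Real.norm_of_nonneg (by positivity),
    ← ENNReal.ofReal_pow (by positivity), ← Real.rpow_natCast, ← Real.rpow_mul (by positivity)]
  congr 2; push_cast; ring

lemma measurable_fourierL2 {F : Space → ℝ} (hF : MemLp F 2 volume) :
    AEMeasurable (fun ξ => ‖fourierL2 F ξ‖ₑ ^ 2) volume :=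
  ((memLp_fourierL2 hF).aestronglyMeasurable.enorm).pow_const 2

lemma memLp_dif {F : Space → ℝ} (hF : MemLp F 2 volume) (h : Space) : MemLp (dif h F) 2 volume :=
  (memLp_translate hF h).sub hF

lemma memLp_dif_iterate {F : Space → ℝ} (hF : MemLp F 2 volume) (h : Space) (m : ℕ) :
    MemLp ((dif h)^[m] F) 2 volume := by
  induction m with
  | zero => exact hF
  | succ m ih => rw [Function.iterate_succ_apply']; exact memLp_dif ih h

lemma fourierL2_sub {F G : Space → ℝ} (hF : MemLp F 2 volume) (hG : MemLp G 2 volume) :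
    fourierL2 (fun x => F x - G x) =ᵐ[volume] fun ξ => fourierL2 F ξ - fourierL2 G ξ := by
  have h1 := fourierL2_add hF (hG.const_mul (-1))
  have h2 := fourierL2_const_mul hG (-1)
  have e : (fun x => F x - G x) = fun x => F x + (-1) * G x := by ext; ring
  rw [e]
  filter_upwards [h1, h2] with ξ h1 h2
  rw [h1, h2]; push_cast; ring

lemma fourierL2_dif {F : Space → ℝ} (hF : MemLp F 2 volume) (h : Space) :
    fourierL2 (dif h F) =ᵐ[volume] fun ξ => (phase h ξ - 1) * fourierL2 F ξ := by
  filter_upwards [fourierL2_sub (memLp_translate hF h) hF, fourierL2_translate hF h] with ξ h1 h2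
  unfold dif
  rw [h1, h2]; ring

lemma fourierL2_dif_iterate {F : Space → ℝ} (hF : MemLp F 2 volume) (h : Space) (m : ℕ) :
    fourierL2 ((dif h)^[m] F) =ᵐ[volume] fun ξ => (phase h ξ - 1) ^ m * fourierL2 F ξ := by
  induction m with
  | zero => exact Filter.Eventually.of_forall fun ξ => by simp
  | succ m ih =>
    rw [Function.iterate_succ_apply']
    filter_upwards [ih, fourierL2_dif (memLp_dif_iterate hF h m) h] with ξ h1 h2
    rw [h2, h1]; ring

lemma norm_phase_sub_one_le_two (h ξ : Space) : ‖phase h ξ - 1‖ ≤ 2 := by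
  refine (norm_sub_le _ _).trans ?_
  rw [norm_phase]; norm_num

lemma norm_phase_sub_one (h ξ : Space) : ‖phase h ξ - 1‖ = 2 * |Real.sin (Real.pi * inner ℝ h ξ)| := by
  have := Complex.norm_exp_I_mul_ofReal_sub_one (2 * Real.pi * inner ℝ h ξ)
  unfold phase
  rw [mul_comm, this]
  simp only [norm_mul, Real.norm_eq_abs]
  rw [abs_of_pos (by norm_num : (0:ℝ) < 2)]
  congr 3; ring

lemma norm_phase_sub_one_le (h ξ : Space) :
    ‖phase h ξ - 1‖ ≤ 2 * Real.pi * |inner ℝ h ξ| := by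
  rw [norm_phase_sub_one]
  have h1 := Real.abs_sin_le_one (Real.pi * inner ℝ h ξ)
  have h2 : |Real.sin (Real.pi * inner ℝ h ξ)| ≤ |Real.pi * inner ℝ h ξ| := Real.abs_sin_le_abs
  rw [abs_mul, abs_of_pos Real.pi_pos] at h2
  linarith

lemma inner_step (n : ℕ) (k : Fin 3) (ξ : Space) : (inner ℝ (step n k) ξ : ℝ) = rad n * ξ k := by
  unfold step bas
  rw [inner_smul_left, EuclideanSpace.inner_single_left]
  simp

lemma inner_bas (k : Fin 3) (ξ : Space) : (inner ℝ ξ (bas k) : ℝ) = ξ k := by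
  unfold bas
  rw [EuclideanSpace.inner_single_right]
  simp

lemma abs_coord_le (k : Fin 3) (ξ : Space) : |ξ k| ≤ ‖ξ‖ := by
  have := PiLp.norm_apply_le ξ k
  simpa using this

lemma sum_range_four_pow_le {s : ℝ} (hs : 0 < s) (N : ℕ) :
    ∑ n ∈ Finset.range (N + 1), (4 : ℝ) ^ ((n : ℝ) * s) ≤
      (1 - (4 : ℝ) ^ (-s))⁻¹ * (4 : ℝ) ^ ((N : ℝ) * s) := by
  have hp0 : 0 < (4 : ℝ) ^ (-s) := by positivity
  have hp1 : (4 : ℝ) ^ (-s) < 1 :=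
    Real.rpow_lt_one_of_one_lt_of_neg (by norm_num) (by linarith)
  have e : ∀ j ∈ Finset.range (N + 1), (4 : ℝ) ^ (((N - j : ℕ) : ℝ) * s) =
      ((4 : ℝ) ^ (-s)) ^ j * (4 : ℝ) ^ ((N : ℝ) * s) := by
    intro j hj
    have hj' : j ≤ N := by simpa [Nat.lt_succ_iff] using hj
    rw [← Real.rpow_natCast ((4 : ℝ) ^ (-s)), ← Real.rpow_mul (by norm_num),
      ← Real.rpow_add (by norm_num), Nat.cast_sub hj']
    congr 1; ring
  rw [← Finset.sum_range_reflect]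
  simp only [Nat.add_sub_cancel]
  rw [Finset.sum_congr rfl e, ← Finset.sum_mul]
  gcongr
  rw [← tsum_geometric_of_lt_one hp0.le hp1]
  exact Summable.sum_le_tsum _ (fun _ _ => by positivity)
    (summable_geometric_of_lt_one hp0.le hp1)

lemma tsum_tail_four_pow_le {s : ℝ} {m : ℕ} (hm : s < m) {a : ℝ} (ha : 0 ≤ a) {N : ℕ}
    (hN : a ≤ 2 ^ (N + 1)) :
    ∑' n : ℕ, ENNReal.ofReal ((4 : ℝ) ^ (((n + (N + 1) : ℕ) : ℝ) * s) *
      (min 1 (rad (n + (N + 1)) * a)) ^ (2 * m)) ≤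
        ENNReal.ofReal (4 ^ m * (1 - (4 : ℝ) ^ (s - m))⁻¹ * (4 : ℝ) ^ ((N : ℝ) * s)) := by
  have hq0 : 0 < (4 : ℝ) ^ (s - m) := by positivity
  have hq1 : (4 : ℝ) ^ (s - m) < 1 :=
    Real.rpow_lt_one_of_one_lt_of_neg (by norm_num) (by linarith)
  have hterm : ∀ n : ℕ, (4 : ℝ) ^ (((n + (N + 1) : ℕ) : ℝ) * s) *
      (min 1 (rad (n + (N + 1)) * a)) ^ (2 * m) ≤
      4 ^ m * (4 : ℝ) ^ ((N : ℝ) * s) * ((4 : ℝ) ^ (s - m)) ^ n := by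
    intro n
    have h1 : min 1 (rad (n + (N + 1)) * a) ≤ rad n := by
      refine (min_le_right _ _).trans ?_
      rw [show rad (n + (N + 1)) = rad n * rad (N + 1) by unfold rad; rw [pow_add], mul_assoc]
      have : rad (N + 1) * a ≤ 1 := by
        unfold rad
        rw [one_div, inv_pow, inv_mul_le_iff₀ (by positivity), mul_one]
        exact hN
      exact mul_le_of_le_one_right (rad_pos n).le this
    have h0 : 0 ≤ min 1 (rad (n + (N + 1)) * a) :=
      le_min zero_le_one (mul_nonneg (rad_pos _).le ha)
    have h2 : (rad n) ^ (2 * m) = (4 : ℝ) ^ (-(n : ℝ) * m) := by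
      have := four_rpow_eq n (-(m : ℝ))
      rw [show -(n : ℝ) * m = n * (-(m : ℝ)) by ring, this, ← Real.rpow_natCast]
      congr 1; push_cast; ring
    calc _ ≤ (4 : ℝ) ^ (((n + (N + 1) : ℕ) : ℝ) * s) * rad n ^ (2 * m) :=
          mul_le_mul_of_nonneg_left (pow_le_pow_left₀ h0 h1 _) (by positivity)
      _ = (4 : ℝ) ^ s * (4 : ℝ) ^ ((N : ℝ) * s) * ((4 : ℝ) ^ (s - m)) ^ n := by
        rw [h2, ← Real.rpow_natCast ((4 : ℝ) ^ (s - m)), ← Real.rpow_mul (by norm_num),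
          ← Real.rpow_add (by norm_num), ← Real.rpow_add (by norm_num),
          ← Real.rpow_add (by norm_num)]
        congr 1; push_cast; ring
      _ ≤ _ := by
        have : (4 : ℝ) ^ s ≤ 4 ^ m := by
          rw [← Real.rpow_natCast]
          exact Real.rpow_le_rpow_of_exponent_le (by norm_num) hm.le
        exact mul_le_mul_of_nonneg_right (mul_le_mul_of_nonneg_right this (by positivity))
          (by positivity)
  calc _ ≤ ∑' n : ℕ, ENNReal.ofReal (4 ^ m * (4 : ℝ) ^ ((N : ℝ) * s) * ((4 : ℝ) ^ (s - m)) ^ n) :=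
        ENNReal.tsum_le_tsum fun n => ENNReal.ofReal_le_ofReal (hterm n)
    _ = ENNReal.ofReal (∑' n : ℕ, 4 ^ m * (4 : ℝ) ^ ((N : ℝ) * s) * ((4 : ℝ) ^ (s - m)) ^ n) := by
        rw [ENNReal.ofReal_tsum_of_nonneg (fun n => by positivity)]
        exact (summable_geometric_of_lt_one hq0.le hq1).mul_left _
    _ = _ := by
        rw [tsum_mul_left, tsum_geometric_of_lt_one hq0.le hq1]
        congr 1; ring

lemma sum_four_pow_le {s : ℝ} (hs : 0 < s) {m : ℕ} (hm : s < m) :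
    ∃ C : ℝ≥0, ∀ a : ℝ, 0 ≤ a →
      ∑' n : ℕ, ENNReal.ofReal ((4 : ℝ) ^ ((n : ℝ) * s) * (min 1 (rad n * a)) ^ (2 * m)) ≤
        C * ENNReal.ofReal ((1 + a ^ 2) ^ s) := by
  obtain ⟨P, hP⟩ : ∃ P : ℝ, P = (1 - (4 : ℝ) ^ (-s))⁻¹ := ⟨_, rfl⟩
  obtain ⟨Q, hQ⟩ : ∃ Q : ℝ, Q = 4 ^ m * (1 - (4 : ℝ) ^ (s - m))⁻¹ := ⟨_, rfl⟩
  have hP0 : 0 ≤ P := by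
    have : (4 : ℝ) ^ (-s) < 1 := Real.rpow_lt_one_of_one_lt_of_neg (by norm_num) (by linarith)
    have := sub_pos.2 this
    rw [hP]; positivity
  have hQ0 : 0 ≤ Q := by
    have : (4 : ℝ) ^ (s - m) < 1 := Real.rpow_lt_one_of_one_lt_of_neg (by norm_num) (by linarith)
    have := sub_pos.2 this
    rw [hQ]; positivity
  refine ⟨(P + Q).toNNReal, fun a ha => ?_⟩
  obtain ⟨N, hN1, hN2⟩ := exists_nat_pow_near (le_max_left 1 a) (by norm_num : (1 : ℝ) < 2)
  have h4N : (4 : ℝ) ^ ((N : ℝ) * s) ≤ (1 + a ^ 2) ^ s := by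
    rw [Real.rpow_mul (by norm_num)]
    refine Real.rpow_le_rpow (by positivity) ?_ hs.le
    rw [Real.rpow_natCast, show (4 : ℝ) = 2 ^ 2 by norm_num, ← pow_mul, mul_comm 2 N, pow_mul]
    refine (pow_le_pow_left₀ (by positivity) hN1 2).trans ?_
    rcases max_cases 1 a with ⟨h, _⟩ | ⟨h, _⟩ <;> rw [h] <;> nlinarith [sq_nonneg a]
  have h0 : ∀ n, 0 ≤ min 1 (rad n * a) := fun n =>
    le_min zero_le_one (mul_nonneg (rad_pos _).le ha)
  obtain ⟨f, hf⟩ : ∃ f : ℕ → ℝ, ∀ n, f n =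
    (4 : ℝ) ^ ((n : ℝ) * s) * (min 1 (rad n * a)) ^ (2 * m) := ⟨_, fun _ => rfl⟩
  have hf0 : ∀ n, 0 ≤ f n := fun n => by
    rw [hf]; exact mul_nonneg (by positivity) (pow_nonneg (h0 n) _)
  have hB := tsum_tail_four_pow_le (m := m) hm ha ((le_max_right 1 a).trans hN2.le)
  rw [← hQ] at hB
  simp_rw [← hf] at hB ⊢
  have hA : ∑ n ∈ Finset.range (N + 1), ENNReal.ofReal (f n) ≤
        ENNReal.ofReal (P * (4 : ℝ) ^ ((N : ℝ) * s)) := by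
    rw [← ENNReal.ofReal_sum_of_nonneg (fun n _ => hf0 n), hP]
    refine ENNReal.ofReal_le_ofReal (le_trans ?_ (sum_range_four_pow_le hs N))
    refine Finset.sum_le_sum fun n _ => ?_
    rw [hf]
    exact mul_le_of_le_one_right (by positivity) (pow_le_one₀ (h0 n) (min_le_left _ _))
  have hsplit := Summable.sum_add_tsum_nat_add' (f := fun n => ENNReal.ofReal (f n)) (k := N + 1)
    ENNReal.summable
  rw [← hsplit]
  refine (add_le_add hA hB).trans ?_
  rw [← ENNReal.ofReal_add (by positivity) (by positivity), ← add_mul,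
    ENNReal.ofReal_mul (add_nonneg hP0 hQ0)]
  exact mul_le_mul_right (ENNReal.ofReal_le_ofReal h4N) _

lemma norm_phase_step_le (n : ℕ) (k : Fin 3) (ξ : Space) :
    ‖phase (step n k) ξ - 1‖ ≤ 2 * Real.pi * min 1 (rad n * |ξ k|) := by
  have h1 := norm_phase_sub_one_le_two (step n k) ξ
  have h2 := norm_phase_sub_one_le (step n k) ξ
  rw [inner_step, abs_mul, abs_of_pos (rad_pos n)] at h2
  rcases min_cases 1 (rad n * |ξ k|) with ⟨h, _⟩ | ⟨h, _⟩ <;> rw [h]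
  · nlinarith [Real.pi_gt_three]
  · exact h2

lemma lintegral_wsum {s : ℝ} {F : Space → ℝ} (hF : MemLp F 2 volume) {a : ℕ → ℝ≥0∞}
    {c : ℕ → Space → ℝ} (hc : ∀ n, Measurable (c n))
    (ha : ∀ n, a n ^ 2 = ∫⁻ ξ, ENNReal.ofReal (c n ξ ^ 2) * ‖fourierL2 F ξ‖ₑ ^ 2) :
    wsum s a = ∫⁻ ξ, (∑' n : ℕ, ENNReal.ofReal ((4 : ℝ) ^ (n * s) * c n ξ ^ 2)) *
      ‖fourierL2 F ξ‖ₑ ^ 2 := by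
  unfold wsum
  simp_rw [ha, ← ENNReal.tsum_mul_right]
  rw [lintegral_tsum]
  · refine tsum_congr fun n => ?_
    have hm : Measurable fun ξ => ENNReal.ofReal (c n ξ ^ 2) := by have := hc n; fun_prop
    have hm2 : AEMeasurable (fun ξ => ENNReal.ofReal (c n ξ ^ 2) * ‖fourierL2 F ξ‖ₑ ^ 2) volume :=
      hm.aemeasurable.mul (measurable_fourierL2 hF)
    rw [← lintegral_const_mul'' _ hm2]
    refine lintegral_congr fun ξ => ?_
    rw [ENNReal.ofReal_mul (by positivity), mul_assoc]
  · intro n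
    have hm : Measurable fun ξ => ENNReal.ofReal ((4 : ℝ) ^ (n * s) * c n ξ ^ 2) := by
      have := hc n; fun_prop
    exact hm.aemeasurable.mul (measurable_fourierL2 hF)

lemma measurable_phase (h : Space) : Measurable (phase h) := (contDiff_phase h).continuous.measurable

lemma sq_nrm_of_fourier {F G : Space → ℝ} (hG : MemLp G 2 volume)
    {c : Space → ℂ} (h : fourierL2 G =ᵐ[volume] fun ξ => c ξ * fourierL2 F ξ) :
    nrm G ^ 2 = ∫⁻ ξ, ENNReal.ofReal (‖c ξ‖ ^ 2) * ‖fourierL2 F ξ‖ₑ ^ 2 := by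
  rw [sq_nrm_fourier hG]
  refine lintegral_congr_ae ?_
  filter_upwards [h] with ξ h
  rw [h, enorm_mul, mul_pow, ENNReal.ofReal_pow (norm_nonneg _), ofReal_norm]

/-- Weighted differences are controlled by the Sobolev norm. -/
lemma wsum_dif_le {s : ℝ} (hs : 0 < s) {m : ℕ} (hm : s < m) :
    ∃ C : ℝ≥0, ∀ (k : Fin 3) (F : Space → ℝ), MemLp F 2 volume →
      wsum s (fun n => nrm ((dif (step n k))^[m] F)) ≤ C * sobolevNorm s F ^ 2 := by
  obtain ⟨C, hC⟩ := sum_four_pow_le hs hm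
  refine ⟨(2 * Real.pi).toNNReal ^ (2 * m) * C, fun k F hF => ?_⟩
  rw [lintegral_wsum hF (c := fun n ξ => ‖(phase (step n k) ξ - 1) ^ m‖)
    (fun n => by have := measurable_phase (step n k); fun_prop) fun n =>
      sq_nrm_of_fourier (memLp_dif_iterate hF _ _) (fourierL2_dif_iterate hF _ _),
    sq_sobolevNorm hF, ← lintegral_const_mul' _ _ ENNReal.coe_ne_top]
  refine lintegral_mono fun ξ => ?_
  rw [← mul_assoc]
  gcongr
  calc _ ≤ ∑' n : ℕ, ((2 * Real.pi).toNNReal : ℝ≥0∞) ^ (2 * m) *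
        ENNReal.ofReal ((4 : ℝ) ^ (n * s) * (min 1 (rad n * |ξ k|)) ^ (2 * m)) := by
        refine ENNReal.tsum_le_tsum fun n => ?_
        have h0 : 0 ≤ min 1 (rad n * |ξ k|) :=
          le_min zero_le_one (mul_nonneg (rad_pos _).le (abs_nonneg _))
        change _ ≤ ENNReal.ofReal (2 * Real.pi) ^ (2 * m) * _
        rw [← ENNReal.ofReal_pow (by positivity), ← ENNReal.ofReal_mul (by positivity)]
        refine ENNReal.ofReal_le_ofReal ?_
        rw [norm_pow, ← pow_mul, mul_comm m 2]
        calc _ ≤ (4 : ℝ) ^ (n * s) * (2 * Real.pi * min 1 (rad n * |ξ k|)) ^ (2 * m) := by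
              gcongr; exact norm_phase_step_le n k ξ
          _ = _ := by rw [mul_pow]; ring
    _ ≤ ((2 * Real.pi).toNNReal : ℝ≥0∞) ^ (2 * m) * (C * ENNReal.ofReal ((1 + |ξ k| ^ 2) ^ s)) := by
        rw [ENNReal.tsum_mul_left]
        gcongr
        exact hC _ (abs_nonneg _)
    _ ≤ _ := by
        rw [← mul_assoc]
        push_cast
        gcongr
        unfold jap
        have := abs_coord_le k ξ
        gcongr

lemma exists_symbol_ge {s : ℝ} (hs : 0 ≤ s) (m : ℕ) (ξ : Space) :
    jap s ξ ≤ ENNReal.ofReal (8 ^ s) * (1 + ∑ k : Fin 3, ∑' n : ℕ,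
      ENNReal.ofReal ((4 : ℝ) ^ (n * s) * ‖(phase (step n k) ξ - 1) ^ m‖ ^ 2)) := by
  by_cases hξ : ‖ξ‖ ≤ 1
  · calc jap s ξ ≤ ENNReal.ofReal (8 ^ s) := by
          unfold jap
          gcongr
          nlinarith [norm_nonneg ξ]
      _ ≤ _ := le_mul_of_one_le_right' le_self_add
  push Not at hξ
  have hn2 : ‖ξ‖ ^ 2 = ξ 0 ^ 2 + ξ 1 ^ 2 + ξ 2 ^ 2 := by
    rw [EuclideanSpace.norm_sq_eq, Fin.sum_univ_three]; simp
  obtain ⟨k, hk⟩ : ∃ k : Fin 3, ‖ξ‖ / 2 ≤ |ξ k| := by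
    by_contra! hcon
    have h : ∀ k, ξ k ^ 2 < (‖ξ‖ / 2) ^ 2 := fun k => by
      rw [← sq_abs (ξ k)]
      exact pow_lt_pow_left₀ (hcon k) (abs_nonneg _) (by norm_num)
    have h0 := h 0; have h1 := h 1; have h2 := h 2
    nlinarith
  set b := |ξ k| with hb
  have hb2 : 1 / 2 ≤ b := by linarith
  obtain ⟨n, hn1, hn2'⟩ := exists_nat_pow_near (by linarith : 1 ≤ 4 * b) (by norm_num : (1 : ℝ) < 2)
  have hlow : 1 / 4 ≤ rad n * b := by
    unfold rad
    rw [one_div, one_div, inv_pow, le_inv_mul_iff₀ (by positivity)]; linarith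
  have hup : rad n * b ≤ 1 / 2 := by
    unfold rad
    rw [one_div, inv_pow, inv_mul_le_iff₀ (by positivity)]
    rw [pow_succ] at hn2'; linarith
  have hsin : 1 ≤ ‖phase (step n k) ξ - 1‖ := by
    rw [norm_phase_sub_one, inner_step]
    have e : |Real.sin (Real.pi * (rad n * ξ k))| = Real.sin (Real.pi * (rad n * b)) := by
      have hpos : 0 ≤ Real.sin (Real.pi * (rad n * b)) := by
        apply Real.sin_nonneg_of_nonneg_of_le_pi
        · have := rad_pos n; positivity
        · nlinarith [Real.pi_pos]
      rw [hb] at *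
      rcases abs_cases (ξ k) with ⟨h, _⟩ | ⟨h, _⟩ <;> rw [h] at hpos ⊢
      · exact abs_of_nonneg hpos
      · rw [← abs_of_nonneg hpos, ← abs_neg, ← Real.sin_neg]; congr 2; ring
    rw [e]
    have : Real.sin (Real.pi / 4) ≤ Real.sin (Real.pi * (rad n * b)) := by
      apply Real.sin_le_sin_of_le_of_le_pi_div_two <;> nlinarith [Real.pi_pos]
    rw [Real.sin_pi_div_four] at this
    have h2 : 1 ≤ √2 := Real.one_le_sqrt.2 (by norm_num)
    linarith
  have hterm : (1 + ‖ξ‖ ^ 2) ^ s ≤ 8 ^ s * ((4 : ℝ) ^ (n * s) * ‖(phase (step n k) ξ - 1) ^ m‖ ^ 2) := by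
    have h1 : (1 : ℝ) ≤ ‖(phase (step n k) ξ - 1) ^ m‖ ^ 2 := by
      rw [norm_pow]
      exact one_le_pow₀ (one_le_pow₀ hsin)
    have h2 : (1 + ‖ξ‖ ^ 2) ^ s ≤ 8 ^ s * (4 : ℝ) ^ (n * s) := by
      rw [Real.rpow_mul (by norm_num), Real.rpow_natCast, ← Real.mul_rpow (by norm_num) (by positivity)]
      refine Real.rpow_le_rpow (by positivity) ?_ hs
      have h3 : (2 * b) ^ 2 ≤ 4 ^ n := by
        rw [show (4 : ℝ) = 2 ^ 2 by norm_num, ← pow_mul, mul_comm 2 n, pow_mul]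
        refine pow_le_pow_left₀ (by linarith) ?_ 2
        rw [pow_succ] at hn2'; linarith
      nlinarith
    calc _ ≤ 8 ^ s * ((4 : ℝ) ^ (n * s) * 1) := by rw [mul_one]; exact h2
      _ ≤ _ := by gcongr
  calc jap s ξ ≤ ENNReal.ofReal (8 ^ s) *
        ENNReal.ofReal ((4 : ℝ) ^ (n * s) * ‖(phase (step n k) ξ - 1) ^ m‖ ^ 2) := by
        rw [← ENNReal.ofReal_mul (by positivity)]
        exact ENNReal.ofReal_le_ofReal hterm
    _ ≤ _ := by
        gcongr
        refine le_trans ?_ le_add_self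
        refine le_trans ?_ (Finset.single_le_sum (f := fun k : Fin 3 => ∑' n : ℕ,
          ENNReal.ofReal ((4 : ℝ) ^ (n * s) * ‖(phase (step n k) ξ - 1) ^ m‖ ^ 2))
          (fun _ _ => zero_le) (Finset.mem_univ k))
        exact ENNReal.le_tsum n

/-- The Sobolev norm is controlled by weighted differences. -/
lemma sq_sobolevNorm_le {s : ℝ} (hs : 0 ≤ s) (m : ℕ) {F : Space → ℝ} (hF : MemLp F 2 volume) :
    sobolevNorm s F ^ 2 ≤ ENNReal.ofReal (8 ^ s) * (nrm F ^ 2 +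
      ∑ k : Fin 3, wsum s (fun n => nrm ((dif (step n k))^[m] F))) := by
  have hw : ∀ k : Fin 3, wsum s (fun n => nrm ((dif (step n k))^[m] F)) =
      ∫⁻ ξ, (∑' n : ℕ, ENNReal.ofReal ((4 : ℝ) ^ (n * s) * ‖(phase (step n k) ξ - 1) ^ m‖ ^ 2)) *
        ‖fourierL2 F ξ‖ₑ ^ 2 := fun k =>
    lintegral_wsum hF (c := fun n ξ => ‖(phase (step n k) ξ - 1) ^ m‖)
    (fun n => by have := measurable_phase (step n k); fun_prop) fun n =>
      sq_nrm_of_fourier (memLp_dif_iterate hF _ _) (fourierL2_dif_iterate hF _ _)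
  have hmeas : ∀ k : Fin 3, AEMeasurable (fun ξ => (∑' n : ℕ, ENNReal.ofReal ((4 : ℝ) ^ (n * s) *
      ‖(phase (step n k) ξ - 1) ^ m‖ ^ 2)) * ‖fourierL2 F ξ‖ₑ ^ 2) volume := by
    intro k
    refine AEMeasurable.mul (Measurable.aemeasurable ?_) (measurable_fourierL2 hF)
    refine Measurable.tsum fun n => ?_
    have := measurable_phase (step n k)
    fun_prop
  rw [sq_sobolevNorm hF, sq_nrm_fourier hF]
  simp_rw [hw]
  rw [← lintegral_finsetSum' _ (fun k _ => hmeas k), ← lintegral_add_left' (measurable_fourierL2 hF),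
    ← lintegral_const_mul' _ _ ENNReal.ofReal_ne_top]
  refine lintegral_mono fun ξ => ?_
  have := mul_le_mul_left (exists_symbol_ge hs m ξ) (‖fourierL2 F ξ‖ₑ ^ 2)
  rw [mul_assoc, add_mul, one_mul, Finset.sum_mul] at this
  exact this

end

section

/-! ### Smooth functions with square integrable derivatives -/

/-- `F` is smooth and all its derivatives are square integrable. -/
def IsHinf (F : Space → ℝ) : Prop :=
  ContDiff ℝ ∞ F ∧ ∀ l : List (Fin 3), MemLp (l.foldr der F) 2 volume

lemma contDiff_der {F : Space → ℝ} (hF : ContDiff ℝ ∞ F) (k : Fin 3) : ContDiff ℝ ∞ (der k F) := by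
  unfold der
  exact (hF.fderiv_right (m := ∞) (by simp)).clm_apply contDiff_const

lemma der_add {F G : Space → ℝ} (hF : ContDiff ℝ ∞ F) (hG : ContDiff ℝ ∞ G) (k : Fin 3) :
    der k (fun x => F x + G x) = fun x => der k F x + der k G x := by
  ext x
  have h := fderiv_add (hF.differentiable (by simp) x) (hG.differentiable (by simp) x)
  have h' : fderiv ℝ (fun x => F x + G x) x = fderiv ℝ F x + fderiv ℝ G x := h
  simp [der, h']

lemma der_const_mul {F : Space → ℝ} (hF : ContDiff ℝ ∞ F) (c : ℝ) (k : Fin 3) :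
    der k (fun x => c * F x) = fun x => c * der k F x := by
  ext x
  have h := fderiv_const_mul (hF.differentiable (by simp) x) c
  simp [der, h]

lemma der_translate (F : Space → ℝ) (h : Space) (k : Fin 3) :
    der k (fun x => F (x + h)) = fun x => der k F (x + h) := by
  ext x
  simp [der, fderiv_comp_add_right]

namespace IsHinf

variable {F G : Space → ℝ}

lemma contDiff (hF : IsHinf F) : ContDiff ℝ ∞ F := hF.1

lemma memLp (hF : IsHinf F) : MemLp F 2 volume := hF.2 []

lemma continuous (hF : IsHinf F) : Continuous F := hF.1.continuous

lemma differentiable (hF : IsHinf F) : Differentiable ℝ F := hF.1.differentiable (by simp)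

lemma der (hF : IsHinf F) (k : Fin 3) : IsHinf (der k F) :=
  ⟨contDiff_der hF.1 k, fun l => by
    have := hF.2 (l ++ [k])
    rwa [List.foldr_append] at this⟩

lemma of_foldr (P : (Space → ℝ) → Prop) (hc : ∀ F, P F → ContDiff ℝ ∞ F)
    (hm : ∀ F, P F → MemLp F 2 volume) (hd : ∀ F k, P F → P (ElasticWave.der k F)) (hF : P F) :
    IsHinf F := by
  refine ⟨hc F hF, fun l => hm _ ?_⟩
  induction l with
  | nil => exact hF
  | cons k l ih => exact hd _ k ih

lemma add (hF : IsHinf F) (hG : IsHinf G) : IsHinf (fun x => F x + G x) := by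
  refine of_foldr (fun H => ∃ F G, IsHinf F ∧ IsHinf G ∧ H = fun x => F x + G x) ?_ ?_ ?_
    ⟨F, G, hF, hG, rfl⟩
  · rintro _ ⟨F, G, hF, hG, rfl⟩; exact hF.1.add hG.1
  · rintro _ ⟨F, G, hF, hG, rfl⟩; exact hF.memLp.add hG.memLp
  · rintro _ k ⟨F, G, hF, hG, rfl⟩; exact ⟨_, _, hF.der k, hG.der k, der_add hF.1 hG.1 k⟩

lemma const_mul (hF : IsHinf F) (c : ℝ) : IsHinf (fun x => c * F x) := by
  refine of_foldr (fun H => ∃ F, IsHinf F ∧ H = fun x => c * F x) ?_ ?_ ?_ ⟨F, hF, rfl⟩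
  · rintro _ ⟨F, hF, rfl⟩; exact contDiff_const.mul hF.1
  · rintro _ ⟨F, hF, rfl⟩; exact hF.memLp.const_mul c
  · rintro _ k ⟨F, hF, rfl⟩; exact ⟨_, hF.der k, der_const_mul hF.1 c k⟩

lemma sub (hF : IsHinf F) (hG : IsHinf G) : IsHinf (fun x => F x - G x) := by
  have := hF.add (hG.const_mul (-1))
  convert this using 2; ring

lemma translate (hF : IsHinf F) (h : Space) : IsHinf (fun x => F (x + h)) := by
  refine of_foldr (fun H => ∃ F, IsHinf F ∧ H = fun x => F (x + h)) ?_ ?_ ?_ ⟨F, hF, rfl⟩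
  · rintro _ ⟨F, hF, rfl⟩; exact hF.1.comp (contDiff_id.add contDiff_const)
  · rintro _ ⟨F, hF, rfl⟩; exact memLp_translate hF.memLp h
  · rintro _ k ⟨F, hF, rfl⟩; exact ⟨_, hF.der k, der_translate F h k⟩

lemma dif (hF : IsHinf F) (h : Space) : IsHinf (dif h F) := (hF.translate h).sub hF

lemma fourier_der (hF : IsHinf F) (k : Fin 3) : fourierL2 (ElasticWave.der k F) =ᵐ[volume]
    fun ξ => (2 * Real.pi * Complex.I * (ξ k : ℝ)) * fourierL2 F ξ := by
  have := fourierL2_deriv hF.memLp hF.differentiable (bas k) (hF.der k).memLp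
  simp_rw [inner_bas] at this
  exact this

end IsHinf

lemma der_dif {F : Space → ℝ} (hF : ContDiff ℝ ∞ F) (h : Space) (k : Fin 3) :
    der k (dif h F) = dif h (der k F) := by
  ext x
  have h1 : DifferentiableAt ℝ (fun x => F (x + h)) x :=
    (hF.comp (contDiff_id.add contDiff_const)).differentiable (by simp) x
  have h2 := hF.differentiable (by simp) x
  have h3 : fderiv ℝ (fun x => F (x + h) - F x) x =
    fderiv ℝ (fun x => F (x + h)) x - fderiv ℝ F x := fderiv_sub h1 h2
  unfold der dif
  rw [h3]
  simp [fderiv_comp_add_right]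

/-! ### Linear estimates for Sobolev norms -/

variable {F G : Space → ℝ}

lemma sobolevNorm_def_of_memLp (hF : MemLp F 2 volume) (s : ℝ) : sobolevNorm s F =
    eLpNorm (fun ξ : Space => (((1 + ‖ξ‖ ^ 2) ^ (s / 2) : ℝ) : ℂ) * fourierL2 F ξ) 2 volume := by
  unfold sobolevNorm; rw [if_pos hF]

lemma aesm_sobolev (hF : MemLp F 2 volume) (s : ℝ) : AEStronglyMeasurable
    (fun ξ : Space => (((1 + ‖ξ‖ ^ 2) ^ (s / 2) : ℝ) : ℂ) * fourierL2 F ξ) volume := by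
  refine AEStronglyMeasurable.mul ?_ (memLp_fourierL2 hF).aestronglyMeasurable
  have : Measurable fun ξ : Space => (((1 + ‖ξ‖ ^ 2) ^ (s / 2) : ℝ) : ℂ) := by fun_prop
  exact this.aestronglyMeasurable

lemma sobolevNorm_add_le (hF : MemLp F 2 volume) (hG : MemLp G 2 volume) (s : ℝ) :
    sobolevNorm s (fun x => F x + G x) ≤ sobolevNorm s F + sobolevNorm s G := by
  rw [sobolevNorm_def_of_memLp hF, sobolevNorm_def_of_memLp hG,
    sobolevNorm_def_of_memLp (F := fun x => F x + G x) (hF.add hG)]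
  refine le_trans (le_of_eq ?_) (eLpNorm_add_le (aesm_sobolev hF s) (aesm_sobolev hG s) (by norm_num))
  refine eLpNorm_congr_ae ?_
  filter_upwards [fourierL2_add hF hG] with ξ h
  simp only [Pi.add_apply]
  rw [h]; ring

lemma sobolevNorm_le_of_fourier (hF : MemLp F 2 volume) (hG : MemLp G 2 volume) (c : ℝ≥0) (s : ℝ)
    (h : ∀ᵐ ξ ∂volume, ‖fourierL2 F ξ‖ ≤ c * ‖fourierL2 G ξ‖) :
    sobolevNorm s F ≤ c * sobolevNorm s G := by
  rw [sobolevNorm_def_of_memLp hF, sobolevNorm_def_of_memLp hG]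
  refine eLpNorm_le_nnreal_smul_eLpNorm_of_ae_le_mul ?_ 2
  filter_upwards [h] with ξ h
  simp only [nnnorm_mul]
  rw [← NNReal.coe_le_coe]
  push_cast
  have : 0 ≤ ‖(((1 + ‖ξ‖ ^ 2) ^ (s / 2) : ℝ) : ℂ)‖ := norm_nonneg _
  nlinarith

lemma sobolevNorm_const_mul_le (hF : MemLp F 2 volume) (c : ℝ) (s : ℝ) :
    sobolevNorm s (fun x => c * F x) ≤ ‖c‖₊ * sobolevNorm s F := by
  refine sobolevNorm_le_of_fourier (hF.const_mul c) hF _ s ?_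
  filter_upwards [fourierL2_const_mul hF c] with ξ h
  rw [h]; simp

lemma sobolevNorm_sub_le (hF : MemLp F 2 volume) (hG : MemLp G 2 volume) (s : ℝ) :
    sobolevNorm s (fun x => F x - G x) ≤ sobolevNorm s F + sobolevNorm s G := by
  have h1 := sobolevNorm_add_le hF (hG.const_mul (-1)) s
  have h2 := sobolevNorm_const_mul_le hG (-1) s
  have e : (fun x => F x - G x) = fun x => F x + (-1) * G x := by ext; ring
  rw [e]
  refine h1.trans (add_le_add le_rfl (h2.trans (by simp)))

lemma sobolevNorm_sum_le {ι : Type*} (t : Finset ι) {F : ι → Space → ℝ} (hF : ∀ i, MemLp (F i) 2 volume)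
    (s : ℝ) : sobolevNorm s (fun x => ∑ i ∈ t, F i x) ≤ ∑ i ∈ t, sobolevNorm s (F i) := by
  classical
  induction t using Finset.induction_on with
  | empty =>
    simp only [Finset.sum_empty]
    have h := sobolevNorm_const_mul_le (F := fun _ : Space => (0 : ℝ)) (by simp) 0 s
    simpa using h
  | insert a t ha ih =>
    simp only [Finset.sum_insert ha]
    refine (sobolevNorm_add_le (hF a) (memLp_finsetSum t fun i _ => hF i) s).trans ?_
    gcongr

lemma sobolevNorm_mono (hF : MemLp F 2 volume) {s s' : ℝ} (h : s ≤ s') :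
    sobolevNorm s F ≤ sobolevNorm s' F := by
  rw [sobolevNorm_def_of_memLp hF, sobolevNorm_def_of_memLp hF]
  refine eLpNorm_mono fun ξ => ?_
  rw [norm_mul, norm_mul, Complex.norm_real, Complex.norm_real, Real.norm_of_nonneg (by positivity),
    Real.norm_of_nonneg (by positivity)]
  gcongr
  nlinarith [sq_nonneg ‖ξ‖]

lemma sobolevNorm_zero (hF : MemLp F 2 volume) : sobolevNorm 0 F = nrm F := by
  rw [sobolevNorm_def_of_memLp hF, nrm, ← eLpNorm_fourierL2 hF]
  simp

lemma nrm_le_sobolevNorm (hF : MemLp F 2 volume) {s : ℝ} (hs : 0 ≤ s) :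
    nrm F ≤ sobolevNorm s F := by
  rw [← sobolevNorm_zero hF]; exact sobolevNorm_mono hF hs

lemma le_of_sq_le_sq {a b : ℝ≥0∞} (h : a ^ 2 ≤ b ^ 2) : a ≤ b :=
  (ENNReal.pow_le_pow_left_iff (by norm_num)).1 h

lemma norm_two_pi_I_mul (a : ℝ) : ‖2 * (Real.pi : ℂ) * Complex.I * (a : ℂ)‖ = 2 * Real.pi * |a| := by
  rw [norm_mul, norm_mul, norm_mul, Complex.norm_I, Complex.norm_ofNat, Complex.norm_real,
    Complex.norm_real, mul_one, Real.norm_eq_abs, Real.norm_eq_abs, abs_of_pos Real.pi_pos]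

lemma sobolevNorm_der_le (hF : IsHinf F) (k : Fin 3) (s : ℝ) :
    sobolevNorm s (der k F) ≤ 7 * sobolevNorm (s + 1) F := by
  rw [sobolevNorm_def_of_memLp hF.memLp, sobolevNorm_def_of_memLp (hF.der k).memLp]
  have := eLpNorm_le_nnreal_smul_eLpNorm_of_ae_le_mul (μ := (volume : Measure Space)) (c := 7)
    (f := fun ξ : Space => (((1 + ‖ξ‖ ^ 2) ^ (s / 2) : ℝ) : ℂ) * fourierL2 (der k F) ξ)
    (g := fun ξ : Space => (((1 + ‖ξ‖ ^ 2) ^ ((s + 1) / 2) : ℝ) : ℂ) * fourierL2 F ξ) ?_ 2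
  · exact this
  filter_upwards [hF.fourier_der k] with ξ h
  rw [h, ← NNReal.coe_le_coe]
  push_cast
  rw [norm_mul, norm_mul (_ * _ * _), norm_two_pi_I_mul, norm_mul, Complex.norm_real,
    Complex.norm_real, Real.norm_of_nonneg (by positivity), Real.norm_of_nonneg (by positivity)]
  have h1 : (1 + ‖ξ‖ ^ 2) ^ ((s + 1) / 2) = (1 + ‖ξ‖ ^ 2) ^ (s / 2) * (1 + ‖ξ‖ ^ 2) ^ (1 / 2 : ℝ) := by
    rw [← Real.rpow_add (by positivity)]; congr 1; ring
  have h2 : |ξ k| ≤ (1 + ‖ξ‖ ^ 2) ^ (1 / 2 : ℝ) := by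
    rw [← Real.sqrt_eq_rpow]
    refine Real.le_sqrt_of_sq_le ?_
    have := pow_le_pow_left₀ (abs_nonneg _) (abs_coord_le k ξ) 2
    linarith
  rw [h1]
  have h3 : 2 * Real.pi * |ξ k| ≤ 7 * (1 + ‖ξ‖ ^ 2) ^ (1 / 2 : ℝ) := by
    have := Real.pi_lt_d2
    have := Real.pi_pos
    nlinarith [abs_nonneg (ξ k)]
  calc _ = ((1 + ‖ξ‖ ^ 2) ^ (s / 2) * ‖fourierL2 F ξ‖) * (2 * Real.pi * |ξ k|) := by ring
    _ ≤ ((1 + ‖ξ‖ ^ 2) ^ (s / 2) * ‖fourierL2 F ξ‖) * (7 * (1 + ‖ξ‖ ^ 2) ^ (1 / 2 : ℝ)) := by gcongr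
    _ = _ := by ring

lemma sq_norm_eq_sum (ξ : Space) : ‖ξ‖ ^ 2 = ∑ j : Fin 3, ξ j ^ 2 := by
  rw [EuclideanSpace.norm_sq_eq]; simp

lemma sq_sobolevNorm_succ_le (hF : IsHinf F) {s : ℝ} (hs : 0 ≤ s) :
    sobolevNorm (s + 1) F ^ 2 ≤ ENNReal.ofReal (2 ^ (s + 1)) * (nrm F ^ 2 +
      ∑ j : Fin 3, sobolevNorm s (der j F) ^ 2) := by
  have hd : ∀ j, sobolevNorm s (der j F) ^ 2 =
      ∫⁻ ξ, (jap s ξ * ENNReal.ofReal ((2 * Real.pi * ξ j) ^ 2)) * ‖fourierL2 F ξ‖ₑ ^ 2 := by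
    intro j
    rw [sq_sobolevNorm (hF.der j).memLp]
    refine lintegral_congr_ae ?_
    filter_upwards [hF.fourier_der j] with ξ h
    rw [h, enorm_mul, mul_pow, ← ofReal_norm (2 * (Real.pi : ℂ) * Complex.I * (ξ j : ℂ)),
      norm_two_pi_I_mul, ← ENNReal.ofReal_pow (by positivity), mul_pow _ |ξ j|, mul_pow _ (ξ j),
      sq_abs, mul_assoc (jap s ξ)]
  have hm : ∀ j : Fin 3, AEMeasurable (fun ξ => (jap s ξ * ENNReal.ofReal ((2 * Real.pi * ξ j) ^ 2)) *
      ‖fourierL2 F ξ‖ₑ ^ 2) volume := by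
    intro j
    have h1 : Measurable fun ξ : Space => jap s ξ * ENNReal.ofReal ((2 * Real.pi * ξ j) ^ 2) :=
      (measurable_jap s).mul (by fun_prop)
    exact h1.aemeasurable.mul (measurable_fourierL2 hF.memLp)
  simp_rw [hd]
  rw [sq_sobolevNorm hF.memLp, sq_nrm_fourier hF.memLp, ← lintegral_finsetSum' _ (fun j _ => hm j),
    ← lintegral_add_left' (measurable_fourierL2 hF.memLp),
    ← lintegral_const_mul' _ _ ENNReal.ofReal_ne_top]
  refine lintegral_mono fun ξ => ?_
  rw [← Finset.sum_mul, ← Finset.mul_sum, ← one_add_mul, ← mul_assoc]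
  gcongr
  unfold jap
  rw [← ENNReal.ofReal_sum_of_nonneg (fun _ _ => by positivity), ← ENNReal.ofReal_mul (by positivity),
    ← ENNReal.ofReal_one, ← ENNReal.ofReal_add (by norm_num) (by positivity),
    ← ENNReal.ofReal_mul (by positivity)]
  refine ENNReal.ofReal_le_ofReal ?_
  have e : ∑ j : Fin 3, (2 * Real.pi * ξ j) ^ 2 = (2 * Real.pi) ^ 2 * ‖ξ‖ ^ 2 := by
    rw [sq_norm_eq_sum, Finset.mul_sum]
    exact Finset.sum_congr rfl fun _ _ => by ring
  rw [e]
  have hpi : (1 : ℝ) ≤ (2 * Real.pi) ^ 2 := by nlinarith [Real.pi_gt_three]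
  have h2s : (2 : ℝ) ≤ 2 ^ (s + 1) := by
    calc (2 : ℝ) = 2 ^ (1 : ℝ) := by simp
      _ ≤ _ := Real.rpow_le_rpow_of_exponent_le (by norm_num) (by linarith)
  have h0 : 0 ≤ (1 + ‖ξ‖ ^ 2) ^ s := by positivity
  by_cases hξ : ‖ξ‖ ≤ 1
  · have h1 : (1 + ‖ξ‖ ^ 2) ^ (s + 1) ≤ 2 ^ (s + 1) := by
      refine Real.rpow_le_rpow (by positivity) ?_ (by linarith)
      nlinarith [norm_nonneg ξ]
    refine h1.trans ?_
    nlinarith [mul_nonneg h0 (mul_nonneg (sq_nonneg (2 * Real.pi)) (sq_nonneg ‖ξ‖))]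
  · push Not at hξ
    rw [Real.rpow_add (by positivity), Real.rpow_one]
    have h1 : 1 + ‖ξ‖ ^ 2 ≤ 2 * ((2 * Real.pi) ^ 2 * ‖ξ‖ ^ 2) := by nlinarith
    calc _ ≤ (1 + ‖ξ‖ ^ 2) ^ s * (2 * ((2 * Real.pi) ^ 2 * ‖ξ‖ ^ 2)) := by gcongr
      _ = 2 * ((1 + ‖ξ‖ ^ 2) ^ s * ((2 * Real.pi) ^ 2 * ‖ξ‖ ^ 2)) := by ring
      _ ≤ 2 ^ (s + 1) * ((1 + ‖ξ‖ ^ 2) ^ s * ((2 * Real.pi) ^ 2 * ‖ξ‖ ^ 2)) := by gcongr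
      _ ≤ _ := by gcongr; linarith

lemma sobolevNorm_lt_top (hF : IsHinf F) (s : ℝ) : sobolevNorm s F < ⊤ := by
  have h : ∀ n : ℕ, ∀ F, IsHinf F → sobolevNorm n F < ⊤ := by
    intro n
    induction n with
    | zero => intro F hF; rw [Nat.cast_zero, sobolevNorm_zero hF.memLp]; exact hF.memLp.2
    | succ n ih =>
      intro F hF
      have h1 := sq_sobolevNorm_succ_le hF (Nat.cast_nonneg n)
      have h2 : sobolevNorm ((n : ℝ) + 1) F ^ 2 < ⊤ := by
        refine h1.trans_lt (ENNReal.mul_lt_top ENNReal.ofReal_lt_top ?_)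
        refine ENNReal.add_lt_top.2 ⟨ENNReal.pow_lt_top hF.memLp.2, ?_⟩
        exact ENNReal.sum_lt_top.2 fun j _ => ENNReal.pow_lt_top (ih _ (hF.der j))
      push_cast
      by_contra hcon
      rw [not_lt_top_iff] at hcon
      simp [hcon] at h2
  obtain ⟨n, hn⟩ := exists_nat_ge s
  exact (sobolevNorm_mono hF.memLp hn).trans_lt (h n F hF)

lemma nrm_le_of_fourier (hF : MemLp F 2 volume) (hG : MemLp G 2 volume) (c : ℝ≥0)
    (h : ∀ᵐ ξ ∂volume, ‖fourierL2 F ξ‖ ≤ c * ‖fourierL2 G ξ‖) :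
    nrm F ≤ c * nrm G := by
  rw [← sobolevNorm_zero hF, ← sobolevNorm_zero hG]
  exact sobolevNorm_le_of_fourier hF hG c 0 h

/-- The dyadic length `2⁻ⁿ` as a nonnegative number. -/
def radN (n : ℕ) : ℝ≥0 := (rad n).toNNReal

lemma coe_radN (n : ℕ) : (radN n : ℝ) = rad n := Real.coe_toNNReal _ (rad_pos n).le

lemma nrm_dif_le (hF : IsHinf F) (n : ℕ) (k : Fin 3) :
    nrm (dif (step n k) F) ≤ radN n * nrm (der k F) := by
  refine nrm_le_of_fourier (hF.dif _).memLp (hF.der k).memLp _ ?_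
  filter_upwards [hF.fourier_der k, fourierL2_dif hF.memLp (step n k)] with ξ h1 h2
  rw [h1, h2, norm_mul, norm_mul, ← mul_assoc]
  gcongr
  rw [norm_two_pi_I_mul, coe_radN]
  have := norm_phase_sub_one_le (step n k) ξ
  rw [inner_step, abs_mul, abs_of_pos (rad_pos n)] at this
  linarith

/-- The difference quotient at scale `2⁻ⁿ` in the direction `e_j`. -/
def dq (n : ℕ) (j : Fin 3) (v : Space → ℝ) : Space → ℝ := fun x => (rad n)⁻¹ * dif (step n j) v x

lemma isHinf_dq (hF : IsHinf F) (n : ℕ) (j : Fin 3) : IsHinf (dq n j F) :=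
  (hF.dif _).const_mul _

lemma norm_exp_sub_le (x : ℝ) : ‖Complex.exp (x * Complex.I) - 1 - x * Complex.I‖ ≤
    2 * |x| * min 1 |x| := by
  have h1 : ‖Complex.exp (x * Complex.I) - 1 - x * Complex.I‖ ≤ 2 * |x| := by
    refine (norm_sub_le _ _).trans ?_
    have := Complex.norm_exp_I_mul_ofReal_sub_one x
    rw [mul_comm] at this
    rw [this, norm_mul, norm_mul, Complex.norm_I, Complex.norm_real, Real.norm_eq_abs,
      Real.norm_eq_abs, Real.norm_eq_abs]
    have h := Real.abs_sin_le_abs (x := x / 2)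
    rw [abs_div] at h
    norm_num at h ⊢
    linarith
  rcases le_total 1 |x| with h | h
  · rw [min_eq_left h, mul_one]; exact h1
  · rw [min_eq_right h]
    have h2 : ‖(x : ℂ) * Complex.I‖ ≤ 1 := by simpa using h
    have := Complex.norm_exp_sub_one_sub_id_le h2
    refine this.trans ?_
    rw [norm_mul, Complex.norm_I, Complex.norm_real, Real.norm_eq_abs]
    nlinarith [abs_nonneg x]

lemma fourier_der_sub_dq (hF : IsHinf F) (n : ℕ) (j : Fin 3) :
    ∀ᵐ ξ ∂volume, fourierL2 (fun x => der j F x - dq n j F x) ξ =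
      ((2 * Real.pi * Complex.I * (ξ j : ℝ)) - (rad n)⁻¹ * (phase (step n j) ξ - 1)) *
        fourierL2 F ξ := by
  filter_upwards [hF.fourier_der j, fourierL2_dif hF.memLp (step n j),
    fourierL2_const_mul (hF.dif (step n j)).memLp (rad n)⁻¹,
    fourierL2_sub (hF.der j).memLp (isHinf_dq hF n j).memLp] with ξ h1 h2 h3 h4
  unfold dq at h4 ⊢
  rw [h4, h3, h2, h1]
  push_cast; ring

lemma norm_symbol_der_sub_dq (n : ℕ) (j : Fin 3) (ξ : Space) :
    ‖(2 * Real.pi * Complex.I * (ξ j : ℝ)) - (rad n)⁻¹ * (phase (step n j) ξ - 1)‖ ≤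
      8 * Real.pi ^ 2 * |ξ j| * min 1 (rad n * |ξ j|) := by
  have h := norm_exp_sub_le (2 * Real.pi * (rad n * ξ j))
  have hr := rad_pos n
  have e : (2 * Real.pi * Complex.I * (ξ j : ℝ)) - (rad n)⁻¹ * (phase (step n j) ξ - 1) =
      -((rad n)⁻¹ : ℝ) * (Complex.exp ((2 * Real.pi * (rad n * ξ j) : ℝ) * Complex.I) - 1 -
        (2 * Real.pi * (rad n * ξ j) : ℝ) * Complex.I) := by
    unfold phase
    rw [inner_step]
    have : (rad n : ℂ) ≠ 0 := by exact_mod_cast hr.ne'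
    push_cast
    field_simp
    ring
  rw [e, norm_mul, norm_neg, Complex.norm_real, Real.norm_of_nonneg (by positivity)]
  have e2 : |2 * Real.pi * (rad n * ξ j)| = 2 * Real.pi * (rad n * |ξ j|) := by
    rw [abs_mul, abs_mul, abs_mul, abs_of_pos hr, abs_of_pos Real.pi_pos]; simp
  rw [e2] at h
  have h3 : min 1 (2 * Real.pi * (rad n * |ξ j|)) ≤ 2 * Real.pi * min 1 (rad n * |ξ j|) := by
    rcases le_total 1 (rad n * |ξ j|) with h | h
    · rw [min_eq_left h]
      exact (min_le_left _ _).trans (by nlinarith [Real.pi_gt_three])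
    · rw [min_eq_right h]; exact min_le_right _ _
  calc _ ≤ (rad n)⁻¹ * (2 * (2 * Real.pi * (rad n * |ξ j|)) *
        (2 * Real.pi * min 1 (rad n * |ξ j|))) := by
        refine mul_le_mul_of_nonneg_left (h.trans ?_) (by positivity)
        gcongr
    _ = _ := by field_simp; ring

lemma nrm_der_sub_dq_le (hF : IsHinf F) (n : ℕ) (j : Fin 3) :
    nrm (fun x => der j F x - dq n j F x) ≤ 2 * radN n * nrm (der j (der j F)) := by
  have h0 := nrm_le_of_fourier ((hF.der j).sub (isHinf_dq hF n j)).memLp ((hF.der j).der j).memLp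
    (2 * radN n) ?_
  · simpa using h0
  filter_upwards [fourier_der_sub_dq hF n j, hF.fourier_der j, (hF.der j).fourier_der j]
    with ξ h1 h2 h3
  rw [h1, h3, h2, norm_mul, norm_mul (_ * _ * _) (_ * _ * _ * _), norm_mul (_ * _ * _) (fourierL2 F ξ),
    norm_two_pi_I_mul, ← mul_assoc, ← mul_assoc]
  gcongr
  rw [NNReal.coe_mul, coe_radN, NNReal.coe_ofNat]
  refine (norm_symbol_der_sub_dq n j ξ).trans ?_
  have h5 : min 1 (rad n * |ξ j|) ≤ rad n * |ξ j| := min_le_right _ _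
  calc _ ≤ 8 * Real.pi ^ 2 * |ξ j| * (rad n * |ξ j|) := by gcongr
    _ = _ := by ring

lemma wsum_der_sub_dq_le {s : ℝ} (hs : 0 < s) (hs1 : s < 1) : ∃ C : ℝ≥0, ∀ (j : Fin 3)
    (F : Space → ℝ), IsHinf F →
    wsum s (fun n => nrm (fun x => der j F x - dq n j F x)) ≤ C * sobolevNorm (s + 1) F ^ 2 := by
  obtain ⟨C, hC⟩ := sum_four_pow_le (m := 1) hs (by simpa using hs1)
  refine ⟨(8 * Real.pi ^ 2).toNNReal ^ 2 * C, fun j F hF => ?_⟩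
  rw [lintegral_wsum hF.memLp (c := fun n ξ => ‖(2 * Real.pi * Complex.I * (ξ j : ℝ)) -
      (rad n)⁻¹ * (phase (step n j) ξ - 1)‖)
    (fun n => by have := measurable_phase (step n j); fun_prop) fun n =>
      sq_nrm_of_fourier ((hF.der j).sub (isHinf_dq hF n j)).memLp (fourier_der_sub_dq hF n j),
    sq_sobolevNorm hF.memLp, ← lintegral_const_mul' _ _ ENNReal.coe_ne_top]
  refine lintegral_mono fun ξ => ?_
  rw [← mul_assoc]
  gcongr
  calc _ ≤ ∑' n : ℕ, (ENNReal.ofReal (8 * Real.pi ^ 2) ^ 2 * ENNReal.ofReal (|ξ j| ^ 2)) *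
        ENNReal.ofReal ((4 : ℝ) ^ (n * s) * (min 1 (rad n * |ξ j|)) ^ (2 * 1)) := by
        refine ENNReal.tsum_le_tsum fun n => ?_
        rw [← ENNReal.ofReal_pow (by positivity), ← ENNReal.ofReal_mul (by positivity),
          ← ENNReal.ofReal_mul (by positivity)]
        refine ENNReal.ofReal_le_ofReal ?_
        calc _ ≤ (4 : ℝ) ^ (n * s) * (8 * Real.pi ^ 2 * |ξ j| * min 1 (rad n * |ξ j|)) ^ 2 := by
              gcongr; exact norm_symbol_der_sub_dq n j ξ
          _ = _ := by ring
    _ ≤ (ENNReal.ofReal (8 * Real.pi ^ 2) ^ 2 * ENNReal.ofReal (|ξ j| ^ 2)) *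
        (C * ENNReal.ofReal ((1 + |ξ j| ^ 2) ^ s)) := by
        rw [ENNReal.tsum_mul_left]
        gcongr
        exact hC _ (abs_nonneg _)
    _ = ENNReal.ofReal (8 * Real.pi ^ 2) ^ 2 * C * (ENNReal.ofReal (|ξ j| ^ 2) *
          ENNReal.ofReal ((1 + |ξ j| ^ 2) ^ s)) := by ring
    _ ≤ _ := by
        rw [← ENNReal.ofReal_mul (by positivity)]
        push_cast
        unfold jap
        gcongr
        · exact le_rfl
        · rw [Real.rpow_add (by positivity), Real.rpow_one, mul_comm]
          have := pow_le_pow_left₀ (abs_nonneg _) (abs_coord_le j ξ) 2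
          gcongr
          linarith

/-! ### Pointwise bounds -/

lemma lintegral_jap_neg_lt_top {s : ℝ} (hs : 3 / 2 < s) :
    ∫⁻ ξ : Space, jap (-s) ξ < ⊤ := by
  have h : (Module.finrank ℝ Space : ℝ) < 2 * s := by simp; linarith
  have := (integrable_rpow_neg_one_add_norm_sq (μ := (volume : Measure Space)) h).lintegral_lt_top
  refine lt_of_le_of_lt (le_of_eq (lintegral_congr fun ξ => ?_)) this
  unfold jap
  congr 2; ring

lemma lintegral_fourier_le {s : ℝ} (hF : MemLp F 2 volume) {w : Space → ℝ} (hw : Measurable w)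
    {c : ℝ≥0} {t : ℝ} (hwc : ∀ ξ, ENNReal.ofReal (w ξ ^ 2) ≤ c ^ 2 * jap t ξ) (hw0 : ∀ ξ, 0 ≤ w ξ) :
    ∫⁻ ξ, ENNReal.ofReal (w ξ) * ‖fourierL2 F ξ‖ₑ ≤
      c * (∫⁻ ξ : Space, jap (-(s - t)) ξ) ^ (1 / 2 : ℝ) * sobolevNorm s F := by
  have hH := ENNReal.lintegral_mul_le_Lp_mul_Lq (volume : Measure Space) Real.HolderConjugate.two_two
    (f := fun ξ => ENNReal.ofReal (w ξ) * jap (-s / 2) ξ)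
    (g := fun ξ => jap (s / 2) ξ * ‖fourierL2 F ξ‖ₑ)
    ((hw.ennreal_ofReal.mul (measurable_jap _)).aemeasurable)
    ((measurable_jap _).aemeasurable.mul (memLp_fourierL2 hF).aestronglyMeasurable.enorm)
  have hj : ∀ a b ξ, jap a ξ * jap b ξ = jap (a + b) ξ := fun a b ξ => by
    unfold jap
    rw [← ENNReal.ofReal_mul (by positivity), ← Real.rpow_add (by positivity)]
  have e1 : (fun ξ => ENNReal.ofReal (w ξ) * ‖fourierL2 F ξ‖ₑ) =
      ((fun ξ => ENNReal.ofReal (w ξ) * jap (-s / 2) ξ) *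
        fun ξ => jap (s / 2) ξ * ‖fourierL2 F ξ‖ₑ) := by
    ext ξ
    simp only [Pi.mul_apply]
    have h1 : jap (-s / 2) ξ * jap (s / 2) ξ = 1 := by
      rw [hj]; unfold jap; simp [show -s / 2 + s / 2 = (0 : ℝ) by ring]
    calc _ = ENNReal.ofReal (w ξ) * (jap (-s / 2) ξ * jap (s / 2) ξ) * ‖fourierL2 F ξ‖ₑ := by
          rw [h1, mul_one]
      _ = _ := by ring
  rw [e1]
  refine hH.trans ?_
  gcongr
  · calc _ ≤ (∫⁻ ξ : Space, (c : ℝ≥0∞) ^ 2 * jap (-(s - t)) ξ) ^ (1 / 2 : ℝ) := by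
          gcongr with ξ
          rw [ENNReal.rpow_two, mul_pow, ← ENNReal.ofReal_pow (hw0 ξ)]
          calc _ ≤ (c : ℝ≥0∞) ^ 2 * jap t ξ * jap (-s / 2) ξ ^ 2 := by gcongr; exact hwc ξ
            _ = _ := by rw [sq (jap _ _), hj, mul_assoc, hj]; congr 2; ring
      _ = _ := by
          rw [lintegral_const_mul' _ _ (by simp), ENNReal.mul_rpow_of_nonneg _ _ (by norm_num),
            ← ENNReal.rpow_two, ← ENNReal.rpow_mul]
          norm_num
  · rw [← ENNReal.rpow_le_rpow_iff (z := 2) (by norm_num), ← ENNReal.rpow_mul]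
    norm_num
    rw [sq_sobolevNorm hF]
    refine le_of_eq (lintegral_congr fun ξ => ?_)
    rw [mul_pow, sq (jap _ _), hj]; congr 2; ring

lemma abs_le_of_lintegral_fourier (hF : IsHinf F) {A : ℝ≥0}
    (h : ∫⁻ ξ, ‖fourierL2 F ξ‖ₑ ≤ A) (x : Space) : |F x| ≤ A := by
  have hi : Integrable (fourierL2 F) volume :=
    ⟨(memLp_fourierL2 hF.memLp).aestronglyMeasurable, h.trans_lt ENNReal.coe_lt_top⟩
  refine (abs_le_integral_fourierL2 hF.memLp hF.continuous hi x).trans ?_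
  rw [integral_norm_eq_lintegral_enorm hi.1]
  exact ENNReal.toReal_le_coe_of_le_coe h

lemma abs_le_sobolev {s : ℝ} (hs : 3 / 2 < s) : ∃ C : ℝ≥0, ∀ (F : Space → ℝ) (A : ℝ≥0), IsHinf F →
    sobolevNorm s F ≤ A → ∀ x, |F x| ≤ C * A := by
  refine ⟨((∫⁻ ξ : Space, jap (-(s - 0)) ξ) ^ (1 / 2 : ℝ)).toNNReal, fun F A hF hA x => ?_⟩
  have hfin : (∫⁻ ξ : Space, jap (-(s - 0)) ξ) ^ (1 / 2 : ℝ) ≠ ⊤ :=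
    (ENNReal.rpow_lt_top_of_nonneg (by norm_num)
      (by rw [sub_zero]; exact (lintegral_jap_neg_lt_top hs).ne)).ne
  have := lintegral_fourier_le (s := s) hF.memLp (w := fun _ => 1) measurable_const (c := 1) (t := 0)
    (fun ξ => by simp [jap]) (fun _ => zero_le_one)
  simp only [ENNReal.ofReal_one, one_mul, ENNReal.coe_one] at this
  have h2 := abs_le_of_lintegral_fourier hF (A := ((∫⁻ ξ : Space, jap (-(s - 0)) ξ) ^ (1 / 2 : ℝ)).toNNReal * A)
    (this.trans (by push_cast; rw [ENNReal.coe_toNNReal hfin]; gcongr)) x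
  simpa using h2

lemma abs_dif_le_sobolev {s : ℝ} (hs : 2 < s) : ∃ C : ℝ≥0, ∀ (F : Space → ℝ) (A : ℝ≥0), IsHinf F →
    sobolevNorm s F ≤ A → ∀ n k x, |dif (step n k) F x| ≤ C * A * √(rad n) := by
  refine ⟨4 * ((∫⁻ ξ : Space, jap (-(s - 1 / 2)) ξ) ^ (1 / 2 : ℝ)).toNNReal, fun F A hF hA n k x => ?_⟩
  have hfin : (∫⁻ ξ : Space, jap (-(s - 1 / 2)) ξ) ^ (1 / 2 : ℝ) ≠ ⊤ :=
    (ENNReal.rpow_lt_top_of_nonneg (by norm_num)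
      (lintegral_jap_neg_lt_top (s := s - 1 / 2) (by linarith)).ne).ne
  set Z := ((∫⁻ ξ : Space, jap (-(s - 1 / 2)) ξ) ^ (1 / 2 : ℝ)).toNNReal with hZ
  have hr := rad_pos n
  have hm := measurable_phase (step n k)
  have key := lintegral_fourier_le (s := s) hF.memLp (w := fun ξ => ‖phase (step n k) ξ - 1‖)
    (by fun_prop) (c := 4 * NNReal.sqrt (radN n)) (t := 1 / 2) ?_ (fun _ => norm_nonneg _)
  · have e : ∫⁻ ξ, ‖fourierL2 (dif (step n k) F) ξ‖ₑ =
        ∫⁻ ξ, ENNReal.ofReal ‖phase (step n k) ξ - 1‖ * ‖fourierL2 F ξ‖ₑ := by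
      refine lintegral_congr_ae ?_
      filter_upwards [fourierL2_dif hF.memLp (step n k)] with ξ h
      rw [h, enorm_mul, ofReal_norm]
    have h2 := abs_le_of_lintegral_fourier (hF.dif (step n k)) (A := 4 * NNReal.sqrt (radN n) * Z * A)
      (by
        rw [e]; refine key.trans ?_
        push_cast
        rw [hZ, ENNReal.coe_toNNReal hfin]
        gcongr) x
    refine h2.trans (le_of_eq ?_)
    push_cast [Real.coe_sqrt, coe_radN]
    ring
  · intro ξ
    have h1 := norm_phase_sub_one_le_two (step n k) ξ
    have h2 := norm_phase_sub_one_le (step n k) ξ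
    rw [inner_step, abs_mul, abs_of_pos hr] at h2
    have h3 : ‖phase (step n k) ξ - 1‖ ^ 2 ≤ 16 * rad n * (1 + ‖ξ‖ ^ 2) ^ (1 / 2 : ℝ) := by
      have h4 : |ξ k| ≤ (1 + ‖ξ‖ ^ 2) ^ (1 / 2 : ℝ) := by
        rw [← Real.sqrt_eq_rpow]
        refine Real.le_sqrt_of_sq_le ?_
        have := pow_le_pow_left₀ (abs_nonneg _) (abs_coord_le k ξ) 2
        linarith
      have h5 : 2 * Real.pi ≤ 8 := by linarith [Real.pi_lt_d2]
      calc _ = ‖phase (step n k) ξ - 1‖ * ‖phase (step n k) ξ - 1‖ := sq _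
        _ ≤ 2 * (2 * Real.pi * (rad n * |ξ k|)) := by gcongr
        _ ≤ 2 * (8 * (rad n * (1 + ‖ξ‖ ^ 2) ^ (1 / 2 : ℝ))) := by gcongr
        _ = _ := by ring
    refine (ENNReal.ofReal_le_ofReal h3).trans (le_of_eq ?_)
    rw [ENNReal.ofReal_mul (by positivity), jap]
    congr 1
    rw [ENNReal.coe_mul, mul_pow, ← ENNReal.coe_pow (NNReal.sqrt _), NNReal.sq_sqrt,
      ENNReal.ofReal_mul (by norm_num)]
    congr 1
    norm_num

end

section

/-! ### Calculus of weighted sums -/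

lemma ennreal_add_sq_le (a b : ℝ≥0∞) : (a + b) ^ 2 ≤ 2 * (a ^ 2 + b ^ 2) := by
  rcases eq_or_ne a ⊤ with rfl | ha
  · simp [ENNReal.mul_top]
  rcases eq_or_ne b ⊤ with rfl | hb
  · simp [ENNReal.mul_top]
  lift a to ℝ≥0 using ha
  lift b to ℝ≥0 using hb
  norm_cast
  rw [← NNReal.coe_le_coe]
  push_cast
  nlinarith [sq_nonneg ((a : ℝ) - b)]

lemma wsum_mono {s : ℝ} {a b : ℕ → ℝ≥0∞} (h : ∀ n, a n ≤ b n) : wsum s a ≤ wsum s b := by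
  unfold wsum
  exact ENNReal.tsum_le_tsum fun n => by gcongr; exact h n

lemma wsum_add_le (s : ℝ) (a b : ℕ → ℝ≥0∞) :
    wsum s (fun n => a n + b n) ≤ 2 * (wsum s a + wsum s b) := by
  unfold wsum
  rw [← ENNReal.tsum_add, ← ENNReal.tsum_mul_left]
  refine ENNReal.tsum_le_tsum fun n => ?_
  calc _ ≤ ENNReal.ofReal ((4 : ℝ) ^ (n * s)) * (2 * (a n ^ 2 + b n ^ 2)) := by
        gcongr; exact ennreal_add_sq_le _ _
    _ = _ := by ring

lemma wsum_const_mul (s : ℝ) (c : ℝ≥0∞) (a : ℕ → ℝ≥0∞) :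
    wsum s (fun n => c * a n) = c ^ 2 * wsum s a := by
  unfold wsum
  rw [← ENNReal.tsum_mul_left]
  exact tsum_congr fun n => by ring

lemma wsum_sum_le {ι : Type*} (t : Finset ι) (s : ℝ) (a : ι → ℕ → ℝ≥0∞) :
    wsum s (fun n => ∑ i ∈ t, a i n) ≤ t.card * ∑ i ∈ t, wsum s (a i) := by
  unfold wsum
  rw [← Summable.tsum_finsetSum (fun _ _ => ENNReal.summable), ← ENNReal.tsum_mul_left]
  refine ENNReal.tsum_le_tsum fun n => ?_
  have h : (∑ i ∈ t, a i n) ^ 2 ≤ t.card * ∑ i ∈ t, a i n ^ 2 := by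
    by_cases htop : ∃ i ∈ t, a i n = ⊤
    · obtain ⟨i, hi, h⟩ := htop
      have h1 : ∑ i ∈ t, a i n ^ 2 = ⊤ := ENNReal.sum_eq_top.2 ⟨i, hi, by simp [h]⟩
      rw [h1, ENNReal.mul_top (by simpa using Finset.ne_empty_of_mem hi)]
      exact le_top
    · push Not at htop
      have h2 : ∀ i ∈ t, a i n = ((a i n).toNNReal : ℝ≥0∞) := fun i hi =>
        (ENNReal.coe_toNNReal (htop i hi)).symm
      rw [Finset.sum_congr rfl h2,
        Finset.sum_congr rfl (fun i hi => by rw [h2 i hi] : ∀ i ∈ t, a i n ^ 2 = _)]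
      have h3 : (∑ i ∈ t, (a i n).toNNReal) ^ 2 ≤ (t.card : ℝ≥0) * ∑ i ∈ t, (a i n).toNNReal ^ 2 := by
        rw [← NNReal.coe_le_coe]
        push_cast
        exact sq_sum_le_card_mul_sum_sq
      exact_mod_cast h3
  calc _ ≤ ENNReal.ofReal ((4 : ℝ) ^ (n * s)) * (t.card * ∑ i ∈ t, a i n ^ 2) := by gcongr
    _ = _ := by rw [Finset.mul_sum, Finset.mul_sum, Finset.mul_sum]; exact
                  Finset.sum_congr rfl fun i _ => by ring

/-- `2^{-nβ}` as an extended nonnegative number. -/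
def rpw (β : ℝ) (n : ℕ) : ℝ≥0∞ := ENNReal.ofReal (rad n ^ β)

lemma wsum_rpw_lt {s β : ℝ} (h : s < β) : ∃ C : ℝ≥0, wsum s (rpw β) ≤ C := by
  have hq1 : (4 : ℝ) ^ (s - β) < 1 :=
    Real.rpow_lt_one_of_one_lt_of_neg (by norm_num) (by linarith)
  refine ⟨(1 - (4 : ℝ) ^ (s - β))⁻¹.toNNReal, ?_⟩
  unfold wsum rpw
  change _ ≤ ENNReal.ofReal _
  rw [← tsum_geometric_of_lt_one (by positivity) hq1,
    ENNReal.ofReal_tsum_of_nonneg (fun n => by positivity)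
      (summable_geometric_of_lt_one (by positivity) hq1)]
  refine ENNReal.tsum_le_tsum fun n => ?_
  have hr := rad_pos n
  rw [← ENNReal.ofReal_pow (by positivity), ← ENNReal.ofReal_mul (by positivity)]
  refine ENNReal.ofReal_le_ofReal (le_of_eq ?_)
  rw [four_rpow_eq, ← Real.rpow_natCast (rad n ^ β), ← Real.rpow_mul hr.le, ← Real.rpow_add hr,
    ← Real.rpow_natCast, ← Real.rpow_mul (by norm_num), mul_comm (s - β), four_rpow_eq]
  congr 1; push_cast; ring

lemma wsum_le_of_le_rpw {s β : ℝ} (h : s < β) : ∃ C : ℝ≥0, ∀ (B : ℝ≥0) (a : ℕ → ℝ≥0∞),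
    (∀ n, a n ≤ B * rpw β n) → wsum s a ≤ C * B ^ 2 := by
  obtain ⟨C, hC⟩ := wsum_rpw_lt h
  refine ⟨C, fun B a ha => (wsum_mono ha).trans ?_⟩
  rw [wsum_const_mul, mul_comm]
  gcongr

/-! ### Calculus of differences in `L²` -/

lemma nrm_add_le {F G : Space → ℝ} (hF : Continuous F) (hG : Continuous G) :
    nrm (fun x => F x + G x) ≤ nrm F + nrm G :=
  eLpNorm_add_le hF.aestronglyMeasurable hG.aestronglyMeasurable (by norm_num)

lemma nrm_mul_le {f g : Space → ℝ} (c : ℝ≥0) (h : ∀ x, |f x| ≤ c) :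
    nrm (fun x => f x * g x) ≤ c * nrm g :=
  eLpNorm_le_nnreal_smul_eLpNorm_of_ae_le_mul (Filter.Eventually.of_forall fun x => by
    rw [nnnorm_mul]; gcongr; exact_mod_cast h x) 2

lemma nrm_mul_le' {f g : Space → ℝ} (c : ℝ≥0) (h : ∀ x, |g x| ≤ c) :
    nrm (fun x => f x * g x) ≤ c * nrm f := by
  have := nrm_mul_le (f := g) (g := f) c h
  simpa only [mul_comm] using this

lemma nrm_const_mul (c : ℝ) (f : Space → ℝ) : nrm (fun x => c * f x) = ‖c‖₊ * nrm f := by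
  have := eLpNorm_const_smul (p := 2) c f (volume : Measure Space)
  exact this

lemma nrm_translate {F : Space → ℝ} (hF : Continuous F) (h : Space) :
    nrm (fun x => F (x + h)) = nrm F := eLpNorm_translate hF.aestronglyMeasurable h 2

lemma nrm_sum_le {ι : Type*} (t : Finset ι) {F : ι → Space → ℝ} (hF : ∀ i, Continuous (F i)) :
    nrm (fun x => ∑ i ∈ t, F i x) ≤ ∑ i ∈ t, nrm (F i) := by
  have := eLpNorm_sum_le (s := t) (f := F) (p := 2) (μ := (volume : Measure Space))
    (fun i _ => (hF i).aestronglyMeasurable) (by norm_num)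
  refine le_trans (le_of_eq ?_) this
  unfold nrm
  congr 1
  ext x; simp

lemma continuous_dif {F : Space → ℝ} (hF : Continuous F) (h : Space) : Continuous (dif h F) :=
  (hF.comp (continuous_id.add continuous_const)).sub hF

lemma nrm_dif_le_two {F : Space → ℝ} (hF : Continuous F) (h : Space) :
    nrm (dif h F) ≤ 2 * nrm F := by
  have h1 : nrm (dif h F) ≤ nrm (fun x => F (x + h)) + nrm F :=
    eLpNorm_sub_le (hF.comp (continuous_id.add continuous_const)).aestronglyMeasurable
      hF.aestronglyMeasurable (by norm_num)
  rw [nrm_translate hF] at h1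
  rwa [two_mul]

lemma abs_dif_le_two {F : Space → ℝ} {c : ℝ} (hF : ∀ x, |F x| ≤ c) (h x : Space) :
    |dif h F x| ≤ 2 * c := by
  unfold dif
  have h1 := hF (x + h); have h2 := hF x
  have := abs_sub (F (x + h)) (F x)
  linarith

lemma dif_dif_mul (h : Space) (f w : Space → ℝ) : dif h (dif h fun x => f x * w x) =
    fun x => f x * dif h (dif h w) x + 2 * (dif h f x * dif h w (x + h)) +
      dif h (dif h f) x * w (x + (h + h)) := by
  ext x; unfold dif; rw [← add_assoc x h h]; ring

lemma dif_dif_dif_mul (h : Space) (f w : Space → ℝ) :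
    dif h (dif h (dif h fun x => f x * w x)) =
    fun x => f x * dif h (dif h (dif h w)) x + 3 * (dif h f x * dif h (dif h w) (x + h)) +
      3 * (dif h (dif h f) x * dif h w (x + (h + h))) +
      dif h (dif h (dif h f)) x * w (x + (h + h + h)) := by
  ext x; unfold dif; rw [← add_assoc x h h, ← add_assoc x (h + h) h, ← add_assoc x h h]; ring

/-! ### Interpolation inequalities of Gagliardo-Nirenberg type -/

lemma integrable_sq_of_nrm {f : Space → ℝ} (hc : Continuous f) (hf : nrm f < ⊤) :
    Integrable (fun x => f x ^ 2) volume :=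
  (MemLp.integrable_sq ⟨hc.aestronglyMeasurable, hf⟩)

lemma sq_nrm_eq_ofReal {f : Space → ℝ} (hc : Continuous f) (hf : nrm f < ⊤) :
    nrm f ^ 2 = ENNReal.ofReal (∫ x, f x ^ 2) := by
  rw [sq_nrm, ofReal_integral_eq_lintegral_ofReal (integrable_sq_of_nrm hc hf)
    (Filter.Eventually.of_forall fun x => sq_nonneg _)]
  refine lintegral_congr fun x => ?_
  rw [← sq_abs, ENNReal.ofReal_pow (abs_nonneg _), Real.enorm_eq_ofReal_abs]

lemma integral_dif_pow_four_le {v : Space → ℝ} (hc : Continuous v) {V : ℝ} (hV : ∀ x, |v x| ≤ V)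
    (h : Space) (hd : nrm (dif h v) < ⊤) :
    Integrable (fun x => dif h v x ^ 4) volume ∧
    ∫ x, dif h v x ^ 4 ≤ 9 * V ^ 2 * ∫ x, dif h (dif h v) x ^ 2 := by
  have hV0 : 0 ≤ V := (abs_nonneg _).trans (hV 0)
  have hcd := continuous_dif hc h
  have hb := abs_dif_le_two hV h
  have hi2 := integrable_sq_of_nrm hcd hd
  have hd2 : nrm (dif h (dif h v)) < ⊤ :=
    (nrm_dif_le_two hcd h).trans_lt (ENNReal.mul_lt_top (by norm_num) hd)
  have hi22 := integrable_sq_of_nrm (continuous_dif hcd h) hd2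
  have hi4 : Integrable (fun x => dif h v x ^ 4) volume := by
    refine (hi2.const_mul ((2 * V) ^ 2)).mono' (by fun_prop) (Filter.Eventually.of_forall fun x => ?_)
    have : dif h v x ^ 2 ≤ (2 * V) ^ 2 := by
      rw [← sq_abs]; exact pow_le_pow_left₀ (abs_nonneg _) (hb x) 2
    rw [Real.norm_of_nonneg (by positivity)]
    nlinarith [sq_nonneg (dif h v x)]
  have hi3 : ∀ g : Space → ℝ, Continuous g → (∀ x, |g x| ≤ V) →
      Integrable (fun x => dif h v x ^ 3 * g x) volume := by
    intro g hg hgV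
    refine (hi2.const_mul ((2 * V) * V)).mono' (by fun_prop) (Filter.Eventually.of_forall fun x => ?_)
    rw [Real.norm_eq_abs, abs_mul, abs_pow]
    calc |dif h v x| ^ 3 * |g x| = |dif h v x| * |g x| * dif h v x ^ 2 := by
          rw [← sq_abs]; ring
      _ ≤ (2 * V) * V * dif h v x ^ 2 := by
          gcongr
          · exact hb x
          · exact hgV x
  have hct : Continuous fun x => v (x + h) := hc.comp (continuous_id.add continuous_const)
  have hA := hi3 _ hct (fun x => hV _)
  have hB := hi3 v hc hV
  have e1 : ∫ x, dif h v x ^ 4 =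
      (∫ x, dif h v x ^ 3 * v (x + h)) - ∫ x, dif h v x ^ 3 * v x := by
    rw [← integral_sub hA hB]
    refine integral_congr_ae (Filter.Eventually.of_forall fun x => ?_)
    simp only [dif]; ring
  have e2 : ∫ x, dif h v x ^ 3 * v x = ∫ x, dif h v (x + h) ^ 3 * v (x + h) :=
    (integral_add_right_eq_self (fun x => dif h v x ^ 3 * v x) h).symm
  have hB' : Integrable (fun x => dif h v (x + h) ^ 3 * v (x + h)) volume := hB.comp_add_right h
  have hi4' : Integrable (fun x => dif h v (x + h) ^ 4) volume := hi4.comp_add_right h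
  have e3 : ∫ x, dif h v (x + h) ^ 4 = ∫ x, dif h v x ^ 4 :=
    integral_add_right_eq_self (fun x => dif h v x ^ 4) h
  refine ⟨hi4, ?_⟩
  have hle : ∫ x, (dif h v x ^ 3 * v (x + h) - dif h v (x + h) ^ 3 * v (x + h)) ≤
      ∫ x, ((1 / 4) * dif h v x ^ 4 + (1 / 4) * dif h v (x + h) ^ 4 +
        9 / 2 * V ^ 2 * dif h (dif h v) x ^ 2) := by
    refine integral_mono (hA.sub hB')
      (((hi4.const_mul _).add (hi4'.const_mul _)).add (hi22.const_mul _)) fun x => ?_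
    simp only
    have hdd : dif h (dif h v) x = dif h v (x + h) - dif h v x := rfl
    rw [hdd]
    generalize dif h v x = a
    generalize dif h v (x + h) = b
    have hw := hV (x + h)
    generalize v (x + h) = w at hw
    have h1 : a ^ 3 * w - b ^ 3 * w ≤ |b - a| * V * (3 / 2 * (a ^ 2 + b ^ 2)) := by
      have h2 : a ^ 3 * w - b ^ 3 * w = (a - b) * w * (a ^ 2 + a * b + b ^ 2) := by ring
      have h3 : a ^ 2 + a * b + b ^ 2 ≤ 3 / 2 * (a ^ 2 + b ^ 2) := by nlinarith [sq_nonneg (a - b)]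
      have h4 : 0 ≤ a ^ 2 + a * b + b ^ 2 := by nlinarith [sq_nonneg (a + b), sq_nonneg a, sq_nonneg b]
      have h5 : (a - b) * w ≤ |b - a| * V := by
        refine (le_abs_self _).trans ?_
        rw [abs_mul, abs_sub_comm]
        gcongr
      rw [h2]
      calc _ ≤ |b - a| * V * (a ^ 2 + a * b + b ^ 2) := by gcongr
        _ ≤ _ := by gcongr
    have h6 : |b - a| ^ 2 = (b - a) ^ 2 := sq_abs _
    have h7 := sq_nonneg (a ^ 2 / 2 - 3 / 2 * (|b - a| * V))
    have h8 := sq_nonneg (b ^ 2 / 2 - 3 / 2 * (|b - a| * V))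
    have h9 : (|b - a| * V) ^ 2 = (b - a) ^ 2 * V ^ 2 := by rw [mul_pow, h6]
    nlinarith
  have hq : Integrable (fun x => (1 / 4) * dif h v x ^ 4 + (1 / 4) * dif h v (x + h) ^ 4) volume :=
    (hi4.const_mul _).add (hi4'.const_mul _)
  rw [integral_sub hA hB', integral_add hq (hi22.const_mul _), integral_add (hi4.const_mul _) (hi4'.const_mul _), integral_const_mul,
    integral_const_mul, integral_const_mul, e3, ← e2, ← e1] at hle
  linarith

/-- `‖δv τδw‖₂` is controlled by second differences and the bounds of `v`, `w`. -/
lemma nrm_dif_mul_dif_le {v w : Space → ℝ} (hv : Continuous v) (hw : Continuous w) {V W : ℝ≥0}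
    (hV0 : 0 < V) (hW0 : 0 < W)
    (hV : ∀ x, |v x| ≤ V) (hW : ∀ x, |w x| ≤ W) (h : Space)
    (hdv : nrm (dif h v) < ⊤) (hdw : nrm (dif h w) < ⊤) :
    nrm (fun x => dif h v x * dif h w (x + h)) ≤
      3 * (W * nrm (dif h (dif h v)) + V * nrm (dif h (dif h w))) := by
  obtain ⟨hiv, hv4⟩ := integral_dif_pow_four_le hv hV h hdv
  obtain ⟨hiw, hw4⟩ := integral_dif_pow_four_le hw hW h hdw
  have hcv := continuous_dif hv h
  have hcw := continuous_dif hw h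
  have hv2 : nrm (dif h (dif h v)) < ⊤ :=
    (nrm_dif_le_two hcv h).trans_lt (ENNReal.mul_lt_top (by norm_num) hdv)
  have hw2 : nrm (dif h (dif h w)) < ⊤ :=
    (nrm_dif_le_two hcw h).trans_lt (ENNReal.mul_lt_top (by norm_num) hdw)
  refine le_of_sq_le_sq ?_
  have hiw' : Integrable (fun x => dif h w (x + h) ^ 4) volume := hiw.comp_add_right h
  have e3 : ∫ x, dif h w (x + h) ^ 4 = ∫ x, dif h w x ^ 4 :=
    integral_add_right_eq_self (fun x => dif h w x ^ 4) h
  have hV1 : (0 : ℝ) < V := hV0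
  have hW1 : (0 : ℝ) < W := hW0
  have hint : Integrable (fun x => (W : ℝ) ^ 2 / V ^ 2 * dif h v x ^ 4 +
      (V : ℝ) ^ 2 / W ^ 2 * dif h w (x + h) ^ 4) volume := (hiv.const_mul _).add (hiw'.const_mul _)
  calc nrm (fun x => dif h v x * dif h w (x + h)) ^ 2
      ≤ ∫⁻ x, ENNReal.ofReal ((W : ℝ) ^ 2 / V ^ 2 * dif h v x ^ 4 +
          (V : ℝ) ^ 2 / W ^ 2 * dif h w (x + h) ^ 4) := by
        rw [sq_nrm]
        refine lintegral_mono fun x => ?_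
        rw [Real.enorm_eq_ofReal_abs, ← ENNReal.ofReal_pow (abs_nonneg _), sq_abs]
        refine ENNReal.ofReal_le_ofReal ?_
        generalize dif h v x = a
        generalize dif h w (x + h) = b
        have h1 := sq_nonneg ((W : ℝ) / V * a ^ 2 - V / W * b ^ 2)
        have h2 : (W : ℝ) / V * a ^ 2 * (V / W * b ^ 2) = a ^ 2 * b ^ 2 := by field_simp
        have h3 : 0 ≤ a ^ 2 * b ^ 2 := by positivity
        calc (a * b) ^ 2 = a ^ 2 * b ^ 2 := by ring
          _ ≤ ((W : ℝ) / V * a ^ 2) ^ 2 + (V / W * b ^ 2) ^ 2 := by nlinarith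
          _ = _ := by ring
    _ = ENNReal.ofReal ((W : ℝ) ^ 2 / V ^ 2 * (∫ x, dif h v x ^ 4) +
          (V : ℝ) ^ 2 / W ^ 2 * ∫ x, dif h w x ^ 4) := by
        rw [← ofReal_integral_eq_lintegral_ofReal hint
          (Filter.Eventually.of_forall fun x => by positivity)]
        rw [integral_add (hiv.const_mul _) (hiw'.const_mul _), integral_const_mul,
          integral_const_mul, e3]
    _ ≤ ENNReal.ofReal (9 * W ^ 2 * ∫ x, dif h (dif h v) x ^ 2) +
          ENNReal.ofReal (9 * V ^ 2 * ∫ x, dif h (dif h w) x ^ 2) := by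
        rw [← ENNReal.ofReal_add
          (mul_nonneg (by positivity) (integral_nonneg fun x => sq_nonneg _))
          (mul_nonneg (by positivity) (integral_nonneg fun x => sq_nonneg _))]
        refine ENNReal.ofReal_le_ofReal (add_le_add ?_ ?_)
        · calc _ ≤ (W : ℝ) ^ 2 / V ^ 2 * (9 * V ^ 2 * ∫ x, dif h (dif h v) x ^ 2) := by gcongr
            _ = _ := by field_simp
        · calc _ ≤ (V : ℝ) ^ 2 / W ^ 2 * (9 * W ^ 2 * ∫ x, dif h (dif h w) x ^ 2) := by gcongr
            _ = _ := by field_simp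
    _ = 9 * W ^ 2 * nrm (dif h (dif h v)) ^ 2 + 9 * V ^ 2 * nrm (dif h (dif h w)) ^ 2 := by
        rw [sq_nrm_eq_ofReal (continuous_dif hcv h) hv2, sq_nrm_eq_ofReal (continuous_dif hcw h) hw2,
          ENNReal.ofReal_mul (by positivity), ENNReal.ofReal_mul (by positivity),
          ENNReal.ofReal_mul (by positivity), ENNReal.ofReal_mul (by positivity),
          ENNReal.ofReal_pow (by positivity), ENNReal.ofReal_pow (by positivity)]
        simp
    _ ≤ 9 * (W * nrm (dif h (dif h v)) + V * nrm (dif h (dif h w))) ^ 2 := by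
        rw [mul_assoc, mul_assoc, ← mul_add, ← mul_pow, ← mul_pow]
        gcongr
        rw [add_sq]
        calc _ ≤ ((W : ℝ≥0∞) * nrm (dif h (dif h v))) ^ 2 + ((V : ℝ≥0∞) * nrm (dif h (dif h w))) ^ 2 +
              2 * (W * nrm (dif h (dif h v))) * (V * nrm (dif h (dif h w))) := le_self_add
          _ = _ := by ring
    _ = _ := by rw [mul_pow]; norm_num

/-- Second differences of a product of bounded functions. -/
lemma nrm_dif_dif_mul_le {v w : Space → ℝ} (hv : Continuous v) (hw : Continuous w) {V W : ℝ≥0}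
    (hV0 : 0 < V) (hW0 : 0 < W)
    (hV : ∀ x, |v x| ≤ V) (hW : ∀ x, |w x| ≤ W) (h : Space)
    (hdv : nrm (dif h v) < ⊤) (hdw : nrm (dif h w) < ⊤) :
    nrm (dif h (dif h (fun x => v x * w x))) ≤
      7 * (W * nrm (dif h (dif h v)) + V * nrm (dif h (dif h w))) := by
  have hcv := continuous_dif hv h
  have hcw := continuous_dif hw h
  have hcvv := continuous_dif hcv h
  have hcww := continuous_dif hcw h
  have ht : ∀ g : Space → ℝ, Continuous g → ∀ y, Continuous fun x => g (x + y) := fun g hg y =>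
    hg.comp (continuous_id.add continuous_const)
  have hw' := ht w hw (h + h)
  have hcw' := ht _ hcw h
  rw [dif_dif_mul]
  refine (nrm_add_le (by fun_prop) (by fun_prop)).trans ?_
  refine (add_le_add_left (nrm_add_le (by fun_prop) (by fun_prop)) _).trans ?_
  have h1 := nrm_mul_le (f := v) (g := dif h (dif h w)) V hV
  have h2 := nrm_dif_mul_dif_le hv hw hV0 hW0 hV hW h hdv hdw
  have h3 := nrm_mul_le' (f := dif h (dif h v)) (g := fun x => w (x + (h + h))) W (fun x => hW _)
  rw [nrm_const_mul]
  have e2 : ((‖(2 : ℝ)‖₊ : ℝ≥0) : ℝ≥0∞) = 2 := by simp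
  rw [e2]
  calc _ ≤ V * nrm (dif h (dif h w)) + 2 * (3 * (W * nrm (dif h (dif h v)) +
        V * nrm (dif h (dif h w)))) + W * nrm (dif h (dif h v)) := by gcongr
    _ = _ := by ring

/-- `‖∂_kP‖₄² ≤ 3 ‖P‖_∞ ‖∂_k²P‖₂`. -/
lemma integral_der_pow_four_le {v : Space → ℝ} (hv : IsHinf v) {V : ℝ} (hV : ∀ x, |v x| ≤ V)
    (k : Fin 3) :
    Integrable (fun x => der k v x ^ 4) volume ∧
    ∫ x, der k v x ^ 4 ≤ 9 * V ^ 2 * ∫ x, der k (der k v) x ^ 2 := by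
  have hV0 : 0 ≤ V := (abs_nonneg _).trans (hV 0)
  obtain ⟨C, hC⟩ := abs_le_sobolev (s := 2) (by norm_num)
  have hD := hv.der k
  have hDD := hD.der k
  set M : ℝ := C * (sobolevNorm 2 (der k v)).toNNReal with hM
  have hb : ∀ x, |der k v x| ≤ M := hC _ _ hD
    (by rw [ENNReal.coe_toNNReal (sobolevNorm_lt_top hD 2).ne])
  have hc0 := hv.continuous
  have hc1 := hD.continuous
  have hc2 := hDD.continuous
  have hi1 : Integrable (fun x => der k v x ^ 2) volume := hD.memLp.integrable_sq
  have hi2 : Integrable (fun x => der k (der k v) x ^ 2) volume := hDD.memLp.integrable_sq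
  have hM0 : 0 ≤ M := (abs_nonneg _).trans (hb 0)
  have hi4 : Integrable (fun x => der k v x ^ 4) volume := by
    refine (hi1.const_mul (M ^ 2)).mono' (by fun_prop) (Filter.Eventually.of_forall fun x => ?_)
    have : der k v x ^ 2 ≤ M ^ 2 := by
      rw [← sq_abs]; exact pow_le_pow_left₀ (abs_nonneg _) (hb x) 2
    rw [Real.norm_of_nonneg (by positivity)]
    nlinarith [sq_nonneg (der k v x)]
  have hderiv : ∀ x, fderiv ℝ (fun x => der k v x ^ 3) x (bas k) =
      3 * der k v x ^ 2 * der k (der k v) x := by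
    intro x
    have := ((hD.differentiable x).hasFDerivAt.pow 3).fderiv
    rw [this]
    simp [der]
  have hpt : ∀ x, |3 * der k v x ^ 2 * der k (der k v) x * v x| ≤
      1 / 2 * der k v x ^ 4 + 9 / 2 * V ^ 2 * der k (der k v) x ^ 2 := by
    intro x
    rw [abs_mul, abs_mul]
    have h1 := hV x
    rw [abs_of_nonneg (by positivity : (0:ℝ) ≤ 3 * der k v x ^ 2)]
    have h2 := sq_nonneg (der k v x ^ 2 - 3 * (V * |der k (der k v) x|))
    have h3 : (V * |der k (der k v) x|) ^ 2 = V ^ 2 * der k (der k v) x ^ 2 := by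
      rw [mul_pow, sq_abs]
    calc _ ≤ 3 * der k v x ^ 2 * |der k (der k v) x| * V := by gcongr
      _ ≤ _ := by nlinarith
  have hmaj : Integrable (fun x => 1 / 2 * der k v x ^ 4 + 9 / 2 * V ^ 2 * der k (der k v) x ^ 2)
      volume := (hi4.const_mul _).add (hi2.const_mul _)
  have hI : Integrable (fun x => 3 * der k v x ^ 2 * der k (der k v) x * v x) volume :=
    hmaj.mono' (by fun_prop) (Filter.Eventually.of_forall fun x => hpt x)
  have ibp := integral_mul_fderiv_eq_neg_fderiv_mul_of_integrable (μ := (volume : Measure Space))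
    (f := fun x => der k v x ^ 3) (g := v) (v := bas k) ?_ ?_ ?_ ?_ ?_
  · refine ⟨hi4, ?_⟩
    have e : ∫ x, der k v x ^ 4 = ∫ x, der k v x ^ 3 * fderiv ℝ v x (bas k) :=
      integral_congr_ae (Filter.Eventually.of_forall fun x => by simp only [der]; ring)
    simp_rw [hderiv] at ibp
    have h1 : ∫ x, der k v x ^ 4 ≤
        ∫ x, (1 / 2 * der k v x ^ 4 + 9 / 2 * V ^ 2 * der k (der k v) x ^ 2) := by
      conv_lhs => rw [e, ibp]
      rw [← integral_neg]
      exact integral_mono hI.neg hmaj fun x => (neg_le_abs _).trans (hpt x)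
    rw [integral_add (hi4.const_mul _) (hi2.const_mul _), integral_const_mul,
      integral_const_mul] at h1
    linarith
  · simp_rw [hderiv]; exact hI
  · refine hi4.congr (Filter.Eventually.of_forall fun x => ?_)
    simp only [der]; ring
  · refine ((hi1.const_mul (M * V)).mono' (by fun_prop) (Filter.Eventually.of_forall fun x => ?_))
    rw [Real.norm_eq_abs, abs_mul, abs_pow]
    calc |der k v x| ^ 3 * |v x| = |der k v x| * |v x| * der k v x ^ 2 := by rw [← sq_abs]; ring
      _ ≤ M * V * der k v x ^ 2 := by
          gcongr
          · exact hb x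
          · exact hV x
  · intro x _
    exact (hD.differentiable x).pow 3
  · intro x _
    exact hv.differentiable x

end

section

/-! ### Finite differences of a smooth function along a sequence of points -/

lemma abs_sub_le_of_deriv {f f' : ℝ → ℝ} {a M : ℝ}
    (hd : ∀ s, HasDerivAt f (f' s) s) (hM : ∀ s ∈ Icc a (a + 1), |f' s| ≤ M) :
    |f (a + 1) - f a| ≤ M := by
  have := (convex_Icc a (a + 1)).norm_image_sub_le_of_norm_hasDerivWithin_le
    (fun s _ => (hd s).hasDerivWithinAt) (fun s hs => by simpa using hM s hs)
    (left_mem_Icc.2 (by linarith)) (right_mem_Icc.2 (by linarith : a ≤ a + 1))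
  simpa using this

lemma abs_second_dif_le {g g1 g2 : ℝ → ℝ} {M : ℝ} (h0 : ∀ s, HasDerivAt g (g1 s) s)
    (h1 : ∀ s, HasDerivAt g1 (g2 s) s) {b : ℝ} (hM : ∀ s ∈ Icc b (b + 2), |g2 s| ≤ M) :
    |g (b + 2) - 2 * g (b + 1) + g b| ≤ M := by
  have hk : ∀ s, HasDerivAt (fun s => g (s + 1) - g s) (g1 (s + 1) - g1 s) s := fun s =>
    ((h0 (s + 1)).comp_add_const s 1).sub (h0 s)
  have := abs_sub_le_of_deriv (a := b) hk (M := M) (fun s hs => by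
    refine abs_sub_le_of_deriv h1 fun t ht => hM t ⟨?_, ?_⟩
    · exact hs.1.trans ht.1
    · have := hs.2; have := ht.2; linarith)
  convert this using 2
  rw [show b + 1 + 1 = b + 2 by ring]; ring

lemma abs_third_dif_le {g g1 g2 g3 : ℝ → ℝ} {M : ℝ} (h0 : ∀ s, HasDerivAt g (g1 s) s)
    (h1 : ∀ s, HasDerivAt g1 (g2 s) s) (h2 : ∀ s, HasDerivAt g2 (g3 s) s)
    (hM : ∀ s ∈ Icc (0 : ℝ) 3, |g3 s| ≤ M) :
    |g 3 - 3 * g 2 + 3 * g 1 - g 0| ≤ M := by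
  have hk : ∀ s, HasDerivAt (fun s => g (s + 1) - g s) (g1 (s + 1) - g1 s) s := fun s =>
    ((h0 (s + 1)).comp_add_const s 1).sub (h0 s)
  have hk1 : ∀ s, HasDerivAt (fun s => g1 (s + 1) - g1 s) (g2 (s + 1) - g2 s) s := fun s =>
    ((h1 (s + 1)).comp_add_const s 1).sub (h1 s)
  have := abs_second_dif_le (b := 0) hk hk1 (M := M) (fun s hs => by
    refine abs_sub_le_of_deriv h2 fun t ht => hM t ⟨?_, ?_⟩
    · exact hs.1.trans ht.1
    · have := hs.2; have := ht.2; linarith)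
  norm_num at this
  convert this using 2
  ring

lemma cubic_le {z v e R : ℝ} (hz : 0 ≤ z) (hv : 0 ≤ v) (he : 0 ≤ e) (hR : 0 ≤ R)
    (heR : e ≤ 4 * R) : z + ((v + 3 * e) ^ 3 + 3 * ((v + 3 * e) * e)) ≤
      (30 * (1 + 40 * R)) * (z + v ^ 3 + e ^ 2 + v * e) := by
  have i1 : (v + 3 * e) ^ 3 ≤ 4 * v ^ 3 + 108 * e ^ 3 := by
    nlinarith [mul_nonneg (add_nonneg hv (mul_nonneg (by norm_num : (0:ℝ) ≤ 3) he))
      (sq_nonneg (v - 3 * e))]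
  have i2 : e ^ 3 ≤ 4 * R * e ^ 2 := by
    rw [pow_succ' e 2]
    exact mul_le_mul_of_nonneg_right heR (sq_nonneg e)
  have j1 : 0 ≤ R * z := by positivity
  have j2 : 0 ≤ R * v ^ 3 := by positivity
  have j3 : 0 ≤ R * e ^ 2 := by positivity
  have j4 : 0 ≤ R * (v * e) := by positivity
  have k2 : 0 ≤ v ^ 3 := by positivity
  have k3 : 0 ≤ e ^ 2 := by positivity
  have k4 : 0 ≤ v * e := by positivity
  have e1 : 3 * ((v + 3 * e) * e) = 3 * (v * e) + 9 * e ^ 2 := by ring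
  have e2 : (30 * (1 + 40 * R)) * (z + v ^ 3 + e ^ 2 + v * e) =
    30 * z + 30 * v ^ 3 + 30 * e ^ 2 + 30 * (v * e) + 1200 * (R * z) + 1200 * (R * v ^ 3) +
      1200 * (R * e ^ 2) + 1200 * (R * (v * e)) := by ring
  have e3 : 4 * R * e ^ 2 = 4 * (R * e ^ 2) := by ring
  rw [e1, e2]
  rw [e3] at i2
  linarith

section Moser

variable {E : Type*} [NormedAddCommGroup E] [NormedSpace ℝ E] [FiniteDimensional ℝ E]

set_option maxSynthPendingDepth 3 in
set_option maxHeartbeats 1000000 in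
/-- Finite differences of a smooth function on bounded sets. -/
lemma exists_dif_comp_bound {G : E → ℝ} (hG : ContDiff ℝ ∞ G) (R : ℝ) :
    ∃ L : ℝ≥0, ∀ a b c d : E, ‖a‖ ≤ R → ‖b‖ ≤ R → ‖c‖ ≤ R → ‖d‖ ≤ R →
      |G a| ≤ L ∧ |G b - G a| ≤ L * ‖b - a‖ ∧
      |G c - 2 * G b + G a| ≤ L * (‖c - (2 : ℝ) • b + a‖ + ‖b - a‖ ^ 2) ∧
      |G d - 3 * G c + 3 * G b - G a| ≤ L * (‖d - (3 : ℝ) • c + (3 : ℝ) • b - a‖ +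
        ‖b - a‖ ^ 3 + ‖c - (2 : ℝ) • b + a‖ ^ 2 + ‖b - a‖ * ‖c - (2 : ℝ) • b + a‖) := by
  set D1 := fderiv ℝ G with hD1
  have c1 : ContDiff ℝ ∞ D1 := hG.fderiv_right (m := ∞) (by simp)
  set D2 := fderiv ℝ D1 with hD2
  have c2 : ContDiff ℝ ∞ D2 := c1.fderiv_right (m := ∞) (by simp)
  set D3 := fderiv ℝ D2 with hD3
  have c3 : ContDiff ℝ ∞ D3 := c2.fderiv_right (m := ∞) (by simp)
  have hK : IsCompact (Metric.closedBall (0 : E) (40 * |R| + 1)) := isCompact_closedBall _ _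
  obtain ⟨L0, hL0⟩ := hK.exists_bound_of_continuousOn hG.continuous.continuousOn
  obtain ⟨L1, hL1⟩ := hK.exists_bound_of_continuousOn c1.continuous.continuousOn
  obtain ⟨L2, hL2⟩ := hK.exists_bound_of_continuousOn c2.continuous.continuousOn
  obtain ⟨L3, hL3⟩ := hK.exists_bound_of_continuousOn c3.continuous.continuousOn
  set L : ℝ := max (max |L0| |L1|) (max |L2| |L3|) with hL
  have l0 : L0 ≤ L := (le_abs_self _).trans ((le_max_left _ _).trans (le_max_left _ _))
  have l1 : L1 ≤ L := (le_abs_self _).trans ((le_max_right _ _).trans (le_max_left _ _))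
  have l2 : L2 ≤ L := (le_abs_self _).trans ((le_max_left _ _).trans (le_max_right _ _))
  have l3 : L3 ≤ L := (le_abs_self _).trans ((le_max_right _ _).trans (le_max_right _ _))
  have hLnn : 0 ≤ L := (abs_nonneg L0).trans ((le_max_left _ _).trans (le_max_left _ _))
  have hR0 : 0 ≤ |R| := abs_nonneg R
  have mem : ∀ x : E, ‖x‖ ≤ 40 * |R| → x ∈ Metric.closedBall (0 : E) (40 * |R| + 1) := fun x hx => by
    rw [mem_closedBall_zero_iff]; linarith
  have hlip : ∀ x y : E, ‖x‖ ≤ 40 * |R| → ‖y‖ ≤ 40 * |R| → |G x - G y| ≤ L * ‖x - y‖ := by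
    intro x y hx hy
    have := (convex_closedBall (0 : E) (40 * |R| + 1)).norm_image_sub_le_of_norm_fderiv_le
      (f := G) (C := L) (𝕜 := ℝ) (fun z _ => hG.differentiable (by simp) z)
      (fun z hz => (hL1 z hz).trans l1) (mem y hy) (mem x hx)
    simpa using this
  set Q : ℝ := 1 + 40 * |R| with hQ
  refine ⟨(L * (30 * Q)).toNNReal, fun a b c d ha hb hc hd => ?_⟩
  rw [Real.coe_toNNReal _ (by positivity : 0 ≤ L * (30 * Q))]
  have hRR : R ≤ |R| := le_abs_self R
  have hQ1 : 1 ≤ Q := by linarith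
  have hLQ : L ≤ L * (30 * Q) := by nlinarith
  have na : ‖a‖ ≤ 40 * |R| := by linarith
  have nb : ‖b‖ ≤ 40 * |R| := by linarith
  refine ⟨((hL0 a (mem a na)).trans l0).trans hLQ, ?_, ?_, ?_⟩
  · exact (hlip b a nb na).trans (mul_le_mul_of_nonneg_right hLQ (norm_nonneg _))
  all_goals
    obtain ⟨v, hv⟩ : ∃ v, v = b - a := ⟨_, rfl⟩
    obtain ⟨e, he⟩ : ∃ e, e = c - (2 : ℝ) • b + a := ⟨_, rfl⟩
    have nv : ‖v‖ ≤ 2 * |R| := by rw [hv]; exact (norm_sub_le _ _).trans (by linarith)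
    have ne : ‖e‖ ≤ 4 * |R| := by
      rw [he]
      refine (norm_add_le _ _).trans ?_
      have h1 := norm_sub_le c ((2 : ℝ) • b)
      rw [norm_smul] at h1
      norm_num at h1
      linarith
    rw [← hv, ← he]
    have hbv : b = a + v := by rw [hv]; abel
    have hce : c = a + (2 : ℝ) • v + e := by rw [hv, he, smul_sub, two_smul, two_smul]; abel
  · -- second differences: replace `c` by the point on the line through `a`, `b`
    have nc : ‖a + (2 : ℝ) • v‖ ≤ 40 * |R| := by
      refine (norm_add_le _ _).trans ?_
      rw [norm_smul]; norm_num; linarith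
    have hp : ∀ s : ℝ, HasDerivAt (fun s : ℝ => a + s • v) v s := fun s => by
      simpa using ((hasDerivAt_id s).smul_const v).const_add a
    have g1 : ∀ s : ℝ, HasDerivAt (fun s : ℝ => G (a + s • v)) (D1 (a + s • v) v) s := fun s =>
      ((hG.differentiable (by simp) (a + s • v)).hasFDerivAt).comp_hasDerivAt s (hp s)
    have g2 : ∀ s : ℝ, HasDerivAt (fun s : ℝ => D1 (a + s • v) v) (D2 (a + s • v) v v) s := by
      intro s
      have h := ((c1.differentiable (by simp) (a + s • v)).hasFDerivAt).comp_hasDerivAt s (hp s)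
      have := h.clm_apply (hasDerivAt_const s v)
      simpa using this
    have key := abs_second_dif_le (b := 0) g1 g2 (M := L * ‖v‖ ^ 2) (fun s hs => by
      have hs2 : ‖a + s • v‖ ≤ 40 * |R| := by
        refine (norm_add_le _ _).trans ?_
        rw [norm_smul, Real.norm_of_nonneg hs.1]
        have := hs.2
        nlinarith [norm_nonneg v]
      have h1 := (D2 (a + s • v)).le_opNorm₂ v v
      have h2 := (hL2 _ (mem _ hs2)).trans l2
      rw [Real.norm_eq_abs] at h1
      refine h1.trans ?_
      rw [mul_assoc, ← sq]
      gcongr)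
    simp only [zero_add, zero_smul, add_zero, one_smul] at key
    rw [← hbv] at key
    have hlc := hlip c (a + (2 : ℝ) • v) (by linarith) nc
    rw [show c - (a + (2 : ℝ) • v) = e by rw [hce]; abel] at hlc
    have e1 : G c - 2 * G b + G a = (G c - G (a + (2 : ℝ) • v)) +
      (G (a + (2 : ℝ) • v) - 2 * G b + G a) := by ring
    rw [e1]
    refine (abs_add_le _ _).trans ((add_le_add hlc key).trans ?_)
    rw [← mul_add]
    gcongr
  · obtain ⟨z, hz⟩ : ∃ z, z = d - (3 : ℝ) • c + (3 : ℝ) • b - a := ⟨_, rfl⟩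
    rw [← hz]
    have hp : ∀ s : ℝ, HasDerivAt (fun s : ℝ => a + s • v + (s * (s - 1) / 2) • e)
        (v + (s - 1 / 2) • e) s := fun s => by
      have h2 : HasDerivAt (fun s : ℝ => s * (s - 1) / 2) (s - 1 / 2) s :=
        (((hasDerivAt_id' s).mul ((hasDerivAt_id' s).sub_const 1)).div_const 2).congr_deriv
          (by ring)
      exact ((((hasDerivAt_id' s).smul_const v).const_add a).add (h2.smul_const e)).congr_deriv
        (by rw [one_smul])
    have hp' : ∀ s : ℝ, HasDerivAt (fun s : ℝ => v + (s - 1 / 2) • e) e s := fun s =>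
      ((((hasDerivAt_id' s).sub_const (1 / 2)).smul_const e).const_add v).congr_deriv (one_smul _ _)
    set p : ℝ → E := fun s : ℝ => a + s • v + (s * (s - 1) / 2) • e with hpdef
    set p' : ℝ → E := fun s : ℝ => v + (s - 1 / 2) • e with hp'def
    have g1 : ∀ s : ℝ, HasDerivAt (fun s : ℝ => G (p s)) (D1 (p s) (p' s)) s := fun s =>
      ((hG.differentiable (by simp) (p s)).hasFDerivAt).comp_hasDerivAt s (hp s)
    have d1 : ∀ s : ℝ, HasDerivAt (fun s : ℝ => D1 (p s)) (D2 (p s) (p' s)) s := fun s =>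
      ((c1.differentiable (by simp) (p s)).hasFDerivAt).comp_hasDerivAt s (hp s)
    have d2 : ∀ s : ℝ, HasDerivAt (fun s : ℝ => D2 (p s)) (D3 (p s) (p' s)) s := fun s =>
      ((c2.differentiable (by simp) (p s)).hasFDerivAt).comp_hasDerivAt s (hp s)
    have g2 : ∀ s : ℝ, HasDerivAt (fun s : ℝ => D1 (p s) (p' s))
        (D2 (p s) (p' s) (p' s) + D1 (p s) e) s := fun s => (d1 s).clm_apply (hp' s)
    have g3 : ∀ s : ℝ, HasDerivAt (fun s : ℝ => D2 (p s) (p' s) (p' s) + D1 (p s) e)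
        (D3 (p s) (p' s) (p' s) (p' s) + D2 (p s) e (p' s) + D2 (p s) (p' s) e +
          D2 (p s) (p' s) e) s := by
      intro s
      have h1 := ((d2 s).clm_apply (hp' s)).clm_apply (hp' s)
      have h2 := (d1 s).clm_apply (hasDerivAt_const s e)
      exact (h1.add h2).congr_deriv (by
        simp only [add_apply, map_zero, add_zero])
    have hbd : ∀ s ∈ Icc (0 : ℝ) 3, ‖p s‖ ≤ 40 * |R| ∧ ‖p' s‖ ≤ ‖v‖ + 3 * ‖e‖ := by
      intro s hs
      have h0 := hs.1
      have h3 := hs.2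
      constructor
      · refine (norm_add_le _ _).trans ?_
        refine (add_le_add_left (norm_add_le _ _) _).trans ?_
        rw [norm_smul, norm_smul, Real.norm_of_nonneg hs.1, Real.norm_eq_abs]
        have h1 : |s * (s - 1) / 2| ≤ 3 := by rw [abs_le]; constructor <;> nlinarith
        nlinarith [norm_nonneg v, norm_nonneg e, mul_le_mul h1 ne (norm_nonneg _) (by norm_num)]
      · refine (norm_add_le _ _).trans ?_
        rw [norm_smul, Real.norm_eq_abs]
        have h1 : |s - 1 / 2| ≤ 3 := by rw [abs_le]; constructor <;> linarith
        gcongr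
    have key := abs_third_dif_le g1 g2 g3
      (M := L * (‖v‖ + 3 * ‖e‖) ^ 3 + 3 * (L * (‖v‖ + 3 * ‖e‖) * ‖e‖)) (fun s hs => by
      obtain ⟨hs1, hs2⟩ := hbd s hs
      have m2 := (hL2 _ (mem _ hs1)).trans l2
      have m3 := (hL3 _ (mem _ hs1)).trans l3
      have t1 : |D3 (p s) (p' s) (p' s) (p' s)| ≤ L * (‖v‖ + 3 * ‖e‖) ^ 3 := by
        have h1 := (D3 (p s) (p' s)).le_opNorm₂ (p' s) (p' s)
        have h2 := (D3 (p s)).le_opNorm (p' s)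
        rw [Real.norm_eq_abs] at h1
        calc _ ≤ _ := h1
          _ ≤ L * (‖v‖ + 3 * ‖e‖) * (‖v‖ + 3 * ‖e‖) * (‖v‖ + 3 * ‖e‖) := by
            gcongr
            exact h2.trans (by gcongr)
          _ = _ := by ring
      have t2 : |D2 (p s) e (p' s)| ≤ L * (‖v‖ + 3 * ‖e‖) * ‖e‖ := by
        have h1 := (D2 (p s)).le_opNorm₂ e (p' s)
        rw [Real.norm_eq_abs] at h1
        calc _ ≤ _ := h1
          _ ≤ L * ‖e‖ * (‖v‖ + 3 * ‖e‖) := by gcongr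
          _ = _ := by ring
      have t3 : |D2 (p s) (p' s) e| ≤ L * (‖v‖ + 3 * ‖e‖) * ‖e‖ := by
        have h1 := (D2 (p s)).le_opNorm₂ (p' s) e
        rw [Real.norm_eq_abs] at h1
        calc _ ≤ _ := h1
          _ ≤ L * (‖v‖ + 3 * ‖e‖) * ‖e‖ := by gcongr
      have := abs_add_le (D3 (p s) (p' s) (p' s) (p' s) + D2 (p s) e (p' s) + D2 (p s) (p' s) e)
        (D2 (p s) (p' s) e)
      have := abs_add_le (D3 (p s) (p' s) (p' s) (p' s) + D2 (p s) e (p' s)) (D2 (p s) (p' s) e)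
      have := abs_add_le (D3 (p s) (p' s) (p' s) (p' s)) (D2 (p s) e (p' s))
      linarith)
    have p0 : p 0 = a := by simp [hpdef]
    have p1 : p 1 = b := by simp [hpdef, hbv]
    have p2 : p 2 = c := by rw [hce]; simp only [hpdef]; norm_num
    have p3 : d - p 3 = z := by
      rw [hz, hce, hbv]
      simp only [hpdef]
      module
    rw [p0, p1, p2] at key
    have hlc := hlip d (p 3) (by linarith) (hbd 3 (by norm_num)).1
    rw [p3] at hlc
    have e1 : G d - 3 * G c + 3 * G b - G a = (G d - G (p 3)) +
      (G (p 3) - 3 * G c + 3 * G b - G a) := by ring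
    rw [e1]
    refine (abs_add_le _ _).trans ((add_le_add hlc key).trans ?_)
    have nv0 := norm_nonneg v
    have ne0 := norm_nonneg e
    have i3 := cubic_le (norm_nonneg z) nv0 ne0 hR0 ne
    rw [← hQ] at i3
    calc _ = L * (‖z‖ + ((‖v‖ + 3 * ‖e‖) ^ 3 + 3 * ((‖v‖ + 3 * ‖e‖) * ‖e‖))) := by ring
      _ ≤ L * ((30 * Q) * (‖z‖ + ‖v‖ ^ 3 + ‖e‖ ^ 2 + ‖v‖ * ‖e‖)) := by gcongr
      _ = _ := by ring

end Moser

end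

section

/-! ### Minkowski's inequality for families, and differences of smooth functions -/

lemma lintegral_sq_le (a b : ℝ) (g : ℝ → ℝ≥0∞) (hg : Measurable g) :
    (∫⁻ s in Icc a b, g s) ^ 2 ≤ ENNReal.ofReal (b - a) * ∫⁻ s in Icc a b, g s ^ 2 := by
  have h := ENNReal.lintegral_mul_le_Lp_mul_Lq (volume.restrict (Icc a b))
    (Real.HolderConjugate.two_two) (f := g) (g := fun _ => 1) hg.aemeasurable aemeasurable_const
  simp only [Pi.mul_apply, mul_one, ENNReal.one_rpow, lintegral_const, one_mul,
    Measure.restrict_apply MeasurableSet.univ, univ_inter, Real.volume_Icc] at h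
  calc _ ≤ _ := pow_le_pow_left' h 2
    _ = _ := by
      rw [mul_pow, ← ENNReal.rpow_natCast, ← ENNReal.rpow_natCast, ← ENNReal.rpow_mul,
        ← ENNReal.rpow_mul, mul_comm]
      norm_num

lemma nrm_le_of_le_lintegral {F : Space → ℝ} {g : ℝ → Space → ℝ} {a b : ℝ} {M : ℝ≥0∞}
    (hg : Continuous fun p : ℝ × Space => g p.1 p.2)
    (hF : ∀ x, ‖F x‖ₑ ≤ ∫⁻ s in Icc a b, ‖g s x‖ₑ) (hM : ∀ s ∈ Icc a b, nrm (g s) ≤ M) :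
    nrm F ≤ ENNReal.ofReal (b - a) * M := by
  refine le_of_sq_le_sq ?_
  have hm : Measurable fun p : Space × ℝ => ‖g p.2 p.1‖ₑ ^ 2 :=
    ((hg.comp continuous_swap).measurable.enorm).pow_const 2
  calc nrm F ^ 2 = ∫⁻ x, ‖F x‖ₑ ^ 2 := sq_nrm F
    _ ≤ ∫⁻ x, ENNReal.ofReal (b - a) * ∫⁻ s in Icc a b, ‖g s x‖ₑ ^ 2 := by
        refine lintegral_mono fun x => (pow_le_pow_left' (hF x) 2).trans ?_
        refine lintegral_sq_le a b _ ?_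
        exact ((hg.comp (continuous_id.prodMk continuous_const)).measurable).enorm
    _ = ENNReal.ofReal (b - a) * ∫⁻ s in Icc a b, ∫⁻ x, ‖g s x‖ₑ ^ 2 := by
        rw [lintegral_const_mul' _ _ ENNReal.ofReal_ne_top]
        congr 1
        exact lintegral_lintegral_swap hm.aemeasurable
    _ ≤ ENNReal.ofReal (b - a) * ∫⁻ s in Icc a b, M ^ 2 := by
        refine mul_le_mul' le_rfl ?_
        refine setLIntegral_mono measurable_const fun s hs => ?_
        rw [← sq_nrm]
        exact pow_le_pow_left' (hM s hs) 2
    _ = _ := by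
        rw [lintegral_const, Measure.restrict_apply MeasurableSet.univ, univ_inter, Real.volume_Icc]
        ring

lemma dif_eq_integral {f : Space → ℝ} (hf : ContDiff ℝ ∞ f) (n : ℕ) (k : Fin 3) (x : Space) :
    dif (step n k) f x = ∫ s in (0 : ℝ)..1, rad n * der k f (x + s • step n k) := by
  have hd : ∀ s ∈ uIcc (0 : ℝ) 1, HasDerivAt (fun s : ℝ => f (x + s • step n k))
      (rad n * der k f (x + s • step n k)) s := by
    intro s _
    have h1 : HasDerivAt (fun s : ℝ => x + s • step n k) (step n k) s :=
      (((hasDerivAt_id' s).smul_const (step n k)).const_add x).congr_deriv (one_smul _ _)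
    have h2 := ((hf.differentiable (by simp) (x + s • step n k)).hasFDerivAt).comp_hasDerivAt s h1
    refine h2.congr_deriv ?_
    simp [step, der]
  rw [intervalIntegral.integral_eq_sub_of_hasDerivAt hd]
  · simp [dif]
  · have := (contDiff_der hf k).continuous
    exact Continuous.intervalIntegrable (by fun_prop) _ _

lemma nrm_dif_le_of_der {f : Space → ℝ} (hf : ContDiff ℝ ∞ f) (n : ℕ) (k : Fin 3) :
    nrm (dif (step n k) f) ≤ radN n * nrm (der k f) := by
  have hc := (contDiff_der hf k).continuous
  have := nrm_le_of_le_lintegral (F := dif (step n k) f) (a := 0) (b := 1)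
    (g := fun s x => rad n * der k f (x + s • step n k)) (M := radN n * nrm (der k f))
    (by fun_prop) (fun x => by
      rw [dif_eq_integral hf, intervalIntegral.integral_of_le zero_le_one,
        ← integral_Icc_eq_integral_Ioc]
      exact enorm_integral_le_lintegral_enorm _) (fun s _ => by
      rw [nrm_const_mul, nrm_translate hc]
      gcongr
      rw [← NNReal.coe_le_coe, coe_nnnorm, Real.norm_of_nonneg (rad_pos n).le, coe_radN])
  simpa using this

lemma abs_dif_le_of_der {f : Space → ℝ} (hf : ContDiff ℝ ∞ f) {k : Fin 3} {c : ℝ}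
    (hc : ∀ x, |der k f x| ≤ c) (n : ℕ) (x : Space) : |dif (step n k) f x| ≤ c * rad n := by
  rw [dif_eq_integral hf]
  have := intervalIntegral.norm_integral_le_of_norm_le_const (a := 0) (b := 1) (C := c * rad n)
    (f := fun s => rad n * der k f (x + s • step n k)) (fun s _ => by
      rw [norm_mul, Real.norm_of_nonneg (rad_pos n).le, Real.norm_eq_abs, mul_comm]
      exact mul_le_mul_of_nonneg_right (hc _) (rad_pos n).le)
  simpa using this

lemma contDiff_dif {f : Space → ℝ} (hf : ContDiff ℝ ∞ f) (h : Space) : ContDiff ℝ ∞ (dif h f) :=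
  (hf.comp (contDiff_id.add contDiff_const)).sub hf

/-! ### Products in `L²` -/

lemma sq_nrm_mul_le {f g : Space → ℝ} (hf : Continuous f) (hg : Continuous g) :
    nrm (fun x => f x * g x) ^ 2 ≤ nrm (fun x => f x ^ 2) * nrm (fun x => g x ^ 2) := by
  have h := ENNReal.lintegral_mul_le_Lp_mul_Lq volume (Real.HolderConjugate.two_two)
    (f := fun x => ‖f x ^ 2‖ₑ) (g := fun x => ‖g x ^ 2‖ₑ)
    (by fun_prop : Continuous fun x => f x ^ 2).measurable.enorm.aemeasurable
    (by fun_prop : Continuous fun x => g x ^ 2).measurable.enorm.aemeasurable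
  have e : ∀ F : Space → ℝ, (∫⁻ x, ‖F x‖ₑ ^ (2 : ℝ)) ^ (1 / (2 : ℝ)) = nrm F := by
    intro F
    have : ∫⁻ x, ‖F x‖ₑ ^ (2 : ℝ) = nrm F ^ (2 : ℝ) := by
      rw [ENNReal.rpow_two, sq_nrm]; simp
    rw [this, ← ENNReal.rpow_mul]; norm_num
  rw [e, e] at h
  rw [sq_nrm]
  refine le_trans (le_of_eq (lintegral_congr fun x => ?_)) h
  rw [Pi.mul_apply, enorm_mul, enorm_pow, enorm_pow, mul_pow]

lemma nrm_sq_dif_le {v : Space → ℝ} (hc : Continuous v) {V : ℝ≥0} (hV : ∀ x, |v x| ≤ V)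
    (h : Space) (hd : nrm (dif h v) < ⊤) :
    nrm (fun x => dif h v x ^ 2) ≤ 3 * V * nrm (dif h (dif h v)) := by
  obtain ⟨hi, hle⟩ := integral_dif_pow_four_le hc hV h hd
  have hcd := continuous_dif hc h
  have hd2 : nrm (dif h (dif h v)) < ⊤ :=
    (nrm_dif_le_two hcd h).trans_lt (ENNReal.mul_lt_top (by norm_num) hd)
  refine le_of_sq_le_sq ?_
  rw [mul_pow, sq_nrm_eq_ofReal (continuous_dif hcd h) hd2, sq_nrm]
  calc ∫⁻ x, ‖dif h v x ^ 2‖ₑ ^ 2 = ENNReal.ofReal (∫ x, dif h v x ^ 4) := by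
        rw [ofReal_integral_eq_lintegral_ofReal hi (Filter.Eventually.of_forall fun x => by positivity)]
        refine lintegral_congr fun x => ?_
        rw [Real.enorm_of_nonneg (by positivity), ← ENNReal.ofReal_pow (by positivity)]
        congr 1; ring
    _ ≤ ENNReal.ofReal (9 * V ^ 2 * ∫ x, dif h (dif h v) x ^ 2) := ENNReal.ofReal_le_ofReal hle
    _ = _ := by
        rw [ENNReal.ofReal_mul (by positivity)]
        congr 1
        rw [show (9 * (V : ℝ) ^ 2) = ((3 * V : ℝ≥0) : ℝ) ^ 2 by push_cast; ring,
          ENNReal.ofReal_pow (NNReal.coe_nonneg _), ENNReal.ofReal_coe_nnreal]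
        push_cast; rfl

lemma nrm_sq_der_le {v : Space → ℝ} (hv : IsHinf v) {V : ℝ≥0} (hV : ∀ x, |v x| ≤ V) (k : Fin 3) :
    nrm (fun x => der k v x ^ 2) ≤ 3 * V * nrm (der k (der k v)) := by
  obtain ⟨hi, hle⟩ := integral_der_pow_four_le hv hV k
  refine le_of_sq_le_sq ?_
  rw [mul_pow, sq_nrm_eq_ofReal ((hv.der k).der k).continuous ((hv.der k).der k).memLp.2, sq_nrm]
  calc ∫⁻ x, ‖der k v x ^ 2‖ₑ ^ 2 = ENNReal.ofReal (∫ x, der k v x ^ 4) := by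
        rw [ofReal_integral_eq_lintegral_ofReal hi (Filter.Eventually.of_forall fun x => by positivity)]
        refine lintegral_congr fun x => ?_
        rw [Real.enorm_of_nonneg (by positivity), ← ENNReal.ofReal_pow (by positivity)]
        congr 1; ring
    _ ≤ ENNReal.ofReal (9 * V ^ 2 * ∫ x, der k (der k v) x ^ 2) := ENNReal.ofReal_le_ofReal hle
    _ = _ := by
        rw [ENNReal.ofReal_mul (by positivity)]
        congr 1
        rw [show (9 * (V : ℝ) ^ 2) = ((3 * V : ℝ≥0) : ℝ) ^ 2 by push_cast; ring,
          ENNReal.ofReal_pow (NNReal.coe_nonneg _), ENNReal.ofReal_coe_nnreal]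
        push_cast; rfl

/-! ### Powers of the dyadic length -/

/-- `2^{-nβ}` as a nonnegative number. -/
def rpN (β : ℝ) (n : ℕ) : ℝ≥0 := (rad n ^ β).toNNReal

lemma coe_rpN (β : ℝ) (n : ℕ) : (rpN β n : ℝ) = rad n ^ β :=
  Real.coe_toNNReal _ (Real.rpow_nonneg (rad_pos n).le _)

lemma rpN_mul (β γ : ℝ) (n : ℕ) : rpN β n * rpN γ n = rpN (β + γ) n := by
  rw [← NNReal.coe_inj, NNReal.coe_mul, coe_rpN, coe_rpN, coe_rpN, Real.rpow_add (rad_pos n)]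

lemma rpN_one (n : ℕ) : rpN 1 n = radN n := by simp [rpN, radN]

lemma rpN_zero (n : ℕ) : rpN 0 n = 1 := by simp [rpN]

lemma rpN_le {β γ : ℝ} (h : γ ≤ β) (n : ℕ) : rpN β n ≤ rpN γ n := by
  rw [← NNReal.coe_le_coe, coe_rpN, coe_rpN]
  exact Real.rpow_le_rpow_of_exponent_ge (rad_pos n) (rad_le_one n) h

lemma rpN_half (n : ℕ) : (rpN (1 / 2) n : ℝ) = √(rad n) := by rw [coe_rpN, Real.sqrt_eq_rpow]

lemma wsum_le_of_le_rpN {s β : ℝ} (h : s < β) : ∃ C : ℝ≥0, ∀ (B : ℝ≥0) (a : ℕ → ℝ≥0∞),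
    (∀ n, a n ≤ ((B * rpN β n : ℝ≥0) : ℝ≥0∞)) → wsum s a ≤ C * B ^ 2 := by
  obtain ⟨C, hC⟩ := wsum_le_of_le_rpw h
  exact ⟨C, fun B a ha => hC B a fun n => by simpa [rpw, rpN, ENNReal.ofReal] using ha n⟩

lemma wsum_rpN_mul (s β : ℝ) (a : ℕ → ℝ≥0∞) :
    wsum s (fun n => rpN β n * a n) = wsum (s - β) a := by
  unfold wsum
  refine tsum_congr fun n => ?_
  rw [mul_pow, ← mul_assoc]
  congr 1
  change _ * (ENNReal.ofReal (rad n ^ β)) ^ 2 = _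
  rw [← ENNReal.ofReal_pow (Real.rpow_nonneg (rad_pos n).le _), ← ENNReal.ofReal_mul (by positivity),
    four_rpow_eq, four_rpow_eq, ← Real.rpow_natCast, ← Real.rpow_mul (rad_pos n).le,
    ← Real.rpow_add (rad_pos n)]
  congr 2; push_cast; ring

end

section

variable {ι : Type*}

/-- A family of functions that is bounded in `H^s`. -/
structure HsBounded (s : ℝ) (f : ι → Space → ℝ) : Prop where
  isHinf : ∀ i, IsHinf (f i)
  bound : ∃ C : ℝ≥0, ∀ i, sobolevNorm s (f i) ≤ C

/-- A family of functions for which the finite difference seminorms that occur in `H^{2+σ}` are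
uniformly bounded. The functions need not decay. -/
structure Coef (σ : ℝ) (f : ι → Space → ℝ) : Prop where
  cont : ∀ i, Continuous (f i)
  sup : ∃ C : ℝ≥0, ∀ i x, |f i x| ≤ C
  dif_sup : ∃ C : ℝ≥0, ∀ i k n x, |dif (step n k) (f i) x| ≤ (C * rpN (1 / 2) n : ℝ≥0)
  nrm_dif : ∃ C : ℝ≥0, ∀ i k n, nrm (dif (step n k) (f i)) ≤ (C * rpN 1 n : ℝ≥0)
  nrm_dif_dif : ∃ C : ℝ≥0, ∀ i k n,
    nrm (dif (step n k) (dif (step n k) (f i))) ≤ (C * rpN 2 n : ℝ≥0)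
  wsum_dif : ∃ C : ℝ≥0, ∀ i k,
    wsum (2 + σ) (fun n => nrm (dif (step n k) (dif (step n k) (dif (step n k) (f i))))) ≤ C

lemma nrm_der_le_sobolev {F : Space → ℝ} (hF : IsHinf F) (k : Fin 3) {s : ℝ} (hs : 1 ≤ s) :
    nrm (der k F) ≤ 7 * sobolevNorm s F := by
  rw [← sobolevNorm_zero (hF.der k).memLp]
  refine (sobolevNorm_der_le hF k 0).trans ?_
  gcongr
  exact sobolevNorm_mono hF.memLp (by linarith)

lemma nrm_der_der_le_sobolev {F : Space → ℝ} (hF : IsHinf F) (j k : Fin 3) {s : ℝ} (hs : 2 ≤ s) :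
    nrm (der j (der k F)) ≤ 49 * sobolevNorm s F := by
  refine (nrm_der_le_sobolev (hF.der k) j (s := s - 1) (by linarith)).trans ?_
  refine (mul_le_mul' le_rfl (sobolevNorm_der_le hF k (s - 1))).trans (le_of_eq ?_)
  rw [← mul_assoc, sub_add_cancel]; norm_num

namespace HsBounded

variable {s : ℝ} {f g : ι → Space → ℝ}

lemma mono (hf : HsBounded s f) {s' : ℝ} (h : s' ≤ s) : HsBounded s' f := by
  obtain ⟨C, hC⟩ := hf.bound
  exact ⟨hf.isHinf, C, fun i => (sobolevNorm_mono (hf.isHinf i).memLp h).trans (hC i)⟩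

lemma der (hf : HsBounded s f) (k : Fin 3) {s' : ℝ} (h : s' + 1 ≤ s) :
    HsBounded s' (fun i => der k (f i)) := by
  obtain ⟨C, hC⟩ := (hf.mono h).bound
  refine ⟨fun i => (hf.isHinf i).der k, 7 * C, fun i => ?_⟩
  refine (sobolevNorm_der_le (hf.isHinf i) k s').trans ?_
  push_cast
  gcongr
  exact hC i

lemma nrm_bound (hf : HsBounded s f) (hs : 0 ≤ s) : ∃ C : ℝ≥0, ∀ i, nrm (f i) ≤ C := by
  obtain ⟨C, hC⟩ := hf.bound
  exact ⟨C, fun i => (nrm_le_sobolevNorm (hf.isHinf i).memLp hs).trans (hC i)⟩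

lemma sup_bound (hf : HsBounded s f) (hs : 3 / 2 < s) : ∃ C : ℝ≥0, ∀ i x, |f i x| ≤ C := by
  obtain ⟨C, hC⟩ := hf.bound
  obtain ⟨B, hB⟩ := abs_le_sobolev hs
  exact ⟨B * C, fun i x => by
    simpa using hB (f i) C (hf.isHinf i) (hC i) x⟩

lemma dif_sup_bound (hf : HsBounded s f) (hs : 2 < s) :
    ∃ C : ℝ≥0, ∀ i k n x, |dif (step n k) (f i) x| ≤ (C * rpN (1 / 2) n : ℝ≥0) := by
  obtain ⟨C, hC⟩ := hf.bound
  obtain ⟨B, hB⟩ := abs_dif_le_sobolev hs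
  exact ⟨B * C, fun i k n x => by
    rw [NNReal.coe_mul, rpN_half]
    simpa using hB (f i) C (hf.isHinf i) (hC i) n k x⟩

lemma nrm_dif_bound (hf : HsBounded s f) (hs : 1 ≤ s) :
    ∃ C : ℝ≥0, ∀ i k n, nrm (dif (step n k) (f i)) ≤ (C * rpN 1 n : ℝ≥0) := by
  obtain ⟨C, hC⟩ := hf.bound
  refine ⟨7 * C, fun i k n => (nrm_dif_le (hf.isHinf i) n k).trans ?_⟩
  rw [rpN_one, mul_comm]
  push_cast
  gcongr
  refine (nrm_der_le_sobolev (hf.isHinf i) k hs).trans ?_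
  gcongr
  exact hC i

lemma wsum_bound (hf : HsBounded s f) (hs : 0 < s) (m : ℕ) (hm : s < m) :
    ∃ C : ℝ≥0, ∀ i k, wsum s (fun n => nrm ((dif (step n k))^[m] (f i))) ≤ C := by
  obtain ⟨C, hC⟩ := hf.bound
  obtain ⟨B, hB⟩ := wsum_dif_le hs hm
  refine ⟨B * C ^ 2, fun i k => (hB k (f i) (hf.isHinf i).memLp).trans ?_⟩
  push_cast
  gcongr
  exact hC i

lemma coef {σ : ℝ} (hσ : 0 < σ) (hσ' : σ < 1 / 2) (hf : HsBounded (2 + σ) f) : Coef σ f where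
  cont i := (hf.isHinf i).continuous
  sup := hf.sup_bound (by linarith)
  dif_sup := hf.dif_sup_bound (by linarith)
  nrm_dif := hf.nrm_dif_bound (by linarith)
  nrm_dif_dif := by
    obtain ⟨C, hC⟩ := hf.bound
    refine ⟨49 * C, fun i k n => ?_⟩
    have h1 := nrm_dif_le ((hf.isHinf i).dif (step n k)) n k
    rw [der_dif (hf.isHinf i).contDiff] at h1
    have h2 := nrm_dif_le ((hf.isHinf i).der k) n k
    have h3 := (nrm_der_der_le_sobolev (hf.isHinf i) k k (s := 2 + σ) (by linarith)).trans
      (mul_le_mul' le_rfl (hC i))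
    refine h1.trans ((mul_le_mul' le_rfl (h2.trans (mul_le_mul' le_rfl h3))).trans (le_of_eq ?_))
    rw [show (2 : ℝ) = 1 + 1 by norm_num, ← rpN_mul, rpN_one]
    push_cast
    ring
  wsum_dif := hf.wsum_bound (by linarith) 3 (by push_cast; linarith)

end HsBounded

lemma nrm_le_mul {F g : Space → ℝ} (c : ℝ≥0) (h : ∀ x, |F x| ≤ c * |g x|) :
    nrm F ≤ c * nrm g :=
  eLpNorm_le_nnreal_smul_eLpNorm_of_ae_le_mul (Filter.Eventually.of_forall fun x => by
    rw [← NNReal.coe_le_coe]; simpa using h x) 2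

lemma nrm_abs (F : Space → ℝ) : nrm (fun x => |F x|) = nrm F := eLpNorm_norm F

lemma pi_norm_le_sum_abs {κ : Type*} [Fintype κ] (v : κ → ℝ) : ‖v‖ ≤ ∑ a, |v a| :=
  (pi_norm_le_iff_of_nonneg (Finset.sum_nonneg fun _ _ => abs_nonneg _)).2 fun a =>
    Finset.single_le_sum (f := fun a => |v a|) (fun _ _ => abs_nonneg _) (Finset.mem_univ a)

lemma le_sum_nnreal {κ : Type*} [Fintype κ] (C : κ → ℝ≥0) (a : κ) : C a ≤ ∑ b, C b :=
  Finset.single_le_sum (f := C) (fun _ _ => zero_le) (Finset.mem_univ a)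

section Comp

variable {κ : Type*} [Fintype κ] {σ : ℝ} {P : κ → ι → Space → ℝ} {G : (κ → ℝ) → ℝ}

lemma Coef.nrm_sq_dif {f : ι → Space → ℝ} (hf : Coef σ f) :
    ∃ C : ℝ≥0, ∀ i k n, nrm (fun x => dif (step n k) (f i) x ^ 2) ≤ (C * rpN 2 n : ℝ≥0) := by
  obtain ⟨V, hV⟩ := hf.sup
  obtain ⟨B, hB⟩ := hf.nrm_dif
  obtain ⟨C, hC⟩ := hf.nrm_dif_dif
  refine ⟨3 * V * C, fun i k n => ?_⟩
  refine (nrm_sq_dif_le (hf.cont i) (hV i) _ ((hB i k n).trans_lt ENNReal.coe_lt_top)).trans ?_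
  refine (mul_le_mul' le_rfl (hC i k n)).trans (le_of_eq ?_)
  push_cast; ring

/-- Smooth functions of coefficients are coefficients. -/
lemma Coef.comp (hσ' : σ < 1 / 2) (hP : ∀ a, Coef σ (P a)) (hG : ContDiff ℝ ∞ G) :
    Coef σ (fun i x => G (fun a => P a i x)) := by
  choose C0 hC0 using fun a => (hP a).sup
  choose C1 hC1 using fun a => (hP a).dif_sup
  choose C2 hC2 using fun a => (hP a).nrm_dif
  choose C3 hC3 using fun a => (hP a).nrm_dif_dif
  choose C4 hC4 using fun a => (hP a).wsum_dif
  choose C5 hC5 using fun a => (hP a).nrm_sq_dif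
  obtain ⟨L, hL⟩ := exists_dif_comp_bound hG ((∑ a, C0 a : ℝ≥0) : ℝ)
  have hcP : ∀ a i, Continuous (P a i) := fun a i => (hP a).cont i
  have h0 : ‖(0 : κ → ℝ)‖ ≤ ((∑ a, C0 a : ℝ≥0) : ℝ) := by
    rw [norm_zero]; exact NNReal.coe_nonneg _
  have hY : ∀ i x, ‖(fun a => P a i x)‖ ≤ ((∑ a, C0 a : ℝ≥0) : ℝ) := fun i x =>
    (pi_norm_le_iff_of_nonneg (NNReal.coe_nonneg _)).2 fun a =>
      (hC0 a i x).trans (by exact_mod_cast le_sum_nnreal C0 a)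
  have hcG : ∀ i, Continuous fun x => G (fun a => P a i x) := fun i =>
    hG.continuous.comp (continuous_pi fun a => hcP a i)
  -- the sums of the absolute values of the differences of the arguments
  let s1 : ι → Space → Space → ℝ := fun i h x => ∑ a, |dif h (P a i) x|
  let s2 : ι → Space → Space → ℝ := fun i h x => ∑ a, |dif h (dif h (P a i)) x|
  let s3 : ι → Space → Space → ℝ := fun i h x => ∑ a, |dif h (dif h (dif h (P a i))) x|
  have n1 : ∀ i h x, 0 ≤ s1 i h x := fun i h x => Finset.sum_nonneg fun _ _ => abs_nonneg _
  have n2 : ∀ i h x, 0 ≤ s2 i h x := fun i h x => Finset.sum_nonneg fun _ _ => abs_nonneg _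
  have n3 : ∀ i h x, 0 ≤ s3 i h x := fun i h x => Finset.sum_nonneg fun _ _ => abs_nonneg _
  have cd1 : ∀ a i h, Continuous (dif h (P a i)) := fun a i h => continuous_dif (hcP a i) h
  have cd2 : ∀ a i h, Continuous (dif h (dif h (P a i))) := fun a i h => continuous_dif (cd1 a i h) h
  have cd3 : ∀ a i h, Continuous (dif h (dif h (dif h (P a i)))) := fun a i h =>
    continuous_dif (cd2 a i h) h
  have c1 : ∀ i h, Continuous (s1 i h) := fun i h =>
    continuous_finsetSum _ fun a _ => (cd1 a i h).abs
  have c2 : ∀ i h, Continuous (s2 i h) := fun i h =>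
    continuous_finsetSum _ fun a _ => (cd2 a i h).abs
  have c3 : ∀ i h, Continuous (s3 i h) := fun i h =>
    continuous_finsetSum _ fun a _ => (cd3 a i h).abs
  have p1 : ∀ i h x, |dif h (fun x => G (fun a => P a i x)) x| ≤ L * s1 i h x := by
    intro i h x
    have := (hL (fun a => P a i x) (fun a => P a i (x + h)) 0 0 (hY _ _) (hY _ _)
      h0 h0).2.1
    refine this.trans (mul_le_mul_of_nonneg_left (pi_norm_le_sum_abs _) L.2)
  have p2 : ∀ i h x, |dif h (dif h (fun x => G (fun a => P a i x))) x| ≤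
      L * (s2 i h x + s1 i h x ^ 2) := by
    intro i h x
    have := (hL (fun a => P a i x) (fun a => P a i (x + h)) (fun a => P a i (x + h + h)) 0
      (hY _ _) (hY _ _) (hY _ _) h0).2.2.1
    have e : dif h (dif h (fun x => G (fun a => P a i x))) x = G (fun a => P a i (x + h + h)) -
      2 * G (fun a => P a i (x + h)) + G (fun a => P a i x) := by simp only [dif]; ring
    rw [e]
    refine this.trans (mul_le_mul_of_nonneg_left (add_le_add ?_ ?_) L.2)
    · refine (pi_norm_le_sum_abs _).trans (le_of_eq (Finset.sum_congr rfl fun a _ => ?_))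
      congr 1
      simp [dif]; ring
    · exact pow_le_pow_left₀ (norm_nonneg _) (pi_norm_le_sum_abs _) 2
  have p3 : ∀ i h x, |dif h (dif h (dif h (fun x => G (fun a => P a i x)))) x| ≤
      L * (s3 i h x + s1 i h x ^ 3 + s2 i h x ^ 2 + s1 i h x * s2 i h x) := by
    intro i h x
    have := (hL (fun a => P a i x) (fun a => P a i (x + h)) (fun a => P a i (x + h + h))
      (fun a => P a i (x + h + h + h)) (hY _ _) (hY _ _) (hY _ _) (hY _ _)).2.2.2
    have e : dif h (dif h (dif h (fun x => G (fun a => P a i x)))) x =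
      G (fun a => P a i (x + h + h + h)) - 3 * G (fun a => P a i (x + h + h)) +
      3 * G (fun a => P a i (x + h)) - G (fun a => P a i x) := by simp only [dif]; ring
    rw [e]
    have q1 : ‖(fun a => P a i (x + h)) - (fun a => P a i x)‖ ≤ s1 i h x := pi_norm_le_sum_abs _
    have q2 : ‖(fun a => P a i (x + h + h)) - (2 : ℝ) • (fun a => P a i (x + h)) +
        (fun a => P a i x)‖ ≤ s2 i h x := by
      refine (pi_norm_le_sum_abs _).trans (le_of_eq (Finset.sum_congr rfl fun a _ => ?_))
      congr 1
      simp [dif]; ring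
    have q3 : ‖(fun a => P a i (x + h + h + h)) - (3 : ℝ) • (fun a => P a i (x + h + h)) +
        (3 : ℝ) • (fun a => P a i (x + h)) - (fun a => P a i x)‖ ≤ s3 i h x := by
      refine (pi_norm_le_sum_abs _).trans (le_of_eq (Finset.sum_congr rfl fun a _ => ?_))
      congr 1
      simp [dif]; ring
    refine this.trans (mul_le_mul_of_nonneg_left (add_le_add (add_le_add (add_le_add q3 ?_) ?_) ?_) L.2)
    · exact pow_le_pow_left₀ (norm_nonneg _) q1 3
    · exact pow_le_pow_left₀ (norm_nonneg _) q2 2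
    · exact mul_le_mul q1 q2 (norm_nonneg _) (n1 i h x)
  set B1 : ℝ≥0 := ∑ a, C1 a
  set B2 : ℝ≥0 := ∑ a, C2 a
  set B3 : ℝ≥0 := ∑ a, C3 a
  set B5 : ℝ≥0 := ∑ a, C5 a
  have u1 : ∀ i k n x, s1 i (step n k) x ≤ (B1 * rpN (1 / 2) n : ℝ≥0) := by
    intro i k n x
    rw [Finset.sum_mul, NNReal.coe_sum]
    exact Finset.sum_le_sum fun a _ => hC1 a i k n x
  have u2 : ∀ i k n x, s2 i (step n k) x ≤ 2 * (B1 * rpN (1 / 2) n : ℝ≥0) := by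
    intro i k n x
    rw [Finset.sum_mul, NNReal.coe_sum, Finset.mul_sum]
    exact Finset.sum_le_sum fun a _ => abs_dif_le_two (hC1 a i k n) _ _
  have m1 : ∀ i k n, nrm (s1 i (step n k)) ≤ (B2 * rpN 1 n : ℝ≥0) := by
    intro i k n
    rw [Finset.sum_mul, ENNReal.ofNNReal_finsetSum]
    refine (nrm_sum_le _ fun a => (cd1 a i (step n k)).abs).trans (Finset.sum_le_sum fun a _ => ?_)
    rw [nrm_abs]; exact hC2 a i k n
  have m2 : ∀ i k n, nrm (s2 i (step n k)) ≤ (B3 * rpN 2 n : ℝ≥0) := by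
    intro i k n
    rw [Finset.sum_mul, ENNReal.ofNNReal_finsetSum]
    refine (nrm_sum_le _ fun a => (cd2 a i (step n k)).abs).trans (Finset.sum_le_sum fun a _ => ?_)
    rw [nrm_abs]; exact hC3 a i k n
  have m3 : ∀ i k n, nrm (s3 i (step n k)) ≤
      ∑ a, nrm (dif (step n k) (dif (step n k) (dif (step n k) (P a i)))) := by
    intro i k n
    refine (nrm_sum_le _ fun a => (cd3 a i (step n k)).abs).trans (Finset.sum_le_sum fun a _ => ?_)
    rw [nrm_abs]
  have m1' : ∀ i k n, nrm (fun x => s1 i (step n k) x ^ 2) ≤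
      ((Fintype.card κ * B5) * rpN 2 n : ℝ≥0) := by
    intro i k n
    have h1 : nrm (fun x => s1 i (step n k) x ^ 2) ≤ (Fintype.card κ : ℝ≥0) *
        nrm (fun x => ∑ a, dif (step n k) (P a i) x ^ 2) := by
      refine nrm_le_mul _ fun x => ?_
      rw [abs_of_nonneg (sq_nonneg _), abs_of_nonneg (Finset.sum_nonneg fun _ _ => sq_nonneg _)]
      have := sq_sum_le_card_mul_sum_sq (s := Finset.univ) (f := fun a => |dif (step n k) (P a i) x|)
      simpa using this
    refine h1.trans ?_
    rw [mul_assoc, ENNReal.coe_mul]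
    refine mul_le_mul' le_rfl ?_
    rw [Finset.sum_mul, ENNReal.ofNNReal_finsetSum]
    exact (nrm_sum_le _ fun a => (cd1 a i (step n k)).pow 2).trans
      (Finset.sum_le_sum fun a _ => hC5 a i k n)
  refine ⟨hcG, ⟨L, fun i x => ?_⟩, ⟨L * B1, fun i k n x => ?_⟩, ⟨L * B2, fun i k n => ?_⟩,
    ⟨L * (B3 + Fintype.card κ * B5), fun i k n => ?_⟩, ?_⟩
  · exact (hL (fun a => P a i x) 0 0 0 (hY _ _) h0 h0 h0).1
  · refine (p1 i (step n k) x).trans ?_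
    rw [mul_assoc, NNReal.coe_mul]
    exact mul_le_mul_of_nonneg_left (u1 i k n x) L.2
  · refine (nrm_le_mul L fun x => ?_).trans ((mul_le_mul' le_rfl (m1 i k n)).trans (le_of_eq ?_))
    · rw [abs_of_nonneg (n1 i (step n k) x)]; exact p1 i (step n k) x
    · push_cast; ring
  · refine (nrm_le_mul (g := fun x => s2 i (step n k) x + s1 i (step n k) x ^ 2) L fun x => ?_).trans ?_
    · rw [abs_of_nonneg (add_nonneg (n2 i (step n k) x) (sq_nonneg _))]; exact p2 i (step n k) x
    · refine (mul_le_mul' le_rfl ((nrm_add_le (c2 i _) ((c1 i _).pow 2)).trans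
        (add_le_add (m2 i k n) (m1' i k n)))).trans (le_of_eq ?_)
      push_cast; ring
  · obtain ⟨W, hW⟩ := wsum_le_of_le_rpN (s := 2 + σ) (β := 5 / 2) (by linarith)
    set B6 : ℝ≥0 := B1 * (Fintype.card κ * B5 + 3 * B3)
    refine ⟨L ^ 2 * (2 * (Fintype.card κ * ∑ a, C4 a + W * B6 ^ 2)), fun i k => ?_⟩
    have key : ∀ n, nrm (dif (step n k) (dif (step n k) (dif (step n k)
        (fun x => G (fun a => P a i x))))) ≤
        L * (∑ a, nrm (dif (step n k) (dif (step n k) (dif (step n k) (P a i)))) +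
          ((B6 * rpN (5 / 2) n : ℝ≥0) : ℝ≥0∞)) := by
      intro n
      have h1 : nrm (fun x => (B1 * rpN (1 / 2) n : ℝ≥0) *
          (s1 i (step n k) x ^ 2 + 3 * s2 i (step n k) x)) ≤ ((B6 * rpN (5 / 2) n : ℝ≥0) : ℝ≥0∞) := by
        rw [nrm_const_mul]
        have h2 := nrm_add_le (F := fun x => s1 i (step n k) x ^ 2)
          (G := fun x => 3 * s2 i (step n k) x) ((c1 i (step n k)).pow 2)
          (continuous_const.mul (c2 i (step n k)))
        rw [nrm_const_mul] at h2
        refine (mul_le_mul' le_rfl (h2.trans (add_le_add (m1' i k n)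
          (mul_le_mul' le_rfl (m2 i k n))))).trans (le_of_eq ?_)
        rw [show (5 / 2 : ℝ) = 1 / 2 + 2 by norm_num, ← rpN_mul]
        have e1 : ‖((B1 * rpN (1 / 2) n : ℝ≥0) : ℝ)‖₊ = B1 * rpN (1 / 2) n := NNReal.nnnorm_eq _
        have e2 : ‖(3 : ℝ)‖₊ = 3 := by simp
        rw [e1, e2]
        norm_cast
        simp only [B6]; ring
      refine (nrm_le_mul (g := fun x => s3 i (step n k) x + (B1 * rpN (1 / 2) n : ℝ≥0) *
          (s1 i (step n k) x ^ 2 + 3 * s2 i (step n k) x)) L fun x => ?_).trans ?_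
      · refine (p3 i (step n k) x).trans (mul_le_mul_of_nonneg_left ?_ L.2)
        refine le_trans ?_ (le_abs_self _)
        have a1 := n1 i (step n k) x
        have a2 := n2 i (step n k) x
        have b1 := u1 i k n x
        have b2 := u2 i k n x
        generalize s1 i (step n k) x = y1 at *
        generalize s2 i (step n k) x = y2 at *
        generalize (((B1 * rpN (1 / 2) n : ℝ≥0)) : ℝ) = r at *
        have t1 : y1 ^ 3 ≤ r * y1 ^ 2 := by
          rw [pow_succ']; exact mul_le_mul_of_nonneg_right b1 (sq_nonneg _)
        have t2 : y2 ^ 2 ≤ 2 * r * y2 := by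
          rw [sq]; exact mul_le_mul_of_nonneg_right b2 a2
        have t3 : y1 * y2 ≤ r * y2 := mul_le_mul_of_nonneg_right b1 a2
        linarith
      · refine mul_le_mul' le_rfl ((nrm_add_le (c3 i _) ?_).trans (add_le_add (m3 i k n) h1))
        exact continuous_const.mul (((c1 i _).pow 2).add (continuous_const.mul (c2 i _)))
    refine (wsum_mono key).trans ?_
    rw [wsum_const_mul]
    push_cast
    refine mul_le_mul' le_rfl ((wsum_add_le _ _ _).trans ?_)
    refine mul_le_mul' le_rfl (add_le_add ?_ ?_)
    · refine (wsum_sum_le _ _ _).trans ?_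
      rw [Finset.card_univ]
      gcongr with a _
      exact hC4 a i k
    · have := hW B6 (fun n => ((B6 * rpN (5 / 2) n : ℝ≥0) : ℝ≥0∞)) (fun n => le_rfl)
      exact_mod_cast this

end Comp

end

section

variable {ι : Type*} {σ : ℝ}

lemma nrm_mul_translate_le {f g : Space → ℝ} (hg : Continuous g) (c : ℝ≥0) (h : ∀ x, |f x| ≤ c)
    (y : Space) : nrm (fun x => f x * g (x + y)) ≤ c * nrm g := by
  have := nrm_mul_le (g := fun x => g (x + y)) c h
  rwa [nrm_translate hg] at this

lemma nrm_mul_translate_le' {f g : Space → ℝ} (c : ℝ≥0) (h : ∀ x, |g x| ≤ c)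
    (y : Space) : nrm (fun x => f x * g (x + y)) ≤ c * nrm f :=
  nrm_mul_le' (g := fun x => g (x + y)) c fun x => h (x + y)

/-- Second differences of a product whose second factor is split in two parts. -/
lemma nrm_dif_dif_mul_split_le {f w a b : Space → ℝ} (hf : Continuous f) (ha : Continuous a)
    (hb : Continuous b) (hw : w = fun x => a x + b x) {c0 c1 ca : ℝ≥0} (h : Space)
    (h0 : ∀ x, |f x| ≤ c0) (h1 : ∀ x, |dif h f x| ≤ c1) (hA : ∀ x, |a x| ≤ ca) :
    nrm (dif h (dif h fun x => f x * w x)) ≤ c0 * nrm (dif h (dif h w)) +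
      2 * (c1 * nrm (dif h w)) + (ca * nrm (dif h (dif h f)) + 2 * c1 * nrm b) := by
  have hwc : Continuous w := by rw [hw]; exact ha.add hb
  have d1 := continuous_dif hf h
  have d2 := continuous_dif d1 h
  have e1 := continuous_dif hwc h
  have e2 := continuous_dif e1 h
  have h2 : ∀ x, |dif h (dif h f) x| ≤ (2 * c1 : ℝ≥0) := fun x => by
    simpa using abs_dif_le_two h1 h x
  rw [dif_dif_mul]
  have e : (fun x => f x * dif h (dif h w) x + 2 * (dif h f x * dif h w (x + h)) +
      dif h (dif h f) x * w (x + (h + h))) = fun x => (f x * dif h (dif h w) x +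
      2 * (dif h f x * dif h w (x + h))) + (dif h (dif h f) x * a (x + (h + h)) +
        dif h (dif h f) x * b (x + (h + h))) := by
    ext x; rw [hw]; ring
  rw [e]
  refine (nrm_add_le (by fun_prop) (by fun_prop)).trans (add_le_add ?_ ?_)
  · refine (nrm_add_le (by fun_prop) (by fun_prop)).trans (add_le_add ?_ ?_)
    · exact nrm_mul_le c0 h0
    · rw [nrm_const_mul]
      exact mul_le_mul' (by simp) (nrm_mul_translate_le e1 c1 h1 _)
  · refine (nrm_add_le (by fun_prop) (by fun_prop)).trans (add_le_add ?_ ?_)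
    · exact nrm_mul_translate_le' ca hA _
    · exact_mod_cast nrm_mul_translate_le hb (2 * c1) h2 _

/-- The commutator of third differences with multiplication. -/
lemma nrm_commutator_le {f w a b : Space → ℝ} (hf : Continuous f) (ha : Continuous a)
    (hb : Continuous b) (hw : w = fun x => a x + b x) {c1 c2 c3 ca : ℝ≥0} (h : Space)
    (h1 : ∀ x, |dif h f x| ≤ c1) (h2 : ∀ x, |dif h (dif h f) x| ≤ c2)
    (h3 : ∀ x, |dif h (dif h (dif h f)) x| ≤ c3) (hA : ∀ x, |a x| ≤ ca) :
    nrm (fun x => dif h (dif h (dif h fun x => f x * w x)) x - f x * dif h (dif h (dif h w)) x) ≤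
      3 * (c1 * nrm (dif h (dif h w))) + 3 * (c2 * nrm (dif h w)) +
        (ca * nrm (dif h (dif h (dif h f))) + c3 * nrm b) := by
  have hwc : Continuous w := by rw [hw]; exact ha.add hb
  have d1 := continuous_dif hf h
  have d2 := continuous_dif d1 h
  have d3 := continuous_dif d2 h
  have e1 := continuous_dif hwc h
  have e2 := continuous_dif e1 h
  rw [dif_dif_dif_mul]
  have e : (fun x => f x * dif h (dif h (dif h w)) x + 3 * (dif h f x * dif h (dif h w) (x + h)) +
      3 * (dif h (dif h f) x * dif h w (x + (h + h))) +
      dif h (dif h (dif h f)) x * w (x + (h + h + h)) - f x * dif h (dif h (dif h w)) x) =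
      fun x => (3 * (dif h f x * dif h (dif h w) (x + h)) +
        3 * (dif h (dif h f) x * dif h w (x + (h + h)))) +
        (dif h (dif h (dif h f)) x * a (x + (h + h + h)) +
          dif h (dif h (dif h f)) x * b (x + (h + h + h))) := by
    ext x; rw [hw]; ring
  rw [e]
  refine (nrm_add_le (by fun_prop) (by fun_prop)).trans (add_le_add ?_ ?_)
  · refine (nrm_add_le (by fun_prop) (by fun_prop)).trans (add_le_add ?_ ?_)
    · rw [nrm_const_mul]
      exact mul_le_mul' (by simp) (nrm_mul_translate_le e2 c1 h1 _)
    · rw [nrm_const_mul]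
      exact mul_le_mul' (by simp) (nrm_mul_translate_le e1 c2 h2 _)
  · refine (nrm_add_le (by fun_prop) (by fun_prop)).trans (add_le_add ?_ ?_)
    · exact nrm_mul_translate_le' ca hA _
    · exact nrm_mul_translate_le hb c3 h3 _

lemma abs_dq_le {v : Space → ℝ} {n : ℕ} {j : Fin 3} {c : ℝ≥0} {β : ℝ}
    (h : ∀ x, |dif (step n j) v x| ≤ (c * rpN β n : ℝ≥0)) (x : Space) :
    |dq n j v x| ≤ (c * rpN (β - 1) n : ℝ≥0) := by
  have hr := rad_pos n
  unfold dq
  rw [abs_mul, abs_of_pos (inv_pos.2 hr)]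
  refine (mul_le_mul_of_nonneg_left (h x) (inv_pos.2 hr).le).trans (le_of_eq ?_)
  push_cast
  rw [coe_rpN, coe_rpN, Real.rpow_sub hr, Real.rpow_one]
  field_simp

lemma der_eq_dq_add (v : Space → ℝ) (n : ℕ) (j : Fin 3) :
    der j v = fun x => dq n j v x + (der j v x - dq n j v x) := by ext x; ring

/-- Products `f ∂_j v` with `f`, `v` of class `H^{2+σ}` are of class `H^{1+σ}`. -/
lemma Coef.wsum_mul_der (hσ : 0 < σ) (hσ' : σ < 1 / 2) {f v : ι → Space → ℝ} (hf : Coef σ f)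
    (hv : HsBounded (2 + σ) v) (j : Fin 3) :
    ∃ C : ℝ≥0, ∀ i k, wsum (1 + σ)
      (fun n => nrm (dif (step n k) (dif (step n k) fun x => f i x * der j (v i) x))) ≤ C := by
  have hw : HsBounded (1 + σ) fun i => der j (v i) := hv.der j (by linarith)
  obtain ⟨c0, h0⟩ := hf.sup
  obtain ⟨c1, h1⟩ := hf.dif_sup
  obtain ⟨c2, h2⟩ := hf.nrm_dif_dif
  obtain ⟨d1, g1⟩ := hw.nrm_dif_bound (by linarith)
  obtain ⟨ca, ga⟩ := hv.dif_sup_bound (by linarith)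
  obtain ⟨d2, g2⟩ := (hw.der j (s' := 0) (by linarith)).nrm_bound le_rfl
  obtain ⟨W, hW⟩ := hw.wsum_bound (by linarith) 2 (by push_cast; linarith)
  obtain ⟨R, hR⟩ := wsum_le_of_le_rpN (s := 1 + σ) (β := 3 / 2) (by linarith)
  set B : ℝ≥0 := 2 * c1 * d1 + ca * c2 + 4 * c1 * d2
  refine ⟨2 * (c0 ^ 2 * W + R * B ^ 2), fun i k => ?_⟩
  have key : ∀ n, nrm (dif (step n k) (dif (step n k) fun x => f i x * der j (v i) x)) ≤
      c0 * nrm (dif (step n k) (dif (step n k) (der j (v i)))) + (B * rpN (3 / 2) n : ℝ≥0) := by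
    intro n
    have hI := hv.isHinf i
    have := nrm_dif_dif_mul_split_le (hf.cont i) (isHinf_dq hI n j).continuous
      ((hI.der j).sub (isHinf_dq hI n j)).continuous (der_eq_dq_add (v i) n j) (step n k)
      (h0 i) (h1 i k n) (abs_dq_le (ga i j n))
    refine this.trans ?_
    rw [add_assoc]
    refine add_le_add le_rfl ?_
    have t1 := g1 i k n
    have t2 := h2 i k n
    have t3 := (nrm_der_sub_dq_le hI n j).trans (mul_le_mul' le_rfl (g2 i))
    rw [← rpN_one] at t3
    calc _ ≤ 2 * (((c1 * rpN (1 / 2) n : ℝ≥0) : ℝ≥0∞) * (d1 * rpN 1 n : ℝ≥0)) +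
          (((ca * rpN (1 / 2 - 1) n : ℝ≥0) : ℝ≥0∞) * (c2 * rpN 2 n : ℝ≥0) +
            2 * ((c1 * rpN (1 / 2) n : ℝ≥0) : ℝ≥0∞) * (2 * rpN 1 n * d2)) := by gcongr
      _ = _ := by
          norm_cast
          have r1 : rpN (1 / 2) n * rpN 1 n = rpN (3 / 2) n := by rw [rpN_mul]; norm_num
          have r2 : rpN (1 / 2 - 1) n * rpN 2 n = rpN (3 / 2) n := by rw [rpN_mul]; norm_num
          calc _ = 2 * c1 * d1 * (rpN (1 / 2) n * rpN 1 n) + ca * c2 * (rpN (1 / 2 - 1) n * rpN 2 n)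
                + 4 * c1 * d2 * (rpN (1 / 2) n * rpN 1 n) := by ring
            _ = _ := by rw [r1, r2]; simp only [B]; ring
  refine (wsum_mono key).trans ((wsum_add_le _ _ _).trans ?_)
  rw [wsum_const_mul]
  push_cast
  gcongr
  · exact hW i k
  · exact_mod_cast hR B _ fun n => le_rfl

/-- The commutator with a coefficient of class `H^{2+σ}`. -/
lemma Coef.wsum_commutator (hσ : 0 < σ) (hσ' : σ < 1 / 2) {f v : ι → Space → ℝ} (hf : Coef σ f)
    (hfs : ∀ i, ContDiff ℝ ∞ (f i)) (hv : HsBounded (1 + σ) v) {Λ : ι → ℝ≥0} {L V : ℝ≥0}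
    (hL : ∀ i k x, |der k (f i) x| ≤ L * Λ i) (hV : ∀ i x, |v i x| ≤ V * Λ i) (j : Fin 3) :
    ∃ C : ℝ≥0, ∀ i k, wsum (1 + σ) (fun n => nrm (fun x =>
      dif (step n k) (dif (step n k) (dif (step n k) fun x => f i x * der j (v i) x)) x -
        f i x * dif (step n k) (dif (step n k) (dif (step n k) (der j (v i)))) x)) ≤
      (C * Λ i ^ 2 : ℝ≥0) := by
  have hw : HsBounded σ fun i => der j (v i) := hv.der j (by linarith)
  obtain ⟨W1, hW1⟩ := hw.wsum_bound hσ 1 (by push_cast; linarith)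
  obtain ⟨W3, hW3⟩ := hf.wsum_dif
  obtain ⟨E, hE⟩ := wsum_der_sub_dq_le hσ (by linarith)
  obtain ⟨A, hA⟩ := hv.bound
  refine ⟨4 * (144 * L ^ 2 * W1) + 4 * (16 * L ^ 2 * (E * A ^ 2)) + 2 * (4 * V ^ 2 * W3), fun i k => ?_⟩
  have hI := hv.isHinf i
  have key : ∀ n, nrm (fun x =>
      dif (step n k) (dif (step n k) (dif (step n k) fun x => f i x * der j (v i) x)) x -
        f i x * dif (step n k) (dif (step n k) (dif (step n k) (der j (v i)))) x) ≤
      (((12 * L * Λ i : ℝ≥0) : ℝ≥0∞) * (rpN 1 n * nrm (dif (step n k) (der j (v i)))) +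
        ((4 * L * Λ i : ℝ≥0) : ℝ≥0∞) * (rpN 1 n * nrm (fun x => der j (v i) x - dq n j (v i) x))) +
      ((2 * V * Λ i : ℝ≥0) : ℝ≥0∞) * (rpN (-1) n *
        nrm (dif (step n k) (dif (step n k) (dif (step n k) (f i))))) := by
    intro n
    have q1 : ∀ x, |dif (step n k) (f i) x| ≤ (L * Λ i * rpN 1 n : ℝ≥0) := fun x => by
      rw [rpN_one]
      simpa [coe_radN] using abs_dif_le_of_der (hfs i) (hL i k) n x
    have q2 : ∀ x, |dif (step n k) (dif (step n k) (f i)) x| ≤ (2 * (L * Λ i * rpN 1 n) : ℝ≥0) :=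
      fun x => by simpa using abs_dif_le_two q1 _ x
    have q3 : ∀ x, |dif (step n k) (dif (step n k) (dif (step n k) (f i))) x| ≤
        (2 * (2 * (L * Λ i * rpN 1 n)) : ℝ≥0) := fun x => by simpa using abs_dif_le_two q2 _ x
    have qa : ∀ x, |dif (step n j) (v i) x| ≤ (2 * V * Λ i * rpN 0 n : ℝ≥0) := fun x => by
      rw [rpN_zero]
      have := abs_dif_le_two (hV i) (step n j) x
      simpa [mul_assoc] using this
    have := nrm_commutator_le (hf.cont i) (isHinf_dq hI n j).continuous
      ((hI.der j).sub (isHinf_dq hI n j)).continuous (der_eq_dq_add (v i) n j) (step n k)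
      q1 q2 q3 (abs_dq_le qa)
    refine this.trans ?_
    have t := nrm_dif_le_two (continuous_dif (hI.der j).continuous (step n k)) (step n k)
    calc _ ≤ 3 * (((L * Λ i * rpN 1 n : ℝ≥0) : ℝ≥0∞) * (2 * nrm (dif (step n k) (der j (v i))))) +
          3 * (((2 * (L * Λ i * rpN 1 n) : ℝ≥0) : ℝ≥0∞) * nrm (dif (step n k) (der j (v i)))) + _ := by
          gcongr
      _ = _ := by push_cast; rw [zero_sub]; ring
  refine (wsum_mono key).trans ((wsum_add_le _ _ _).trans ?_)
  refine (mul_le_mul' le_rfl (add_le_add (wsum_add_le _ _ _) le_rfl)).trans ?_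
  rw [wsum_const_mul, wsum_const_mul, wsum_const_mul, wsum_rpN_mul, wsum_rpN_mul, wsum_rpN_mul,
    show 1 + σ - 1 = σ by ring, show 1 + σ - -1 = 2 + σ by ring]
  have e1 := hW1 i k
  have e2 : wsum σ (fun n => nrm (fun x => der j (v i) x - dq n j (v i) x)) ≤ (E * A ^ 2 : ℝ≥0) := by
    refine (hE j (v i) hI).trans ?_
    push_cast
    gcongr
    rw [add_comm]; exact hA i
  have e3 := hW3 i k
  calc _ ≤ 2 * (2 * (((12 * L * Λ i : ℝ≥0) : ℝ≥0∞) ^ 2 * W1 +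
        ((4 * L * Λ i : ℝ≥0) : ℝ≥0∞) ^ 2 * (E * A ^ 2 : ℝ≥0)) +
        ((2 * V * Λ i : ℝ≥0) : ℝ≥0∞) ^ 2 * W3) := by gcongr; exact e1
    _ = _ := by norm_cast; ring

/-- The commutator with a coefficient of class `H^{3+σ}`. -/
lemma Coef.wsum_commutator_smooth (hσ : 0 < σ) (hσ' : σ < 1 / 2) {f v : ι → Space → ℝ}
    (hfs : ∀ i, ContDiff ℝ ∞ (f i)) (hf : ∀ k, Coef σ fun i => der k (f i))
    (hv : HsBounded (2 + σ) v) (j : Fin 3) :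
    ∃ C : ℝ≥0, ∀ i k, wsum (2 + σ) (fun n => nrm (fun x =>
      dif (step n k) (dif (step n k) (dif (step n k) fun x => f i x * der j (v i) x)) x -
        f i x * dif (step n k) (dif (step n k) (dif (step n k) (der j (v i)))) x)) ≤ C := by
  have hw : HsBounded (1 + σ) fun i => der j (v i) := hv.der j (by linarith)
  obtain ⟨W, hW⟩ := hw.wsum_bound (by linarith) 2 (by push_cast; linarith)
  choose c1' h1' using fun k => (hf k).sup
  choose c2' h2' using fun k => (hf k).dif_sup
  choose c3' h3' using fun k => (hf k).nrm_dif_dif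
  set c1 : ℝ≥0 := ∑ k, c1' k
  set c2 : ℝ≥0 := ∑ k, c2' k
  set c3 : ℝ≥0 := ∑ k, c3' k
  obtain ⟨d1, g1⟩ := hw.nrm_dif_bound (by linarith)
  obtain ⟨ca, ga⟩ := hv.dif_sup_bound (by linarith)
  obtain ⟨d2, g2⟩ := (hw.der j (s' := 0) (by linarith)).nrm_bound le_rfl
  obtain ⟨R, hR⟩ := wsum_le_of_le_rpN (s := 2 + σ) (β := 5 / 2) (by linarith)
  set B : ℝ≥0 := 3 * c2 * d1 + ca * c3 + 4 * c2 * d2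
  refine ⟨2 * ((3 * c1) ^ 2 * W + R * B ^ 2), fun i k => ?_⟩
  have hI := hv.isHinf i
  have key : ∀ n, nrm (fun x =>
      dif (step n k) (dif (step n k) (dif (step n k) fun x => f i x * der j (v i) x)) x -
        f i x * dif (step n k) (dif (step n k) (dif (step n k) (der j (v i)))) x) ≤
      ((3 * c1 : ℝ≥0) : ℝ≥0∞) * (rpN 1 n * nrm (dif (step n k) (dif (step n k) (der j (v i))))) +
        (B * rpN (5 / 2) n : ℝ≥0) := by
    intro n
    have q1 : ∀ x, |dif (step n k) (f i) x| ≤ (c1 * rpN 1 n : ℝ≥0) := fun x => by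
      rw [rpN_one]
      have := abs_dif_le_of_der (hfs i) (fun x => (h1' k i x).trans
        (NNReal.coe_le_coe.2 (le_sum_nnreal c1' k))) n x
      rwa [NNReal.coe_mul, coe_radN]
    have q2 : ∀ x, |dif (step n k) (dif (step n k) (f i)) x| ≤ (c2 * rpN (3 / 2) n : ℝ≥0) := by
      intro x
      have h1 : ∀ x, |der k (dif (step n k) (f i)) x| ≤ (c2 * rpN (1 / 2) n : ℝ≥0) := fun x => by
        rw [der_dif (hfs i)]
        refine (h2' k i k n x).trans ?_
        push_cast
        exact mul_le_mul_of_nonneg_right (by exact_mod_cast le_sum_nnreal c2' k) (NNReal.coe_nonneg _)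
      have := abs_dif_le_of_der (contDiff_dif (hfs i) _) h1 n x
      refine this.trans (le_of_eq ?_)
      rw [← coe_radN, ← rpN_one, ← NNReal.coe_mul, mul_assoc, rpN_mul]; norm_num
    have q3 : ∀ x, |dif (step n k) (dif (step n k) (dif (step n k) (f i))) x| ≤
        (2 * (c2 * rpN (3 / 2) n) : ℝ≥0) := fun x => by simpa using abs_dif_le_two q2 _ x
    have q4 : nrm (dif (step n k) (dif (step n k) (dif (step n k) (f i)))) ≤
        (c3 * rpN 3 n : ℝ≥0) := by
      refine (nrm_dif_le_of_der (contDiff_dif (contDiff_dif (hfs i) _) _) n k).trans ?_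
      rw [der_dif (contDiff_dif (hfs i) _), der_dif (hfs i)]
      refine (mul_le_mul' le_rfl (h3' k i k n)).trans ?_
      rw [← rpN_one]
      norm_cast
      rw [show (3 : ℝ) = 1 + 2 by norm_num, ← rpN_mul, mul_left_comm]
      exact mul_le_mul' (le_sum_nnreal c3' k) le_rfl
    have := nrm_commutator_le (hfs i).continuous (isHinf_dq hI n j).continuous
      ((hI.der j).sub (isHinf_dq hI n j)).continuous (der_eq_dq_add (v i) n j) (step n k)
      q1 q2 q3 (abs_dq_le (ga i j n))
    refine this.trans ?_
    have t1 := g1 i k n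
    have t3 := (nrm_der_sub_dq_le hI n j).trans (mul_le_mul' le_rfl (g2 i))
    rw [← rpN_one] at t3
    rw [add_assoc]
    refine add_le_add (le_of_eq (by push_cast; ring)) ?_
    calc _ ≤ 3 * (((c2 * rpN (3 / 2) n : ℝ≥0) : ℝ≥0∞) * (d1 * rpN 1 n : ℝ≥0)) +
          (((ca * rpN (1 / 2 - 1) n : ℝ≥0) : ℝ≥0∞) * (c3 * rpN 3 n : ℝ≥0) +
            ((2 * (c2 * rpN (3 / 2) n) : ℝ≥0) : ℝ≥0∞) * (2 * rpN 1 n * d2)) := by gcongr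
      _ = _ := by
          norm_cast
          have r1 : rpN (3 / 2) n * rpN 1 n = rpN (5 / 2) n := by rw [rpN_mul]; norm_num
          have r2 : rpN (1 / 2 - 1) n * rpN 3 n = rpN (5 / 2) n := by rw [rpN_mul]; norm_num
          calc _ = 3 * c2 * d1 * (rpN (3 / 2) n * rpN 1 n) + ca * c3 * (rpN (1 / 2 - 1) n * rpN 3 n)
                + 4 * c2 * d2 * (rpN (3 / 2) n * rpN 1 n) := by ring
            _ = _ := by rw [r1, r2]; simp only [B]; ring
  refine (wsum_mono key).trans ((wsum_add_le _ _ _).trans ?_)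
  rw [wsum_const_mul, wsum_rpN_mul, show 2 + σ - 1 = 1 + σ by ring]
  push_cast
  gcongr
  · exact hW i k
  · exact_mod_cast hR B _ fun n => le_rfl

/-- Tame estimate for the product of two functions of class `H^{1+σ}`. -/
lemma wsum_mul_tame {s : ℝ} {f g : ι → Space → ℝ} (hf : ∀ i, Continuous (f i))
    (hg : ∀ i, Continuous (g i)) (hf2 : ∀ i, nrm (f i) < ⊤) (hg2 : ∀ i, nrm (g i) < ⊤)
    {Λ : ι → ℝ≥0} (hΛ : ∀ i, 0 < Λ i) (hfΛ : ∃ C : ℝ≥0, ∀ i x, |f i x| ≤ C * Λ i)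
    (hgΛ : ∃ C : ℝ≥0, ∀ i x, |g i x| ≤ C * Λ i)
    (hfw : ∃ C : ℝ≥0, ∀ i k, wsum s (fun n => nrm (dif (step n k) (dif (step n k) (f i)))) ≤ C)
    (hgw : ∃ C : ℝ≥0, ∀ i k, wsum s (fun n => nrm (dif (step n k) (dif (step n k) (g i)))) ≤ C) :
    ∃ C : ℝ≥0, ∀ i k, wsum s (fun n => nrm (dif (step n k) (dif (step n k)
      fun x => f i x * g i x))) ≤ (C * Λ i ^ 2 : ℝ≥0) := by
  obtain ⟨F, hF⟩ := hfΛ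
  obtain ⟨G, hG⟩ := hgΛ
  obtain ⟨W, hW⟩ := hfw
  obtain ⟨Z, hZ⟩ := hgw
  refine ⟨98 * ((G + 1) ^ 2 * W + (F + 1) ^ 2 * Z), fun i k => ?_⟩
  have b1 : ∀ x, |f i x| ≤ ((F + 1) * Λ i : ℝ≥0) := fun x => (hF i x).trans (by
    push_cast; exact mul_le_mul_of_nonneg_right (by linarith) (NNReal.coe_nonneg _))
  have b2 : ∀ x, |g i x| ≤ ((G + 1) * Λ i : ℝ≥0) := fun x => (hG i x).trans (by
    push_cast; exact mul_le_mul_of_nonneg_right (by linarith) (NNReal.coe_nonneg _))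
  have p1 : 0 < (F + 1) * Λ i := mul_pos (by positivity) (hΛ i)
  have p2 : 0 < (G + 1) * Λ i := mul_pos (by positivity) (hΛ i)
  have key : ∀ n, _ := fun n => nrm_dif_dif_mul_le (hf i) (hg i) p1 p2 b1 b2 (step n k)
    ((nrm_dif_le_two (hf i) _).trans_lt (ENNReal.mul_lt_top (by norm_num) (hf2 i)))
    ((nrm_dif_le_two (hg i) _).trans_lt (ENNReal.mul_lt_top (by norm_num) (hg2 i)))
  refine (wsum_mono key).trans ?_
  rw [wsum_const_mul]
  refine (mul_le_mul' le_rfl (wsum_add_le _ _ _)).trans ?_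
  rw [wsum_const_mul, wsum_const_mul]
  calc _ ≤ (7 : ℝ≥0∞) ^ 2 * (2 * ((((G + 1) * Λ i : ℝ≥0) : ℝ≥0∞) ^ 2 * W +
        (((F + 1) * Λ i : ℝ≥0) : ℝ≥0∞) ^ 2 * Z)) := by
        gcongr
        · exact hW i k
        · exact hZ i k
    _ = _ := by norm_cast; ring

end

section

/-! ### Calculus on space-time -/

lemma dir_succ (k : Fin 3) : dir k.succ = ((0 : ℝ), bas k) := rfl

lemma contDiff_pd {w : Spacetime → ℝ} (hw : ContDiff ℝ ∞ w) (α : Fin 4) : ContDiff ℝ ∞ (pd α w) :=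
  (hw.fderiv_right (m := ∞) (by simp)).clm_apply contDiff_const

lemma contDiff_sd {w : Spacetime → ℝ} (hw : ContDiff ℝ ∞ w) (k : Fin 3) : ContDiff ℝ ∞ (sd k w) :=
  contDiff_pd hw _

lemma pd_comm {w : Spacetime → ℝ} (hw : ContDiff ℝ ∞ w) (α β : Fin 4) :
    pd α (pd β w) = pd β (pd α w) := by
  have h : ∀ (α β : Fin 4) (p : Spacetime), pd α (pd β w) p =
      fderiv ℝ (fderiv ℝ w) p (dir α) (dir β) := by
    intro α β p
    have h1 : DifferentiableAt ℝ (fderiv ℝ w) p :=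
      (hw.fderiv_right (m := ∞) (by simp)).differentiable (by simp) p
    have h2 := (h1.hasFDerivAt.clm_apply (hasFDerivAt_const (dir β) p)).fderiv
    unfold pd
    rw [h2]
    simp
  ext p
  rw [h, h]
  have hs : IsSymmSndFDerivAt ℝ w p := (contDiff_infty.1 hw 2).contDiffAt.isSymmSndFDerivAt (by simp)
  exact hs (dir α) (dir β)

lemma pd_add {v w : Spacetime → ℝ} (hv : ContDiff ℝ ∞ v) (hw : ContDiff ℝ ∞ w) (α : Fin 4) :
    pd α (fun p => v p + w p) = fun p => pd α v p + pd α w p := by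
  ext p
  have := fderiv_fun_add (hv.differentiable (by simp) p) (hw.differentiable (by simp) p)
  simp only [pd, this, add_apply]

lemma pd_sub {v w : Spacetime → ℝ} (hv : ContDiff ℝ ∞ v) (hw : ContDiff ℝ ∞ w) (α : Fin 4) :
    pd α (fun p => v p - w p) = fun p => pd α v p - pd α w p := by
  ext p
  have := fderiv_fun_sub (hv.differentiable (by simp) p) (hw.differentiable (by simp) p)
  simp only [pd, this, sub_apply]

lemma pd_mul {v w : Spacetime → ℝ} (hv : ContDiff ℝ ∞ v) (hw : ContDiff ℝ ∞ w) (α : Fin 4) :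
    pd α (fun p => v p * w p) = fun p => v p * pd α w p + pd α v p * w p := by
  ext p
  have := fderiv_fun_mul (hv.differentiable (by simp) p) (hw.differentiable (by simp) p)
  simp only [pd, this, add_apply, smul_apply, smul_eq_mul]
  ring

lemma pd_const_mul {w : Spacetime → ℝ} (hw : ContDiff ℝ ∞ w) (α : Fin 4) (c : ℝ) :
    pd α (fun p => c * w p) = fun p => c * pd α w p := by
  ext p
  have := fderiv_const_mul (hw.differentiable (by simp) p) c
  simp only [pd, this, smul_apply, smul_eq_mul]

lemma pd_zero (α : Fin 4) : pd α (fun _ => (0 : ℝ)) = fun _ => 0 := by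
  ext p; simp [pd]

lemma pd_sum {κ : Type*} (s : Finset κ) {w : κ → Spacetime → ℝ} (hw : ∀ a, ContDiff ℝ ∞ (w a))
    (α : Fin 4) : pd α (fun p => ∑ a ∈ s, w a p) = fun p => ∑ a ∈ s, pd α (w a) p := by
  ext p
  have := fderiv_fun_sum (u := s) (fun a _ => (hw a).differentiable (by simp) p)
  simp only [pd, this, sum_apply]

/-- Spatial translation of a function on space-time. -/
def shift (h : Space) (w : Spacetime → ℝ) : Spacetime → ℝ := fun p => w (p.1, p.2 + h)

/-- Spatial difference of a function on space-time. -/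
def stDif (h : Space) (w : Spacetime → ℝ) : Spacetime → ℝ := fun p => shift h w p - w p

lemma shift_eq (h : Space) (w : Spacetime → ℝ) : shift h w = fun p => w (p + ((0 : ℝ), h)) := by
  ext p
  simp [shift, Prod.add_def]

lemma contDiff_shift {w : Spacetime → ℝ} (hw : ContDiff ℝ ∞ w) (h : Space) :
    ContDiff ℝ ∞ (shift h w) := by
  rw [shift_eq]; exact hw.comp (contDiff_id.add contDiff_const)

lemma pd_shift (w : Spacetime → ℝ) (h : Space) (α : Fin 4) :
    pd α (shift h w) = shift h (pd α w) := by
  ext p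
  rw [shift_eq, shift_eq]
  unfold pd
  rw [fderiv_comp_add_right]

lemma contDiff_stDif {w : Spacetime → ℝ} (hw : ContDiff ℝ ∞ w) (h : Space) :
    ContDiff ℝ ∞ (stDif h w) := (contDiff_shift hw h).sub hw

lemma pd_stDif {w : Spacetime → ℝ} (hw : ContDiff ℝ ∞ w) (h : Space) (α : Fin 4) :
    pd α (stDif h w) = stDif h (pd α w) := by
  unfold stDif
  rw [pd_sub (contDiff_shift hw h) hw, pd_shift]

lemma continuous_slice {w : Spacetime → ℝ} (hw : Continuous w) (t : ℝ) : Continuous (slice t w) :=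
  hw.comp (by fun_prop)

lemma contDiff_slice {w : Spacetime → ℝ} (hw : ContDiff ℝ ∞ w) (t : ℝ) :
    ContDiff ℝ ∞ (slice t w) := hw.comp (contDiff_const.prodMk contDiff_id)

lemma der_slice {w : Spacetime → ℝ} (hw : ContDiff ℝ ∞ w) (t : ℝ) (k : Fin 3) :
    der k (slice t w) = slice t (sd k w) := by
  ext x
  have h1 : HasFDerivAt (fun x : Space => (t, x)) (ContinuousLinearMap.inr ℝ ℝ Space) x := by
    have := (hasFDerivAt_const (𝕜 := ℝ) t x).prodMk (hasFDerivAt_id x)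
    exact this
  have h2 := ((hw.differentiable (by simp) (t, x)).hasFDerivAt.comp x h1).fderiv
  unfold der slice sd pd
  rw [dir_succ]
  rw [show (fun x => w (t, x)) = w ∘ fun x : Space => (t, x) from rfl, h2]
  rfl

lemma hasDerivAt_time {w : Spacetime → ℝ} (hw : ContDiff ℝ ∞ w) (t : ℝ) (x : Space) :
    HasDerivAt (fun s : ℝ => w (s, x)) (pd 0 w (t, x)) t := by
  have h1 : HasDerivAt (fun s : ℝ => (s, x)) ((1 : ℝ), (0 : Space)) t :=
    (hasDerivAt_id t).prodMk (hasDerivAt_const t x)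
  exact (hw.differentiable (by simp) (t, x)).hasFDerivAt.comp_hasDerivAt t h1

lemma pd_eq_zero_of_slab {w : Spacetime → ℝ} (hw : ContDiff ℝ ∞ w) {T : ℝ} (hT : 0 < T)
    (h : ∀ p : Spacetime, p.1 ∈ Icc 0 T → w p = 0) (α : Fin 4) :
    ∀ p : Spacetime, p.1 ∈ Icc 0 T → pd α w p = 0 := by
  have hopen : ∀ p : Spacetime, p.1 ∈ Ioo 0 T → pd α w p = 0 := by
    intro p hp
    have he : w =ᶠ[nhds p] fun _ => 0 := by
      have : IsOpen {q : Spacetime | q.1 ∈ Ioo 0 T} := isOpen_Ioo.preimage continuous_fst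
      filter_upwards [this.mem_nhds hp] with q hq using h q ⟨hq.1.le, hq.2.le⟩
    unfold pd
    rw [he.fderiv_eq]
    simp
  rintro ⟨t, x⟩ ht
  have hc : Continuous fun s : ℝ => pd α w (s, x) :=
    (contDiff_pd hw α).continuous.comp (by fun_prop)
  have hcl : IsClosed {s : ℝ | pd α w (s, x) = 0} := isClosed_eq hc continuous_const
  have hsub : Ioo 0 T ⊆ {s : ℝ | pd α w (s, x) = 0} := fun s hs => hopen (s, x) hs
  have := hcl.closure_subset_iff.2 hsub
  rw [closure_Ioo hT.ne] at this
  exact this ht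

/-! ### Functions whose derivatives are bounded in `L²` on a slab -/

/-- Smooth functions all of whose derivatives are bounded in `L²(Σ_t)`, `t ∈ [0,T]`. -/
structure Good (T : ℝ) (w : Spacetime → ℝ) : Prop where
  smooth : ContDiff ℝ ∞ w
  bound : ∀ l : List (Fin 4), ∃ M : ℝ≥0, ∀ t ∈ Icc 0 T, nrm (slice t (l.foldr pd w)) ≤ M

namespace Good

variable {T : ℝ} {v w : Spacetime → ℝ}

lemma of_closed (Q : (Spacetime → ℝ) → Prop) (hc : ∀ w, Q w → ContDiff ℝ ∞ w)
    (hb : ∀ w, Q w → ∃ M : ℝ≥0, ∀ t ∈ Icc 0 T, nrm (slice t w) ≤ M)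
    (hd : ∀ w α, Q w → Q (ElasticWave.pd α w)) (hw : Q w) : Good T w := by
  have h : ∀ l : List (Fin 4), Q (l.foldr ElasticWave.pd w) := by
    intro l
    induction l with
    | nil => exact hw
    | cons α l ih => exact hd _ α ih
  exact ⟨hc w hw, fun l => hb _ (h l)⟩

lemma pd (hw : Good T w) (α : Fin 4) : Good T (pd α w) :=
  ⟨contDiff_pd hw.smooth α, fun l => by
    obtain ⟨M, hM⟩ := hw.bound (l ++ [α])
    exact ⟨M, fun t ht => by simpa using hM t ht⟩⟩

lemma sd (hw : Good T w) (k : Fin 3) : Good T (sd k w) := hw.pd _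

lemma nrm_bound (hw : Good T w) : ∃ M : ℝ≥0, ∀ t ∈ Icc 0 T, nrm (slice t w) ≤ M := hw.bound []

lemma continuous (hw : Good T w) : Continuous w := hw.smooth.continuous

lemma add (hv : Good T v) (hw : Good T w) : Good T (fun p => v p + w p) := by
  refine of_closed (fun u => ∃ v w, Good T v ∧ Good T w ∧ u = fun p => v p + w p) ?_ ?_ ?_
    ⟨v, w, hv, hw, rfl⟩
  · rintro _ ⟨v, w, hv, hw, rfl⟩; exact hv.smooth.add hw.smooth
  · rintro _ ⟨v, w, hv, hw, rfl⟩
    obtain ⟨M, hM⟩ := hv.nrm_bound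
    obtain ⟨M', hM'⟩ := hw.nrm_bound
    refine ⟨M + M', fun t ht => (nrm_add_le (continuous_slice hv.continuous t)
      (continuous_slice hw.continuous t)).trans ?_⟩
    push_cast
    exact add_le_add (hM t ht) (hM' t ht)
  · rintro _ α ⟨v, w, hv, hw, rfl⟩
    exact ⟨_, _, hv.pd α, hw.pd α, pd_add hv.smooth hw.smooth α⟩

lemma const_mul (hw : Good T w) (c : ℝ) : Good T (fun p => c * w p) := by
  refine of_closed (fun u => ∃ w, Good T w ∧ u = fun p => c * w p) ?_ ?_ ?_ ⟨w, hw, rfl⟩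
  · rintro _ ⟨w, hw, rfl⟩; exact contDiff_const.mul hw.smooth
  · rintro _ ⟨w, hw, rfl⟩
    obtain ⟨M, hM⟩ := hw.nrm_bound
    refine ⟨‖c‖₊ * M, fun t ht => ?_⟩
    have := nrm_const_mul c (slice t w)
    refine (le_of_eq this).trans ?_
    push_cast
    gcongr
    exact hM t ht
  · rintro _ α ⟨w, hw, rfl⟩
    exact ⟨_, hw.pd α, pd_const_mul hw.smooth α c⟩

lemma sub (hv : Good T v) (hw : Good T w) : Good T (fun p => v p - w p) := by
  have := hv.add (hw.const_mul (-1))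
  simpa [sub_eq_add_neg] using this

lemma zero : Good T (fun _ => 0) := by
  refine of_closed (fun u => u = fun _ => 0) ?_ ?_ ?_ rfl
  · rintro _ rfl; exact contDiff_const
  · rintro _ rfl
    exact ⟨0, fun t _ => by
      have : slice t (fun _ : Spacetime => (0 : ℝ)) = 0 := rfl
      rw [this]; simp [nrm]⟩
  · rintro _ α rfl; exact pd_zero α

lemma sum {κ : Type*} (s : Finset κ) {w : κ → Spacetime → ℝ} (hw : ∀ a, Good T (w a)) :
    Good T (fun p => ∑ a ∈ s, w a p) := by
  classical
  induction s using Finset.induction_on with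
  | empty => simpa using zero
  | insert a s ha ih =>
    simp_rw [Finset.sum_insert ha]
    exact (hw a).add ih

lemma shift (hw : Good T w) (h : Space) : Good T (shift h w) := by
  refine of_closed (fun u => ∃ w, Good T w ∧ u = ElasticWave.shift h w) ?_ ?_ ?_ ⟨w, hw, rfl⟩
  · rintro _ ⟨w, hw, rfl⟩; exact contDiff_shift hw.smooth h
  · rintro _ ⟨w, hw, rfl⟩
    obtain ⟨M, hM⟩ := hw.nrm_bound
    exact ⟨M, fun t ht =>
      (nrm_translate (continuous_slice hw.continuous t) h).le.trans (hM t ht)⟩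
  · rintro _ α ⟨w, hw, rfl⟩
    exact ⟨_, hw.pd α, pd_shift w h α⟩

lemma stDif (hw : Good T w) (h : Space) : Good T (stDif h w) := (hw.shift h).sub hw

lemma isHinf (hw : Good T w) {t : ℝ} (ht : t ∈ Icc 0 T) : IsHinf (slice t w) := by
  refine IsHinf.of_foldr (fun F => ∃ w, Good T w ∧ F = slice t w) ?_ ?_ ?_ ⟨w, hw, rfl⟩
  · rintro _ ⟨w, hw, rfl⟩; exact contDiff_slice hw.smooth t
  · rintro _ ⟨w, hw, rfl⟩
    obtain ⟨M, hM⟩ := hw.nrm_bound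
    exact ⟨(continuous_slice hw.continuous t).aestronglyMeasurable,
      (hM t ht).trans_lt ENNReal.coe_lt_top⟩
  · rintro _ k ⟨w, hw, rfl⟩
    exact ⟨_, hw.sd k, der_slice hw.smooth t k⟩

/-- The slices of a good function are bounded in every Sobolev space. -/
lemma hsBounded (hw : Good T w) (s : ℝ) : HsBounded s (fun t : Icc 0 T => slice t w) := by
  have h : ∀ (m : ℕ) (w : Spacetime → ℝ), Good T w →
      ∃ C : ℝ≥0, ∀ t : Icc 0 T, sobolevNorm m (slice t w) ≤ C := by
    intro m
    induction m with
    | zero =>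
      intro w hw
      obtain ⟨M, hM⟩ := hw.nrm_bound
      exact ⟨M, fun t => by
        rw [Nat.cast_zero, sobolevNorm_zero (hw.isHinf t.2).memLp]; exact hM t t.2⟩
    | succ m ih =>
      intro w hw
      obtain ⟨M, hM⟩ := hw.nrm_bound
      choose C hC using fun j => ih (ElasticWave.sd j w) (hw.sd j)
      set B : ℝ≥0 := ((2 : ℝ) ^ ((m : ℝ) + 1)).toNNReal * (M ^ 2 + ∑ j, C j ^ 2) + 1
      refine ⟨B, fun t => le_of_sq_le_sq ?_⟩
      rw [Nat.cast_succ]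
      refine (sq_sobolevNorm_succ_le (hw.isHinf t.2) (Nat.cast_nonneg m)).trans ?_
      have h1 : ENNReal.ofReal (2 ^ ((m : ℝ) + 1)) * (nrm (slice t w) ^ 2 +
          ∑ j : Fin 3, sobolevNorm m (der j (slice t w)) ^ 2) ≤ (B : ℝ≥0∞) := by
        simp only [B]
        push_cast
        refine le_add_right ?_
        refine mul_le_mul' le_rfl ?_
        gcongr with j _
        · exact hM t t.2
        · rw [der_slice hw.smooth]; exact hC j t
      refine h1.trans ?_
      have : (1 : ℝ≥0∞) ≤ B := by simp only [B]; push_cast; exact le_add_left le_rfl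
      rw [sq]
      exact le_mul_of_one_le_left' this
  obtain ⟨m, hm⟩ := exists_nat_ge s
  exact HsBounded.mono ⟨fun t => hw.isHinf t.2, h m w hw⟩ hm

lemma sup_bound (hw : Good T w) : ∃ C : ℝ≥0, ∀ p : Spacetime, p.1 ∈ Icc 0 T → |w p| ≤ C := by
  obtain ⟨C, hC⟩ := (hw.hsBounded 2).sup_bound (by norm_num)
  exact ⟨C, fun p hp => hC ⟨p.1, hp⟩ p.2⟩

/-- Differences in time. -/
lemma nrm_sub_le (hw : Good T w) {a b : ℝ} (hab : a ≤ b)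
    {M : ℝ≥0∞} (hM : ∀ t ∈ Icc a b, nrm (slice t (ElasticWave.pd 0 w)) ≤ M) :
    nrm (fun x => slice b w x - slice a w x) ≤ ENNReal.ofReal (b - a) * M := by
  refine nrm_le_of_le_lintegral (g := fun s x => ElasticWave.pd 0 w (s, x)) ?_ (fun x => ?_) hM
  · exact (contDiff_pd hw.smooth 0).continuous
  · have hd : ∀ s ∈ uIcc a b, HasDerivAt (fun s : ℝ => w (s, x)) (ElasticWave.pd 0 w (s, x)) s :=
      fun s _ => hasDerivAt_time hw.smooth s x
    have hc : Continuous fun s : ℝ => ElasticWave.pd 0 w (s, x) :=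
      (contDiff_pd hw.smooth 0).continuous.comp (by fun_prop)
    have := intervalIntegral.integral_eq_sub_of_hasDerivAt hd (hc.intervalIntegrable _ _)
    rw [intervalIntegral.integral_of_le hab, ← integral_Icc_eq_integral_Ioc] at this
    unfold slice
    rw [← this]
    exact enorm_integral_le_lintegral_enorm _

end Good

end

section

/-! ### The energy inequality -/

/-- The norm of `L¹(ℝ³)`. -/
def nrm1 (F : Space → ℝ) : ℝ≥0∞ := eLpNorm F 1 volume

lemma nrm1_eq (F : Space → ℝ) : nrm1 F = ∫⁻ x, ‖F x‖ₑ := eLpNorm_one_eq_lintegral_enorm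

lemma nrm1_add_le {F G : Space → ℝ} (hF : Continuous F) (hG : Continuous G) :
    nrm1 (fun x => F x + G x) ≤ nrm1 F + nrm1 G :=
  eLpNorm_add_le hF.aestronglyMeasurable hG.aestronglyMeasurable le_rfl

lemma nrm1_sum_le {κ : Type*} (s : Finset κ) {F : κ → Space → ℝ} (hF : ∀ i, Continuous (F i)) :
    nrm1 (fun x => ∑ i ∈ s, F i x) ≤ ∑ i ∈ s, nrm1 (F i) := by
  have := eLpNorm_sum_le (s := s) (f := F) (p := 1) (μ := (volume : Measure Space))
    (fun i _ => (hF i).aestronglyMeasurable) le_rfl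
  refine le_trans (le_of_eq ?_) this
  unfold nrm1
  congr 1
  ext x; simp

lemma integrable_of_nrm1 {F : Space → ℝ} (hF : Continuous F) (h : nrm1 F < ⊤) :
    Integrable F volume :=
  memLp_one_iff_integrable.1 ⟨hF.aestronglyMeasurable, h⟩

lemma nrm1_mul_le {f g h : Space → ℝ} (hg : Continuous g) (hh : Continuous h) (c : ℝ≥0)
    (hf : ∀ x, |f x| ≤ c) : nrm1 (fun x => f x * (g x * h x)) ≤ c * (nrm g * nrm h) := by
  have e : ∀ F : Space → ℝ, (∫⁻ x, ‖F x‖ₑ ^ (2 : ℝ)) ^ (1 / (2 : ℝ)) = nrm F := by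
    intro F
    have : ∫⁻ x, ‖F x‖ₑ ^ (2 : ℝ) = nrm F ^ (2 : ℝ) := by
      rw [ENNReal.rpow_two, sq_nrm]; simp
    rw [this, ← ENNReal.rpow_mul]; norm_num
  have h1 := ENNReal.lintegral_mul_le_Lp_mul_Lq volume (Real.HolderConjugate.two_two)
    (f := fun x => ‖g x‖ₑ) (g := fun x => ‖h x‖ₑ)
    hg.measurable.enorm.aemeasurable hh.measurable.enorm.aemeasurable
  rw [e, e] at h1
  rw [nrm1_eq]
  calc _ ≤ ∫⁻ x, c * (‖g x‖ₑ * ‖h x‖ₑ) := by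
        refine lintegral_mono fun x => ?_
        rw [enorm_mul, enorm_mul]
        gcongr
        rw [enorm_le_coe, ← NNReal.coe_le_coe]
        simpa using hf x
    _ = c * ∫⁻ x, ‖g x‖ₑ * ‖h x‖ₑ := lintegral_const_mul' _ _ ENNReal.coe_ne_top
    _ ≤ _ := mul_le_mul' le_rfl h1

lemma integrable_slab {f : Spacetime → ℝ} (hf : Continuous f) {t : ℝ} {M : ℝ≥0}
    (hM : ∀ τ ∈ Icc 0 t, nrm1 (slice τ f) ≤ M) :
    Integrable (fun q : Space × ℝ => f (q.2, q.1)) (volume.prod (volume.restrict (Icc 0 t))) := by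
  have hm : Continuous fun q : Space × ℝ => f (q.2, q.1) := hf.comp (by fun_prop)
  refine ⟨hm.aestronglyMeasurable, ?_⟩
  unfold HasFiniteIntegral
  rw [lintegral_prod_symm _ hm.measurable.enorm.aemeasurable]
  calc _ ≤ ∫⁻ τ in Icc 0 t, (M : ℝ≥0∞) := by
        refine setLIntegral_mono measurable_const fun τ hτ => ?_
        have := hM τ hτ
        rwa [nrm1_eq] at this
    _ < ⊤ := by
        rw [lintegral_const, Measure.restrict_apply MeasurableSet.univ, univ_inter, Real.volume_Icc]
        exact ENNReal.mul_lt_top ENNReal.coe_lt_top ENNReal.ofReal_lt_top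

lemma ofReal_integral_slice_le {f : Spacetime → ℝ} (hf : ContDiff ℝ ∞ f) {t : ℝ} (ht : 0 ≤ t)
    (h0 : Integrable (slice 0 f) volume) (h1 : Integrable (slice t f) volume) {M : ℝ≥0}
    (hM : ∀ τ ∈ Icc 0 t, nrm1 (slice τ (pd 0 f)) ≤ M) :
    ENNReal.ofReal (∫ x, slice t f x) ≤ ENNReal.ofReal (∫ x, slice 0 f x) +
      ∫⁻ τ in Icc 0 t, ‖∫ x, slice τ (pd 0 f) x‖ₑ := by
  have hc := (contDiff_pd hf 0).continuous
  have hftc : ∀ x, slice t f x - slice 0 f x = ∫ τ in Icc 0 t, pd 0 f (τ, x) := by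
    intro x
    have hd : ∀ s ∈ uIcc 0 t, HasDerivAt (fun s : ℝ => f (s, x)) (pd 0 f (s, x)) s :=
      fun s _ => hasDerivAt_time hf s x
    have hcx : Continuous fun s : ℝ => pd 0 f (s, x) := hc.comp (by fun_prop)
    have := intervalIntegral.integral_eq_sub_of_hasDerivAt hd (hcx.intervalIntegrable _ _)
    rw [intervalIntegral.integral_of_le ht, ← integral_Icc_eq_integral_Ioc] at this
    exact this.symm
  have hswap : ∫ x, ∫ τ in Icc 0 t, pd 0 f (τ, x) = ∫ τ in Icc 0 t, ∫ x, pd 0 f (τ, x) :=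
    integral_integral_swap (integrable_slab hc hM)
  have e : ∫ x, slice t f x = (∫ x, slice 0 f x) + ∫ τ in Icc 0 t, ∫ x, pd 0 f (τ, x) := by
    rw [← hswap, ← integral_congr_ae (Filter.Eventually.of_forall hftc), integral_sub h1 h0]
    ring
  rw [e]
  refine ENNReal.ofReal_add_le.trans (add_le_add le_rfl ?_)
  refine le_trans ?_ (enorm_integral_le_lintegral_enorm _)
  rw [Real.enorm_eq_ofReal_abs]
  exact ENNReal.ofReal_le_ofReal (le_abs_self _)

/-- The residual `∂_t² z - a^{jk} ∂_j ∂_k z`. -/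
def residual (a : Fin 3 → Fin 3 → Spacetime → ℝ) (z : Spacetime → ℝ) : Spacetime → ℝ :=
  fun p => pd 0 (pd 0 z) p - ∑ j, ∑ k, a j k p * sd j (sd k z) p

/-- The energy density. -/
def energyDensity (a : Fin 3 → Fin 3 → Spacetime → ℝ) (z : Spacetime → ℝ) : Spacetime → ℝ :=
  fun p => pd 0 z p * pd 0 z p + ∑ j, ∑ k, a j k p * (sd j z p * sd k z p)

/-- The production term in the energy identity. -/
def energyFlux (a : Fin 3 → Fin 3 → Spacetime → ℝ) (z : Spacetime → ℝ) : Spacetime → ℝ :=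
  fun p => 2 * (pd 0 z p * residual a z p) + ∑ j, ∑ k, (pd 0 (a j k) p * (sd j z p * sd k z p) +
    -2 * sd j (a j k) p * (pd 0 z p * sd k z p))

section

variable {a : Fin 3 → Fin 3 → Spacetime → ℝ} {z : Spacetime → ℝ}

lemma contDiff_residual (ha : ∀ j k, ContDiff ℝ ∞ (a j k)) (hz : ContDiff ℝ ∞ z) :
    ContDiff ℝ ∞ (residual a z) :=
  (contDiff_pd (contDiff_pd hz _) _).sub (ContDiff.sum fun j _ => ContDiff.sum fun k _ =>
    (ha j k).mul (contDiff_sd (contDiff_sd hz _) _))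

lemma contDiff_energyDensity (ha : ∀ j k, ContDiff ℝ ∞ (a j k)) (hz : ContDiff ℝ ∞ z) :
    ContDiff ℝ ∞ (energyDensity a z) :=
  ((contDiff_pd hz _).mul (contDiff_pd hz _)).add (ContDiff.sum fun j _ => ContDiff.sum fun k _ =>
    (ha j k).mul ((contDiff_sd hz _).mul (contDiff_sd hz _)))

lemma pd_energyDensity (ha : ∀ j k, ContDiff ℝ ∞ (a j k)) (hs : ∀ j k, a j k = a k j)
    (hz : ContDiff ℝ ∞ z) (p : Spacetime) :
    pd 0 (energyDensity a z) p = energyFlux a z p + ∑ j, ∑ k, 2 *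
      ((a j k p * pd 0 z p) * sd j (sd k z) p +
        (a j k p * sd j (pd 0 z) p + sd j (a j k) p * pd 0 z p) * sd k z p) := by
  have hzt := contDiff_pd hz 0
  have hcm : ∀ j, pd 0 (sd j z) = sd j (pd 0 z) := fun j => pd_comm hz _ _
  have hjk : ∀ j k, ContDiff ℝ ∞ fun p => a j k p * (sd j z p * sd k z p) := fun j k =>
    (ha j k).mul ((contDiff_sd hz _).mul (contDiff_sd hz _))
  have hj : ∀ j, ContDiff ℝ ∞ fun p => ∑ k, a j k p * (sd j z p * sd k z p) := fun j =>
    ContDiff.sum fun k _ => hjk j k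
  have e : pd 0 (energyDensity a z) = fun p => (pd 0 z p * pd 0 (pd 0 z) p +
      pd 0 (pd 0 z) p * pd 0 z p) + ∑ j, ∑ k, (a j k p * (sd j z p * sd k (pd 0 z) p +
        sd j (pd 0 z) p * sd k z p) + pd 0 (a j k) p * (sd j z p * sd k z p)) := by
    unfold energyDensity
    rw [pd_add (hzt.mul hzt) (ContDiff.sum fun j _ => hj j), pd_mul hzt hzt, pd_sum _ hj]
    ext p
    congr 1
    refine Finset.sum_congr rfl fun j _ => ?_
    rw [pd_sum _ (hjk j)]
    refine Finset.sum_congr rfl fun k _ => ?_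
    rw [pd_mul (ha j k) ((contDiff_sd hz _).mul (contDiff_sd hz _)),
      pd_mul (contDiff_sd hz _) (contDiff_sd hz _), hcm, hcm]
  rw [e]
  have hsw : ∑ j, ∑ k, a j k p * (sd j z p * sd k (pd 0 z) p) =
      ∑ j, ∑ k, a j k p * (sd j (pd 0 z) p * sd k z p) := by
    rw [Finset.sum_comm]
    refine Finset.sum_congr rfl fun j _ => Finset.sum_congr rfl fun k _ => ?_
    rw [hs k j]; ring
  simp only [energyFlux, residual, mul_add, Finset.sum_add_distrib, mul_sub, add_mul] at hsw ⊢
  rw [hsw]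
  have e2 : ∀ j k, 2 * (a j k p * pd 0 z p * sd j (sd k z) p) =
    2 * (pd 0 z p * (a j k p * sd j (sd k z) p)) := fun j k => by ring
  have e3 : ∀ j k, 2 * (a j k p * sd j (pd 0 z) p * sd k z p) =
    a j k p * (sd j (pd 0 z) p * sd k z p) + a j k p * (sd j (pd 0 z) p * sd k z p) :=
    fun j k => by ring
  have e4 : ∀ j k, 2 * (sd j (a j k) p * pd 0 z p * sd k z p) =
    -(-2 * sd j (a j k) p * (pd 0 z p * sd k z p)) := fun j k => by ring
  simp only [e2, e3, e4, Finset.sum_neg_distrib, Finset.sum_add_distrib, ← Finset.mul_sum]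
  ring

end

section

variable {T : ℝ} {a : Fin 3 → Fin 3 → Spacetime → ℝ} {z : Spacetime → ℝ} {B : ℝ≥0}

lemma integral_pd_energyDensity (ha : ∀ j k, ContDiff ℝ ∞ (a j k)) (hs : ∀ j k, a j k = a k j)
    (hz : Good T z) (hB : ∀ j k p, p.1 ∈ Icc 0 T → |a j k p| ≤ B)
    (hB' : ∀ α j k p, p.1 ∈ Icc 0 T → |pd α (a j k) p| ≤ B) {τ : ℝ} (hτ : τ ∈ Icc 0 T)
    (hfl : Integrable (slice τ (energyFlux a z)) volume) :
    ∫ x, slice τ (pd 0 (energyDensity a z)) x = ∫ x, slice τ (energyFlux a z) x := by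
  have hzt := hz.pd 0
  let F : Fin 3 → Fin 3 → Space → ℝ := fun j k => slice τ fun p => a j k p * pd 0 z p
  let G : Fin 3 → Space → ℝ := fun k => slice τ (sd k z)
  have cz : ∀ w, Good T w → Continuous (slice τ w) := fun w hw => continuous_slice hw.continuous τ
  have fz : ∀ w, Good T w → nrm (slice τ w) < ⊤ := fun w hw => (hw.isHinf hτ).memLp.2
  have ca : ∀ j k, Continuous (slice τ (a j k)) := fun j k => continuous_slice (ha j k).continuous τ
  have cda : ∀ j k, Continuous (slice τ (sd j (a j k))) := fun j k =>
    continuous_slice (contDiff_sd (ha j k) j).continuous τ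
  have I : ∀ (f g h : Space → ℝ), Continuous f → Continuous g → Continuous h → (∀ x, |f x| ≤ B) →
      nrm g < ⊤ → nrm h < ⊤ → Integrable (fun x => f x * (g x * h x)) volume := by
    intro f g h cf cg ch hf hg hh
    exact integrable_of_nrm1 (by fun_prop) ((nrm1_mul_le cg ch B hf).trans_lt
      (ENNReal.mul_lt_top ENNReal.coe_lt_top (ENNReal.mul_lt_top hg hh)))
  have hF : ∀ j k, ContDiff ℝ ∞ (F j k) := fun j k => contDiff_slice ((ha j k).mul hzt.smooth) τ
  have hG : ∀ k, IsHinf (G k) := fun k => (hz.sd k).isHinf hτ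
  have dF : ∀ j k x, der j (F j k) x = a j k (τ, x) * sd j (pd 0 z) (τ, x) +
      sd j (a j k) (τ, x) * pd 0 z (τ, x) := by
    intro j k x
    rw [der_slice ((ha j k).mul hzt.smooth)]
    unfold sd
    rw [pd_mul (ha j k) hzt.smooth]
    rfl
  have dG : ∀ j k x, der j (G k) x = sd j (sd k z) (τ, x) := fun j k x => by
    rw [der_slice (hz.sd k).smooth]; rfl
  have i1 : ∀ j k, Integrable (fun x => F j k x * der j (G k) x) volume := by
    intro j k
    have := I (slice τ (a j k)) (slice τ (pd 0 z)) (slice τ (sd j (sd k z))) (ca j k) (cz _ hzt)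
      (cz _ ((hz.sd k).sd j)) (fun x => hB j k (τ, x) hτ) (fz _ hzt) (fz _ ((hz.sd k).sd j))
    refine this.congr (Filter.Eventually.of_forall fun x => ?_)
    simp only [dG, F, slice]; ring
  have i2 : ∀ j k, Integrable (fun x => der j (F j k) x * G k x) volume := by
    intro j k
    have h1 := I (slice τ (a j k)) (slice τ (sd j (pd 0 z))) (slice τ (sd k z)) (ca j k)
      (cz _ (hzt.sd j)) (cz _ (hz.sd k)) (fun x => hB j k (τ, x) hτ) (fz _ (hzt.sd j)) (fz _ (hz.sd k))
    have h2 := I (slice τ (sd j (a j k))) (slice τ (pd 0 z)) (slice τ (sd k z)) (cda j k)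
      (cz _ hzt) (cz _ (hz.sd k)) (fun x => hB' _ j k (τ, x) hτ) (fz _ hzt) (fz _ (hz.sd k))
    refine (h1.add h2).congr (Filter.Eventually.of_forall fun x => ?_)
    simp only [dF, G, slice, Pi.add_apply]; ring
  have i3 : ∀ j k, Integrable (fun x => F j k x * G k x) volume := by
    intro j k
    have h1 := I (slice τ (a j k)) (slice τ (pd 0 z)) (slice τ (sd k z)) (ca j k)
      (cz _ hzt) (cz _ (hz.sd k)) (fun x => hB j k (τ, x) hτ) (fz _ hzt) (fz _ (hz.sd k))
    refine h1.congr (Filter.Eventually.of_forall fun x => ?_)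
    simp only [F, G, slice]; ring
  have ibp : ∀ j k, ∫ x, F j k x * der j (G k) x = -∫ x, der j (F j k) x * G k x := by
    intro j k
    exact integral_mul_fderiv_eq_neg_fderiv_mul_of_integrable (i2 j k) (i1 j k) (i3 j k)
      (fun x _ => (hF j k).differentiable (by simp) x) (fun x _ => (hG k).differentiable x)
  have e : ∀ x, slice τ (pd 0 (energyDensity a z)) x = slice τ (energyFlux a z) x +
      ∑ j, ∑ k, 2 * (F j k x * der j (G k) x + der j (F j k) x * G k x) := by
    intro x
    simp only [dF, dG]
    exact pd_energyDensity ha hs hz.smooth (τ, x)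
  have i4 : ∀ j k, Integrable (fun x => 2 * (F j k x * der j (G k) x + der j (F j k) x * G k x))
      volume := fun j k => ((i1 j k).add (i2 j k)).const_mul 2
  rw [integral_congr_ae (Filter.Eventually.of_forall e),
    integral_add hfl (integrable_finsetSum _ fun j _ => integrable_finsetSum _ fun k _ => i4 j k),
    integral_finsetSum _ (fun j _ => integrable_finsetSum _ fun k _ => i4 j k)]
  have : ∀ j, ∫ x, ∑ k, 2 * (F j k x * der j (G k) x + der j (F j k) x * G k x) = 0 := by
    intro j
    rw [integral_finsetSum _ (fun k _ => i4 j k)]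
    refine Finset.sum_eq_zero fun k _ => ?_
    rw [integral_const_mul, integral_add (i1 j k) (i2 j k), ibp]
    ring
  simp [this]

lemma nrm1_energyFlux_le (ha : ∀ j k, ContDiff ℝ ∞ (a j k)) (hz : Good T z) {τ : ℝ} {L : ℝ≥0} (hL : ∀ α j k x, |pd α (a j k) (τ, x)| ≤ L) :
    nrm1 (slice τ (energyFlux a z)) ≤
      2 * (nrm (slice τ (pd 0 z)) * nrm (slice τ (residual a z))) +
      9 * L * (nrm (slice τ (pd 0 z)) ^ 2 + ∑ j, nrm (slice τ (sd j z)) ^ 2) := by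
  have hzt := hz.pd 0
  have cz : ∀ w, Good T w → Continuous (slice τ w) := fun w hw => continuous_slice hw.continuous τ
  have cr := continuous_slice (contDiff_residual ha hz.smooth).continuous τ
  have cda : ∀ α j k, Continuous (slice τ (pd α (a j k))) := fun α j k =>
    continuous_slice (contDiff_pd (ha j k) α).continuous τ
  have two_mul_le : ∀ x y : ℝ≥0∞, 2 * (x * y) ≤ x ^ 2 + y ^ 2 := by
    intro x y
    rcases eq_or_ne x ⊤ with rfl | hx
    · simp
    rcases eq_or_ne y ⊤ with rfl | hy
    · simp
    lift x to ℝ≥0 using hx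
    lift y to ℝ≥0 using hy
    norm_cast
    rw [← NNReal.coe_le_coe]
    push_cast
    nlinarith [sq_nonneg ((x : ℝ) - y)]
  set Zt := nrm (slice τ (pd 0 z))
  set Zj : Fin 3 → ℝ≥0∞ := fun j => nrm (slice τ (sd j z))
  have t1 : ∀ j k, nrm1 (fun x => slice τ (pd 0 (a j k)) x * (slice τ (sd j z) x * slice τ (sd k z) x) +
      -2 * slice τ (sd j (a j k)) x * (slice τ (pd 0 z) x * slice τ (sd k z) x)) ≤
      L * (Zj j * Zj k) + (2 * L) * (Zt * Zj k) := by
    intro j k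
    have c1 := cda 0 j k
    have c2 : Continuous (slice τ (sd j (a j k))) := cda j.succ j k
    have c3 := cz _ (hz.sd j)
    have c4 := cz _ (hz.sd k)
    have c5 := cz _ hzt
    refine (nrm1_add_le (by fun_prop) (by fun_prop)).trans (add_le_add ?_ ?_)
    · exact nrm1_mul_le c3 c4 L fun x => hL 0 j k x
    · have := nrm1_mul_le (f := fun x => -2 * slice τ (sd j (a j k)) x) c5 c4 (2 * L) (fun x => by
        rw [abs_mul]
        push_cast
        have := hL j.succ j k x
        norm_num
        exact this)
      exact_mod_cast this
  have hsplit : nrm1 (slice τ (energyFlux a z)) ≤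
      nrm1 (fun x => 2 * (slice τ (pd 0 z) x * slice τ (residual a z) x)) +
      ∑ j, ∑ k, (L * (Zj j * Zj k) + (2 * L) * (Zt * Zj k)) := by
    have cjk : ∀ j k, Continuous (fun x => slice τ (pd 0 (a j k)) x * (slice τ (sd j z) x *
        slice τ (sd k z) x) + -2 * slice τ (sd j (a j k)) x *
          (slice τ (pd 0 z) x * slice τ (sd k z) x)) := fun j k => by
      have c1 := cda 0 j k
      have c2 : Continuous (slice τ (sd j (a j k))) := cda j.succ j k
      have c3 := cz _ (hz.sd j)
      have c4 := cz _ (hz.sd k)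
      have c5 := cz _ hzt
      fun_prop
    have c5 := cz _ hzt
    refine (nrm1_add_le (F := fun x => 2 * (slice τ (pd 0 z) x * slice τ (residual a z) x))
      (G := fun x => ∑ j, ∑ k, (slice τ (pd 0 (a j k)) x * (slice τ (sd j z) x *
        slice τ (sd k z) x) + -2 * slice τ (sd j (a j k)) x *
          (slice τ (pd 0 z) x * slice τ (sd k z) x))) (by fun_prop)
      (continuous_finsetSum _ fun j _ => continuous_finsetSum _ fun k _ => cjk j k)).trans ?_
    refine add_le_add le_rfl ?_
    refine (nrm1_sum_le _ fun j => continuous_finsetSum _ fun k _ => cjk j k).trans ?_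
    refine Finset.sum_le_sum fun j _ => ?_
    exact (nrm1_sum_le _ (cjk j)).trans (Finset.sum_le_sum fun k _ => t1 j k)
  refine hsplit.trans (add_le_add ?_ ?_)
  · have := nrm1_mul_le (f := fun _ => (2 : ℝ)) (cz _ hzt) cr 2 (fun x => by norm_num)
    simpa using this
  · have hb : ∀ j k, L * (Zj j * Zj k) + (2 * L) * (Zt * Zj k) ≤
        L * (Zj j ^ 2 + Zj k ^ 2 + (Zt ^ 2 + Zj k ^ 2)) := by
      intro j k
      have h1 : Zj j * Zj k ≤ Zj j ^ 2 + Zj k ^ 2 :=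
        le_trans (le_mul_of_one_le_left' (by norm_num)) (two_mul_le _ _)
      have h2 := two_mul_le Zt (Zj k)
      calc _ = L * (Zj j * Zj k + 2 * (Zt * Zj k)) := by ring
        _ ≤ _ := by gcongr
    refine (Finset.sum_le_sum fun j _ => Finset.sum_le_sum fun k _ => hb j k).trans (le_of_eq ?_)
    simp only [Fin.sum_univ_three]
    ring

/-- The energy inequality for `∂_t² - a^{jk} ∂_j ∂_k`. -/
lemma energy_le (ha : ∀ j k, ContDiff ℝ ∞ (a j k)) (hs : ∀ j k, a j k = a k j)
    (hz : Good T z) (hB : ∀ j k p, p.1 ∈ Icc 0 T → |a j k p| ≤ B)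
    (hB' : ∀ α j k p, p.1 ∈ Icc 0 T → |pd α (a j k) p| ≤ B)
    {Λ : ℝ → ℝ≥0} (hΛ : ∀ α j k p, p.1 ∈ Icc 0 T → |pd α (a j k) p| ≤ Λ p.1)
    {c C : ℝ≥0} (hc : ∀ p : Spacetime, p.1 ∈ Icc 0 T → ∀ ξ : Fin 3 → ℝ,
      c * ∑ j, ξ j ^ 2 ≤ ∑ j, ∑ k, a j k p * (ξ j * ξ k) ∧
      ∑ j, ∑ k, a j k p * (ξ j * ξ k) ≤ C * ∑ j, ξ j ^ 2)
    {t : ℝ} (ht : t ∈ Icc 0 T) :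
    nrm (slice t (pd 0 z)) ^ 2 + c * ∑ j, nrm (slice t (sd j z)) ^ 2 ≤
      nrm (slice 0 (pd 0 z)) ^ 2 + C * ∑ j, nrm (slice 0 (sd j z)) ^ 2 +
      ∫⁻ τ in Icc 0 t, (2 * (nrm (slice τ (pd 0 z)) * nrm (slice τ (residual a z))) +
        9 * Λ τ * (nrm (slice τ (pd 0 z)) ^ 2 + ∑ j, nrm (slice τ (sd j z)) ^ 2)) := by
  have hzt := hz.pd 0
  have h0T : (0 : ℝ) ∈ Icc 0 T := ⟨le_rfl, ht.1.trans ht.2⟩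
  have hsub : ∀ τ ∈ Icc 0 t, τ ∈ Icc 0 T := fun τ hτ => ⟨hτ.1, hτ.2.trans ht.2⟩
  have cz : ∀ τ w, Good T w → Continuous (slice τ w) := fun τ w hw => continuous_slice hw.continuous τ
  have fz : ∀ τ ∈ Icc 0 T, ∀ w, Good T w → nrm (slice τ w) < ⊤ := fun τ hτ w hw =>
    (hw.isHinf hτ).memLp.2
  have cda : ∀ τ j k, Continuous (slice τ (a j k)) := fun τ j k => continuous_slice (ha j k).continuous τ
  have hd := contDiff_energyDensity ha hz.smooth
  -- the residual is bounded in `L²`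
  have hres : ∃ M : ℝ≥0, ∀ τ ∈ Icc 0 T, nrm (slice τ (residual a z)) ≤ M := by
    obtain ⟨M0, hM0⟩ := (hzt.pd 0).nrm_bound
    choose M hM using fun j k => ((hz.sd k).sd j).nrm_bound
    refine ⟨M0 + ∑ j, ∑ k, B * M j k, fun τ hτ => ?_⟩
    have c2 := cz τ _ (hzt.pd 0)
    have hcjk : ∀ j k, Continuous fun x => slice τ (a j k) x * slice τ (sd j (sd k z)) x :=
      fun j k => (cda τ j k).mul (cz τ _ ((hz.sd k).sd j))
    have hcj : ∀ j, Continuous fun x => ∑ k, slice τ (a j k) x * slice τ (sd j (sd k z)) x :=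
      fun j => continuous_finsetSum _ fun k _ => hcjk j k
    have : nrm (slice τ (residual a z)) ≤ nrm (slice τ (pd 0 (pd 0 z))) +
        nrm (fun x => ∑ j, ∑ k, slice τ (a j k) x * slice τ (sd j (sd k z)) x) :=
      eLpNorm_sub_le c2.aestronglyMeasurable
        (continuous_finsetSum _ fun j _ => hcj j).aestronglyMeasurable (by norm_num)
    refine this.trans ?_
    push_cast
    refine add_le_add (hM0 τ hτ) ((nrm_sum_le _ hcj).trans (Finset.sum_le_sum fun j _ =>
      (nrm_sum_le _ (hcjk j)).trans (Finset.sum_le_sum fun k _ => ?_)))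
    exact (nrm_mul_le B fun x => hB j k (τ, x) hτ).trans (mul_le_mul' le_rfl (hM j k τ hτ))
  have hflux : ∀ τ ∈ Icc 0 T, nrm1 (slice τ (energyFlux a z)) ≤
      2 * (nrm (slice τ (pd 0 z)) * nrm (slice τ (residual a z))) +
        9 * B * (nrm (slice τ (pd 0 z)) ^ 2 + ∑ j, nrm (slice τ (sd j z)) ^ 2) := fun τ hτ =>
    nrm1_energyFlux_le ha hz fun α j k x => hB' α j k (τ, x) hτ
  have hflc : Continuous (energyFlux a z) := by
    have h1 := (contDiff_residual ha hz.smooth).continuous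
    have h2 := hzt.continuous
    have h3 : ∀ j, Continuous (sd j z) := fun j => (hz.sd j).continuous
    have h4 : ∀ α j k, Continuous (pd α (a j k)) := fun α j k => (contDiff_pd (ha j k) α).continuous
    have h5 : ∀ i j k, Continuous (sd i (a j k)) := fun α j k => (contDiff_pd (ha j k) _).continuous
    unfold energyFlux
    fun_prop
  have hfin : ∀ τ ∈ Icc 0 T, nrm1 (slice τ (energyFlux a z)) < ⊤ := by
    intro τ hτ
    obtain ⟨M, hM⟩ := hres
    refine (hflux τ hτ).trans_lt (ENNReal.add_lt_top.2 ⟨?_, ?_⟩)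
    · exact ENNReal.mul_lt_top (by norm_num) (ENNReal.mul_lt_top (fz τ hτ _ hzt)
        ((hM τ hτ).trans_lt ENNReal.coe_lt_top))
    · refine ENNReal.mul_lt_top (ENNReal.mul_lt_top (by norm_num) ENNReal.coe_lt_top)
        (ENNReal.add_lt_top.2 ⟨ENNReal.pow_lt_top (fz τ hτ _ hzt), ?_⟩)
      exact ENNReal.sum_lt_top.2 fun j _ => ENNReal.pow_lt_top (fz τ hτ _ (hz.sd j))
  have hint : ∀ τ ∈ Icc 0 T, Integrable (slice τ (energyFlux a z)) volume := fun τ hτ =>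
    integrable_of_nrm1 (continuous_slice hflc τ) (hfin τ hτ)
  -- integrability of the time derivative of the density
  have hM : ∃ M : ℝ≥0, ∀ τ ∈ Icc 0 t, nrm1 (slice τ (pd 0 (energyDensity a z))) ≤ M := by
    obtain ⟨M, hM⟩ := hres
    obtain ⟨Mt, hMt⟩ := hzt.nrm_bound
    choose M1 hM1 using fun j => (hz.sd j).nrm_bound
    choose M2 hM2 using fun j k => ((hz.sd k).sd j).nrm_bound
    choose M3 hM3 using fun j => (hzt.sd j).nrm_bound
    refine ⟨(2 * (Mt * M) + 9 * B * (Mt ^ 2 + ∑ j, M1 j ^ 2)) +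
      ∑ j, ∑ k, ((2 * B) * (Mt * M2 j k) + ((2 * B) * (M3 j * M1 k) + (2 * B) * (Mt * M1 k))),
      fun τ hτt => ?_⟩
    have hτ := hsub τ hτt
    have cjk : ∀ j k, Continuous fun x => (2 * slice τ (a j k) x) * (slice τ (pd 0 z) x *
        slice τ (sd j (sd k z)) x) + ((2 * slice τ (a j k) x) * (slice τ (sd j (pd 0 z)) x *
        slice τ (sd k z) x) + (2 * slice τ (sd j (a j k)) x) *
          (slice τ (pd 0 z) x * slice τ (sd k z) x)) := by
      intro j k
      have c1 := cda τ j k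
      have c2 : Continuous (slice τ (sd j (a j k))) :=
        continuous_slice (contDiff_pd (ha j k) _).continuous τ
      have c3 := cz τ _ hzt
      have c4 := cz τ _ (hz.sd k)
      have c5 := cz τ _ ((hz.sd k).sd j)
      have c6 := cz τ _ (hzt.sd j)
      fun_prop
    have e : slice τ (pd 0 (energyDensity a z)) = fun x => slice τ (energyFlux a z) x +
        ∑ j, ∑ k, ((2 * slice τ (a j k) x) * (slice τ (pd 0 z) x *
        slice τ (sd j (sd k z)) x) + ((2 * slice τ (a j k) x) * (slice τ (sd j (pd 0 z)) x *
        slice τ (sd k z) x) + (2 * slice τ (sd j (a j k)) x) *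
          (slice τ (pd 0 z) x * slice τ (sd k z) x))) := by
      ext x
      refine (pd_energyDensity ha hs hz.smooth (τ, x)).trans ?_
      congr 1
      refine Finset.sum_congr rfl fun j _ => Finset.sum_congr rfl fun k _ => ?_
      simp only [slice]; ring
    rw [e]
    refine (nrm1_add_le (continuous_slice hflc τ) (continuous_finsetSum _ fun j _ =>
      continuous_finsetSum _ fun k _ => cjk j k)).trans ?_
    rw [ENNReal.coe_add]
    refine add_le_add ((hflux τ hτ).trans ?_) ?_
    · push_cast
      gcongr
      · exact hMt τ hτ
      · exact hM τ hτ
      · exact hMt τ hτ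
      · exact hM1 _ τ hτ
    · refine (nrm1_sum_le _ fun j => continuous_finsetSum _ fun k _ => cjk j k).trans ?_
      rw [ENNReal.ofNNReal_finsetSum]
      refine Finset.sum_le_sum fun j _ => (nrm1_sum_le _ (cjk j)).trans ?_
      rw [ENNReal.ofNNReal_finsetSum]
      refine Finset.sum_le_sum fun k _ => ?_
      have c1 := cda τ j k
      have c2 : Continuous (slice τ (sd j (a j k))) :=
        continuous_slice (contDiff_pd (ha j k) _).continuous τ
      have c3 := cz τ _ hzt
      have c4 := cz τ _ (hz.sd k)
      have c5 := cz τ _ ((hz.sd k).sd j)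
      have c6 := cz τ _ (hzt.sd j)
      have b1 : ∀ x, |2 * slice τ (a j k) x| ≤ (2 * B : ℝ≥0) := fun x => by
        rw [abs_mul]; push_cast; norm_num; exact hB j k (τ, x) hτ
      have b2 : ∀ x, |2 * slice τ (sd j (a j k)) x| ≤ (2 * B : ℝ≥0) := fun x => by
        rw [abs_mul]; push_cast; norm_num; exact hB' _ j k (τ, x) hτ
      have n1 := (nrm1_mul_le c3 c5 (2 * B) b1).trans
        (mul_le_mul' le_rfl (mul_le_mul' (hMt τ hτ) (hM2 j k τ hτ)))
      have n2 := (nrm1_mul_le c6 c4 (2 * B) b1).trans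
        (mul_le_mul' le_rfl (mul_le_mul' (hM3 j τ hτ) (hM1 k τ hτ)))
      have n3 := (nrm1_mul_le c3 c4 (2 * B) b2).trans
        (mul_le_mul' le_rfl (mul_le_mul' (hMt τ hτ) (hM1 k τ hτ)))
      refine (nrm1_add_le (by fun_prop) (by fun_prop)).trans ?_
      rw [ENNReal.coe_add, ENNReal.coe_add]
      refine add_le_add (by exact_mod_cast n1) ((nrm1_add_le (by fun_prop) (by fun_prop)).trans
        (add_le_add (by exact_mod_cast n2) (by exact_mod_cast n3)))
  have hdi : ∀ τ ∈ Icc 0 T, Integrable (slice τ (energyDensity a z)) volume := by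
    intro τ hτ
    have h1 : ∀ w, Good T w → Integrable (fun x => slice τ w x * slice τ w x) volume := fun w hw => by
      simpa [sq] using integrable_sq_of_nrm (cz τ w hw) (fz τ hτ w hw)
    refine (h1 _ hzt).add (integrable_finsetSum _ fun j _ => integrable_finsetSum _ fun k _ => ?_)
    have c1 := cda τ j k
    have c3 := cz τ _ (hz.sd j)
    have c4 := cz τ _ (hz.sd k)
    refine integrable_of_nrm1 (F := fun x => slice τ (a j k) x * (slice τ (sd j z) x *
      slice τ (sd k z) x)) (by fun_prop) ((nrm1_mul_le c3 c4 B fun x => hB j k (τ, x) hτ).trans_lt ?_)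
    exact ENNReal.mul_lt_top ENNReal.coe_lt_top (ENNReal.mul_lt_top (fz τ hτ _ (hz.sd j))
      (fz τ hτ _ (hz.sd k)))
  have hsq : ∀ τ ∈ Icc 0 T, ∀ w, Good T w → Integrable (fun x => slice τ w x ^ 2) volume :=
    fun τ hτ w hw => integrable_sq_of_nrm (cz τ w hw) (fz τ hτ w hw)
  have hquad : ∀ τ ∈ Icc 0 T, ∀ K : ℝ≥0, nrm (slice τ (pd 0 z)) ^ 2 +
      K * ∑ j, nrm (slice τ (sd j z)) ^ 2 = ENNReal.ofReal (∫ x, (slice τ (pd 0 z) x ^ 2 +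
        K * ∑ j, slice τ (sd j z) x ^ 2)) := by
    intro τ hτ K
    have hi := hsq τ hτ _ hzt
    have hj := fun j => hsq τ hτ _ (hz.sd j)
    have p1 : 0 ≤ ∫ x, slice τ (pd 0 z) x ^ 2 := integral_nonneg fun x => sq_nonneg _
    have p2 : ∀ j, 0 ≤ ∫ x, slice τ (sd j z) x ^ 2 := fun j => integral_nonneg fun x => sq_nonneg _
    rw [integral_add hi ((integrable_finsetSum _ fun j _ => hj j).const_mul _), integral_const_mul,
      integral_finsetSum _ (fun j _ => hj j), ENNReal.ofReal_add p1 (mul_nonneg K.coe_nonneg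
        (Finset.sum_nonneg fun j _ => p2 j)), ENNReal.ofReal_mul K.coe_nonneg, ENNReal.ofReal_coe_nnreal,
      ENNReal.ofReal_sum_of_nonneg (fun j _ => p2 j),
      sq_nrm_eq_ofReal (cz τ _ hzt) (fz τ hτ _ hzt)]
    congr 2
    exact Finset.sum_congr rfl fun j _ => sq_nrm_eq_ofReal (cz τ _ (hz.sd j)) (fz τ hτ _ (hz.sd j))
  obtain ⟨M, hM⟩ := hM
  have main := ofReal_integral_slice_le hd ht.1 (hdi 0 h0T) (hdi t ht) hM
  rw [hquad t ht c, hquad 0 h0T C]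
  have hqi : ∀ τ ∈ Icc 0 T, ∀ K : ℝ≥0, Integrable (fun x => slice τ (pd 0 z) x ^ 2 +
        K * ∑ j, slice τ (sd j z) x ^ 2) volume := fun τ hτ K =>
    (hsq τ hτ _ hzt).add ((integrable_finsetSum _ fun j _ => hsq τ hτ _ (hz.sd j)).const_mul _)
  refine le_trans (ENNReal.ofReal_le_ofReal (integral_mono (hqi t ht c) (hdi t ht) fun x => ?_))
    (main.trans (add_le_add (ENNReal.ofReal_le_ofReal (integral_mono (hdi 0 h0T) (hqi 0 h0T C)
      fun x => ?_)) ?_))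
  · have := (hc (t, x) ht (fun j => sd j z (t, x))).1
    simp only [energyDensity, slice, sq] at this ⊢
    linarith
  · have := (hc (0, x) h0T (fun j => sd j z (0, x))).2
    simp only [energyDensity, slice, sq] at this ⊢
    linarith
  · refine setLIntegral_mono' measurableSet_Icc fun τ hτt => ?_
    have hτ := hsub τ hτt
    rw [integral_pd_energyDensity ha hs hz hB hB' hτ (hint τ hτ)]
    refine (enorm_integral_le_lintegral_enorm _).trans ?_
    rw [← nrm1_eq]
    exact nrm1_energyFlux_le ha hz fun α j k x => hΛ α j k (τ, x) hτ

end

end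

section

/-- Third differences. -/
def dif3 (h : Space) (F : Space → ℝ) : Space → ℝ := dif h (dif h (dif h F))

/-- Third spatial differences of a function on space-time. -/
def stDif3 (h : Space) (w : Spacetime → ℝ) : Spacetime → ℝ := stDif h (stDif h (stDif h w))

lemma slice_stDif3 (t : ℝ) (h : Space) (w : Spacetime → ℝ) :
    slice t (stDif3 h w) = dif3 h (slice t w) := rfl

lemma pd_stDif3 {w : Spacetime → ℝ} (hw : ContDiff ℝ ∞ w) (h : Space) (α : Fin 4) :
    pd α (stDif3 h w) = stDif3 h (pd α w) := by
  unfold stDif3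
  rw [pd_stDif (contDiff_stDif (contDiff_stDif hw h) h), pd_stDif (contDiff_stDif hw h),
    pd_stDif hw]

lemma sd_stDif3 {w : Spacetime → ℝ} (hw : ContDiff ℝ ∞ w) (h : Space) (k : Fin 3) :
    sd k (stDif3 h w) = stDif3 h (sd k w) := pd_stDif3 hw h _

lemma Good.stDif3 {T : ℝ} {w : Spacetime → ℝ} (hw : Good T w) (h : Space) :
    Good T (stDif3 h w) := ((hw.stDif h).stDif h).stDif h

lemma continuous_dif3 {F : Space → ℝ} (hF : Continuous F) (h : Space) : Continuous (dif3 h F) :=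
  continuous_dif (continuous_dif (continuous_dif hF h) h) h

lemma dif_sub' (h : Space) (F G : Space → ℝ) :
    dif h (fun x => F x - G x) = fun x => dif h F x - dif h G x := by
  ext x; simp only [dif]; ring

lemma dif_sum {κ : Type*} (s : Finset κ) (h : Space) (F : κ → Space → ℝ) :
    dif h (fun x => ∑ a ∈ s, F a x) = fun x => ∑ a ∈ s, dif h (F a) x := by
  ext x; simp only [dif, Finset.sum_sub_distrib]

lemma dif3_sub (h : Space) (F G : Space → ℝ) :
    dif3 h (fun x => F x - G x) = fun x => dif3 h F x - dif3 h G x := by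
  unfold dif3; rw [dif_sub', dif_sub', dif_sub']

lemma dif3_sum {κ : Type*} (s : Finset κ) (h : Space) (F : κ → Space → ℝ) :
    dif3 h (fun x => ∑ a ∈ s, F a x) = fun x => ∑ a ∈ s, dif3 h (F a) x := by
  unfold dif3; rw [dif_sum, dif_sum, dif_sum]

lemma nrm_dif3_le_dif {F : Space → ℝ} (hF : Continuous F) (h : Space) :
    nrm (dif3 h F) ≤ 2 * nrm (dif h (dif h F)) := nrm_dif_le_two (continuous_dif (continuous_dif hF h) h) h

/-- The residual of third differences, in terms of commutators. -/
lemma nrm_residual_stDif3_le {a : Fin 3 → Fin 3 → Spacetime → ℝ} {w : Spacetime → ℝ}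
    (ha : ∀ j k, ContDiff ℝ ∞ (a j k)) (hw : ContDiff ℝ ∞ w) (h : Space) (τ : ℝ) :
    nrm (slice τ (residual a (stDif3 h w))) ≤ nrm (dif3 h (slice τ (residual a w))) +
      ∑ j, ∑ k, nrm (fun x =>
        dif3 h (fun x => slice τ (a j k) x * der j (slice τ (sd k w)) x) x -
          slice τ (a j k) x * dif3 h (der j (slice τ (sd k w))) x) := by
  have ca : ∀ j k, Continuous (slice τ (a j k)) := fun j k => continuous_slice (ha j k).continuous τ
  have cd : ∀ j k, Continuous (der j (slice τ (sd k w))) := fun j k =>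
    (contDiff_der (contDiff_slice (contDiff_sd hw k) τ) j).continuous
  have hs : ∀ j k, der j (slice τ (sd k w)) = slice τ (sd j (sd k w)) := fun j k =>
    der_slice (contDiff_sd hw k) τ j
  have hc : ∀ j k, Continuous fun x =>
      dif3 h (fun x => slice τ (a j k) x * der j (slice τ (sd k w)) x) x -
        slice τ (a j k) x * dif3 h (der j (slice τ (sd k w))) x := fun j k =>
    (continuous_dif3 ((ca j k).mul (cd j k)) h).sub ((ca j k).mul (continuous_dif3 (cd j k) h))
  have e : slice τ (residual a (stDif3 h w)) = fun x => dif3 h (slice τ (residual a w)) x +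
      ∑ j, ∑ k, (dif3 h (fun x => slice τ (a j k) x * der j (slice τ (sd k w)) x) x -
          slice τ (a j k) x * dif3 h (der j (slice τ (sd k w))) x) := by
    have e1 : slice τ (residual a w) = fun x => slice τ (pd 0 (pd 0 w)) x -
        ∑ j, ∑ k, slice τ (a j k) x * der j (slice τ (sd k w)) x := by
      simp only [hs]; rfl
    have e2 : slice τ (residual a (stDif3 h w)) = fun x => dif3 h (slice τ (pd 0 (pd 0 w))) x -
        ∑ j, ∑ k, slice τ (a j k) x * dif3 h (der j (slice τ (sd k w))) x := by
      ext x
      simp only [slice, residual]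
      rw [pd_stDif3 hw, pd_stDif3 (contDiff_pd hw 0)]
      refine congrArg₂ _ rfl (Finset.sum_congr rfl fun j _ => Finset.sum_congr rfl fun k _ => ?_)
      rw [sd_stDif3 hw, sd_stDif3 (contDiff_sd hw k)]
      exact congrArg (fun F => a j k (τ, x) * dif3 h F x) (hs j k).symm
    rw [e1, e2, dif3_sub, dif3_sum]
    ext x
    simp only [dif3_sum, Finset.sum_sub_distrib]
    ring
  rw [e]
  refine (nrm_add_le ?_ ?_).trans (add_le_add le_rfl ?_)
  · exact continuous_dif3 (continuous_slice (contDiff_residual ha hw).continuous τ) h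
  · exact continuous_finsetSum _ fun j _ => continuous_finsetSum _ fun k _ => hc j k
  · refine (nrm_sum_le _ fun j => continuous_finsetSum _ fun k _ => hc j k).trans ?_
    exact Finset.sum_le_sum fun j _ => nrm_sum_le _ (hc j)

lemma sum_lintegral_le {κ : Type*} (s : Finset κ) (f : κ → ℝ → ℝ≥0∞) (μ : Measure ℝ) :
    ∑ i ∈ s, ∫⁻ τ, f i τ ∂μ ≤ ∫⁻ τ, ∑ i ∈ s, f i τ ∂μ := by
  classical
  induction s using Finset.induction_on with
  | empty => simp
  | insert i s hi ih =>
    simp_rw [Finset.sum_insert hi]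
    exact (add_le_add le_rfl ih).trans (le_lintegral_add _ _)

lemma two_mul_le_weighted (x y : ℝ≥0∞) {l : ℝ≥0} (hl : 0 < l) :
    2 * (x * y) ≤ l * x ^ 2 + (l : ℝ≥0∞)⁻¹ * y ^ 2 := by
  have hl0 : (l : ℝ≥0∞) ≠ 0 := by exact_mod_cast hl.ne'
  have hi0 : (l : ℝ≥0∞)⁻¹ ≠ 0 := ENNReal.inv_ne_zero.2 ENNReal.coe_ne_top
  rcases eq_or_ne x ⊤ with rfl | hx
  · simp [ENNReal.mul_top, hl0]
  rcases eq_or_ne y ⊤ with rfl | hy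
  · rw [show (⊤ : ℝ≥0∞) ^ 2 = ⊤ by simp, ENNReal.mul_top hi0]; simp
  lift x to ℝ≥0 using hx
  lift y to ℝ≥0 using hy
  rw [← ENNReal.coe_inv hl.ne']
  norm_cast
  rw [← NNReal.coe_le_coe]
  push_cast
  have hl' : (0 : ℝ) < l := hl
  have : (l : ℝ) * x ^ 2 + (l : ℝ)⁻¹ * y ^ 2 - 2 * (x * y) = (l : ℝ)⁻¹ * (l * x - y) ^ 2 := by
    field_simp; ring
  have h2 : 0 ≤ (l : ℝ)⁻¹ * (l * x - y) ^ 2 := by positivity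
  linarith

/-- The weighted sum of the energies of third differences. -/
lemma wsum_energy_le {T : ℝ} {a : Fin 3 → Fin 3 → Spacetime → ℝ} {w : Spacetime → ℝ} {B : ℝ≥0}
    (ha : ∀ j k, ContDiff ℝ ∞ (a j k)) (hs : ∀ j k, a j k = a k j)
    (hw : Good T w) (hB : ∀ j k p, p.1 ∈ Icc 0 T → |a j k p| ≤ B)
    (hB' : ∀ α j k p, p.1 ∈ Icc 0 T → |pd α (a j k) p| ≤ B)
    {Λ : ℝ → ℝ≥0} (hΛ : ∀ α j k p, p.1 ∈ Icc 0 T → |pd α (a j k) p| ≤ Λ p.1)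
    (hΛ0 : ∀ τ, 0 < Λ τ)
    {c C : ℝ≥0} (hc : ∀ p : Spacetime, p.1 ∈ Icc 0 T → ∀ ξ : Fin 3 → ℝ,
      c * ∑ j, ξ j ^ 2 ≤ ∑ j, ∑ k, a j k p * (ξ j * ξ k) ∧
      ∑ j, ∑ k, a j k p * (ξ j * ξ k) ≤ C * ∑ j, ξ j ^ 2)
    {t : ℝ} (ht : t ∈ Icc 0 T) (s : ℝ) (i : Fin 3) {X Z : ℝ≥0}
    (hX : ∀ τ ∈ Icc 0 t, wsum s (fun n => nrm (dif3 (step n i) (slice τ (pd 0 w)))) +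
      ∑ j, wsum s (fun n => nrm (dif3 (step n i) (slice τ (sd j w)))) ≤ X)
    (hZ : ∀ τ ∈ Icc 0 t, wsum s (fun n => nrm (slice τ (residual a (stDif3 (step n i) w)))) ≤
      (Z * Λ τ ^ 2 : ℝ≥0)) :
    wsum s (fun n => nrm (dif3 (step n i) (slice t (pd 0 w)))) +
      c * ∑ j, wsum s (fun n => nrm (dif3 (step n i) (slice t (sd j w)))) ≤
    wsum s (fun n => nrm (dif3 (step n i) (slice 0 (pd 0 w)))) +
      C * ∑ j, wsum s (fun n => nrm (dif3 (step n i) (slice 0 (sd j w)))) +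
      (10 * X + Z) * ∫⁻ τ in Icc 0 t, Λ τ := by
  have hcomb : ∀ (K : ℝ≥0) (τ : ℝ), wsum s (fun n => nrm (dif3 (step n i) (slice τ (pd 0 w)))) +
      K * ∑ j, wsum s (fun n => nrm (dif3 (step n i) (slice τ (sd j w)))) =
      ∑' n : ℕ, ENNReal.ofReal ((4 : ℝ) ^ (n * s)) * (nrm (dif3 (step n i) (slice τ (pd 0 w))) ^ 2 +
        K * ∑ j, nrm (dif3 (step n i) (slice τ (sd j w))) ^ 2) := by
    intro K τ
    unfold wsum
    rw [← Summable.tsum_finsetSum (fun _ _ => ENNReal.summable), ← ENNReal.tsum_mul_left,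
      ← ENNReal.tsum_add]
    refine tsum_congr fun n => ?_
    rw [mul_add, Finset.mul_sum, Finset.mul_sum, Finset.mul_sum]
    congr 1
    exact Finset.sum_congr rfl fun j _ => by ring
  rw [hcomb c t, hcomb C 0]
  refine ENNReal.tsum_le_of_sum_range_le fun M => ?_
  have hen : ∀ n : ℕ, nrm (dif3 (step n i) (slice t (pd 0 w))) ^ 2 +
        c * ∑ j, nrm (dif3 (step n i) (slice t (sd j w))) ^ 2 ≤
      nrm (dif3 (step n i) (slice 0 (pd 0 w))) ^ 2 +
        C * ∑ j, nrm (dif3 (step n i) (slice 0 (sd j w))) ^ 2 +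
      ∫⁻ τ in Icc 0 t, (2 * (nrm (dif3 (step n i) (slice τ (pd 0 w))) *
          nrm (slice τ (residual a (stDif3 (step n i) w)))) +
        9 * Λ τ * (nrm (dif3 (step n i) (slice τ (pd 0 w))) ^ 2 +
          ∑ j, nrm (dif3 (step n i) (slice τ (sd j w))) ^ 2)) := by
    intro n
    have := energy_le ha hs (hw.stDif3 (step n i)) hB hB' hΛ hc ht
    simp only [pd_stDif3 hw.smooth, sd_stDif3 hw.smooth, slice_stDif3] at this
    exact this
  calc _ ≤ ∑ n ∈ Finset.range M, (ENNReal.ofReal ((4 : ℝ) ^ (n * s)) *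
        (nrm (dif3 (step n i) (slice 0 (pd 0 w))) ^ 2 +
        C * ∑ j, nrm (dif3 (step n i) (slice 0 (sd j w))) ^ 2) +
        ∫⁻ τ in Icc 0 t, ENNReal.ofReal ((4 : ℝ) ^ (n * s)) *
          (2 * (nrm (dif3 (step n i) (slice τ (pd 0 w))) *
          nrm (slice τ (residual a (stDif3 (step n i) w)))) +
        9 * Λ τ * (nrm (dif3 (step n i) (slice τ (pd 0 w))) ^ 2 +
          ∑ j, nrm (dif3 (step n i) (slice τ (sd j w))) ^ 2))) := by
        refine Finset.sum_le_sum fun n _ => ?_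
        rw [lintegral_const_mul' _ _ ENNReal.ofReal_ne_top, ← mul_add]
        exact mul_le_mul' le_rfl (hen n)
    _ ≤ _ := by
        rw [Finset.sum_add_distrib]
        refine add_le_add (ENNReal.sum_le_tsum _) ((sum_lintegral_le _ _ _).trans ?_)
        rw [← lintegral_const_mul' _ _ (by exact_mod_cast ENNReal.coe_ne_top (r := 10 * X + Z))]
        refine setLIntegral_mono' measurableSet_Icc fun τ hτ => ?_
        have hl := hΛ0 τ
        have hl0 : (Λ τ : ℝ≥0∞) ≠ 0 := by exact_mod_cast hl.ne'
        have hX' := hX τ hτ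
        have h1 := hcomb 1 τ
        rw [ENNReal.coe_one, one_mul] at h1
        simp only [one_mul] at h1
        rw [h1] at hX'
        have hZ' := hZ τ hτ
        unfold wsum at hZ'
        calc _ ≤ ∑' n : ℕ, ENNReal.ofReal ((4 : ℝ) ^ (n * s)) *
              (2 * (nrm (dif3 (step n i) (slice τ (pd 0 w))) *
              nrm (slice τ (residual a (stDif3 (step n i) w)))) +
            9 * Λ τ * (nrm (dif3 (step n i) (slice τ (pd 0 w))) ^ 2 +
              ∑ j, nrm (dif3 (step n i) (slice τ (sd j w))) ^ 2)) := ENNReal.sum_le_tsum _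
          _ ≤ ∑' n : ℕ, (10 * Λ τ * (ENNReal.ofReal ((4 : ℝ) ^ (n * s)) *
                (nrm (dif3 (step n i) (slice τ (pd 0 w))) ^ 2 +
                  ∑ j, nrm (dif3 (step n i) (slice τ (sd j w))) ^ 2)) +
              (Λ τ : ℝ≥0∞)⁻¹ * (ENNReal.ofReal ((4 : ℝ) ^ (n * s)) *
                nrm (slice τ (residual a (stDif3 (step n i) w))) ^ 2)) := by
              refine ENNReal.tsum_le_tsum fun n => ?_
              have h2 := two_mul_le_weighted (nrm (dif3 (step n i) (slice τ (pd 0 w))))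
                (nrm (slice τ (residual a (stDif3 (step n i) w)))) hl
              calc _ ≤ ENNReal.ofReal ((4 : ℝ) ^ (n * s)) *
                    ((Λ τ * (nrm (dif3 (step n i) (slice τ (pd 0 w))) ^ 2 +
                      ∑ j, nrm (dif3 (step n i) (slice τ (sd j w))) ^ 2) +
                    (Λ τ : ℝ≥0∞)⁻¹ * nrm (slice τ (residual a (stDif3 (step n i) w))) ^ 2) +
                    9 * Λ τ * (nrm (dif3 (step n i) (slice τ (pd 0 w))) ^ 2 +
                      ∑ j, nrm (dif3 (step n i) (slice τ (sd j w))) ^ 2)) := by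
                    gcongr
                    refine h2.trans ?_
                    gcongr
                    exact le_add_right le_rfl
                _ = _ := by ring
          _ ≤ 10 * Λ τ * X + (Λ τ : ℝ≥0∞)⁻¹ * (Z * Λ τ ^ 2 : ℝ≥0) := by
              rw [ENNReal.tsum_add, ENNReal.tsum_mul_left, ENNReal.tsum_mul_left]
              gcongr
          _ = _ := by
              push_cast
              have : (Λ τ : ℝ≥0∞)⁻¹ * (Z * Λ τ ^ 2) = Z * Λ τ * ((Λ τ : ℝ≥0∞)⁻¹ * Λ τ) := by ring
              rw [this, ENNReal.inv_mul_cancel hl0 ENNReal.coe_ne_top]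
              ring

/-- The estimate in Sobolev spaces for `∂_t² - a^{jk} ∂_j ∂_k`. -/
lemma sobolev_energy_le {s : ℝ} (hs1 : 1 ≤ s) (hs3 : s < 3) {c C : ℝ≥0} (hc0 : 0 < c) :
    ∃ C₁ : ℝ≥0, ∀ A Z : ℝ≥0, ∃ K : ℝ≥0, ∀ (T : ℝ) (a : Fin 3 → Fin 3 → Spacetime → ℝ)
      (w : Spacetime → ℝ) (B : ℝ≥0) (Λ : ℝ → ℝ≥0) (t : ℝ),
      (∀ j k, ContDiff ℝ ∞ (a j k)) → (∀ j k, a j k = a k j) → Good T w →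
      (∀ j k p, p.1 ∈ Icc 0 T → |a j k p| ≤ B) →
      (∀ α j k p, p.1 ∈ Icc 0 T → |pd α (a j k) p| ≤ B) →
      (∀ α j k p, p.1 ∈ Icc 0 T → |pd α (a j k) p| ≤ Λ p.1) → (∀ τ, 1 ≤ Λ τ) →
      (∀ p : Spacetime, p.1 ∈ Icc 0 T → ∀ ξ : Fin 3 → ℝ,
        c * ∑ j, ξ j ^ 2 ≤ ∑ j, ∑ k, a j k p * (ξ j * ξ k) ∧
        ∑ j, ∑ k, a j k p * (ξ j * ξ k) ≤ C * ∑ j, ξ j ^ 2) →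
      t ∈ Icc 0 T → T ≤ 1 →
      (∀ τ ∈ Icc 0 t, sobolevNorm (s + 1) (slice τ w) ≤ A) →
      (∀ τ ∈ Icc 0 t, sobolevNorm s (slice τ (pd 0 w)) ≤ A) →
      (∀ τ ∈ Icc 0 t, nrm (slice τ (pd 0 (pd 0 w))) ≤ A) →
      (∀ τ ∈ Icc 0 t, ∀ i, wsum s (fun n => nrm (slice τ (residual a (stDif3 (step n i) w)))) ≤
        (Z * Λ τ ^ 2 : ℝ≥0)) →
      sobolevNorm (s + 1) (slice t w) ^ 2 + sobolevNorm s (slice t (pd 0 w)) ^ 2 ≤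
        C₁ * (sobolevNorm (s + 1) (slice 0 w) ^ 2 + sobolevNorm s (slice 0 (pd 0 w)) ^ 2) +
          K * ∫⁻ τ in Icc 0 t, Λ τ := by
  have hs0 : 0 < s := by linarith
  obtain ⟨W, hW⟩ := wsum_dif_le hs0 (m := 3) (by exact_mod_cast hs3)
  set e8 : ℝ≥0 := ((8 : ℝ) ^ s).toNNReal
  set e2 : ℝ≥0 := ((2 : ℝ) ^ (s + 1)).toNNReal
  set D : ℝ≥0 := c⁻¹ + 1
  refine ⟨(e8 + e2 + 3 * e2 * e8) * (98 + 3 * D * (W + 147 * C * W)), fun A Z => ?_⟩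
  set X : ℝ≥0 := W * A ^ 2 + 3 * (W * (49 * A ^ 2))
  refine ⟨(e8 + e2 + 3 * e2 * e8) * (98 * A ^ 2 + 3 * D * (10 * X + Z)), ?_⟩
  intro T a w B Λ t ha hsym hw hB hB' hΛ hΛ1 hell ht hT1 hA hA' hA2 hZ
  have h0T : (0 : ℝ) ∈ Icc 0 T := ⟨le_rfl, ht.1.trans ht.2⟩
  have hsub : ∀ τ ∈ Icc 0 t, τ ∈ Icc 0 T := fun τ hτ => ⟨hτ.1, hτ.2.trans ht.2⟩
  have hzt := hw.pd 0
  have hdj : ∀ τ ∈ Icc 0 T, ∀ j, sobolevNorm s (slice τ (sd j w)) ≤ 7 * sobolevNorm (s + 1) (slice τ w) :=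
    fun τ hτ j => by
      rw [← der_slice hw.smooth]; exact sobolevNorm_der_le (hw.isHinf hτ) j s
  have hWt : ∀ τ ∈ Icc 0 T, ∀ i, wsum s (fun n => nrm (dif3 (step n i) (slice τ (pd 0 w)))) ≤
      W * sobolevNorm s (slice τ (pd 0 w)) ^ 2 := fun τ hτ i => hW i _ (hzt.isHinf hτ).memLp
  have hWj : ∀ τ ∈ Icc 0 T, ∀ i j, wsum s (fun n => nrm (dif3 (step n i) (slice τ (sd j w)))) ≤
      W * (49 * sobolevNorm (s + 1) (slice τ w) ^ 2) := fun τ hτ i j => by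
    refine (hW i _ ((hw.sd j).isHinf hτ).memLp).trans (mul_le_mul' le_rfl ?_)
    refine (pow_le_pow_left' (hdj τ hτ j) 2).trans (le_of_eq ?_)
    rw [mul_pow]; norm_num
  have hX : ∀ i, ∀ τ ∈ Icc 0 t, wsum s (fun n => nrm (dif3 (step n i) (slice τ (pd 0 w)))) +
      ∑ j, wsum s (fun n => nrm (dif3 (step n i) (slice τ (sd j w)))) ≤ X := by
    intro i τ hτ
    have h1 := (hWt τ (hsub τ hτ) i).trans (mul_le_mul' le_rfl (pow_le_pow_left' (hA' τ hτ) 2))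
    have h2 : ∀ j, wsum s (fun n => nrm (dif3 (step n i) (slice τ (sd j w)))) ≤
      W * (49 * (A : ℝ≥0∞) ^ 2) := fun j =>
      (hWj τ (hsub τ hτ) i j).trans (by gcongr; exact hA τ hτ)
    refine (add_le_add h1 (Finset.sum_le_sum fun j _ => h2 j)).trans (le_of_eq ?_)
    simp only [Finset.sum_const, Finset.card_univ, Fintype.card_fin, nsmul_eq_mul, X]
    push_cast; ring
  have hmain := fun i => wsum_energy_le ha hsym hw hB hB' hΛ
    (fun τ => lt_of_lt_of_le one_pos (hΛ1 τ)) hell ht s i (hX i) (fun τ hτ => hZ τ hτ i)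
  set J := ∫⁻ τ in Icc 0 t, (Λ τ : ℝ≥0∞) with hJ
  set Y := sobolevNorm (s + 1) (slice 0 w) ^ 2 + sobolevNorm s (slice 0 (pd 0 w)) ^ 2 with hY
  have htJ : ENNReal.ofReal t ≤ J := by
    have : ∫⁻ τ in Icc 0 t, (1 : ℝ≥0∞) ≤ J :=
      lintegral_mono fun τ => ENNReal.one_le_coe_iff.2 (hΛ1 τ)
    rwa [lintegral_const, Measure.restrict_apply MeasurableSet.univ, univ_inter, Real.volume_Icc,
      one_mul, sub_zero] at this
  have ht1 : ENNReal.ofReal t ≤ 1 := by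
    rw [← ENNReal.ofReal_one]; exact ENNReal.ofReal_le_ofReal (ht.2.trans hT1)
  -- low order terms
  have hlow : ∀ v, Good T v → ∀ M : ℝ≥0, (∀ τ ∈ Icc 0 t, nrm (slice τ (pd 0 v)) ≤ M) →
      nrm (slice t v) ^ 2 ≤ 2 * nrm (slice 0 v) ^ 2 + 2 * M ^ 2 * J := by
    intro v hv M hM
    have h1 := hv.nrm_sub_le ht.1 hM
    have h2 : nrm (slice t v) ≤ nrm (slice 0 v) + ENNReal.ofReal (t - 0) * M := by
      have h3 := nrm_add_le (continuous_slice hv.continuous 0)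
        ((continuous_slice hv.continuous t).sub (continuous_slice hv.continuous 0))
      refine le_trans (le_of_eq ?_) (h3.trans (add_le_add le_rfl h1))
      congr 1
      ext x; simp
    rw [sub_zero] at h2
    calc _ ≤ (nrm (slice 0 v) + ENNReal.ofReal t * M) ^ 2 := pow_le_pow_left' h2 2
      _ ≤ 2 * (nrm (slice 0 v) ^ 2 + (ENNReal.ofReal t * M) ^ 2) := ennreal_add_sq_le _ _
      _ = 2 * nrm (slice 0 v) ^ 2 + 2 * M ^ 2 * (ENNReal.ofReal t * ENNReal.ofReal t) := by ring
      _ ≤ _ := by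
        refine add_le_add le_rfl (mul_le_mul' le_rfl ?_)
        calc _ ≤ 1 * J := mul_le_mul' ht1 htJ
          _ = J := one_mul _
  have b0 : nrm (slice t w) ^ 2 ≤ 2 * Y + 2 * A ^ 2 * J := by
    refine (hlow w hw A fun τ hτ => (nrm_le_sobolevNorm (hzt.isHinf (hsub τ hτ)).memLp hs0.le).trans
      (hA' τ hτ)).trans ?_
    gcongr
    refine (pow_le_pow_left' (nrm_le_sobolevNorm (hw.isHinf h0T).memLp (by linarith :
      0 ≤ s + 1)) 2).trans (le_add_right le_rfl)
  have bt : nrm (slice t (pd 0 w)) ^ 2 ≤ 2 * Y + 2 * A ^ 2 * J := by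
    refine (hlow _ hzt A hA2).trans ?_
    gcongr
    exact (pow_le_pow_left' (nrm_le_sobolevNorm (hzt.isHinf h0T).memLp hs0.le) 2).trans
      (le_add_left le_rfl)
  have bj : ∀ j, nrm (slice t (sd j w)) ^ 2 ≤ 98 * Y + 98 * A ^ 2 * J := by
    intro j
    refine (hlow _ (hw.sd j) (7 * A) fun τ hτ => ?_).trans ?_
    · rw [show pd 0 (sd j w) = sd j (pd 0 w) from pd_comm hw.smooth _ _, ← der_slice hzt.smooth]
      refine (nrm_der_le_sobolev (hzt.isHinf (hsub τ hτ)) j hs1).trans ?_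
      push_cast
      exact mul_le_mul' le_rfl (hA' τ hτ)
    · have h1 := (nrm_le_sobolevNorm ((hw.sd j).isHinf h0T).memLp hs0.le).trans (hdj 0 h0T j)
      refine add_le_add ?_ (le_of_eq ?_)
      · calc _ ≤ 2 * (7 * sobolevNorm (s + 1) (slice 0 w)) ^ 2 := by gcongr
          _ = 98 * sobolevNorm (s + 1) (slice 0 w) ^ 2 := by rw [mul_pow, ← mul_assoc]; norm_num
          _ ≤ _ := mul_le_mul' le_rfl (le_add_right le_rfl)
      · push_cast; rw [mul_pow]; ring
  have hfinal : ∀ v, Good T v → ∀ N R : ℝ≥0∞, nrm (slice t v) ^ 2 ≤ N →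
      (∀ i, wsum s (fun n => nrm (dif3 (step n i) (slice t v))) ≤ R) →
      sobolevNorm s (slice t v) ^ 2 ≤ e8 * (N + 3 * R) := by
    intro v hv N R hN hR
    refine (sq_sobolevNorm_le hs0.le 3 (hv.isHinf ht).memLp).trans ?_
    change (e8 : ℝ≥0∞) * _ ≤ _
    refine mul_le_mul' le_rfl (add_le_add hN ((Finset.sum_le_sum fun i _ => hR i).trans (le_of_eq ?_)))
    simp
  set R : ℝ≥0∞ := (W + 147 * C * W) * Y + (10 * X + Z) * J with hR
  have hinit : ∀ i, wsum s (fun n => nrm (dif3 (step n i) (slice 0 (pd 0 w)))) +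
      C * ∑ j, wsum s (fun n => nrm (dif3 (step n i) (slice 0 (sd j w)))) +
      (10 * X + Z) * J ≤ R := by
    intro i
    refine add_le_add ?_ le_rfl
    have h1 : wsum s (fun n => nrm (dif3 (step n i) (slice 0 (pd 0 w)))) ≤ W * Y :=
      (hWt 0 h0T i).trans (mul_le_mul' le_rfl (le_add_left le_rfl))
    have h2 : ∀ j, wsum s (fun n => nrm (dif3 (step n i) (slice 0 (sd j w)))) ≤ W * (49 * Y) :=
      fun j => (hWj 0 h0T i j).trans (mul_le_mul' le_rfl (mul_le_mul' le_rfl (le_add_right le_rfl)))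
    refine (add_le_add h1 (mul_le_mul' le_rfl (Finset.sum_le_sum fun j _ => h2 j))).trans (le_of_eq ?_)
    simp only [Finset.sum_const, Finset.card_univ, Fintype.card_fin, nsmul_eq_mul]
    push_cast; ring
  have hD1 : R ≤ D * R := le_mul_of_one_le_left' (by
    simp only [D]; push_cast; exact le_add_left le_rfl)
  have rt : ∀ i, wsum s (fun n => nrm (dif3 (step n i) (slice t (pd 0 w)))) ≤ D * R := fun i =>
    ((le_add_right le_rfl).trans ((hmain i).trans (hinit i))).trans hD1
  have rj : ∀ j i, wsum s (fun n => nrm (dif3 (step n i) (slice t (sd j w)))) ≤ D * R := by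
    intro j i
    have h1 : c * wsum s (fun n => nrm (dif3 (step n i) (slice t (sd j w)))) ≤ R :=
      le_trans (mul_le_mul' le_rfl (Finset.single_le_sum (f := fun j =>
        wsum s (fun n => nrm (dif3 (step n i) (slice t (sd j w))))) (fun _ _ => zero_le)
        (Finset.mem_univ j))) ((le_add_left le_rfl).trans ((hmain i).trans (hinit i)))
    have hc0' : (c : ℝ≥0∞) ≠ 0 := by exact_mod_cast hc0.ne'
    calc _ = (c : ℝ≥0∞)⁻¹ * (c * wsum s (fun n => nrm (dif3 (step n i) (slice t (sd j w))))) := by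
          rw [← mul_assoc, ENNReal.inv_mul_cancel hc0' ENNReal.coe_ne_top, one_mul]
      _ ≤ (c : ℝ≥0∞)⁻¹ * R := mul_le_mul' le_rfl h1
      _ ≤ _ := by
          refine mul_le_mul' ?_ le_rfl
          simp only [D]
          rw [ENNReal.coe_add, ENNReal.coe_inv hc0.ne']
          exact le_add_right le_rfl
  set Q : ℝ≥0∞ := 98 * Y + 98 * A ^ 2 * J + 3 * (D * R) with hQ
  have le98 : 2 * Y + 2 * A ^ 2 * J ≤ 98 * Y + 98 * A ^ 2 * J := by gcongr <;> norm_num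
  have ft : sobolevNorm s (slice t (pd 0 w)) ^ 2 ≤ e8 * Q :=
    hfinal _ hzt _ _ (bt.trans le98) rt
  have fj : ∀ j, sobolevNorm s (slice t (sd j w)) ^ 2 ≤ e8 * Q := fun j =>
    hfinal _ (hw.sd j) _ _ (bj j) (rj j)
  have fw : sobolevNorm (s + 1) (slice t w) ^ 2 ≤ e2 * (Q + 3 * (e8 * Q)) := by
    refine (sq_sobolevNorm_succ_le (hw.isHinf ht) hs0.le).trans ?_
    change (e2 : ℝ≥0∞) * _ ≤ _
    refine mul_le_mul' le_rfl (add_le_add ((b0.trans le98).trans (le_add_right le_rfl)) ?_)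
    refine (Finset.sum_le_sum fun j _ => (?_ : _ ≤ (e8 : ℝ≥0∞) * Q)).trans (le_of_eq (by simp))
    rw [der_slice hw.smooth]; exact fj j
  refine (add_le_add fw ft).trans (le_of_eq ?_)
  simp only [hQ, hR]
  push_cast
  ring

end

section

/-! ### The div-curl estimate -/

lemma abs_symbol_le {P : Fin 3 → Fin 3 → ℂ} {ξ : Space} (hξ : ξ ≠ 0)
    (h : ∀ i j k, (ξ k : ℂ) * P j i = (ξ j : ℂ) * P k i) (j i : Fin 3) :
    ‖P j i‖ ≤ ‖∑ k, P k k‖ + ∑ k, ‖P k i - P i k‖ := by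
  have hn : 0 < ‖ξ‖ ^ 2 := by positivity
  have key : ((‖ξ‖ ^ 2 : ℝ) : ℂ) * P j i = (ξ j : ℂ) * (ξ i : ℂ) * ∑ k, P k k +
      ∑ k, (ξ k : ℂ) * (ξ j : ℂ) * (P k i - P i k) := by
    rw [sq_norm_eq_sum]
    push_cast
    rw [Finset.sum_mul, Finset.mul_sum, ← Finset.sum_add_distrib]
    refine Finset.sum_congr rfl fun k _ => ?_
    have h1 := h i j k
    have h2 := h k i k
    linear_combination (ξ k : ℂ) * h1 + (ξ j : ℂ) * h2
  have hb : ∀ a b, ‖(ξ a : ℂ) * (ξ b : ℂ)‖ ≤ ‖ξ‖ ^ 2 := by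
    intro a b
    rw [norm_mul, Complex.norm_real, Complex.norm_real, sq]
    exact mul_le_mul (abs_coord_le a ξ) (abs_coord_le b ξ) (norm_nonneg _) (norm_nonneg _)
  have h3 : ‖ξ‖ ^ 2 * ‖P j i‖ ≤ ‖ξ‖ ^ 2 * (‖∑ k, P k k‖ + ∑ k, ‖P k i - P i k‖) := by
    calc ‖ξ‖ ^ 2 * ‖P j i‖ = ‖((‖ξ‖ ^ 2 : ℝ) : ℂ) * P j i‖ := by
          rw [norm_mul, Complex.norm_real, Real.norm_of_nonneg hn.le]
      _ ≤ ‖(ξ j : ℂ) * (ξ i : ℂ) * ∑ k, P k k‖ + ∑ k, ‖(ξ k : ℂ) * (ξ j : ℂ) * (P k i - P i k)‖ := by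
          rw [key]; exact (norm_add_le _ _).trans (add_le_add le_rfl (norm_sum_le _ _))
      _ ≤ ‖ξ‖ ^ 2 * ‖∑ k, P k k‖ + ∑ k, ‖ξ‖ ^ 2 * ‖P k i - P i k‖ := by
          refine add_le_add ?_ (Finset.sum_le_sum fun k _ => ?_)
          · rw [norm_mul]; exact mul_le_mul_of_nonneg_right (hb j i) (norm_nonneg _)
          · rw [norm_mul]; exact mul_le_mul_of_nonneg_right (hb k j) (norm_nonneg _)
      _ = _ := by rw [← Finset.mul_sum]; ring
  exact le_of_mul_le_mul_left h3 hn

/-- A gradient is controlled by its trace and its antisymmetric part. -/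
lemma sobolevNorm_le_div_curl {p : Fin 3 → Fin 3 → Space → ℝ} (hp : ∀ j i, IsHinf (p j i))
    (h : ∀ i j k, der k (p j i) = der j (p k i)) (s : ℝ) (j i : Fin 3) :
    sobolevNorm s (p j i) ≤ sobolevNorm s (fun x => ∑ k, p k k x) +
      ∑ k, sobolevNorm s (fun x => p k i x - p i k x) := by
  have hm : ∀ j i, MemLp (p j i) 2 volume := fun j i => (hp j i).memLp
  have hdm : ∀ k, MemLp (fun x => p k i x - p i k x) 2 volume := fun k => (hm k i).sub (hm i k)
  have hsm : MemLp (fun x => ∑ k, p k k x) 2 volume :=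
    memLp_finsetSum _ fun k _ => hm k k
  have f1 : ∀ᵐ ξ ∂volume, ∀ i j k, fourierL2 (der k (p j i)) ξ =
      (2 * Real.pi * Complex.I * (ξ k : ℝ)) * fourierL2 (p j i) ξ := by
    simp_rw [ae_all_iff]; exact fun i j k => (hp j i).fourier_der k
  have f2 : ∀ᵐ ξ ∂volume, fourierL2 (fun x => ∑ k, p k k x) ξ = ∑ k, fourierL2 (p k k) ξ := by
    simp_rw [Fin.sum_univ_three]
    filter_upwards [fourierL2_add (hm 0 0) (hm 1 1),
      fourierL2_add ((hm 0 0).add (hm 1 1)) (hm 2 2)] with ξ h1 h2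
    have h2' : fourierL2 (fun x => p 0 0 x + p 1 1 x + p 2 2 x) ξ =
      fourierL2 (fun x => p 0 0 x + p 1 1 x) ξ + fourierL2 (p 2 2) ξ := h2
    rw [h2', h1]
  have f3 : ∀ᵐ ξ ∂volume, ∀ k, fourierL2 (fun x => p k i x - p i k x) ξ =
      fourierL2 (p k i) ξ - fourierL2 (p i k) ξ := by
    simp_rw [ae_all_iff]; exact fun k => fourierL2_sub (hm k i) (hm i k)
  have f4 : ∀ᵐ ξ : Space ∂volume, ξ ≠ 0 := by
    simp [ae_iff]
  have hpt : ∀ᵐ ξ ∂volume, ‖fourierL2 (p j i) ξ‖ ≤ ‖fourierL2 (fun x => ∑ k, p k k x) ξ‖ +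
      ∑ k, ‖fourierL2 (fun x => p k i x - p i k x) ξ‖ := by
    filter_upwards [f1, f2, f3, f4] with ξ h1 h2 h3 h4
    rw [h2]
    simp_rw [h3]
    refine abs_symbol_le (P := fun j i => fourierL2 (p j i) ξ) h4 (fun i j k => ?_) j i
    have h5 := h1 i j k
    rw [h i j k, h1 i k j] at h5
    have h6 : (2 * (Real.pi : ℂ) * Complex.I) ≠ 0 := by
      simp [Real.pi_ne_zero]
    refine mul_left_cancel₀ h6 ?_
    linear_combination -h5
  rw [sobolevNorm_def_of_memLp (hm j i), sobolevNorm_def_of_memLp hsm]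
  have e : ∀ k, sobolevNorm s (fun x => p k i x - p i k x) = _ := fun k =>
    sobolevNorm_def_of_memLp (hdm k) s
  simp_rw [e]
  set g0 : Space → ℂ := fun ξ => (((1 + ‖ξ‖ ^ 2) ^ (s / 2) : ℝ) : ℂ) *
    fourierL2 (fun x => ∑ k, p k k x) ξ
  set g : Fin 3 → Space → ℂ := fun k ξ => (((1 + ‖ξ‖ ^ 2) ^ (s / 2) : ℝ) : ℂ) *
    fourierL2 (fun x => p k i x - p i k x) ξ
  have m0 : AEStronglyMeasurable g0 volume := aesm_sobolev hsm s
  have mk : ∀ k, AEStronglyMeasurable (g k) volume := fun k => aesm_sobolev (hdm k) s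
  calc _ ≤ eLpNorm (fun ξ => ‖g0 ξ‖ + ∑ k, ‖g k ξ‖) 2 volume := by
        refine eLpNorm_mono_ae ?_
        filter_upwards [hpt] with ξ hξ
        rw [Real.norm_of_nonneg (add_nonneg (norm_nonneg _) (Finset.sum_nonneg fun _ _ => norm_nonneg _))]
        simp only [g0, g, norm_mul]
        rw [← Finset.mul_sum, ← mul_add]
        exact mul_le_mul_of_nonneg_left hξ (norm_nonneg _)
    _ ≤ eLpNorm (fun ξ => ‖g0 ξ‖) 2 volume + eLpNorm (∑ k, fun ξ => ‖g k ξ‖) 2 volume := by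
        refine le_trans (le_of_eq ?_) (eLpNorm_add_le m0.norm
          (Finset.aestronglyMeasurable_sum _ fun k _ => (mk k).norm) (by norm_num))
        congr 1
    _ ≤ _ := by
        rw [eLpNorm_norm]
        refine add_le_add le_rfl ((eLpNorm_sum_le (fun k _ => (mk k).norm) (by norm_num)).trans ?_)
        exact Finset.sum_le_sum fun k _ => (eLpNorm_norm _).le

/-! ### Interpolation -/

lemma sq_le_rpow_add {σ ε : ℝ} (hσ : 0 < σ) (hε : 0 < ε) {y : ℝ} (hy : 1 ≤ y) :
    y ^ 2 ≤ ε * y ^ (2 + σ) + (ε⁻¹ ^ σ⁻¹) ^ 2 := by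
  have hy0 : 0 < y := by linarith
  rcases le_or_gt (ε⁻¹) (y ^ σ) with h | h
  · have h1 : 1 ≤ ε * y ^ σ := by
      have := mul_le_mul_of_nonneg_left h hε.le
      rwa [mul_inv_cancel₀ hε.ne'] at this
    have h2 : y ^ (2 + σ) = y ^ 2 * y ^ σ := by
      rw [Real.rpow_add hy0]; norm_num
    have h3 : 0 ≤ (ε⁻¹ ^ σ⁻¹) ^ 2 := by positivity
    rw [h2]
    nlinarith [sq_nonneg y]
  · have h1 : y ≤ ε⁻¹ ^ σ⁻¹ := by
      have := Real.rpow_le_rpow (by positivity) h.le (inv_pos.2 hσ).le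
      rwa [← Real.rpow_mul hy0.le, mul_inv_cancel₀ hσ.ne', Real.rpow_one] at this
    have h2 : 0 ≤ ε * y ^ (2 + σ) := by positivity
    have h3 := pow_le_pow_left₀ hy0.le h1 2
    linarith

lemma sq_nrm_der_der_le {σ : ℝ} (hσ : 0 < σ) {ε : ℝ≥0} (hε : 0 < ε) : ∃ C : ℝ≥0,
    ∀ (F : Space → ℝ) (j k : Fin 3), IsHinf F →
      nrm (der j (der k F)) ^ 2 ≤ ε * sobolevNorm (2 + σ) F ^ 2 + C * nrm F ^ 2 := by
  have hp : (0 : ℝ) < (2 * Real.pi) ^ 4 := by positivity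
  set ε' : ℝ := ε / (2 * Real.pi) ^ 4 with hε'
  have hε0 : 0 < ε' := div_pos hε hp
  refine ⟨((2 * Real.pi) ^ 4 * (ε'⁻¹ ^ σ⁻¹) ^ 2).toNNReal, fun F j k hF => ?_⟩
  have hfour : fourierL2 (der j (der k F)) =ᵐ[volume] fun ξ =>
      ((2 * Real.pi * Complex.I * (ξ j : ℝ)) * (2 * Real.pi * Complex.I * (ξ k : ℝ))) *
        fourierL2 F ξ := by
    filter_upwards [(hF.der k).fourier_der j, hF.fourier_der k] with ξ h1 h2
    rw [h1, h2]; ring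
  rw [sq_nrm_of_fourier ((hF.der k).der j).memLp hfour, sq_sobolevNorm hF.memLp,
    sq_nrm_fourier hF.memLp, ← lintegral_const_mul' _ _ ENNReal.coe_ne_top,
    ← lintegral_const_mul' _ _ ENNReal.coe_ne_top, ← lintegral_add_left']
  · refine lintegral_mono fun ξ => ?_
    rw [← mul_assoc (ε : ℝ≥0∞), ← add_mul]
    refine mul_le_mul' ?_ le_rfl
    have e1 : (ε : ℝ≥0∞) * jap (2 + σ) ξ = ENNReal.ofReal (ε * (1 + ‖ξ‖ ^ 2) ^ (2 + σ)) := by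
      unfold jap
      rw [ENNReal.ofReal_mul ε.coe_nonneg, ENNReal.ofReal_coe_nnreal]
    rw [e1]
    change _ ≤ _ + ENNReal.ofReal _
    rw [← ENNReal.ofReal_add (by positivity) (by positivity)]
    refine ENNReal.ofReal_le_ofReal ?_
    rw [norm_mul, norm_two_pi_I_mul, norm_two_pi_I_mul]
    have hj := abs_coord_le j ξ
    have hk := abs_coord_le k ξ
    have h1 : (|ξ j| * |ξ k|) ≤ ‖ξ‖ ^ 2 := by
      rw [sq]; exact mul_le_mul hj hk (abs_nonneg _) (norm_nonneg _)
    have h2 : (|ξ j| * |ξ k|) ^ 2 ≤ (1 + ‖ξ‖ ^ 2) ^ 2 :=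
      pow_le_pow_left₀ (by positivity) (by linarith) 2
    have h3 := sq_le_rpow_add hσ hε0 (y := 1 + ‖ξ‖ ^ 2) (by nlinarith [sq_nonneg ‖ξ‖])
    have h4 : ε = (2 * Real.pi) ^ 4 * ε' := by rw [hε']; field_simp
    calc _ = (2 * Real.pi) ^ 4 * (|ξ j| * |ξ k|) ^ 2 := by ring
      _ ≤ (2 * Real.pi) ^ 4 * (ε' * (1 + ‖ξ‖ ^ 2) ^ (2 + σ) + (ε'⁻¹ ^ σ⁻¹) ^ 2) := by
          gcongr; exact h2.trans h3
      _ = _ := by rw [h4]; ring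
  · exact ((measurable_jap _).aemeasurable.mul (measurable_fourierL2 hF.memLp)).const_mul _

/-! ### Suprema over slices -/

/-- The supremum of `|w|` over `Σ_τ`. -/
def supN (w : Spacetime → ℝ) (τ : ℝ) : ℝ≥0∞ := ⨆ x : Space, ‖w (τ, x)‖ₑ

lemma measurable_supN {w : Spacetime → ℝ} (hw : Continuous w) : Measurable (supN w) := by
  refine (lowerSemicontinuous_iSup fun x => Continuous.lowerSemicontinuous ?_).measurable
  exact (hw.comp (by fun_prop : Continuous fun τ : ℝ => (τ, x))).enorm

lemma supN_le_eLpNorm {w : Spacetime → ℝ} (hw : Continuous w) (τ : ℝ) :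
    supN w τ ≤ eLpNorm (slice τ w) ∞ volume := by
  refine iSup_le fun x => ?_
  by_contra hlt
  push Not at hlt
  have hc : Continuous fun x => ‖slice τ w x‖ₑ := (continuous_slice hw τ).enorm
  have hopen : IsOpen {y | eLpNorm (slice τ w) ∞ volume < ‖slice τ w y‖ₑ} :=
    isOpen_lt continuous_const hc
  have hz : volume {y | eLpNorm (slice τ w) ∞ volume < ‖slice τ w y‖ₑ} = 0 := by
    have := ae_le_eLpNormEssSup (f := slice τ w) (μ := (volume : Measure Space))
    rw [ae_iff] at this
    rw [← eLpNorm_exponent_top] at this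
    simpa using this
  have := (hopen.measure_eq_zero_iff volume).1 hz
  exact (this ▸ (show x ∈ {y | eLpNorm (slice τ w) ∞ volume < ‖slice τ w y‖ₑ} from hlt) :
    x ∈ (∅ : Set Space)).elim

lemma abs_le_supN (w : Spacetime → ℝ) (τ : ℝ) (x : Space) : ‖w (τ, x)‖ₑ ≤ supN w τ :=
  le_iSup (fun x => ‖w (τ, x)‖ₑ) x

lemma Good.supN_lt_top {T : ℝ} {w : Spacetime → ℝ} (hw : Good T w) {τ : ℝ} (hτ : τ ∈ Icc 0 T) :
    supN w τ < ⊤ := by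
  obtain ⟨C, hC⟩ := hw.sup_bound
  refine lt_of_le_of_lt (iSup_le fun x => ?_) (ENNReal.coe_lt_top (r := C))
  rw [enorm_le_coe, ← NNReal.coe_le_coe]
  simpa using hC (τ, x) hτ

/-! ### Continuity in time of Sobolev norms -/

lemma Good.sobolevNorm_sub_le {T : ℝ} {w : Spacetime → ℝ} (hw : Good T w) (s : ℝ) :
    ∃ C : ℝ≥0, ∀ t ∈ Icc 0 T, ∀ t' ∈ Icc 0 T, t ≤ t' →
      sobolevNorm s (fun x => slice t' w x - slice t w x) ≤ C * ENNReal.ofReal (t' - t) := by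
  have h : ∀ (m : ℕ) (w : Spacetime → ℝ), Good T w → ∃ C : ℝ≥0, ∀ t ∈ Icc 0 T, ∀ t' ∈ Icc 0 T,
      t ≤ t' → sobolevNorm m (fun x => slice t' w x - slice t w x) ≤
        C * ENNReal.ofReal (t' - t) := by
    intro m
    induction m with
    | zero =>
      intro w hw
      obtain ⟨M, hM⟩ := (hw.pd 0).nrm_bound
      refine ⟨M, fun t ht t' ht' h => ?_⟩
      rw [Nat.cast_zero, sobolevNorm_zero ((hw.isHinf ht').sub (hw.isHinf ht)).memLp, mul_comm]
      exact hw.nrm_sub_le h fun τ hτ => hM τ ⟨ht.1.trans hτ.1, hτ.2.trans ht'.2⟩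
    | succ m ih =>
      intro w hw
      obtain ⟨M, hM⟩ := (hw.pd 0).nrm_bound
      choose C hC using fun j => ih (ElasticWave.sd j w) (hw.sd j)
      set B : ℝ≥0 := ((2 : ℝ) ^ ((m : ℝ) + 1)).toNNReal * (M ^ 2 + ∑ j, C j ^ 2) + 1
      refine ⟨B, fun t ht t' ht' h => le_of_sq_le_sq ?_⟩
      have hI := (hw.isHinf ht').sub (hw.isHinf ht)
      rw [Nat.cast_succ]
      refine (sq_sobolevNorm_succ_le hI (Nat.cast_nonneg m)).trans ?_
      have hd : ∀ j, der j (fun x => slice t' w x - slice t w x) =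
          fun x => slice t' (ElasticWave.sd j w) x - slice t (ElasticWave.sd j w) x := fun j => by
        have h1 := contDiff_slice hw.smooth t'
        have h2 := contDiff_slice hw.smooth t
        rw [← der_slice hw.smooth, ← der_slice hw.smooth]
        ext x
        have := fderiv_fun_sub (h1.differentiable (by simp) x) (h2.differentiable (by simp) x)
        simp only [der, this, sub_apply]
      set d := ENNReal.ofReal (t' - t)
      have h1 : ENNReal.ofReal (2 ^ ((m : ℝ) + 1)) * (nrm (fun x => slice t' w x - slice t w x) ^ 2 +
          ∑ j : Fin 3, sobolevNorm m (der j (fun x => slice t' w x - slice t w x)) ^ 2) ≤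
          (B : ℝ≥0∞) * d ^ 2 := by
        calc _ ≤ ENNReal.ofReal (2 ^ ((m : ℝ) + 1)) * ((d * M) ^ 2 + ∑ j : Fin 3, (C j * d) ^ 2) := by
              gcongr with j _
              · exact hw.nrm_sub_le h fun τ hτ => hM τ ⟨ht.1.trans hτ.1, hτ.2.trans ht'.2⟩
              · rw [hd]; exact hC j t ht t' ht' h
          _ = (ENNReal.ofReal (2 ^ ((m : ℝ) + 1)) * (M ^ 2 + ∑ j : Fin 3, (C j : ℝ≥0∞) ^ 2)) * d ^ 2 := by
              simp_rw [mul_pow]; rw [← Finset.sum_mul]; ring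
          _ ≤ _ := by
              refine mul_le_mul' ?_ le_rfl
              simp only [B]
              push_cast
              exact le_add_right le_rfl
      refine h1.trans ?_
      have : (1 : ℝ≥0∞) ≤ B := by simp only [B]; push_cast; exact le_add_left le_rfl
      rw [mul_pow, sq (B : ℝ≥0∞)]
      exact mul_le_mul' (le_mul_of_one_le_left' this) le_rfl
  obtain ⟨m, hm⟩ := exists_nat_ge s
  obtain ⟨C, hC⟩ := h m w hw
  exact ⟨C, fun t ht t' ht' h => (sobolevNorm_mono ((hw.isHinf ht').sub (hw.isHinf ht)).memLp hm).trans
    (hC t ht t' ht' h)⟩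

lemma Good.continuousOn_sobolevNorm {T : ℝ} {w : Spacetime → ℝ} (hw : Good T w) (s : ℝ) :
    ContinuousOn (fun t => (sobolevNorm s (slice t w)).toReal) (Icc 0 T) := by
  obtain ⟨C, hC⟩ := hw.sobolevNorm_sub_le s
  have hfin : ∀ t ∈ Icc 0 T, sobolevNorm s (slice t w) ≠ ⊤ := fun t ht =>
    (sobolevNorm_lt_top (hw.isHinf ht) s).ne
  have key : ∀ t ∈ Icc 0 T, ∀ t' ∈ Icc 0 T, t ≤ t' →
      |(sobolevNorm s (slice t' w)).toReal - (sobolevNorm s (slice t w)).toReal| ≤ C * (t' - t) := by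
    intro t ht t' ht' h
    have h1 := hC t ht t' ht' h
    have hm := (hw.isHinf ht).memLp
    have hm' := (hw.isHinf ht').memLp
    have hmd := ((hw.isHinf ht').sub (hw.isHinf ht)).memLp
    have a1 : sobolevNorm s (slice t' w) ≤ sobolevNorm s (slice t w) + C * ENNReal.ofReal (t' - t) := by
      refine le_trans (le_of_eq ?_) ((sobolevNorm_add_le hm hmd s).trans (add_le_add le_rfl h1))
      congr 1; ext x; ring
    have a2 : sobolevNorm s (slice t w) ≤ sobolevNorm s (slice t' w) + C * ENNReal.ofReal (t' - t) := by
      refine le_trans (le_of_eq ?_) ((ElasticWave.sobolevNorm_sub_le hm' hmd s).trans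
        (add_le_add le_rfl h1))
      congr 1; ext x; ring
    have hc : (C : ℝ≥0∞) * ENNReal.ofReal (t' - t) ≠ ⊤ :=
      ENNReal.mul_ne_top ENNReal.coe_ne_top ENNReal.ofReal_ne_top
    have e : ((C : ℝ≥0∞) * ENNReal.ofReal (t' - t)).toReal = C * (t' - t) := by
      rw [ENNReal.toReal_mul, ENNReal.toReal_ofReal (by linarith)]; simp
    have b1 := ENNReal.toReal_mono (ENNReal.add_ne_top.2 ⟨hfin t ht, hc⟩) a1
    have b2 := ENNReal.toReal_mono (ENNReal.add_ne_top.2 ⟨hfin t' ht', hc⟩) a2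
    rw [ENNReal.toReal_add (hfin t ht) hc, e] at b1
    rw [ENNReal.toReal_add (hfin t' ht') hc, e] at b2
    rw [abs_le]; constructor <;> linarith
  refine LipschitzOnWith.continuousOn (K := C) (LipschitzOnWith.of_dist_le_mul fun t ht t' ht' => ?_)
  rw [Real.dist_eq, Real.dist_eq]
  rcases le_total t t' with h | h
  · rw [abs_sub_comm, abs_sub_comm t]
    rw [abs_of_nonneg (by linarith : 0 ≤ t' - t)]
    exact key t ht t' ht' h
  · rw [abs_of_nonneg (by linarith : 0 ≤ t - t')]
    exact key t' ht' t ht h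

end

section

/-! ### Smooth vector fields -/

/-- Smooth vector fields whose gradients have derivatives bounded in `L²` on the slab. -/
structure GoodField (T : ℝ) (V : Field) : Prop where
  smooth : ∀ i, ContDiff ℝ ∞ (V i)
  good : ∀ j i, Good T (sd j (V i))

lemma IsSmoothField.goodField {T : ℝ} {V : Field} (hV : IsSmoothField T V) : GoodField T V where
  smooth := hV.1
  good j i := ⟨contDiff_sd (hV.1 i) j, fun l => by
    obtain ⟨M, hM⟩ := hV.2 l.length l.get j i
    refine ⟨M.toNNReal, fun t ht => ?_⟩
    have := hM t ht
    unfold pdIter at this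
    rw [List.ofFn_get] at this
    exact this⟩

/-- The time derivative of a vector field. -/
def dt (V : Field) : Field := fun i => pd 0 (V i)

namespace GoodField

variable {T : ℝ} {V : Field}

lemma dt (hV : GoodField T V) : GoodField T (dt V) where
  smooth i := contDiff_pd (hV.smooth i) 0
  good j i := by
    have h : ElasticWave.sd j (ElasticWave.dt V i) = pd 0 (ElasticWave.sd j (V i)) :=
      pd_comm (hV.smooth i) _ _
    rw [h]; exact (hV.good j i).pd 0

lemma div (hV : GoodField T V) : Good T (div V) := Good.sum _ fun i => hV.good i i

lemma curl (hV : GoodField T V) (i : Fin 3) : Good T (curl V i) := (hV.good _ _).sub (hV.good _ _)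

lemma sd_dt (hV : GoodField T V) (j i : Fin 3) :
    sd j (ElasticWave.dt V i) = pd 0 (sd j (V i)) := pd_comm (hV.smooth i) _ _

lemma div_dt (hV : GoodField T V) :
    ElasticWave.div (ElasticWave.dt V) = pd 0 (ElasticWave.div V) := by
  unfold ElasticWave.div
  rw [pd_sum _ fun i => contDiff_sd (hV.smooth i) i]
  ext p
  exact Finset.sum_congr rfl fun i _ => by rw [hV.sd_dt]

lemma curl_dt (hV : GoodField T V) (i : Fin 3) :
    ElasticWave.curl (ElasticWave.dt V) i = pd 0 (ElasticWave.curl V i) := by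
  unfold ElasticWave.curl
  rw [pd_sub (contDiff_sd (hV.smooth _) _) (contDiff_sd (hV.smooth _) _)]
  ext p
  rw [hV.sd_dt, hV.sd_dt]

lemma sobolevNorm_antisymm_le (hV : GoodField T V) {t : ℝ} (ht : t ∈ Icc 0 T) (s : ℝ) (k i : Fin 3) :
    sobolevNorm s (fun x => slice t (sd k (V i)) x - slice t (sd i (V k)) x) ≤
      ∑ l, sobolevNorm s (slice t (ElasticWave.curl V l)) := by
  have hm : ∀ l, MemLp (slice t (ElasticWave.curl V l)) 2 volume := fun l =>
    ((hV.curl l).isHinf ht).memLp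
  have h1 : ∀ l (c : ℝ), ‖c‖₊ ≤ 1 → sobolevNorm s (fun x => c * slice t (ElasticWave.curl V l) x) ≤
      ∑ l, sobolevNorm s (slice t (ElasticWave.curl V l)) := by
    intro l c hc
    refine (sobolevNorm_const_mul_le (hm l) c s).trans ?_
    refine le_trans (mul_le_of_le_one_left zero_le (by exact_mod_cast hc)) ?_
    exact Finset.single_le_sum (f := fun l => sobolevNorm s (slice t (ElasticWave.curl V l)))
      (fun _ _ => zero_le) (Finset.mem_univ l)
  have h2 : ∃ (l : Fin 3) (c : ℝ), ‖c‖₊ ≤ 1 ∧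
      (fun x => slice t (sd k (V i)) x - slice t (sd i (V k)) x) =
        fun x => c * slice t (ElasticWave.curl V l) x := by
    have c1 : ‖(1 : ℝ)‖₊ ≤ 1 := by simp
    have c2 : ‖(-1 : ℝ)‖₊ ≤ 1 := by simp
    have c0 : ‖(0 : ℝ)‖₊ ≤ 1 := by simp
    have e : ∀ l x, slice t (ElasticWave.curl V l) x =
      sd (l + 1) (V (l + 2)) (t, x) - sd (l + 2) (V (l + 1)) (t, x) := fun _ _ => rfl
    fin_cases k <;> fin_cases i
    · exact ⟨0, 0, c0, by ext x; simp⟩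
    · exact ⟨2, 1, c1, by ext x; rw [e]; simp [slice]⟩
    · exact ⟨1, -1, c2, by ext x; rw [e]; simp [slice]⟩
    · exact ⟨2, -1, c2, by ext x; rw [e]; simp [slice]⟩
    · exact ⟨0, 0, c0, by ext x; simp⟩
    · exact ⟨0, 1, c1, by ext x; rw [e]; simp [slice]⟩
    · exact ⟨1, 1, c1, by ext x; rw [e]; simp [slice]⟩
    · exact ⟨0, -1, c2, by ext x; rw [e]; simp [slice]⟩
    · exact ⟨0, 0, c0, by ext x; simp⟩
  obtain ⟨l, c, hc, e⟩ := h2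
  rw [e]
  exact h1 l c hc

/-- The gradient of a vector field is controlled by its divergence and its curl. -/
lemma sobolevNorm_sd_le (hV : GoodField T V) {t : ℝ} (ht : t ∈ Icc 0 T) (s : ℝ) (j i : Fin 3) :
    sobolevNorm s (slice t (sd j (V i))) ≤ sobolevNorm s (slice t (ElasticWave.div V)) +
      3 * ∑ l, sobolevNorm s (slice t (ElasticWave.curl V l)) := by
  have h := sobolevNorm_le_div_curl (p := fun j i => slice t (sd j (V i)))
    (fun j i => (hV.good j i).isHinf ht) (fun i j k => by
      rw [der_slice (hV.good j i).smooth, der_slice (hV.good k i).smooth]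
      congr 1
      exact pd_comm (hV.smooth i) _ _) s j i
  refine h.trans (add_le_add le_rfl ?_)
  refine (Finset.sum_le_sum fun k _ => hV.sobolevNorm_antisymm_le ht s k i).trans (le_of_eq ?_)
  simp

end GoodField

lemma sobolevNorm_zero_fun (s : ℝ) : sobolevNorm s (fun _ => (0 : ℝ)) = 0 := by
  have h := sobolevNorm_const_mul_le (F := fun _ => (0 : ℝ)) MemLp.zero 0 s
  simpa using h

/-! ### Components of the gradients -/

/-- Indices of the components of `(∂φ, ∂ψ)`. -/
abbrev Comp := (Fin 3 × Fin 3) ⊕ (Fin 3 × Fin 3)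

/-- The components of `(∂φ, ∂ψ)`. -/
def comp (φ ψ : Field) : Comp → Spacetime → ℝ
  | Sum.inl a => sd a.1 (φ a.2)
  | Sum.inr a => sd a.1 (ψ a.2)

/-- Reassembles a pair of gradients from its components. -/
def toPair (y : Comp → ℝ) : Grad × Grad :=
  (fun j i => y (Sum.inl (j, i)), fun j i => y (Sum.inr (j, i)))

lemma toPair_comp (φ ψ : Field) (p : Spacetime) :
    toPair (fun a => comp φ ψ a p) = (grad φ p, grad ψ p) := rfl

lemma contDiff_toPair : ContDiff ℝ ∞ toPair := by
  unfold toPair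
  fun_prop

/-- The unit vectors of `Hess × Hess`. -/
def unitHess : Fin 3 × Comp → Hess × Hess
  | (j, Sum.inl a) => (Pi.single j (Pi.single a.1 (Pi.single a.2 1)), 0)
  | (j, Sum.inr a) => (0, Pi.single j (Pi.single a.1 (Pi.single a.2 1)))

/-- The unit vectors of `Third`. -/
def unitThird (c : Fin 3 × Fin 3 × Fin 3 × Fin 3) : Third :=
  Pi.single c.1 (Pi.single c.2.1 (Pi.single c.2.2.1 (Pi.single c.2.2.2 1)))

lemma hess_eq_sum (φ ψ : Field) (p : Spacetime) :
    (hess φ p, hess ψ p) = ∑ c : Fin 3 × Comp, sd c.1 (comp φ ψ c.2) p • unitHess c := by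
  rw [Fintype.sum_prod_type]
  simp only [Fintype.sum_sum_type, Fintype.sum_prod_type, Fin.sum_univ_three]
  refine Prod.ext ?_ ?_ <;> funext j k i <;> fin_cases j <;> fin_cases k <;> fin_cases i <;>
    simp [comp, unitHess, hess]

lemma third_eq_sum (ψ : Field) (p : Spacetime) :
    third ψ p = ∑ c : Fin 3 × Fin 3 × Fin 3 × Fin 3,
      sd c.1 (sd c.2.1 (sd c.2.2.1 (ψ c.2.2.2))) p • unitThird c := by
  have h : ∀ y : Third, y = ∑ c : Fin 3 × Fin 3 × Fin 3 × Fin 3,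
      y c.1 c.2.1 c.2.2.1 c.2.2.2 • unitThird c := by
    intro y
    funext j k l i
    rw [Finset.sum_apply, Finset.sum_apply, Finset.sum_apply, Finset.sum_apply,
      Finset.sum_eq_single (j, k, l, i)]
    · simp [unitThird]
    · rintro ⟨j', k', l', i'⟩ - hne
      simp only [unitThird, Pi.smul_apply, smul_eq_mul]
      rcases eq_or_ne j' j with rfl | h1
      · rcases eq_or_ne k' k with rfl | h2
        · rcases eq_or_ne l' l with rfl | h3
          · have h4 : i ≠ i' := fun h => hne (by rw [h])
            simp [Pi.single_eq_of_ne h4]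
          · simp [Pi.single_eq_of_ne h3.symm]
        · simp [Pi.single_eq_of_ne h2.symm]
      · simp [Pi.single_eq_of_ne h1.symm]
    · simp
  exact h _

/-- The coefficient of the product of two second derivatives. -/
def quadCoef (S : WaveSystem) (c d : Fin 3 × Comp) (y : Comp → ℝ) : ℝ :=
  S.quadDiv (toPair y) (unitHess c) (unitHess d)

/-- The coefficient of a third derivative of `ψ`. -/
def linCoef (S : WaveSystem) (c : Fin 3 × Fin 3 × Fin 3 × Fin 3) (y : Comp → ℝ) : ℝ :=
  S.linDiv (toPair y) (toPair y) (unitThird c)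

lemma contDiff_quadCoef (S : WaveSystem) (c d) : ContDiff ℝ ∞ (quadCoef S c d) :=
  ((S.quadDiv_smooth.comp contDiff_toPair).clm_apply contDiff_const).clm_apply contDiff_const

lemma contDiff_linCoef (S : WaveSystem) (c) : ContDiff ℝ ∞ (linCoef S c) :=
  ((S.linDiv_smooth.comp contDiff_toPair).clm_apply contDiff_toPair).clm_apply contDiff_const

/-- The inhomogeneity of the faster equation in components. -/
lemma source_eq (S : WaveSystem) (φ ψ : Field) (p : Spacetime) :
    S.quadDiv (grad φ p, grad ψ p) (hess φ p, hess ψ p) (hess φ p, hess ψ p) +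
      S.linDiv (grad φ p, grad ψ p) (grad φ p, grad ψ p) (third ψ p) =
    (∑ c, ∑ d, quadCoef S c d (fun a => comp φ ψ a p) * sd c.1 (comp φ ψ c.2) p *
      sd d.1 (comp φ ψ d.2) p) +
    ∑ c, linCoef S c (fun a => comp φ ψ a p) * sd c.1 (sd c.2.1 (sd c.2.2.1 (ψ c.2.2.2))) p := by
  congr 1
  · conv_lhs => rw [hess_eq_sum]
    simp only [map_sum, map_smul, sum_apply, smul_apply, smul_eq_mul, quadCoef, toPair_comp,
      Finset.mul_sum]
    rw [Finset.sum_comm]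
    refine Finset.sum_congr rfl fun c _ => Finset.sum_congr rfl fun d _ => ?_
    ring
  · rw [third_eq_sum]
    simp only [map_sum, map_smul, smul_eq_mul, linCoef, toPair_comp]
    exact Finset.sum_congr rfl fun c _ => mul_comm _ _

end

section

/-! ### Irrotational and solenoidal fields -/

namespace GoodField

variable {T : ℝ} {V : Field}

lemma sobolevNorm_sd_of_curl (hV : GoodField T V)
    (h : ∀ p : Spacetime, p.1 ∈ Icc 0 T → ∀ l, ElasticWave.curl V l p = 0) {t : ℝ}
    (ht : t ∈ Icc 0 T) (s : ℝ) (j i : Fin 3) :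
    sobolevNorm s (slice t (sd j (V i))) ≤ sobolevNorm s (slice t (ElasticWave.div V)) := by
  have h0 : ∀ l, slice t (ElasticWave.curl V l) = fun _ => 0 := fun l => by
    ext x; exact h (t, x) ht l
  refine (hV.sobolevNorm_sd_le ht s j i).trans (le_of_eq ?_)
  simp [h0, sobolevNorm_zero_fun]

lemma sobolevNorm_sd_of_div (hV : GoodField T V)
    (h : ∀ p : Spacetime, p.1 ∈ Icc 0 T → ElasticWave.div V p = 0) {t : ℝ}
    (ht : t ∈ Icc 0 T) (s : ℝ) (j i : Fin 3) :
    sobolevNorm s (slice t (sd j (V i))) ≤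
      3 * ∑ l, sobolevNorm s (slice t (ElasticWave.curl V l)) := by
  have h0 : slice t (ElasticWave.div V) = fun _ => 0 := by
    ext x; exact h (t, x) ht
  refine (hV.sobolevNorm_sd_le ht s j i).trans (le_of_eq ?_)
  rw [h0, sobolevNorm_zero_fun, zero_add]

lemma curl_dt_eq_zero (hV : GoodField T V) (hT : 0 < T)
    (h : ∀ p : Spacetime, p.1 ∈ Icc 0 T → ∀ l, ElasticWave.curl V l p = 0) :
    ∀ p : Spacetime, p.1 ∈ Icc 0 T → ∀ l, ElasticWave.curl (ElasticWave.dt V) l p = 0 := by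
  intro p hp l
  rw [hV.curl_dt]
  exact pd_eq_zero_of_slab (hV.curl l).smooth hT (fun p hp => h p hp l) 0 p hp

lemma div_dt_eq_zero (hV : GoodField T V) (hT : 0 < T)
    (h : ∀ p : Spacetime, p.1 ∈ Icc 0 T → ElasticWave.div V p = 0) :
    ∀ p : Spacetime, p.1 ∈ Icc 0 T → ElasticWave.div (ElasticWave.dt V) p = 0 := by
  intro p hp
  rw [hV.div_dt]
  exact pd_eq_zero_of_slab hV.div.smooth hT h 0 p hp

end GoodField

/-! ### Compositions with smooth functions -/

section Composition

variable {κ : Type*} [Fintype κ] {G : (κ → ℝ) → ℝ} {c : κ → Spacetime → ℝ}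

/-- The partial derivatives of a function of several variables. -/
def partialDeriv [DecidableEq κ] (G : (κ → ℝ) → ℝ) (a : κ) (y : κ → ℝ) : ℝ := fderiv ℝ G y (Pi.single a 1)

lemma contDiff_partialDeriv [DecidableEq κ] (hG : ContDiff ℝ ∞ G) (a : κ) : ContDiff ℝ ∞ (partialDeriv G a) :=
  (hG.fderiv_right (m := ∞) (by simp)).clm_apply contDiff_const

lemma contDiff_comp_pi (hG : ContDiff ℝ ∞ G) (hc : ∀ a, ContDiff ℝ ∞ (c a)) :
    ContDiff ℝ ∞ fun p => G fun a => c a p := hG.comp (contDiff_pi.2 hc)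

lemma pd_comp [DecidableEq κ] (hG : ContDiff ℝ ∞ G) (hc : ∀ a, ContDiff ℝ ∞ (c a)) (α : Fin 4) (p : Spacetime) :
    pd α (fun p => G fun a => c a p) p = ∑ a, partialDeriv G a (fun a => c a p) * pd α (c a) p := by
  have h1 : HasFDerivAt (fun p => (fun a => c a p : κ → ℝ))
      (ContinuousLinearMap.pi fun a => fderiv ℝ (c a) p) p :=
    hasFDerivAt_pi.2 fun a => ((hc a).differentiable (by simp) p).hasFDerivAt
  have h2 : HasFDerivAt G (fderiv ℝ G (fun a => c a p)) (fun a => c a p) :=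
    (hG.differentiable (by simp) _).hasFDerivAt
  have h3 := (h2.comp p h1).fderiv
  unfold pd
  rw [show (fun p => G fun a => c a p) = G ∘ fun p => (fun a => c a p : κ → ℝ) from rfl, h3]
  rw [ContinuousLinearMap.comp_apply]
  conv_lhs => rw [show (ContinuousLinearMap.pi fun a => fderiv ℝ (c a) p) (dir α) =
    ∑ a, fderiv ℝ (c a) p (dir α) • (Pi.single a 1 : κ → ℝ) from by
      rw [← pi_eq_sum_univ' (fun a => fderiv ℝ (c a) p (dir α))]; rfl]
  simp only [map_sum, map_smul, smul_eq_mul, partialDeriv]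
  exact Finset.sum_congr rfl fun a _ => mul_comm _ _

lemma exists_bound_of_contDiff (hG : ContDiff ℝ ∞ G) (R : ℝ) :
    ∃ L : ℝ≥0, ∀ y, (∀ a, |y a| ≤ R) → |G y| ≤ L := by
  obtain ⟨L, hL⟩ := (isCompact_closedBall (0 : κ → ℝ) |R|).exists_bound_of_continuousOn
    hG.continuous.continuousOn
  refine ⟨L.toNNReal, fun y hy => (hL y ?_).trans (Real.le_coe_toNNReal L)⟩
  rw [mem_closedBall_zero_iff, pi_norm_le_iff_of_nonneg (abs_nonneg _)]
  exact fun a => (hy a).trans (le_abs_self R)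

end Composition

/-! ### The a priori assumptions -/

/-- The supremum of the derivatives of `∂φ` on a slice, increased by one. -/
def lam (φ : Field) (τ : ℝ) : ℝ≥0 :=
  1 + (∑ α, ∑ j, ∑ i, supN (pd α (sd j (φ i))) τ).toNNReal

lemma one_le_lam (φ : Field) (τ : ℝ) : 1 ≤ lam φ τ := le_add_of_nonneg_right zero_le

lemma GoodField.abs_le_lam {T : ℝ} {φ : Field} (hφ : GoodField T φ) {p : Spacetime}
    (hp : p.1 ∈ Icc 0 T) (α : Fin 4) (j i : Fin 3) : |pd α (sd j (φ i)) p| ≤ lam φ p.1 := by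
  have hfin : ∑ α, ∑ j, ∑ i, supN (pd α (sd j (φ i))) p.1 ≠ ⊤ :=
    ENNReal.sum_ne_top.2 fun α _ => ENNReal.sum_ne_top.2 fun j _ => ENNReal.sum_ne_top.2 fun i _ =>
      (((hφ.good j i).pd α).supN_lt_top hp).ne
  have h1 : ‖pd α (sd j (φ i)) p‖ₑ ≤ ∑ α, ∑ j, ∑ i, supN (pd α (sd j (φ i))) p.1 := by
    refine (abs_le_supN _ p.1 p.2).trans ?_
    refine le_trans ?_ (Finset.single_le_sum (f := fun α => ∑ j, ∑ i, supN (pd α (sd j (φ i))) p.1)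
      (fun _ _ => zero_le) (Finset.mem_univ α))
    refine le_trans ?_ (Finset.single_le_sum (f := fun j => ∑ i, supN (pd α (sd j (φ i))) p.1)
      (fun _ _ => zero_le) (Finset.mem_univ j))
    exact Finset.single_le_sum (f := fun i => supN (pd α (sd j (φ i))) p.1)
      (fun _ _ => zero_le) (Finset.mem_univ i)
  have h2 := ENNReal.toNNReal_mono hfin h1
  have h3 : ‖pd α (sd j (φ i)) p‖₊ ≤ lam φ p.1 := by
    refine le_trans ?_ (h2.trans (le_add_of_nonneg_left zero_le))
    simp
  exact_mod_cast h3

/-- The a priori assumptions under which the estimates for a solution are uniform. -/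
structure Hyp (S : WaveSystem) (σ : ℝ) (K : Set (Grad × Grad)) (A : ℝ≥0) (T : ℝ) (φ ψ : Field) :
    Prop where
  pos : 0 < T
  le_one : T ≤ 1
  sol : IsSolution S T φ ψ
  mem : ∀ p : Spacetime, p.1 ∈ Icc 0 T → (grad φ p, grad ψ p) ∈ K
  div_le : ∀ t ∈ Icc 0 T, sobolevNorm (2 + σ) (slice t (div φ)) ≤ A
  dt_div_le : ∀ t ∈ Icc 0 T, sobolevNorm (1 + σ) (slice t (pd 0 (div φ))) ≤ A
  curl_le : ∀ t ∈ Icc 0 T, ∀ i, sobolevNorm (3 + σ) (slice t (curl ψ i)) ≤ A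
  dt_curl_le : ∀ t ∈ Icc 0 T, ∀ i, sobolevNorm (2 + σ) (slice t (pd 0 (curl ψ i))) ≤ A

namespace Hyp

variable {S : WaveSystem} {σ : ℝ} {K : Set (Grad × Grad)} {A : ℝ≥0} {T : ℝ} {φ ψ : Field}

lemma goodφ (h : Hyp S σ K A T φ ψ) : GoodField T φ := h.sol.smooth_div.goodField

lemma goodψ (h : Hyp S σ K A T φ ψ) : GoodField T ψ := h.sol.smooth_curl.goodField

lemma good_comp (h : Hyp S σ K A T φ ψ) (a : Comp) : Good T (comp φ ψ a) := by
  rcases a with a | a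
  · exact h.goodφ.good _ _
  · exact h.goodψ.good _ _

lemma contDiff_comp (h : Hyp S σ K A T φ ψ) (a : Comp) : ContDiff ℝ ∞ (comp φ ψ a) :=
  (h.good_comp a).smooth

end Hyp

/-- A solution that satisfies the a priori assumptions, together with a time. -/
structure Sit (S : WaveSystem) (σ : ℝ) (K : Set (Grad × Grad)) (A : ℝ≥0) where
  T : ℝ
  φ : Field
  ψ : Field
  t : ℝ
  hyp : Hyp S σ K A T φ ψ
  mem : t ∈ Icc 0 T

namespace Sit

variable {S : WaveSystem} {σ : ℝ} {K : Set (Grad × Grad)} {A : ℝ≥0}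

lemma hs_of_good {s : ℝ} (w : Sit S σ K A → Spacetime → ℝ) (hw : ∀ z, Good z.T (w z)) (C : ℝ≥0)
    (h : ∀ z, sobolevNorm s (slice z.t (w z)) ≤ C) : HsBounded s fun z => slice z.t (w z) :=
  ⟨fun z => (hw z).isHinf z.mem, C, h⟩

lemma hs_div : HsBounded (2 + σ) fun z : Sit S σ K A => slice z.t (div z.φ) :=
  hs_of_good _ (fun z => z.hyp.goodφ.div) A fun z => z.hyp.div_le z.t z.mem

lemma hs_curl (i : Fin 3) : HsBounded (3 + σ) fun z : Sit S σ K A => slice z.t (curl z.ψ i) :=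
  hs_of_good _ (fun z => z.hyp.goodψ.curl i) A fun z => z.hyp.curl_le z.t z.mem i

lemma hs_sd_div (k : Fin 3) : HsBounded (1 + σ) fun z : Sit S σ K A => slice z.t (sd k (div z.φ)) := by
  have h := (hs_div (S := S) (σ := σ) (K := K) (A := A)).der k (s' := 1 + σ) (by linarith)
  simpa only [der_slice ((Sit.hyp _).goodφ.div.smooth)] using h

lemma hs_sd_curl (i k : Fin 3) :
    HsBounded (2 + σ) fun z : Sit S σ K A => slice z.t (sd k (curl z.ψ i)) := by
  have h := (hs_curl (S := S) (σ := σ) (K := K) (A := A) i).der k (s' := 2 + σ) (by linarith)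
  simpa only [der_slice (((Sit.hyp _).goodψ.curl i).smooth)] using h

lemma hs_sdφ (j i : Fin 3) : HsBounded (2 + σ) fun z : Sit S σ K A => slice z.t (sd j (z.φ i)) :=
  hs_of_good _ (fun z => z.hyp.goodφ.good j i) A fun z =>
    (z.hyp.goodφ.sobolevNorm_sd_of_curl z.hyp.sol.curl_eq_zero z.mem _ j i).trans
      (z.hyp.div_le z.t z.mem)

lemma hs_sdψ (j i : Fin 3) : HsBounded (3 + σ) fun z : Sit S σ K A => slice z.t (sd j (z.ψ i)) :=
  hs_of_good _ (fun z => z.hyp.goodψ.good j i) (3 * ∑ _l : Fin 3, A) fun z => by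
    refine (z.hyp.goodψ.sobolevNorm_sd_of_div z.hyp.sol.div_eq_zero z.mem _ j i).trans ?_
    push_cast
    gcongr with l
    exact z.hyp.curl_le z.t z.mem l

lemma hs_pd_sdψ (α : Fin 4) (j i : Fin 3) :
    HsBounded (2 + σ) fun z : Sit S σ K A => slice z.t (pd α (sd j (z.ψ i))) := by
  refine Fin.cases ?_ (fun k => ?_) α
  · refine hs_of_good _ (fun z => (z.hyp.goodψ.good j i).pd 0) (3 * ∑ _l : Fin 3, A) fun z => ?_
    rw [← z.hyp.goodψ.sd_dt]
    refine (z.hyp.goodψ.dt.sobolevNorm_sd_of_div (z.hyp.goodψ.div_dt_eq_zero z.hyp.pos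
      z.hyp.sol.div_eq_zero) z.mem _ j i).trans ?_
    push_cast
    gcongr with l
    rw [z.hyp.goodψ.curl_dt]
    exact z.hyp.dt_curl_le z.t z.mem l
  · have h := (hs_sdψ (S := S) (σ := σ) (K := K) (A := A) j i).der k (s' := 2 + σ) (by linarith)
    simp only [der_slice ((Sit.hyp _).goodψ.good j i).smooth] at h
    exact h

lemma hs_comp (a : Comp) : HsBounded (2 + σ) fun z : Sit S σ K A => slice z.t (comp z.φ z.ψ a) := by
  rcases a with a | a
  · exact hs_sdφ a.1 a.2
  · exact (hs_sdψ a.1 a.2).mono (by linarith)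

/-- Pointwise bounds for the first derivatives of the gradients. -/
lemma abs_pd_comp_le (hσ : 0 < σ) : ∃ C : ℝ≥0, ∀ (z : Sit S σ K A) α a x,
    |pd α (comp z.φ z.ψ a) (z.t, x)| ≤ C * lam z.φ z.t := by
  choose B hB using fun (q : Fin 4 × Fin 3 × Fin 3) =>
    (hs_pd_sdψ (S := S) (σ := σ) (K := K) (A := A) q.1 q.2.1 q.2.2).sup_bound (by linarith)
  refine ⟨1 + ∑ q, B q, fun z α a x => ?_⟩
  have h1 : (1 : ℝ) ≤ lam z.φ z.t := by exact_mod_cast one_le_lam z.φ z.t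
  rcases a with a | a
  · refine (z.hyp.goodφ.abs_le_lam (p := (z.t, x)) z.mem α a.1 a.2).trans ?_
    refine le_mul_of_one_le_left (by positivity) ?_
    exact_mod_cast le_add_of_nonneg_right zero_le
  · refine (hB (α, a.1, a.2) z x).trans ?_
    have h2 : (B (α, a.1, a.2) : ℝ) ≤ (1 + ∑ q, B q : ℝ≥0) := by
      exact_mod_cast (le_sum_nnreal B _).trans (le_add_of_nonneg_left zero_le)
    exact h2.trans (le_mul_of_one_le_right (NNReal.coe_nonneg _) h1)

/-- Pointwise bounds for the gradients. -/
lemma abs_comp_le (hσ : 0 < σ) : ∃ C : ℝ≥0, ∀ (z : Sit S σ K A) a x,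
    |comp z.φ z.ψ a (z.t, x)| ≤ C := by
  choose B hB using fun a => (hs_comp (S := S) (σ := σ) (K := K) (A := A) a).sup_bound (by linarith)
  exact ⟨∑ a, B a, fun z a x => (hB a z x).trans (by exact_mod_cast le_sum_nnreal B a)⟩

lemma coef_comp (hσ : 0 < σ) (hσ' : σ < 1 / 2) {G : (Comp → ℝ) → ℝ} (hG : ContDiff ℝ ∞ G) :
    Coef σ fun (z : Sit S σ K A) x => G fun a => comp z.φ z.ψ a (z.t, x) :=
  Coef.comp hσ' (P := fun a (z : Sit S σ K A) => slice z.t (comp z.φ z.ψ a))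
    (fun a => (hs_comp a).coef hσ hσ') hG

/-- Pointwise bounds for the first derivatives of functions of the gradients. -/
lemma abs_pd_comp_fun_le (hσ : 0 < σ) {G : (Comp → ℝ) → ℝ} (hG : ContDiff ℝ ∞ G) :
    ∃ C : ℝ≥0, ∀ (z : Sit S σ K A) α x,
      |pd α (fun p => G fun a => comp z.φ z.ψ a p) (z.t, x)| ≤ C * lam z.φ z.t := by
  obtain ⟨R, hR⟩ := abs_comp_le (S := S) (K := K) (A := A) hσ
  obtain ⟨B, hB⟩ := abs_pd_comp_le (S := S) (K := K) (A := A) hσ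
  choose L hL using fun a => exists_bound_of_contDiff (contDiff_partialDeriv hG a) R
  refine ⟨∑ a, L a * B, fun z α x => ?_⟩
  rw [pd_comp hG z.hyp.contDiff_comp]
  push_cast
  rw [Finset.sum_mul]
  refine (Finset.abs_sum_le_sum_abs _ _).trans (Finset.sum_le_sum fun a _ => ?_)
  rw [abs_mul, mul_assoc]
  exact mul_le_mul (hL a _ fun b => hR z b x) (hB z α a x) (abs_nonneg _) (NNReal.coe_nonneg _)

end Sit

end

section

/-! ### Uniform bounds of weighted sums -/

/-- Weighted sums of a family, bounded by `Λ²`. -/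
def WLe {ι : Type*} (s : ℝ) (Λ : ι → ℝ≥0) (a : ι → Fin 3 → ℕ → ℝ≥0∞) : Prop :=
  ∃ C : ℝ≥0, ∀ i k, wsum s (a i k) ≤ (C * Λ i ^ 2 : ℝ≥0)

namespace WLe

variable {ι : Type*} {s : ℝ} {Λ : ι → ℝ≥0} {a b : ι → Fin 3 → ℕ → ℝ≥0∞}

lemma mono (hb : WLe s Λ b) (h : ∀ i k n, a i k n ≤ b i k n) : WLe s Λ a := by
  obtain ⟨C, hC⟩ := hb
  exact ⟨C, fun i k => (wsum_mono (h i k)).trans (hC i k)⟩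

lemma of_le (hΛ : ∀ i, 1 ≤ Λ i) (h : ∃ C : ℝ≥0, ∀ i k, wsum s (a i k) ≤ C) : WLe s Λ a := by
  obtain ⟨C, hC⟩ := h
  refine ⟨C, fun i k => (hC i k).trans ?_⟩
  exact_mod_cast le_mul_of_one_le_right zero_le (one_le_pow₀ (hΛ i))

lemma sum {κ : Type*} [Fintype κ] {a : κ → ι → Fin 3 → ℕ → ℝ≥0∞} (h : ∀ c, WLe s Λ (a c)) :
    WLe s Λ fun i k n => ∑ c, a c i k n := by
  choose C hC using h
  refine ⟨Fintype.card κ * ∑ c, C c, fun i k => (wsum_sum_le _ _ _).trans ?_⟩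
  refine (mul_le_mul' le_rfl (Finset.sum_le_sum fun c _ => hC c i k)).trans (le_of_eq ?_)
  push_cast
  rw [← Finset.sum_mul, mul_assoc, Finset.card_univ]

lemma add (ha : WLe s Λ a) (hb : WLe s Λ b) : WLe s Λ fun i k n => a i k n + b i k n := by
  obtain ⟨C, hC⟩ := ha
  obtain ⟨B, hB⟩ := hb
  refine ⟨2 * (C + B), fun i k => (wsum_add_le _ _ _).trans ?_⟩
  refine (mul_le_mul' le_rfl (add_le_add (hC i k) (hB i k))).trans (le_of_eq ?_)
  push_cast
  ring

lemma const_mul (c : ℝ≥0) (ha : WLe s Λ a) : WLe s Λ fun i k n => c * a i k n := by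
  obtain ⟨C, hC⟩ := ha
  refine ⟨c ^ 2 * C, fun i k => ?_⟩
  rw [wsum_const_mul]
  refine (mul_le_mul' le_rfl (hC i k)).trans (le_of_eq ?_)
  push_cast
  ring

end WLe

/-! ### The faster equation -/

/-- The coefficients of the faster metric as functions of the components of the gradients. -/
def gCoef (S : WaveSystem) (j k : Fin 3) (y : Comp → ℝ) : ℝ := S.gInv (toPair y) j k

lemma contDiff_gCoef (S : WaveSystem) (j k : Fin 3) : ContDiff ℝ ∞ (gCoef S j k) := by
  have h : ContDiff ℝ ∞ fun y => S.fg (toPair y) j k :=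
    contDiff_pi.1 (contDiff_pi.1 (S.fg_smooth.comp contDiff_toPair) j) k
  exact contDiff_const.add h

/-- The spatial part of the inverse of the faster metric along a solution. -/
def gMet (S : WaveSystem) (φ ψ : Field) (j k : Fin 3) : Spacetime → ℝ :=
  fun p => gCoef S j k fun a => comp φ ψ a p

/-- The inhomogeneity of the faster equation. -/
def divSource (S : WaveSystem) (φ ψ : Field) : Spacetime → ℝ := fun p =>
  (∑ c, ∑ d, quadCoef S c d (fun a => comp φ ψ a p) * sd c.1 (comp φ ψ c.2) p *
    sd d.1 (comp φ ψ d.2) p) +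
  ∑ c, linCoef S c (fun a => comp φ ψ a p) * sd c.1 (sd c.2.1 (sd c.2.2.1 (ψ c.2.2.2))) p

lemma reducedBox_lorentz (B : Spacetime → Matrix (Fin 3) (Fin 3) ℝ) (u : Spacetime → ℝ)
    (p : Spacetime) : reducedBox (fun q => lorentz (B q)) u p =
      -residual (fun j k q => B q j k) u p := by
  simp only [reducedBox, residual, Fin.sum_univ_succ (n := 3), lorentz, Matrix.of_apply,
    Fin.cons_zero, Fin.cons_succ, sd]
  simp only [neg_mul, one_mul, zero_mul, Finset.sum_const_zero, add_zero, zero_add]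
  ring

lemma residual_div {S : WaveSystem} {T : ℝ} {φ ψ : Field} (h : IsSolution S T φ ψ) {p : Spacetime}
    (hp : p.1 ∈ Icc 0 T) : residual (gMet S φ ψ) (div φ) p = -divSource S φ ψ p := by
  have h1 := h.faster p hp
  rw [source_eq, reducedBox_lorentz] at h1
  rw [divSource, ← h1, neg_neg]
  rfl

namespace Sit

variable {S : WaveSystem} {σ : ℝ} {K : Set (Grad × Grad)} {A : ℝ≥0}

lemma hs_sd_comp (c : Fin 3 × Comp) :
    HsBounded (1 + σ) fun z : Sit S σ K A => slice z.t (sd c.1 (comp z.φ z.ψ c.2)) := by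
  have h := (hs_comp (S := S) (σ := σ) (K := K) (A := A) c.2).der c.1 (s' := 1 + σ) (by linarith)
  simpa only [der_slice ((Sit.hyp _).contDiff_comp c.2)] using h

lemma contDiff_comp_fun {G : (Comp → ℝ) → ℝ} (hG : ContDiff ℝ ∞ G) (z : Sit S σ K A) :
    ContDiff ℝ ∞ fun p => G fun a => comp z.φ z.ψ a p :=
  contDiff_comp_pi hG z.hyp.contDiff_comp

lemma contDiff_gMet (z : Sit S σ K A) (j k : Fin 3) : ContDiff ℝ ∞ (gMet S z.φ z.ψ j k) :=
  contDiff_comp_fun (contDiff_gCoef S j k) z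

/-- The terms of the inhomogeneity that are quadratic in the second derivatives. -/
lemma wle_quad (hσ : 0 < σ) (hσ' : σ < 1 / 2) {G : (Comp → ℝ) → ℝ} (hG : ContDiff ℝ ∞ G)
    (c d : Fin 3 × Comp) :
    WLe (1 + σ) (fun z : Sit S σ K A => lam z.φ z.t) fun z k n => nrm (dif (step n k)
      (dif (step n k) fun x => (G (fun a => comp z.φ z.ψ a (z.t, x)) *
        sd c.1 (comp z.φ z.ψ c.2) (z.t, x)) * sd d.1 (comp z.φ z.ψ d.2) (z.t, x))) := by
  have hcoef := coef_comp (S := S) (K := K) (A := A) hσ hσ' hG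
  obtain ⟨L, hL⟩ := hcoef.sup
  obtain ⟨B, hB⟩ := abs_pd_comp_le (S := S) (K := K) (A := A) hσ
  have hH := fun c => hs_sd_comp (S := S) (σ := σ) (K := K) (A := A) c
  have hw := hcoef.wsum_mul_der hσ hσ' (hs_comp c.2) c.1
  simp only [der_slice ((Sit.hyp _).contDiff_comp c.2)] at hw
  refine wsum_mul_tame (f := fun (z : Sit S σ K A) x => G (fun a => comp z.φ z.ψ a (z.t, x)) *
        sd c.1 (comp z.φ z.ψ c.2) (z.t, x))
    (g := fun z x => sd d.1 (comp z.φ z.ψ d.2) (z.t, x))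
    (fun z => (hcoef.cont z).mul ((hH c).isHinf z).continuous)
    (fun z => ((hH d).isHinf z).continuous) (fun z => ?_) (fun z => ?_)
    (fun z => lt_of_lt_of_le one_pos (one_le_lam _ _)) ⟨L * B, fun z x => ?_⟩
    ⟨B, fun z x => hB z _ _ x⟩ hw ((hH d).wsum_bound (by linarith) 2 (by push_cast; linarith))
  · exact (nrm_mul_le L (hL z)).trans_lt
      (ENNReal.mul_lt_top ENNReal.coe_lt_top ((hH c).isHinf z).memLp.2)
  · exact ((hH d).isHinf z).memLp.2
  · rw [abs_mul]
    push_cast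
    rw [mul_assoc]
    exact mul_le_mul (hL z x) (hB z _ _ x) (abs_nonneg _) (NNReal.coe_nonneg _)

/-- The terms of the inhomogeneity that are linear in the third derivatives. -/
lemma wle_lin (hσ : 0 < σ) (hσ' : σ < 1 / 2) {G : (Comp → ℝ) → ℝ} (hG : ContDiff ℝ ∞ G)
    (c : Fin 3 × Fin 3 × Fin 3 × Fin 3) :
    WLe (1 + σ) (fun z : Sit S σ K A => lam z.φ z.t) fun z k n => nrm (dif (step n k)
      (dif (step n k) fun x => G (fun a => comp z.φ z.ψ a (z.t, x)) *
        sd c.1 (sd c.2.1 (sd c.2.2.1 (z.ψ c.2.2.2))) (z.t, x))) := by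
  have hw := (coef_comp (S := S) (K := K) (A := A) hσ hσ' hG).wsum_mul_der hσ hσ'
    (hs_pd_sdψ c.2.1.succ c.2.2.1 c.2.2.2) c.1
  simp only [der_slice (((Sit.hyp _).goodψ.good c.2.2.1 c.2.2.2).pd c.2.1.succ).smooth] at hw
  exact WLe.of_le (fun z => one_le_lam _ _) hw

lemma wle_divSource (hσ : 0 < σ) (hσ' : σ < 1 / 2) :
    WLe (1 + σ) (fun z : Sit S σ K A => lam z.φ z.t) fun z k n =>
      nrm (dif (step n k) (dif (step n k) (slice z.t (divSource S z.φ z.ψ)))) := by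
  have h1 := WLe.sum fun c => WLe.sum fun d =>
    wle_quad (S := S) (K := K) (A := A) hσ hσ' (contDiff_quadCoef S c d) c d
  have h2 := WLe.sum fun c =>
    wle_lin (S := S) (K := K) (A := A) hσ hσ' (contDiff_linCoef S c) c
  refine (h1.add h2).mono fun z k n => ?_
  have hc : ∀ {G : (Comp → ℝ) → ℝ}, ContDiff ℝ ∞ G → Continuous fun x =>
      G fun a => comp z.φ z.ψ a (z.t, x) := fun hG =>
    continuous_slice (contDiff_comp_fun hG z).continuous z.t
  have hH : ∀ c : Fin 3 × Comp, Continuous fun x => sd c.1 (comp z.φ z.ψ c.2) (z.t, x) := fun c =>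
    continuous_slice ((z.hyp.good_comp c.2).sd c.1).continuous z.t
  have hΨ : ∀ c : Fin 3 × Fin 3 × Fin 3 × Fin 3, Continuous fun x =>
      sd c.1 (sd c.2.1 (sd c.2.2.1 (z.ψ c.2.2.2))) (z.t, x) := fun c =>
    continuous_slice (((z.hyp.goodψ.good _ _).sd _).sd _).continuous z.t
  have e : slice z.t (divSource S z.φ z.ψ) = fun x =>
    (∑ c, ∑ d, quadCoef S c d (fun a => comp z.φ z.ψ a (z.t, x)) *
      sd c.1 (comp z.φ z.ψ c.2) (z.t, x) * sd d.1 (comp z.φ z.ψ d.2) (z.t, x)) +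
    ∑ c, linCoef S c (fun a => comp z.φ z.ψ a (z.t, x)) *
      sd c.1 (sd c.2.1 (sd c.2.2.1 (z.ψ c.2.2.2))) (z.t, x) := rfl
  have dif_add : ∀ (h : Space) (F G : Space → ℝ), dif h (fun x => F x + G x) =
      fun x => dif h F x + dif h G x := fun h F G => by ext x; simp only [dif]; ring
  rw [e]
  simp only [dif_add, dif_sum]
  have c1 : ∀ c d : Fin 3 × Comp, Continuous (dif (step n k) (dif (step n k) fun x =>
      quadCoef S c d (fun a => comp z.φ z.ψ a (z.t, x)) * sd c.1 (comp z.φ z.ψ c.2) (z.t, x) *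
        sd d.1 (comp z.φ z.ψ d.2) (z.t, x))) := fun c d =>
    continuous_dif (continuous_dif (((hc (contDiff_quadCoef S c d)).mul (hH c)).mul (hH d)) _) _
  have c2 : ∀ c, Continuous (dif (step n k) (dif (step n k) fun x =>
      linCoef S c (fun a => comp z.φ z.ψ a (z.t, x)) *
        sd c.1 (sd c.2.1 (sd c.2.2.1 (z.ψ c.2.2.2))) (z.t, x))) := fun c =>
    continuous_dif (continuous_dif ((hc (contDiff_linCoef S c)).mul (hΨ c)) _) _
  refine (nrm_add_le (continuous_finsetSum _ fun c _ => continuous_finsetSum _ fun d _ => c1 c d)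
    (continuous_finsetSum _ fun c _ => c2 c)).trans (add_le_add ?_ ?_)
  · refine (nrm_sum_le _ fun c => continuous_finsetSum _ fun d _ => c1 c d).trans
      (Finset.sum_le_sum fun c _ => nrm_sum_le _ fun d => c1 c d)
  · exact nrm_sum_le _ c2

lemma slice_residual_div (z : Sit S σ K A) :
    slice z.t (residual (gMet S z.φ z.ψ) (div z.φ)) = fun x => -slice z.t (divSource S z.φ z.ψ) x := by
  ext x
  exact residual_div z.hyp.sol z.mem

lemma abs_sd_div_le_lam (z : Sit S σ K A) (k : Fin 3) (x : Space) :
    |slice z.t (sd k (div z.φ)) x| ≤ (3 : ℝ≥0) * lam z.φ z.t := by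
  have e : sd k (div z.φ) = fun p => ∑ i, sd k (sd i (z.φ i)) p :=
    pd_sum _ (fun i => (z.hyp.goodφ.good i i).smooth) _
  simp only [slice, e]
  refine (Finset.abs_sum_le_sum_abs _ _).trans ((Finset.sum_le_sum fun i _ =>
    z.hyp.goodφ.abs_le_lam (p := (z.t, x)) z.mem k.succ i i).trans (le_of_eq ?_))
  simp

/-- The inhomogeneity of the equation for the third differences of `div φ`. -/
lemma wle_residual_div (hσ : 0 < σ) (hσ' : σ < 1 / 2) :
    WLe (1 + σ) (fun z : Sit S σ K A => lam z.φ z.t) fun z k n =>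
      nrm (slice z.t (residual (gMet S z.φ z.ψ) (stDif3 (step n k) (div z.φ)))) := by
  have h1 : ∀ j k, WLe (1 + σ) (fun z : Sit S σ K A => lam z.φ z.t) fun z i n =>
      nrm (fun x => dif3 (step n i) (fun x => slice z.t (gMet S z.φ z.ψ j k) x *
          der j (slice z.t (sd k (div z.φ))) x) x -
        slice z.t (gMet S z.φ z.ψ j k) x *
          dif3 (step n i) (der j (slice z.t (sd k (div z.φ)))) x) := by
    intro j k
    obtain ⟨L, hL⟩ := abs_pd_comp_fun_le (S := S) (K := K) (A := A) hσ (contDiff_gCoef S j k)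
    have hcoef : Coef σ fun z : Sit S σ K A => slice z.t (gMet S z.φ z.ψ j k) :=
      coef_comp (S := S) (K := K) (A := A) hσ hσ' (contDiff_gCoef S j k)
    have hder : ∀ (z : Sit S σ K A) i x, |der i (slice z.t (gMet S z.φ z.ψ j k)) x| ≤
        L * lam z.φ z.t := by
      intro z i x
      rw [der_slice (contDiff_gMet z j k) z.t i]
      exact hL z i.succ x
    exact hcoef.wsum_commutator hσ hσ' (fun z => contDiff_slice (contDiff_gMet z j k) z.t)
      (hs_sd_div k) hder (fun z x => abs_sd_div_le_lam z k x) j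
  have h2 := ((wle_divSource (S := S) (K := K) (A := A) hσ hσ').const_mul 2).add
    (WLe.sum fun j => WLe.sum fun k => h1 j k)
  refine h2.mono fun z i n => ?_
  refine (nrm_residual_stDif3_le (contDiff_gMet z) z.hyp.goodφ.div.smooth (step n i) z.t).trans
    (add_le_add ?_ le_rfl)
  have hcs : Continuous (slice z.t (divSource S z.φ z.ψ)) := by
    have := continuous_slice (contDiff_residual (contDiff_gMet z)
      z.hyp.goodφ.div.smooth).continuous z.t
    rw [slice_residual_div] at this
    exact this.neg.congr fun x => neg_neg _
  rw [slice_residual_div]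
  have e : (dif3 (step n i) fun x => -slice z.t (divSource S z.φ z.ψ) x) =
      fun x => -1 * dif3 (step n i) (slice z.t (divSource S z.φ z.ψ)) x := by
    ext x; simp only [dif3, dif]; ring
  rw [e, nrm_const_mul]
  simpa using nrm_dif3_le_dif hcs (step n i)

end Sit

end

section

/-! ### The geometric wave operator -/

lemma det_lorentz (B : Matrix (Fin 3) (Fin 3) ℝ) : (lorentz B).det = -B.det := by
  rw [Matrix.det_succ_row_zero, Fin.sum_univ_succ]
  have h1 : (lorentz B).submatrix Fin.succ (Fin.succAbove 0) = B := by
    ext j k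
    simp [lorentz]
  have h2 : ∀ k : Fin 3, lorentz B 0 k.succ = 0 := fun k => by simp [lorentz]
  rw [h1]
  simp [h2]
  simp [lorentz]

lemma density_lorentz (B : Spacetime → Matrix (Fin 3) (Fin 3) ℝ) :
    density (fun q => lorentz (B q)) = fun q => (√|(B q).det|)⁻¹ := by
  ext q
  rw [density, Matrix.det_nonsing_inv, Ring.inverse_eq_inv', det_lorentz, abs_inv, abs_neg,
    Real.sqrt_inv]

/-- Differentiation of a product with the inverse square root of a positive function. -/
lemma pd_inv_sqrt_mul {d V : Spacetime → ℝ} (hd : ContDiff ℝ ∞ d) (hV : ContDiff ℝ ∞ V)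
    {p : Spacetime} (hp : 0 < d p) (α : Fin 4) :
    ((√|d p|)⁻¹)⁻¹ * pd α (fun q => (√|d q|)⁻¹ * V q) p =
      pd α V p - (d p)⁻¹ / 2 * pd α d p * V p := by
  have hd' : DifferentiableAt ℝ d p := hd.differentiable (by simp) p
  have hV' : DifferentiableAt ℝ V p := hV.differentiable (by simp) p
  have hev : (fun q => (√|d q|)⁻¹ * V q) =ᶠ[nhds p] fun q => (√(d q))⁻¹ * V q := by
    filter_upwards [hd.continuous.continuousAt.eventually (lt_mem_nhds hp)] with q hq
    rw [abs_of_pos hq]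
  have hs : √(d p) ≠ 0 := (Real.sqrt_pos.2 hp).ne'
  have h1 : HasFDerivAt (fun q => √(d q)) ((1 / (2 * √(d p))) • fderiv ℝ d p) p :=
    hd'.hasFDerivAt.sqrt hp.ne'
  have h2 : HasFDerivAt (fun q => (√(d q))⁻¹) (-((√(d p)) ^ 2)⁻¹ • ((1 / (2 * √(d p))) • fderiv ℝ d p)) p := by
    have := (hasDerivAt_inv hs).comp_hasFDerivAt p h1
    exact this
  have h3 := (h2.mul hV'.hasFDerivAt).fderiv
  unfold pd
  rw [hev.fderiv_eq]
  rw [show (fun q => (√(d q))⁻¹ * V q) = (fun q => (√(d q))⁻¹) * V from rfl, h3, abs_of_pos hp]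
  simp only [add_apply, smul_apply, smul_eq_mul]
  have h4 : √(d p) ^ 2 = d p := Real.sq_sqrt hp.le
  rw [h4]
  field_simp
  ring

lemma geometricBox_lorentz {B : Spacetime → Matrix (Fin 3) (Fin 3) ℝ} {u d : Spacetime → ℝ}
    (hB : ∀ j k, ContDiff ℝ ∞ fun q => B q j k) (hu : ContDiff ℝ ∞ u) (hd : ContDiff ℝ ∞ d)
    (hdB : ∀ q, d q = (B q).det) {p : Spacetime} (hp : 0 < d p) :
    residual (fun j k q => B q j k) u p = -geometricBox (fun q => lorentz (B q)) u p +
      (d p)⁻¹ / 2 * pd 0 d p * pd 0 u p + ∑ j : Fin 3, ∑ k, pd j.succ (fun q => B q j k) p *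
        pd k.succ u p -
      ∑ j : Fin 3, (d p)⁻¹ / 2 * pd j.succ d p * ∑ k : Fin 3, B p j k * pd k.succ u p := by
  have e : ∀ q, (B q).det = d q := fun q => (hdB q).symm
  have hbox : geometricBox (fun q => lorentz (B q)) u p = ∑ α, ((√|d p|)⁻¹)⁻¹ *
      pd α (fun q => (√|d q|)⁻¹ * ∑ β, lorentz (B q) α β * pd β u q) p := by
    simp only [geometricBox, density_lorentz, e]
    exact Finset.mul_sum _ _ _
  rw [hbox]
  have hV : ∀ α : Fin 4, ContDiff ℝ ∞ fun q => ∑ β, lorentz (B q) α β * pd β u q := by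
    intro α
    refine ContDiff.sum fun β _ => ContDiff.mul ?_ (contDiff_pd hu β)
    refine Fin.cases ?_ (fun j => ?_) α <;> refine Fin.cases ?_ (fun k => ?_) β <;>
      simp only [lorentz, Matrix.of_apply, Fin.cons_zero, Fin.cons_succ]
    · exact contDiff_const
    · exact contDiff_const
    · exact contDiff_const
    · exact hB j k
  rw [Finset.sum_congr rfl fun α _ => pd_inv_sqrt_mul hd (hV α) hp α]
  have h0 : (fun q => ∑ β, lorentz (B q) 0 β * pd β u q) = fun q => -1 * pd 0 u q := by
    ext q
    simp [Fin.sum_univ_succ (n := 3), lorentz]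
  have hj : ∀ j : Fin 3, (fun q => ∑ β, lorentz (B q) j.succ β * pd β u q) =
      fun q => ∑ k : Fin 3, B q j k * pd k.succ u q := by
    intro j
    ext q
    rw [Fin.sum_univ_succ]
    simp [lorentz]
  have h0' := congrFun h0 p
  have hj' := fun j => congrFun (hj j) p
  rw [Fin.sum_univ_succ]
  simp only [h0, hj, h0', hj', pd_const_mul (contDiff_pd hu 0)]
  have h5 : ∀ j : Fin 3, pd j.succ (fun q => ∑ k : Fin 3, B q j k * pd k.succ u q) p =
      ∑ k : Fin 3, (B p j k * pd j.succ (pd k.succ u) p +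
        pd j.succ (fun q => B q j k) p * pd k.succ u p) := by
    intro j
    rw [pd_sum _ fun k => (hB j k).mul (contDiff_pd hu _)]
    refine Finset.sum_congr rfl fun k _ => ?_
    rw [pd_mul (hB j k) (contDiff_pd hu _)]
  simp only [h5, residual, sd, Finset.sum_sub_distrib, Finset.sum_add_distrib]
  ring

/-- A smooth function that agrees with the inverse away from zero. -/
lemma exists_smooth_inv {c : ℝ} (hc : 0 < c) :
    ∃ f : ℝ → ℝ, ContDiff ℝ ∞ f ∧ ∀ x, c ≤ x → f x = x⁻¹ := by
  have hl : ContDiff ℝ ∞ fun x : ℝ => Real.smoothTransition (2 * x / c - 1) :=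
    Real.smoothTransition.contDiff.comp (by fun_prop)
  refine ⟨fun x => (x * Real.smoothTransition (2 * x / c - 1) + 1 -
    Real.smoothTransition (2 * x / c - 1))⁻¹, ?_, fun x hx => ?_⟩
  · refine ContDiff.inv (((contDiff_id.mul hl).add contDiff_const).sub hl) fun x => ?_
    have h0 := Real.smoothTransition.nonneg (2 * x / c - 1)
    have h1 := Real.smoothTransition.le_one (2 * x / c - 1)
    rcases le_or_gt x 0 with hx | hx
    · rw [Real.smoothTransition.zero_of_nonpos]
      · norm_num
      · have : 2 * x / c ≤ 0 := div_nonpos_of_nonpos_of_nonneg (by linarith) hc.le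
        linarith
    · refine ne_of_gt ?_
      rcases h0.eq_or_lt with h | h
      · rw [← h]; norm_num
      · nlinarith [mul_pos hx h]
  · have : Real.smoothTransition (2 * x / c - 1) = 1 := by
      apply Real.smoothTransition.one_of_one_le
      have : 2 ≤ 2 * x / c := by rw [le_div_iff₀ hc]; linarith
      linarith
    simp only [this, mul_one]
    congr 1; ring

/-! ### The slower equation -/

/-- The coefficients of the slower metric as functions of the components of the gradient. -/
def hCoef (S : WaveSystem) (j k : Fin 3) (y : Fin 3 × Fin 3 → ℝ) : ℝ :=
  S.hInv (fun j i => y (j, i)) j k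

lemma contDiff_hCoef (S : WaveSystem) (j k : Fin 3) : ContDiff ℝ ∞ (hCoef S j k) := by
  have h0 : ContDiff ℝ ∞ fun y : Fin 3 × Fin 3 → ℝ => (fun j i => y (j, i) : Grad) := by fun_prop
  have h : ContDiff ℝ ∞ fun y : Fin 3 × Fin 3 → ℝ => S.fh (fun j i => y (j, i)) j k :=
    contDiff_pi.1 (contDiff_pi.1 (S.fh_smooth.comp h0) j) k
  exact contDiff_const.add h

/-- The determinant of the slower metric as a function of the components of the gradient. -/
def hDet (S : WaveSystem) (y : Fin 3 × Fin 3 → ℝ) : ℝ := (S.hInv fun j i => y (j, i)).det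

lemma contDiff_hDet (S : WaveSystem) : ContDiff ℝ ∞ (hDet S) := by
  have h := contDiff_hCoef S
  have e : hDet S = fun y => hCoef S 0 0 y * hCoef S 1 1 y * hCoef S 2 2 y -
      hCoef S 0 0 y * hCoef S 1 2 y * hCoef S 2 1 y - hCoef S 0 1 y * hCoef S 1 0 y * hCoef S 2 2 y +
      hCoef S 0 1 y * hCoef S 1 2 y * hCoef S 2 0 y + hCoef S 0 2 y * hCoef S 1 0 y * hCoef S 2 1 y -
      hCoef S 0 2 y * hCoef S 1 1 y * hCoef S 2 0 y := by
    ext y; exact Matrix.det_fin_three _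
  rw [e]
  exact ((((((h 0 0).mul (h 1 1)).mul (h 2 2)).sub (((h 0 0).mul (h 1 2)).mul (h 2 1))).sub
    (((h 0 1).mul (h 1 0)).mul (h 2 2))).add (((h 0 1).mul (h 1 2)).mul (h 2 0))).add
    (((h 0 2).mul (h 1 0)).mul (h 2 1)) |>.sub (((h 0 2).mul (h 1 1)).mul (h 2 0))

/-- The spatial part of the inverse of the slower metric along a solution. -/
def hMet (S : WaveSystem) (ψ : Field) (j k : Fin 3) : Spacetime → ℝ :=
  fun p => hCoef S j k fun a => sd a.1 (ψ a.2) p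

/-- Indices of the components of `∂ψ` and of its space-time derivatives. -/
abbrev Jet := (Fin 3 × Fin 3) ⊕ (Fin 4 × Fin 3 × Fin 3)

/-- The components of `∂ψ` and of its space-time derivatives. -/
def jet (ψ : Field) : Jet → Spacetime → ℝ
  | Sum.inl a => sd a.1 (ψ a.2)
  | Sum.inr b => pd b.1 (sd b.2.1 (ψ b.2.2))

/-- The derivative of a function of `∂ψ` as a function of the jet. -/
def jetDer (G : (Fin 3 × Fin 3 → ℝ) → ℝ) (α : Fin 4) (y : Jet → ℝ) : ℝ :=
  ∑ a, partialDeriv G a (fun a => y (Sum.inl a)) * y (Sum.inr (α, a))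

lemma contDiff_jetDer {G : (Fin 3 × Fin 3 → ℝ) → ℝ} (hG : ContDiff ℝ ∞ G) (α : Fin 4) :
    ContDiff ℝ ∞ (jetDer G α) := by
  refine ContDiff.sum fun a _ => ContDiff.mul ?_ (by fun_prop)
  exact (contDiff_partialDeriv hG a).comp (by fun_prop)

lemma pd_eq_jetDer {G : (Fin 3 × Fin 3 → ℝ) → ℝ} (hG : ContDiff ℝ ∞ G) {ψ : Field}
    (hψ : ∀ i, ContDiff ℝ ∞ (ψ i)) (α : Fin 4) (p : Spacetime) :
    pd α (fun p => G fun a => sd a.1 (ψ a.2) p) p = jetDer G α fun a => jet ψ a p :=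
  pd_comp hG (fun _ => contDiff_sd (hψ _) _) α p

/-- The derivatives of `curl ψ` as functions of the jet. -/
def jetCurl (i : Fin 3) (β : Fin 4) (y : Jet → ℝ) : ℝ :=
  y (Sum.inr (β, i + 1, i + 2)) - y (Sum.inr (β, i + 2, i + 1))

/-- The inhomogeneity of the slower equation as a function of the jet, with `ι` in place of the
inverse. -/
def curlSource (S : WaveSystem) (ι : ℝ → ℝ) (i : Fin 3) (y : Jet → ℝ) : ℝ :=
  -S.quadCurl i (fun j k => y (Sum.inl (j, k))) (fun j k l => y (Sum.inr (j.succ, k, l)))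
    (fun j k l => y (Sum.inr (j.succ, k, l))) +
  ι (hDet S fun a => y (Sum.inl a)) / 2 * jetDer (hDet S) 0 y * jetCurl i 0 y +
  ∑ j : Fin 3, ∑ k : Fin 3, jetDer (hCoef S j k) j.succ y * jetCurl i k.succ y -
  ∑ j : Fin 3, ι (hDet S fun a => y (Sum.inl a)) / 2 * jetDer (hDet S) j.succ y *
    ∑ k : Fin 3, hCoef S j k (fun a => y (Sum.inl a)) * jetCurl i k.succ y

lemma contDiff_curlSource (S : WaveSystem) {ι : ℝ → ℝ} (hι : ContDiff ℝ ∞ ι) (i : Fin 3) :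
    ContDiff ℝ ∞ (curlSource S ι i) := by
  have hc : ∀ β, ContDiff ℝ ∞ (jetCurl i β) := fun β => by unfold jetCurl; fun_prop
  have hq : ContDiff ℝ ∞ fun y : Jet → ℝ => (fun a => y (Sum.inl a) : Fin 3 × Fin 3 → ℝ) := by
    fun_prop
  have hg : ContDiff ℝ ∞ fun y : Jet → ℝ => (fun j k => y (Sum.inl (j, k)) : Grad) := by fun_prop
  have hh : ContDiff ℝ ∞ fun y : Jet → ℝ => (fun j k l => y (Sum.inr (j.succ, k, l)) : Hess) := by
    fun_prop
  have h1 : ContDiff ℝ ∞ fun y : Jet → ℝ => ι (hDet S fun a => y (Sum.inl a)) / 2 :=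
    (hι.comp ((contDiff_hDet S).comp hq)).div_const 2
  have h2 := contDiff_jetDer (contDiff_hDet S)
  refine ((ContDiff.add ?_ ((h1.mul (h2 0)).mul (hc 0))).add ?_).sub ?_
  · exact ((((S.quadCurl_smooth i).comp hg).clm_apply hh).clm_apply hh).neg
  · exact ContDiff.sum fun j _ => ContDiff.sum fun k _ =>
      (contDiff_jetDer (contDiff_hCoef S j k) _).mul (hc _)
  · exact ContDiff.sum fun j _ => (h1.mul (h2 _)).mul
      (ContDiff.sum fun k _ => ((contDiff_hCoef S j k).comp hq).mul (hc _))

lemma curlSource_of_zero (S : WaveSystem) (ι : ℝ → ℝ) (i : Fin 3) {y : Jet → ℝ}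
    (hy : ∀ b, y (Sum.inr b) = 0) : curlSource S ι i y = 0 := by
  have e : (fun (j k l : Fin 3) => y (Sum.inr (j.succ, k, l))) = (0 : Hess) := by
    funext j k l; exact hy _
  rw [curlSource, e]
  simp [jetCurl, hy]

lemma residual_curl {S : WaveSystem} {T : ℝ} {φ ψ : Field} (h : IsSolution S T φ ψ) {ι : ℝ → ℝ}
    {p : Spacetime} (hp : p.1 ∈ Icc 0 T) (hpos : 0 < (S.hInv (grad ψ p)).det)
    (hι : ι (S.hInv (grad ψ p)).det = ((S.hInv (grad ψ p)).det)⁻¹) (i : Fin 3) :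
    residual (hMet S ψ) (curl ψ i) p = curlSource S ι i fun a => jet ψ a p := by
  have hψ := h.smooth_curl.goodField
  have hsm : ∀ a : Fin 3 × Fin 3, ContDiff ℝ ∞ (sd a.1 (ψ a.2)) := fun a => (hψ.good _ _).smooth
  have e := geometricBox_lorentz (B := fun q => S.hInv (grad ψ q)) (u := curl ψ i)
    (d := fun q => hDet S fun a => sd a.1 (ψ a.2) q)
    (fun j k => contDiff_comp_pi (contDiff_hCoef S j k) hsm) (hψ.curl i).smooth
    (contDiff_comp_pi (contDiff_hDet S) hsm) (fun q => rfl) (p := p) hpos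
  have hcurl : ∀ β, pd β (curl ψ i) p = jetCurl i β fun a => jet ψ a p := fun β =>
    congrFun (pd_sub (hψ.good (i + 1) (i + 2)).smooth (hψ.good (i + 2) (i + 1)).smooth β) p
  have hB : ∀ (j k : Fin 3) (α : Fin 4), pd α (fun q => S.hInv (grad ψ q) j k) p =
      jetDer (hCoef S j k) α fun a => jet ψ a p := fun j k α =>
    pd_eq_jetDer (contDiff_hCoef S j k) hψ.smooth α p
  rw [h.slower p hp i] at e
  simp only [hcurl, hB, pd_eq_jetDer (contDiff_hDet S) hψ.smooth] at e
  refine Eq.trans e ?_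
  have hι' : ι (hDet S fun a => sd a.1 (ψ a.2) p) = (hDet S fun a => sd a.1 (ψ a.2) p)⁻¹ := hι
  rw [← hι']
  rfl

end

section

/-- Uniform hyperbolicity on a set of values of the gradients. -/
structure Elliptic (S : WaveSystem) (c C : ℝ≥0) (K : Set (Grad × Grad)) : Prop where
  pos : 0 < c
  faster : ∀ P ∈ K, ∀ ξ : Fin 3 → ℝ, c * ∑ j, ξ j ^ 2 ≤ ∑ j, ∑ k, S.gInv P j k * (ξ j * ξ k) ∧
    ∑ j, ∑ k, S.gInv P j k * (ξ j * ξ k) ≤ C * ∑ j, ξ j ^ 2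
  slower : ∀ P ∈ K, ∀ ξ : Fin 3 → ℝ, c * ∑ j, ξ j ^ 2 ≤ ∑ j, ∑ k, S.hInv P.2 j k * (ξ j * ξ k) ∧
    ∑ j, ∑ k, S.hInv P.2 j k * (ξ j * ξ k) ≤ C * ∑ j, ξ j ^ 2
  det : ∀ P ∈ K, (c : ℝ) ≤ (S.hInv P.2).det
  abs_le : ∀ P ∈ K, ∀ j k, |S.gInv P j k| ≤ C

lemma nrm_dtt_le {a : Fin 3 → Fin 3 → Spacetime → ℝ} {w : Spacetime → ℝ} {τ : ℝ} {L : ℝ≥0}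
    (ha : ∀ j k, ContDiff ℝ ∞ (a j k)) (hw : ContDiff ℝ ∞ w) (hL : ∀ j k x, |a j k (τ, x)| ≤ L) :
    nrm (slice τ (pd 0 (pd 0 w))) ≤ nrm (slice τ (residual a w)) +
      ∑ j, ∑ k, L * nrm (slice τ (sd j (sd k w))) := by
  have e : slice τ (pd 0 (pd 0 w)) = fun x => slice τ (residual a w) x +
      ∑ j, ∑ k, slice τ (a j k) x * slice τ (sd j (sd k w)) x := by
    ext x; simp [slice, residual]
  have hc : ∀ j k, Continuous fun x => slice τ (a j k) x * slice τ (sd j (sd k w)) x := fun j k =>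
    (continuous_slice (ha j k).continuous τ).mul
      (continuous_slice (contDiff_sd (contDiff_sd hw k) j).continuous τ)
  rw [e]
  refine (nrm_add_le (continuous_slice (contDiff_residual ha hw).continuous τ)
    (continuous_finsetSum _ fun j _ => continuous_finsetSum _ fun k _ => hc j k)).trans
    (add_le_add le_rfl ?_)
  refine (nrm_sum_le _ fun j => continuous_finsetSum _ fun k _ => hc j k).trans
    (Finset.sum_le_sum fun j _ => (nrm_sum_le _ fun k => hc j k).trans
      (Finset.sum_le_sum fun k _ => nrm_mul_le L fun x => hL j k x))

lemma Good.nrm_sd_sd_le {T : ℝ} {w : Spacetime → ℝ} (hw : Good T w) {τ : ℝ} (hτ : τ ∈ Icc 0 T)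
    (j k : Fin 3) {s : ℝ} (hs : 2 ≤ s) :
    nrm (slice τ (ElasticWave.sd j (ElasticWave.sd k w))) ≤ 49 * sobolevNorm s (slice τ w) := by
  rw [← der_slice (hw.sd k).smooth, ← der_slice hw.smooth]
  exact nrm_der_der_le_sobolev (hw.isHinf hτ) j k hs

namespace Sit

variable {S : WaveSystem} {σ : ℝ} {K : Set (Grad × Grad)} {A : ℝ≥0}

lemma hs_jet (a : Jet) : HsBounded (2 + σ) fun z : Sit S σ K A => slice z.t (jet z.ψ a) := by
  rcases a with a | a
  · exact (hs_sdψ a.1 a.2).mono (by linarith)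
  · exact hs_pd_sdψ a.1 a.2.1 a.2.2

lemma coef_jet (hσ : 0 < σ) (hσ' : σ < 1 / 2) {G : (Jet → ℝ) → ℝ} (hG : ContDiff ℝ ∞ G) :
    Coef σ fun (z : Sit S σ K A) x => G fun a => jet z.ψ a (z.t, x) :=
  Coef.comp hσ' (P := fun a (z : Sit S σ K A) => slice z.t (jet z.ψ a))
    (fun a => (hs_jet a).coef hσ hσ') hG

lemma contDiff_hMet (z : Sit S σ K A) (j k : Fin 3) : ContDiff ℝ ∞ (hMet S z.ψ j k) :=
  contDiff_comp_pi (contDiff_hCoef S j k) fun _ => (z.hyp.goodψ.good _ _).smooth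

lemma slice_residual_curl {c : ℝ} (hc : 0 < c) (hK : ∀ P ∈ K, c ≤ (S.hInv P.2).det) {ι : ℝ → ℝ}
    (hι : ∀ x, c ≤ x → ι x = x⁻¹) (z : Sit S σ K A) (i : Fin 3) :
    slice z.t (residual (hMet S z.ψ) (curl z.ψ i)) =
      fun x => curlSource S ι i fun a => jet z.ψ a (z.t, x) := by
  ext x
  have h := hK _ (z.hyp.mem (z.t, x) z.mem)
  exact residual_curl z.hyp.sol z.mem (hc.trans_le h) (hι _ h) i

/-- The inhomogeneity of the equation for the third differences of `curl ψ`. -/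
lemma wle_residual_curl (hσ : 0 < σ) (hσ' : σ < 1 / 2) {c : ℝ} (hc : 0 < c)
    (hK : ∀ P ∈ K, c ≤ (S.hInv P.2).det) (i : Fin 3) :
    WLe (2 + σ) (fun z : Sit S σ K A => lam z.φ z.t) fun z l n =>
      nrm (slice z.t (residual (hMet S z.ψ) (stDif3 (step n l) (curl z.ψ i)))) := by
  obtain ⟨ι, hιs, hι⟩ := exists_smooth_inv hc
  have h1 : ∀ j k, WLe (2 + σ) (fun z : Sit S σ K A => lam z.φ z.t) fun z l n =>
      nrm (fun x => dif3 (step n l) (fun x => slice z.t (hMet S z.ψ j k) x *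
          der j (slice z.t (sd k (curl z.ψ i))) x) x -
        slice z.t (hMet S z.ψ j k) x *
          dif3 (step n l) (der j (slice z.t (sd k (curl z.ψ i)))) x) := by
    intro j k
    have hder : ∀ l, Coef σ fun z : Sit S σ K A => der l (slice z.t (hMet S z.ψ j k)) := by
      intro l
      have h := coef_jet (S := S) (K := K) (A := A) hσ hσ'
        (contDiff_jetDer (contDiff_hCoef S j k) l.succ)
      convert h using 2 with z
      rw [der_slice (contDiff_hMet z j k)]
      ext x
      exact pd_eq_jetDer (contDiff_hCoef S j k) z.hyp.goodψ.smooth l.succ (z.t, x)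
    exact WLe.of_le (fun z => one_le_lam _ _) (Coef.wsum_commutator_smooth hσ hσ'
      (fun z => contDiff_slice (contDiff_hMet z j k) z.t) hder (hs_sd_curl i k) j)
  have h0 : WLe (2 + σ) (fun z : Sit S σ K A => lam z.φ z.t) fun z l n =>
      nrm (dif3 (step n l) (slice z.t (residual (hMet S z.ψ) (curl z.ψ i)))) := by
    simp only [slice_residual_curl hc hK hι]
    exact WLe.of_le (fun z => one_le_lam _ _)
      (coef_jet (S := S) (K := K) (A := A) hσ hσ' (contDiff_curlSource S hιs i)).wsum_dif
  exact (h0.add (WLe.sum fun j => WLe.sum fun k => h1 j k)).mono fun z l n =>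
    nrm_residual_stDif3_le (contDiff_hMet z) (z.hyp.goodψ.curl i).smooth (step n l) z.t

lemma nrm_residual_curl_le (hσ : 0 < σ) {c : ℝ} (hc : 0 < c)
    (hK : ∀ P ∈ K, c ≤ (S.hInv P.2).det) (i : Fin 3) :
    ∃ C : ℝ≥0, ∀ z : Sit S σ K A,
      nrm (slice z.t (residual (hMet S z.ψ) (curl z.ψ i))) ≤ C := by
  obtain ⟨ι, hιs, hι⟩ := exists_smooth_inv hc
  choose R hR using fun a => (hs_jet (S := S) (σ := σ) (K := K) (A := A) a).sup_bound (by linarith)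
  choose N hN using fun a => (hs_jet (S := S) (σ := σ) (K := K) (A := A) a).nrm_bound (by linarith)
  obtain ⟨L, hL⟩ := exists_dif_comp_bound (contDiff_curlSource S hιs i) ((∑ a, R a : ℝ≥0) : ℝ)
  refine ⟨L * ∑ a, N a, fun z => ?_⟩
  rw [slice_residual_curl hc hK hι]
  have hc : ∀ a, Continuous fun x => |slice z.t (jet z.ψ a) x| := fun a =>
    ((hs_jet (S := S) (σ := σ) (K := K) (A := A) a).isHinf z).continuous.abs
  have h1 : nrm (fun x => ∑ a, |slice z.t (jet z.ψ a) x|) ≤ (∑ a, N a : ℝ≥0) := by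
    refine (nrm_sum_le _ hc).trans ?_
    push_cast
    refine Finset.sum_le_sum fun a _ => ?_
    rw [nrm_abs]
    exact hN a z
  refine (nrm_le_mul L (g := fun x => ∑ a, |slice z.t (jet z.ψ a) x|) fun x => ?_).trans ?_
  · set y : Jet → ℝ := fun a => jet z.ψ a (z.t, x) with hy
    set y0 : Jet → ℝ := fun a => Sum.elim (fun b => y (Sum.inl b)) (fun _ => 0) a with hy0
    have hb : ∀ a, |y a| ≤ ((∑ a, R a : ℝ≥0) : ℝ) := fun a =>
      (hR a z x).trans (by exact_mod_cast le_sum_nnreal R a)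
    have n1 : ‖y‖ ≤ ((∑ a, R a : ℝ≥0) : ℝ) := (pi_norm_le_iff_of_nonneg (NNReal.coe_nonneg _)).2 hb
    have n0 : ‖y0‖ ≤ ((∑ a, R a : ℝ≥0) : ℝ) := by
      refine (pi_norm_le_iff_of_nonneg (NNReal.coe_nonneg _)).2 fun a => ?_
      rcases a with a | a
      · exact hb (Sum.inl a)
      · simp only [hy0, Sum.elim_inr, norm_zero]; exact NNReal.coe_nonneg _
    have h2 := (hL y0 y y0 y0 n0 n1 n0 n0).2.1
    rw [curlSource_of_zero S ι i (y := y0) fun b => rfl, sub_zero] at h2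
    refine h2.trans (mul_le_mul_of_nonneg_left ?_ (NNReal.coe_nonneg _))
    rw [abs_of_nonneg (Finset.sum_nonneg fun _ _ => abs_nonneg _)]
    refine (pi_norm_le_sum_abs _).trans (Finset.sum_le_sum fun a _ => ?_)
    rcases a with a | a
    · simp [hy0, slice]
    · simp [hy0, hy, slice]
  · push_cast at h1 ⊢
    gcongr

lemma nrm_dtt_curl_le (hσ : 0 < σ) (hσ' : σ < 1 / 2) {c : ℝ} (hc : 0 < c)
    (hK : ∀ P ∈ K, c ≤ (S.hInv P.2).det) (i : Fin 3) :
    ∃ C : ℝ≥0, ∀ z : Sit S σ K A, nrm (slice z.t (pd 0 (pd 0 (curl z.ψ i)))) ≤ C := by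
  obtain ⟨B, hB⟩ := nrm_residual_curl_le (S := S) (K := K) (A := A) hσ hc hK i
  have hq : ContDiff ℝ ∞ fun y : Jet → ℝ => (fun a => y (Sum.inl a) : Fin 3 × Fin 3 → ℝ) := by
    fun_prop
  choose L hL using fun j k =>
    (coef_jet (S := S) (K := K) (A := A) hσ hσ' ((contDiff_hCoef S j k).comp hq)).sup
  refine ⟨B + ∑ _j : Fin 3, ∑ _k : Fin 3, (∑ j, ∑ k, L j k) * (49 * A), fun z => ?_⟩
  have hL' : ∀ j k x, |hMet S z.ψ j k (z.t, x)| ≤ (∑ j, ∑ k, L j k : ℝ≥0) := fun j k x =>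
    (hL j k z x).trans (by
      exact_mod_cast (le_sum_nnreal (L j) k).trans (le_sum_nnreal (fun j => ∑ k, L j k) j))
  refine (nrm_dtt_le (contDiff_hMet z) (z.hyp.goodψ.curl i).smooth hL').trans ?_
  push_cast
  refine add_le_add (hB z) (Finset.sum_le_sum fun j _ => Finset.sum_le_sum fun k _ =>
    mul_le_mul' (by push_cast; exact le_rfl)
      (((z.hyp.goodψ.curl i).nrm_sd_sd_le z.mem j k (s := 3 + σ) (by linarith)).trans
        (mul_le_mul' le_rfl (z.hyp.curl_le z.t z.mem i))))

end Sit

end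

section

/-! ### Differences of the right-hand side of the faster equation -/

/-- The right-hand side of the faster equation, solved for the second time derivative, as a
function of the gradients `P`, their derivatives `H`, the second derivatives `W` of the divergence
and the third derivatives `Ψ` of `ψ`. -/
def divRhs (S : WaveSystem) (P : Comp → Space → ℝ) (H : Fin 3 × Comp → Space → ℝ)
    (W : Fin 3 × Fin 3 → Space → ℝ) (Ψ : Fin 3 × Fin 3 × Fin 3 × Fin 3 → Space → ℝ) (x : Space) : ℝ :=
  (∑ c, gCoef S c.1 c.2 (fun a => P a x) * W c x) -
    ((∑ c : (Fin 3 × Comp) × (Fin 3 × Comp), quadCoef S c.1 c.2 (fun a => P a x) *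
      (H c.1 x * H c.2 x)) + ∑ c, linCoef S c (fun a => P a x) * Ψ c x)

lemma nrm_mul_sub_mul_le {a b v w : Space → ℝ} (ha : Continuous a) (hb : Continuous b)
    (hv : Continuous v) (hw : Continuous w) {ε L : ℝ≥0} (hε : ∀ x, |a x - b x| ≤ ε)
    (hL : ∀ x, |b x| ≤ L) :
    nrm (fun x => a x * v x - b x * w x) ≤ ε * nrm v + L * nrm (fun x => v x - w x) := by
  have e : (fun x => a x * v x - b x * w x) =
      fun x => (a x - b x) * v x + b x * (v x - w x) := by ext x; ring
  rw [e]
  exact (nrm_add_le ((ha.sub hb).mul hv) (hb.mul (hv.sub hw))).trans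
    (add_le_add (nrm_mul_le ε hε) (nrm_mul_le L hL))

lemma nrm_mul_le_of_sq {f g : Space → ℝ} (hf : Continuous f) (hg : Continuous g) {a b : ℝ≥0}
    (ha : nrm (fun x => f x ^ 2) ≤ (a ^ 2 : ℝ≥0)) (hb : nrm (fun x => g x ^ 2) ≤ (b ^ 2 : ℝ≥0)) :
    nrm (fun x => f x * g x) ≤ (a * b : ℝ≥0) := by
  refine le_of_sq_le_sq ((sq_nrm_mul_le hf hg).trans ((mul_le_mul' ha hb).trans (le_of_eq ?_)))
  push_cast; ring

lemma nrm_sub_le {f g : Space → ℝ} (hf : Continuous f) (hg : Continuous g) :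
    nrm (fun x => f x - g x) ≤ nrm f + nrm g := by
  have h := nrm_add_le hf hg.neg
  have e : nrm (-g) = nrm g := eLpNorm_neg g 2 volume
  simp only [sub_eq_add_neg]
  exact h.trans (by rw [e])

section

variable {P P' : Comp → Space → ℝ} {R e : ℝ≥0}

lemma exists_abs_comp_sub_le {G : (Comp → ℝ) → ℝ} (hG : ContDiff ℝ ∞ G) (R : ℝ≥0) :
    ∃ L : ℝ≥0, ∀ (P P' : Comp → Space → ℝ) (e : ℝ≥0), (∀ a x, |P a x| ≤ R) →
      (∀ a x, |P' a x| ≤ R) → (∀ a x, |P a x - P' a x| ≤ e) → ∀ x,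
      |G (fun a => P a x) - G (fun a => P' a x)| ≤ (L * e : ℝ≥0) ∧ |G (fun a => P' a x)| ≤ L := by
  obtain ⟨L, hL⟩ := exists_dif_comp_bound hG (R : ℝ)
  refine ⟨L, fun P P' e hP hP' he x => ?_⟩
  have n : ∀ {Q : Comp → Space → ℝ}, (∀ a x, |Q a x| ≤ R) → ‖(fun a => Q a x)‖ ≤ (R : ℝ) := fun h =>
    (pi_norm_le_iff_of_nonneg (NNReal.coe_nonneg _)).2 fun a => h a x
  have h := hL _ _ _ _ (n hP') (n hP) (n hP) (n hP)
  refine ⟨h.2.1.trans ?_, h.1⟩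
  rw [NNReal.coe_mul]
  refine mul_le_mul_of_nonneg_left ?_ (NNReal.coe_nonneg _)
  exact (pi_norm_le_iff_of_nonneg (NNReal.coe_nonneg _)).2 fun a => he a x

end

lemma exists_nrm_divRhs_sub_le (S : WaveSystem) (R B : ℝ≥0) :
    ∃ C : ℝ≥0, ∀ (L e r f : ℝ≥0) (P P' : Comp → Space → ℝ) (H H' : Fin 3 × Comp → Space → ℝ)
      (W W' : Fin 3 × Fin 3 → Space → ℝ) (Ψ Ψ' : Fin 3 × Fin 3 × Fin 3 × Fin 3 → Space → ℝ),
      (∀ a, Continuous (P a)) → (∀ a, Continuous (P' a)) → (∀ a, Continuous (H a)) →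
      (∀ a, Continuous (H' a)) → (∀ a, Continuous (W a)) → (∀ a, Continuous (W' a)) →
      (∀ a, Continuous (Ψ a)) → (∀ a, Continuous (Ψ' a)) →
      (∀ a x, |P a x| ≤ R) → (∀ a x, |P' a x| ≤ R) → (∀ a x, |P a x - P' a x| ≤ e) →
      (∀ (c : Fin 3 × Fin 3) x, |gCoef S c.1 c.2 (fun a => P' a x)| ≤ L) → (∀ c, nrm (W c) ≤ B) →
      (∀ c, nrm (Ψ c) ≤ B) → (∀ c, nrm (fun x => H c x ^ 2) ≤ (B ^ 2 : ℝ≥0)) →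
      (∀ c, nrm (fun x => H' c x ^ 2) ≤ (B ^ 2 : ℝ≥0)) →
      (∀ c, nrm (fun x => (H c x - H' c x) ^ 2) ≤ (r ^ 2 : ℝ≥0)) →
      (∀ c, nrm (fun x => Ψ c x - Ψ' c x) ≤ f) →
      nrm (fun x => divRhs S P H W Ψ x - divRhs S P' H' W' Ψ' x) ≤
        L * ∑ c, nrm (fun x => W c x - W' c x) + (C * (e + r + f) : ℝ≥0) := by
  choose Lg hLg using fun c : Fin 3 × Fin 3 => exists_abs_comp_sub_le (contDiff_gCoef S c.1 c.2) R
  choose Lq hLq using fun c : (Fin 3 × Comp) × (Fin 3 × Comp) =>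
    exists_abs_comp_sub_le (contDiff_quadCoef S c.1 c.2) R
  choose Ll hLl using fun c => exists_abs_comp_sub_le (contDiff_linCoef S c) R
  refine ⟨(∑ c, Lg c * B) + (∑ c, Lq c * (B * B + 2 * B)) + ∑ c, Ll c * (B + 1), ?_⟩
  intro L e r f P P' H H' W W' Ψ Ψ' cP cP' cH cH' cW cW' cΨ cΨ' hP hP' he hL hW hΨ hH hH' hr hf
  have hc : ∀ {G : (Comp → ℝ) → ℝ}, ContDiff ℝ ∞ G → Continuous (fun x => G fun a => P a x) :=
    fun hG => hG.continuous.comp (continuous_pi cP)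
  have hc' : ∀ {G : (Comp → ℝ) → ℝ}, ContDiff ℝ ∞ G → Continuous (fun x => G fun a => P' a x) :=
    fun hG => hG.continuous.comp (continuous_pi cP')
  have t1 : ∀ c : Fin 3 × Fin 3, nrm (fun x => gCoef S c.1 c.2 (fun a => P a x) * W c x -
      gCoef S c.1 c.2 (fun a => P' a x) * W' c x) ≤
      L * nrm (fun x => W c x - W' c x) + (Lg c * B * e : ℝ≥0) := by
    intro c
    refine (nrm_mul_sub_mul_le (hc (contDiff_gCoef S c.1 c.2)) (hc' (contDiff_gCoef S c.1 c.2))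
      (cW c) (cW' c) (fun x => (hLg c P P' e hP hP' he x).1) (hL c)).trans ?_
    rw [add_comm]
    refine add_le_add le_rfl ((mul_le_mul' le_rfl (hW c)).trans (le_of_eq ?_))
    push_cast; ring
  have t2 : ∀ c : (Fin 3 × Comp) × (Fin 3 × Comp),
      nrm (fun x => quadCoef S c.1 c.2 (fun a => P a x) * (H c.1 x * H c.2 x) -
        quadCoef S c.1 c.2 (fun a => P' a x) * (H' c.1 x * H' c.2 x)) ≤
      (Lq c * (B * B + 2 * B) * (e + r) : ℝ≥0) := by
    intro c
    refine (nrm_mul_sub_mul_le (hc (contDiff_quadCoef S c.1 c.2))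
      (hc' (contDiff_quadCoef S c.1 c.2)) ((cH _).mul (cH _)) ((cH' _).mul (cH' _))
      (fun x => (hLq c P P' e hP hP' he x).1) (fun x => (hLq c P P' e hP hP' he x).2)).trans ?_
    have h1 := nrm_mul_le_of_sq (cH c.1) (cH c.2) (hH _) (hH _)
    have h2 : nrm (fun x => H c.1 x * H c.2 x - H' c.1 x * H' c.2 x) ≤
        (r * B + B * r : ℝ≥0) := by
      have e : (fun x => H c.1 x * H c.2 x - H' c.1 x * H' c.2 x) =
        fun x => (H c.1 x - H' c.1 x) * H c.2 x + H' c.1 x * (H c.2 x - H' c.2 x) := by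
        ext x; ring
      rw [e]
      refine (nrm_add_le (((cH _).sub (cH' _)).mul (cH _))
        ((cH' _).mul ((cH _).sub (cH' _)))).trans ?_
      rw [ENNReal.coe_add]
      exact add_le_add (nrm_mul_le_of_sq ((cH _).sub (cH' _)) (cH _) (hr _) (hH _))
        (nrm_mul_le_of_sq (cH' _) ((cH _).sub (cH' _)) (hH' _) (hr _))
    refine (add_le_add (mul_le_mul' le_rfl h1) (mul_le_mul' le_rfl h2)).trans ?_
    rw [← ENNReal.coe_mul, ← ENNReal.coe_mul, ← ENNReal.coe_add]
    refine ENNReal.coe_le_coe.2 ?_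
    have : Lq c * (B * B + 2 * B) * (e + r) = (Lq c * e * (B * B) + Lq c * (r * B + B * r)) +
      Lq c * (B * B * r + 2 * B * e) := by ring
    rw [this]
    exact le_add_of_nonneg_right zero_le
  have t3 : ∀ c, nrm (fun x => linCoef S c (fun a => P a x) * Ψ c x -
      linCoef S c (fun a => P' a x) * Ψ' c x) ≤ (Ll c * (B + 1) * (e + f) : ℝ≥0) := by
    intro c
    refine (nrm_mul_sub_mul_le (hc (contDiff_linCoef S c)) (hc' (contDiff_linCoef S c))
      (cΨ c) (cΨ' c) (fun x => (hLl c P P' e hP hP' he x).1)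
      (fun x => (hLl c P P' e hP hP' he x).2)).trans ?_
    refine (add_le_add (mul_le_mul' le_rfl (hΨ c)) (mul_le_mul' le_rfl (hf c))).trans ?_
    rw [← ENNReal.coe_mul, ← ENNReal.coe_mul, ← ENNReal.coe_add]
    refine ENNReal.coe_le_coe.2 ?_
    have : Ll c * (B + 1) * (e + f) = (Ll c * e * B + Ll c * f) + Ll c * (B * f + e) := by ring
    rw [this]
    exact le_add_of_nonneg_right zero_le
  have k1 : ∀ c : Fin 3 × Fin 3, Continuous fun x => gCoef S c.1 c.2 (fun a => P a x) * W c x -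
      gCoef S c.1 c.2 (fun a => P' a x) * W' c x := fun c =>
    ((hc (contDiff_gCoef S c.1 c.2)).mul (cW c)).sub ((hc' (contDiff_gCoef S c.1 c.2)).mul (cW' c))
  have k2 : ∀ c : (Fin 3 × Comp) × (Fin 3 × Comp), Continuous fun x =>
      quadCoef S c.1 c.2 (fun a => P a x) * (H c.1 x * H c.2 x) -
        quadCoef S c.1 c.2 (fun a => P' a x) * (H' c.1 x * H' c.2 x) := fun c =>
    ((hc (contDiff_quadCoef S c.1 c.2)).mul ((cH _).mul (cH _))).sub
      ((hc' (contDiff_quadCoef S c.1 c.2)).mul ((cH' _).mul (cH' _)))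
  have k3 : ∀ c, Continuous fun x => linCoef S c (fun a => P a x) * Ψ c x -
      linCoef S c (fun a => P' a x) * Ψ' c x := fun c =>
    ((hc (contDiff_linCoef S c)).mul (cΨ c)).sub ((hc' (contDiff_linCoef S c)).mul (cΨ' c))
  have e1 : (fun x => divRhs S P H W Ψ x - divRhs S P' H' W' Ψ' x) = fun x =>
      (∑ c : Fin 3 × Fin 3, (gCoef S c.1 c.2 (fun a => P a x) * W c x -
        gCoef S c.1 c.2 (fun a => P' a x) * W' c x)) -
      ((∑ c : (Fin 3 × Comp) × (Fin 3 × Comp), (quadCoef S c.1 c.2 (fun a => P a x) *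
        (H c.1 x * H c.2 x) - quadCoef S c.1 c.2 (fun a => P' a x) * (H' c.1 x * H' c.2 x))) +
      ∑ c, (linCoef S c (fun a => P a x) * Ψ c x - linCoef S c (fun a => P' a x) * Ψ' c x)) := by
    ext x
    simp only [divRhs, Finset.sum_sub_distrib]
    ring
  rw [e1]
  have s1 := (nrm_sum_le Finset.univ k1).trans (Finset.sum_le_sum fun c _ => t1 c)
  have s2 := (nrm_sum_le Finset.univ k2).trans (Finset.sum_le_sum fun c _ => t2 c)
  have s3 := (nrm_sum_le Finset.univ k3).trans (Finset.sum_le_sum fun c _ => t3 c)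
  have f1 := continuous_finsetSum Finset.univ fun c _ => k1 c
  have f2 := continuous_finsetSum Finset.univ fun c _ => k2 c
  have f3 := continuous_finsetSum Finset.univ fun c _ => k3 c
  refine (nrm_sub_le f1 (f2.add f3)).trans ?_
  refine (add_le_add s1 ((nrm_add_le f2 f3).trans (add_le_add s2 s3))).trans ?_
  rw [Finset.sum_add_distrib, ← Finset.mul_sum, add_assoc]
  refine add_le_add le_rfl ?_
  simp only [← ENNReal.ofNNReal_finsetSum, ← ENNReal.coe_add]
  refine ENNReal.coe_le_coe.2 ?_
  simp only [← Finset.sum_mul]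
  rw [add_mul, add_mul, add_assoc]
  refine add_le_add (mul_le_mul' le_rfl ?_)
    (add_le_add (mul_le_mul' le_rfl le_self_add) (mul_le_mul' le_rfl ?_))
  · rw [add_assoc]; exact le_self_add
  · exact add_le_add le_self_add le_rfl

end

section

/-! ### The second time derivative of the divergence -/

lemma HsBounded.nrm_dif_rpN {ι : Type*} {s : ℝ} {f : ι → Space → ℝ} (hf : HsBounded s f)
    (hs : 0 < s) (hs1 : s < 1) :
    ∃ C : ℝ≥0, ∀ i k n, nrm (dif (step n k) (f i)) ≤ (C * rpN s n : ℝ≥0) := by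
  obtain ⟨C, hC⟩ := hf.wsum_bound hs 1 (by simpa using hs1)
  refine ⟨NNReal.sqrt C, fun i k n => ?_⟩
  set a : ℕ → ℝ≥0∞ := fun n => nrm (dif (step n k) (f i)) with ha
  set b : ℕ → ℝ≥0∞ := fun n => rpN (-s) n * a n with hb
  have hab : a = fun n => rpN s n * b n := by
    ext n
    simp only [hb]
    rw [← mul_assoc, ← ENNReal.coe_mul, rpN_mul, add_neg_cancel, rpN_zero]
    simp
  have h1 : wsum 0 b ≤ C := by
    have h := hC i k
    have e := wsum_rpN_mul s s b
    rw [sub_self] at e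
    rw [← e, ← hab]
    exact h
  have h2 : b n ^ 2 ≤ C := by
    refine le_trans ?_ h1
    have h3 := ENNReal.le_tsum (f := fun n : ℕ => ENNReal.ofReal ((4 : ℝ) ^ ((n : ℝ) * 0)) * b n ^ 2) n
    simpa [wsum] using h3
  have h3 : b n ≤ NNReal.sqrt C := by
    refine le_of_sq_le_sq (h2.trans (le_of_eq ?_))
    rw [← ENNReal.coe_pow, NNReal.sq_sqrt]
  have h4 : a n = rpN s n * b n := congrFun hab n
  change a n ≤ _
  rw [h4, ENNReal.coe_mul, mul_comm]
  exact mul_le_mul' h3 le_rfl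

namespace Sit

variable {S : WaveSystem} {σ : ℝ} {K : Set (Grad × Grad)} {A : ℝ≥0}

/-- The gradients on the slice. -/
def grads (z : Sit S σ K A) (a : Comp) : Space → ℝ := slice z.t (comp z.φ z.ψ a)

/-- The second derivatives on the slice. -/
def hessians (z : Sit S σ K A) (c : Fin 3 × Comp) : Space → ℝ :=
  slice z.t (sd c.1 (comp z.φ z.ψ c.2))

/-- The second derivatives of the divergence on the slice. -/
def divHessian (z : Sit S σ K A) (c : Fin 3 × Fin 3) : Space → ℝ :=
  slice z.t (sd c.1 (sd c.2 (div z.φ)))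

/-- The third derivatives of `ψ` on the slice. -/
def thirds (z : Sit S σ K A) (c : Fin 3 × Fin 3 × Fin 3 × Fin 3) : Space → ℝ :=
  slice z.t (sd c.1 (sd c.2.1 (sd c.2.2.1 (z.ψ c.2.2.2))))

/-- The second time derivative of the divergence on the slice. -/
def dttDiv (z : Sit S σ K A) : Space → ℝ := slice z.t (pd 0 (pd 0 (div z.φ)))

lemma dttDiv_eq (z : Sit S σ K A) :
    z.dttDiv = divRhs S z.grads z.hessians z.divHessian z.thirds := by
  ext x
  have h := residual_div z.hyp.sol (p := (z.t, x)) z.mem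
  simp only [residual, divSource] at h
  simp only [dttDiv, slice, divRhs, grads, hessians, divHessian, thirds]
  rw [Fintype.sum_prod_type, Fintype.sum_prod_type (f := fun c : (Fin 3 × Comp) × (Fin 3 × Comp) =>
    quadCoef S c.1 c.2 (fun a => comp z.φ z.ψ a (z.t, x)) *
      (sd c.1.1 (comp z.φ z.ψ c.1.2) (z.t, x) * sd c.2.1 (comp z.φ z.ψ c.2.2) (z.t, x)))]
  simp only [mul_assoc] at h
  simp only [gMet] at h
  linarith

lemma isHinf_grads (z : Sit S σ K A) (a : Comp) : IsHinf (z.grads a) :=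
  (z.hyp.good_comp a).isHinf z.mem

lemma hessians_eq (z : Sit S σ K A) (c : Fin 3 × Comp) : z.hessians c = der c.1 (z.grads c.2) :=
  (der_slice (z.hyp.contDiff_comp c.2) z.t c.1).symm

lemma isHinf_hessians (z : Sit S σ K A) (c : Fin 3 × Comp) : IsHinf (z.hessians c) :=
  ((z.hyp.good_comp c.2).sd c.1).isHinf z.mem

lemma isHinf_divHessian (z : Sit S σ K A) (c : Fin 3 × Fin 3) : IsHinf (z.divHessian c) :=
  ((z.hyp.goodφ.div.sd c.2).sd c.1).isHinf z.mem

lemma isHinf_thirds (z : Sit S σ K A) (c) : IsHinf (z.thirds c) :=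
  (((z.hyp.goodψ.good c.2.2.1 c.2.2.2).sd c.2.1).sd c.1).isHinf z.mem

lemma isHinf_dttDiv (z : Sit S σ K A) : IsHinf z.dttDiv :=
  ((z.hyp.goodφ.div.pd 0).pd 0).isHinf z.mem

lemma hs_thirds (c) : HsBounded (1 + σ) fun z : Sit S σ K A => z.thirds c := by
  have h := (hs_pd_sdψ (S := S) (σ := σ) (K := K) (A := A) c.2.1.succ c.2.2.1 c.2.2.2).der c.1
    (s' := 1 + σ) (by linarith)
  simp only [der_slice (((Sit.hyp _).goodψ.good c.2.2.1 c.2.2.2).pd c.2.1.succ).smooth] at h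
  exact h

/-- The bounds at a fixed time that enter the estimates of the second time derivative. -/
lemma exists_slice_bound (hσ : 0 < σ) : ∃ B : ℝ≥0, ∀ z : Sit S σ K A,
    (∀ a x, |z.grads a x| ≤ B) ∧ (∀ c, nrm (z.divHessian c) ≤ B) ∧ (∀ c, nrm (z.thirds c) ≤ B) ∧
    (∀ c, nrm (fun x => z.hessians c x ^ 2) ≤ (B ^ 2 : ℝ≥0)) ∧
    ∀ a k, nrm (der k (der k (z.grads a))) ≤ B := by
  obtain ⟨R, hR⟩ := abs_comp_le (S := S) (K := K) (A := A) hσ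
  choose B hB using fun a : Comp => (hs_comp (S := S) (σ := σ) (K := K) (A := A) a).bound
  choose N hN using fun c => (hs_thirds (S := S) (σ := σ) (K := K) (A := A) c).nrm_bound
    (by linarith)
  set D : ℝ≥0 := 49 * ∑ a, B a with hD
  have hder : ∀ (z : Sit S σ K A) a k, nrm (der k (der k (z.grads a))) ≤ D := by
    intro z a k
    refine (nrm_der_der_le_sobolev (z.isHinf_grads a) k k (s := 2 + σ) (by linarith)).trans ?_
    refine (mul_le_mul' le_rfl ((hB a z).trans (ENNReal.coe_le_coe.2 (le_sum_nnreal B a)))).trans ?_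
    rw [hD, ENNReal.coe_mul]
    exact le_rfl
  set E : ℝ≥0 := 1 + R + 49 * A + (∑ c, N c) + 3 * R * D + D with hE
  have i1 : 1 ≤ E := by rw [hE]; simp only [add_assoc]; exact le_self_add
  have i5 : 3 * R * D ≤ E := le_self_add.trans' (le_add_of_nonneg_left zero_le)
  have i4 : ∑ c, N c ≤ E := (le_self_add.trans le_self_add).trans' (le_add_of_nonneg_left zero_le)
  have i3 : 49 * A ≤ E := ((le_self_add.trans le_self_add).trans le_self_add).trans'
    (le_add_of_nonneg_left zero_le)
  have i2 : R ≤ E := (((le_self_add.trans le_self_add).trans le_self_add).trans le_self_add).trans'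
    (le_add_of_nonneg_left zero_le)
  have i6 : D ≤ E := le_add_of_nonneg_left zero_le
  refine ⟨E, fun z => ⟨fun a x => (hR z a x).trans (by exact_mod_cast i2), fun c => ?_, fun c => ?_,
    fun c => ?_, fun a k => (hder z a k).trans (ENNReal.coe_le_coe.2 i6)⟩⟩
  · refine (z.hyp.goodφ.div.nrm_sd_sd_le z.mem c.1 c.2 (s := 2 + σ) (by linarith)).trans ?_
    refine (mul_le_mul' le_rfl (z.hyp.div_le z.t z.mem)).trans ?_
    exact_mod_cast i3
  · exact (hN c z).trans (ENNReal.coe_le_coe.2 ((le_sum_nnreal N c).trans i4))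
  · rw [hessians_eq]
    refine (nrm_sq_der_le (z.isHinf_grads c.2) (hR z c.2) c.1).trans ?_
    refine (mul_le_mul' le_rfl (hder z c.2 c.1)).trans ?_
    have : 3 * R * D ≤ E ^ 2 := i5.trans (le_self_pow₀ i1 two_ne_zero)
    exact_mod_cast this

lemma abs_gCoef_le {c C : ℝ≥0} (hK : Elliptic S c C K) (z : Sit S σ K A) (c : Fin 3 × Fin 3)
    (x : Space) : |gCoef S c.1 c.2 fun a => z.grads a x| ≤ C :=
  hK.abs_le _ (z.hyp.mem (z.t, x) z.mem) c.1 c.2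

lemma nrm_dtt_div_le (hσ : 0 < σ) (hσ' : σ < 1 / 2) :
    ∃ C : ℝ≥0, ∀ z : Sit S σ K A, nrm (slice z.t (pd 0 (pd 0 (div z.φ)))) ≤ C := by
  obtain ⟨B, hB⟩ := exists_slice_bound (S := S) (K := K) (A := A) hσ
  obtain ⟨C₀, hC₀⟩ := exists_nrm_divRhs_sub_le S B B
  choose L hL using fun c : Fin 3 × Fin 3 =>
    (coef_comp (S := S) (K := K) (A := A) hσ hσ' (contDiff_gCoef S c.1 c.2)).sup
  refine ⟨(∑ c, L c) * ∑ _c : Fin 3 × Fin 3, B + C₀ * (0 + B + B), fun z => ?_⟩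
  have hc := fun {κ : Type} (_ : κ) => continuous_const (X := Space) (y := (0 : ℝ))
  have hz : divRhs S z.grads (fun _ _ => 0) (fun _ _ => 0) (fun _ _ => 0) = fun _ => 0 := by
    ext x; simp [divRhs]
  have key := hC₀ (∑ c, L c) 0 B B z.grads z.grads z.hessians (fun _ _ => 0) z.divHessian
    (fun _ _ => 0) z.thirds (fun _ _ => 0) (fun a => (z.isHinf_grads a).continuous)
    (fun a => (z.isHinf_grads a).continuous) (fun a => (z.isHinf_hessians a).continuous) hc
    (fun a => (z.isHinf_divHessian a).continuous) hc (fun a => (z.isHinf_thirds a).continuous) hc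
    (hB z).1 (hB z).1 (fun a x => by simp)
    (fun c x => (hL c z x).trans (NNReal.coe_le_coe.2 (le_sum_nnreal L c)))
    (hB z).2.1 (hB z).2.2.1 (hB z).2.2.2.1 (fun c => by simp [nrm])
    (fun c => by simpa only [sub_zero] using (hB z).2.2.2.1 c)
    (fun c => by simpa only [sub_zero] using (hB z).2.2.1 c)
  rw [hz, ← dttDiv_eq] at key
  simp only [sub_zero] at key
  refine key.trans ?_
  rw [ENNReal.coe_add, ENNReal.coe_mul (∑ c, L c), ENNReal.ofNNReal_finsetSum Finset.univ fun _ => B]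
  exact add_le_add (mul_le_mul' le_rfl (Finset.sum_le_sum fun c _ => (hB z).2.1 c)) le_rfl

/-- Spatial differences of the second time derivative. -/
lemma nrm_dif_dttDiv_le (hσ : 0 < σ) (hσ' : σ < 1 / 2) {c C : ℝ≥0} (hK : Elliptic S c C K) :
    ∃ M : ℝ≥0, ∀ (z : Sit S σ K A) k n, nrm (dif (step n k) z.dttDiv) ≤
      C * ∑ c, nrm (dif (step n k) (z.divHessian c)) + (M * rpN (1 / 4 + σ / 2) n : ℝ≥0) := by
  obtain ⟨B, hB⟩ := exists_slice_bound (S := S) (K := K) (A := A) hσ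
  obtain ⟨C₀, hC₀⟩ := exists_nrm_divRhs_sub_le S B B
  choose E hE using fun a => (hs_comp (S := S) (σ := σ) (K := K) (A := A) a).dif_sup_bound
    (by linarith)
  choose F hF using fun c => (hs_thirds (S := S) (σ := σ) (K := K) (A := A) c).nrm_dif_bound
    (by linarith)
  choose D hD using fun c : Fin 3 × Comp => HsBounded.nrm_dif_rpN
    (((hs_comp (S := S) (σ := σ) (K := K) (A := A) c.2).der c.1 (s' := 1 + σ) (by linarith)).der c.1
      (s' := σ) (by linarith)) hσ (by linarith)
  set E' := ∑ a, E a
  set F' := ∑ c, F c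
  set D' := ∑ c, D c
  refine ⟨C₀ * (E' + NNReal.sqrt (3 * E' * D') + F'), fun z k n => ?_⟩
  set h := step n k
  have hEz : ∀ a x, |dif h (z.grads a) x| ≤ (E' * rpN (1 / 2) n : ℝ≥0) := fun a x =>
    (hE a z k n x).trans (by exact_mod_cast mul_le_mul' (le_sum_nnreal E a) le_rfl)
  have hr : ∀ c : Fin 3 × Comp, nrm (fun x => (z.hessians c (x + h) - z.hessians c x) ^ 2) ≤
      ((NNReal.sqrt (3 * E' * D') * rpN (1 / 4 + σ / 2) n) ^ 2 : ℝ≥0) := by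
    intro c
    have e : (fun x => (z.hessians c (x + h) - z.hessians c x) ^ 2) =
        fun x => der c.1 (dif h (z.grads c.2)) x ^ 2 := by
      rw [der_dif (z.isHinf_grads c.2).contDiff, ← hessians_eq]
      rfl
    rw [e]
    refine (nrm_sq_der_le ((z.isHinf_grads c.2).dif h) (hEz c.2) c.1).trans ?_
    rw [der_dif (z.isHinf_grads c.2).contDiff, der_dif ((z.isHinf_grads c.2).der c.1).contDiff]
    have h1 : nrm (dif h (der c.1 (der c.1 (z.grads c.2)))) ≤ (D' * rpN σ n : ℝ≥0) :=
      (hD c z k n).trans (ENNReal.coe_le_coe.2 (mul_le_mul' (le_sum_nnreal D c) le_rfl))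
    refine (mul_le_mul' le_rfl h1).trans (le_of_eq ?_)
    rw [mul_pow, NNReal.sq_sqrt, sq (rpN _ n), rpN_mul,
      show 1 / 4 + σ / 2 + (1 / 4 + σ / 2) = 1 / 2 + σ by ring, ← rpN_mul]
    push_cast
    ring
  have key := hC₀ C (E' * rpN (1 / 2) n) (NNReal.sqrt (3 * E' * D') * rpN (1 / 4 + σ / 2) n)
    (F' * rpN 1 n) (fun a x => z.grads a (x + h)) z.grads (fun a x => z.hessians a (x + h))
    z.hessians (fun a x => z.divHessian a (x + h)) z.divHessian (fun a x => z.thirds a (x + h))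
    z.thirds
    (fun a => (z.isHinf_grads a).continuous.comp (continuous_add_const h))
    (fun a => (z.isHinf_grads a).continuous)
    (fun a => (z.isHinf_hessians a).continuous.comp (continuous_add_const h))
    (fun a => (z.isHinf_hessians a).continuous)
    (fun a => (z.isHinf_divHessian a).continuous.comp (continuous_add_const h))
    (fun a => (z.isHinf_divHessian a).continuous)
    (fun a => (z.isHinf_thirds a).continuous.comp (continuous_add_const h))
    (fun a => (z.isHinf_thirds a).continuous)
    (fun a x => (hB z).1 a _) (hB z).1 hEz (fun c x => abs_gCoef_le hK z c x)
    (fun c => by rw [nrm_translate (z.isHinf_divHessian c).continuous]; exact (hB z).2.1 c)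
    (fun c => by rw [nrm_translate (z.isHinf_thirds c).continuous]; exact (hB z).2.2.1 c)
    (fun c => (nrm_translate (F := fun x => z.hessians c x ^ 2)
      ((z.isHinf_hessians c).continuous.pow 2) h).le.trans ((hB z).2.2.2.1 c))
    (hB z).2.2.2.1 hr
    (fun c => (hF c z k n).trans (ENNReal.coe_le_coe.2 (mul_le_mul' (le_sum_nnreal F c) le_rfl)))
  rw [dttDiv_eq]
  refine le_trans key (add_le_add le_rfl (ENNReal.coe_le_coe.2 ?_))
  rw [mul_assoc C₀, add_mul, add_mul]
  exact mul_le_mul' le_rfl (add_le_add (add_le_add (mul_le_mul' le_rfl (rpN_le (by linarith) n))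
    le_rfl) (mul_le_mul' le_rfl (rpN_le (by linarith) n)))

/-- The same solution at the initial time. -/
def init (z : Sit S σ K A) : Sit S σ K A :=
  ⟨z.T, z.φ, z.ψ, 0, z.hyp, ⟨le_rfl, z.hyp.pos.le⟩⟩

end Sit

end

section

/-! ### Energy estimates for the system -/

lemma Hyp.exists_abs_pd_le {S : WaveSystem} {σ : ℝ} (hσ : 0 < σ) {K : Set (Grad × Grad)} {A : ℝ≥0}
    {T : ℝ} {φ ψ : Field} (h : Hyp S σ K A T φ ψ) {G : (Comp → ℝ) → ℝ} (hG : ContDiff ℝ ∞ G) :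
    ∃ B : ℝ≥0, ∀ p : Spacetime, p.1 ∈ Icc 0 T → |G fun a => comp φ ψ a p| ≤ B ∧
      ∀ α, |pd α (fun p => G fun a => comp φ ψ a p) p| ≤ B := by
  obtain ⟨R, hR⟩ := Sit.abs_comp_le (S := S) (K := K) (A := A) hσ
  obtain ⟨L0, hL0⟩ := exists_bound_of_contDiff hG R
  choose L hL using fun a => exists_bound_of_contDiff (contDiff_partialDeriv hG a) R
  choose B hB using fun (q : Fin 4 × Comp) => ((h.good_comp q.2).pd q.1).sup_bound
  refine ⟨L0 + ∑ a, L a * ∑ q, B q, fun p hp => ⟨?_, fun α => ?_⟩⟩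
  · refine (hL0 _ fun a => hR ⟨T, φ, ψ, p.1, h, hp⟩ a p.2).trans ?_
    exact_mod_cast le_add_of_nonneg_right zero_le
  · rw [pd_comp hG h.contDiff_comp]
    have h1 : ∑ a, |partialDeriv G a (fun a => comp φ ψ a p) * pd α (comp φ ψ a) p| ≤
        (∑ a, L a * ∑ q, B q : ℝ≥0) := by
      push_cast
      refine Finset.sum_le_sum fun a _ => ?_
      rw [abs_mul]
      refine mul_le_mul (hL a _ fun b => hR ⟨T, φ, ψ, p.1, h, hp⟩ b p.2) ?_ (abs_nonneg _)
        (NNReal.coe_nonneg _)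
      exact (hB (α, a) p hp).trans (by exact_mod_cast le_sum_nnreal B (α, a))
    refine (Finset.abs_sum_le_sum_abs _ _).trans (h1.trans ?_)
    exact_mod_cast le_add_of_nonneg_left zero_le

/-- The energy estimate for a scalar unknown of the system, with coefficients that are functions
of the gradients. -/
lemma Hyp.energy_le {σ s : ℝ} (hσ : 0 < σ) (hs1 : 1 ≤ s) (hs3 : s < 3) {c C : ℝ≥0}
    (hc : 0 < c) : ∃ C₁ : ℝ≥0, ∀ (S : WaveSystem) (K : Set (Grad × Grad)) (A N : ℝ≥0)
    (G : Fin 3 → Fin 3 → (Comp → ℝ) → ℝ) (w : Field → Field → Spacetime → ℝ),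
    (∀ j k, ContDiff ℝ ∞ (G j k)) → (∀ j k, G j k = G k j) →
    (∀ P ∈ K, ∀ ξ : Fin 3 → ℝ, c * ∑ j, ξ j ^ 2 ≤ ∑ j, ∑ k, G j k
        (Sum.elim (fun a => P.1 a.1 a.2) (fun a => P.2 a.1 a.2)) * (ξ j * ξ k) ∧
      ∑ j, ∑ k, G j k
        (Sum.elim (fun a => P.1 a.1 a.2) (fun a => P.2 a.1 a.2)) * (ξ j * ξ k) ≤ C * ∑ j, ξ j ^ 2) →
    (∀ z : Sit S σ K A, Good z.T (w z.φ z.ψ) ∧ sobolevNorm (s + 1) (slice z.t (w z.φ z.ψ)) ≤ N ∧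
      sobolevNorm s (slice z.t (pd 0 (w z.φ z.ψ))) ≤ N ∧
      nrm (slice z.t (pd 0 (pd 0 (w z.φ z.ψ)))) ≤ N) →
    WLe s (fun z : Sit S σ K A => lam z.φ z.t) (fun z k n => nrm (slice z.t
      (residual (fun j k p => G j k fun a => comp z.φ z.ψ a p) (stDif3 (step n k) (w z.φ z.ψ))))) →
    ∃ M : ℝ≥0, ∀ (T : ℝ) (φ ψ : Field), Hyp S σ K A T φ ψ → ∀ t ∈ Icc 0 T,
      sobolevNorm (s + 1) (slice t (w φ ψ)) ^ 2 + sobolevNorm s (slice t (pd 0 (w φ ψ))) ^ 2 ≤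
        C₁ * (sobolevNorm (s + 1) (slice 0 (w φ ψ)) ^ 2 +
          sobolevNorm s (slice 0 (pd 0 (w φ ψ))) ^ 2) + M * ∫⁻ τ in Icc 0 t, lam φ τ := by
  obtain ⟨C₁, hC₁⟩ := sobolev_energy_le (C := C) hs1 hs3 hc
  refine ⟨C₁, fun S K A N G w hG hsymm hell hw hZ => ?_⟩
  obtain ⟨Z, hZ⟩ := hZ
  choose L hL using fun j k => Sit.abs_pd_comp_fun_le (S := S) (K := K) (A := A) hσ (hG j k)
  obtain ⟨M, hM⟩ := hC₁ N Z
  set L' : ℝ≥0 := 1 + ∑ j, ∑ k, L j k with hL'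
  have hL1 : 1 ≤ L' := le_add_of_nonneg_right zero_le
  refine ⟨M * L', fun T φ ψ h t ht => ?_⟩
  choose B hB using fun j k => h.exists_abs_pd_le hσ (hG j k)
  have hBle : ∀ j k, (B j k : ℝ) ≤ (∑ j, ∑ k, B j k : ℝ≥0) := fun j k => by
    exact_mod_cast (le_sum_nnreal (B j) k).trans (le_sum_nnreal (fun j => ∑ k, B j k) j)
  let z : ∀ τ ∈ Icc 0 T, Sit S σ K A := fun τ hτ => ⟨T, φ, ψ, τ, h, hτ⟩
  have hsub : ∀ τ ∈ Icc 0 t, τ ∈ Icc 0 T := fun τ hτ => ⟨hτ.1, hτ.2.trans ht.2⟩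
  have key := hM T (fun j k p => G j k fun a => comp φ ψ a p) (w φ ψ) (∑ j, ∑ k, B j k)
    (fun τ => L' * lam φ τ) t (fun j k => contDiff_comp_pi (hG j k) h.contDiff_comp)
    (fun j k => by rw [hsymm j k]) (hw (z t ht)).1
    (fun j k p hp => ((hB j k p hp).1).trans (hBle j k))
    (fun α j k p hp => ((hB j k p hp).2 α).trans (hBle j k))
    (fun α j k p hp => by
      refine (hL j k (z p.1 hp) α p.2).trans ?_
      rw [NNReal.coe_mul]
      refine mul_le_mul_of_nonneg_right ?_ (NNReal.coe_nonneg _)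
      exact_mod_cast ((le_sum_nnreal (L j) k).trans (le_sum_nnreal (fun j => ∑ k, L j k) j)).trans
        (le_add_of_nonneg_left zero_le))
    (fun τ => one_le_mul_of_one_le_of_one_le hL1 (one_le_lam φ τ))
    (fun p hp ξ => by
      have e : (fun a => comp φ ψ a p) = Sum.elim (fun a => (grad φ p, grad ψ p).1 a.1 a.2)
          (fun a => (grad φ p, grad ψ p).2 a.1 a.2) := by
        funext a; rcases a with a | a <;> rfl
      simp only [e]
      exact hell _ (h.mem p hp) ξ)
    ht h.le_one (fun τ hτ => (hw (z τ (hsub τ hτ))).2.1)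
    (fun τ hτ => (hw (z τ (hsub τ hτ))).2.2.1) (fun τ hτ => (hw (z τ (hsub τ hτ))).2.2.2)
    (fun τ hτ i => (hZ (z τ (hsub τ hτ)) i).trans (by
      refine ENNReal.coe_le_coe.2 (mul_le_mul' le_rfl (pow_le_pow_left₀ zero_le ?_ 2))
      exact le_mul_of_one_le_left zero_le hL1))
  refine key.trans (add_le_add le_rfl (le_of_eq ?_))
  simp only [ENNReal.coe_mul]
  rw [lintegral_const_mul' _ _ ENNReal.coe_ne_top, mul_assoc]

lemma Hyp.energy_div_le {σ : ℝ} (hσ : 0 < σ) (hσ' : σ < 1 / 2) {c C : ℝ≥0} (hc : 0 < c) :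
    ∃ C₁ : ℝ≥0, ∀ (S : WaveSystem) (K : Set (Grad × Grad)) (A : ℝ≥0), Elliptic S c C K →
    ∃ M : ℝ≥0, ∀ (T : ℝ) (φ ψ : Field), Hyp S σ K A T φ ψ → ∀ t ∈ Icc 0 T,
      sobolevNorm (2 + σ) (slice t (div φ)) ^ 2 + sobolevNorm (1 + σ) (slice t (pd 0 (div φ))) ^ 2 ≤
        C₁ * (sobolevNorm (2 + σ) (slice 0 (div φ)) ^ 2 +
          sobolevNorm (1 + σ) (slice 0 (pd 0 (div φ))) ^ 2) + M * ∫⁻ τ in Icc 0 t, lam φ τ := by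
  obtain ⟨C₁, hC₁⟩ := Hyp.energy_le hσ (s := 1 + σ) (by linarith) (by linarith) (C := C) hc
  rw [show 1 + σ + 1 = 2 + σ by ring] at hC₁
  refine ⟨C₁, fun S K A hK => ?_⟩
  obtain ⟨N, hN⟩ := Sit.nrm_dtt_div_le (S := S) (K := K) (A := A) hσ hσ'
  have hAN : ∀ {x : ℝ≥0∞}, x ≤ A → x ≤ (A + N : ℝ≥0) := fun h => h.trans (by
    exact_mod_cast le_add_of_nonneg_right zero_le)
  refine hC₁ S K A (A + N) (gCoef S) (fun φ _ => div φ) (contDiff_gCoef S) (fun j k => ?_) hK.faster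
    (fun z => ⟨z.hyp.goodφ.div, hAN (z.hyp.div_le z.t z.mem), hAN (z.hyp.dt_div_le z.t z.mem),
      (hN z).trans (by exact_mod_cast le_add_of_nonneg_left zero_le)⟩)
    (Sit.wle_residual_div hσ hσ')
  ext y
  simp only [gCoef, WaveSystem.gInv, Matrix.of_apply, S.fg_symm _ j k, eq_comm (a := j)]

lemma Hyp.energy_curl_le {σ : ℝ} (hσ : 0 < σ) (hσ' : σ < 1 / 2) {c C : ℝ≥0} (hc : 0 < c) :
    ∃ C₁ : ℝ≥0, ∀ (S : WaveSystem) (K : Set (Grad × Grad)) (A : ℝ≥0), Elliptic S c C K →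
    ∀ i, ∃ M : ℝ≥0, ∀ (T : ℝ) (φ ψ : Field), Hyp S σ K A T φ ψ → ∀ t ∈ Icc 0 T,
      sobolevNorm (3 + σ) (slice t (curl ψ i)) ^ 2 +
          sobolevNorm (2 + σ) (slice t (pd 0 (curl ψ i))) ^ 2 ≤
        C₁ * (sobolevNorm (3 + σ) (slice 0 (curl ψ i)) ^ 2 +
          sobolevNorm (2 + σ) (slice 0 (pd 0 (curl ψ i))) ^ 2) + M * ∫⁻ τ in Icc 0 t, lam φ τ := by
  obtain ⟨C₁, hC₁⟩ := Hyp.energy_le hσ (s := 2 + σ) (by linarith) (by linarith) (C := C) hc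
  rw [show 2 + σ + 1 = 3 + σ by ring] at hC₁
  refine ⟨C₁, fun S K A hK i => ?_⟩
  obtain ⟨N, hN⟩ := Sit.nrm_dtt_curl_le (S := S) (K := K) (A := A) hσ hσ' hK.pos hK.det i
  have hAN : ∀ {x : ℝ≥0∞}, x ≤ A → x ≤ (A + N : ℝ≥0) := fun h => h.trans (by
    exact_mod_cast le_add_of_nonneg_right zero_le)
  refine hC₁ S K A (A + N) (fun j k y => hCoef S j k fun a => y (Sum.inr a)) (fun _ ψ => curl ψ i)
    (fun j k => (contDiff_hCoef S j k).comp (by fun_prop)) (fun j k => ?_) hK.slower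
    (fun z => ⟨z.hyp.goodψ.curl i, hAN (z.hyp.curl_le z.t z.mem i),
      hAN (z.hyp.dt_curl_le z.t z.mem i),
      (hN z).trans (by exact_mod_cast le_add_of_nonneg_left zero_le)⟩)
    (Sit.wle_residual_curl hσ hσ' hK.pos hK.det i)
  ext y
  simp only [hCoef, WaveSystem.hInv, Matrix.of_apply, S.fh_symm _ j k, eq_comm (a := j)]

end

section

lemma der_sub {F G : Space → ℝ} (hF : ContDiff ℝ ∞ F) (hG : ContDiff ℝ ∞ G) (k : Fin 3) :
    der k (fun x => F x - G x) = fun x => der k F x - der k G x := by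
  ext x
  exact congrArg (fun l => l (bas k))
    (fderiv_sub (hF.differentiable (by simp) x) (hG.differentiable (by simp) x))

lemma exists_pos_le_of_continuous {F : ℝ≥0 → ℝ≥0} (hF : Continuous F) (h0 : F 0 = 0) {η : ℝ≥0}
    (hη : 0 < η) : ∃ ε : ℝ≥0, 0 < ε ∧ F ε ≤ η := by
  have h1 : ∀ᶠ ε in nhds (0 : ℝ≥0), F ε < η := by
    have h := hF.tendsto 0
    rw [h0] at h
    exact h.eventually (gt_mem_nhds hη)
  have h2 : ∀ᶠ ε in nhdsWithin (0 : ℝ≥0) (Ioi 0), F ε < η := nhdsWithin_le_nhds h1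
  obtain ⟨ε, h3, h4⟩ := (h2.and self_mem_nhdsWithin).exists
  exact ⟨ε, h4, h3.le⟩

lemma enorm_sub_le_lintegral {w : Spacetime → ℝ} (hw : ContDiff ℝ ∞ w) {t : ℝ} (ht : 0 ≤ t)
    (x : Space) : ‖w (t, x) - w (0, x)‖ₑ ≤ ∫⁻ τ in Icc 0 t, ‖pd 0 w (τ, x)‖ₑ := by
  have hc : Continuous fun τ : ℝ => pd 0 w (τ, x) :=
    (contDiff_pd hw 0).continuous.comp (Continuous.prodMk continuous_id continuous_const)
  have h := intervalIntegral.integral_eq_sub_of_hasDerivAt (fun τ _ => hasDerivAt_time hw τ x)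
    (hc.intervalIntegrable 0 t)
  rw [← h, intervalIntegral.integral_of_le ht]
  refine (enorm_integral_le_lintegral_enorm _).trans ?_
  exact lintegral_mono_set Ioc_subset_Icc_self

namespace Sit

variable {S : WaveSystem} {σ : ℝ} {K : Set (Grad × Grad)} {A : ℝ≥0}

/-- The time integral of the supremum of the derivatives of `∂φ`. -/
def action (z : Sit S σ K A) : ℝ≥0∞ := ∫⁻ τ in Icc 0 z.T, lam z.φ τ

lemma ofReal_t_le_action (z : Sit S σ K A) : ENNReal.ofReal z.t ≤ z.action := by
  refine (ENNReal.ofReal_le_ofReal z.mem.2).trans ?_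
  have h : ∫⁻ _ in Icc 0 z.T, (1 : ℝ≥0∞) = ENNReal.ofReal z.T := by simp
  rw [← h]
  exact lintegral_mono fun τ => ENNReal.one_le_coe_iff.2 (one_le_lam _ _)

lemma abs_grads_sub_le (hσ : 0 < σ) : ∃ C : ℝ≥0, ∀ (z : Sit S σ K A) (ε : ℝ≥0), z.action ≤ ε →
    ∀ a x, |z.grads a x - z.init.grads a x| ≤ (C * ε : ℝ≥0) := by
  obtain ⟨C, hC⟩ := abs_pd_comp_le (S := S) (K := K) (A := A) hσ
  refine ⟨C, fun z ε hε a x => ?_⟩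
  have h1 : ‖z.grads a x - z.init.grads a x‖ₑ ≤ (C * ε : ℝ≥0) := by
    refine (enorm_sub_le_lintegral (z.hyp.contDiff_comp a) z.mem.1 x).trans ?_
    rw [ENNReal.coe_mul]
    refine le_trans ?_ (mul_le_mul' le_rfl hε)
    rw [action, ← lintegral_const_mul' _ _ ENNReal.coe_ne_top]
    refine le_trans ?_ (lintegral_mono_set (Icc_subset_Icc le_rfl z.mem.2))
    refine setLIntegral_mono' measurableSet_Icc fun τ hτ => ?_
    have h2 := hC ⟨z.T, z.φ, z.ψ, τ, z.hyp, ⟨hτ.1, hτ.2.trans z.mem.2⟩⟩ 0 a x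
    rw [← ENNReal.coe_mul, enorm_le_coe]
    exact_mod_cast h2
  rw [enorm_le_coe] at h1
  exact_mod_cast h1

/-- Continuity in time of the second time derivative of the divergence. -/
lemma nrm_dttDiv_sub_le (hσ : 0 < σ) {c C : ℝ≥0} (hK : Elliptic S c C K) {η : ℝ≥0}
    (hη : 0 < η) : ∃ ε : ℝ≥0, 0 < ε ∧ ∀ z : Sit S σ K A, z.action ≤ ε →
      nrm (fun x => z.dttDiv x - z.init.dttDiv x) ≤ η := by
  obtain ⟨B, hB⟩ := exists_slice_bound (S := S) (K := K) (A := A) hσ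
  obtain ⟨C₀, hC₀⟩ := exists_nrm_divRhs_sub_le S B B
  obtain ⟨E, hE⟩ := abs_grads_sub_le (S := S) (K := K) (A := A) hσ
  choose F hF using fun q : Fin 3 × Fin 3 =>
    (hs_pd_sdψ (S := S) (σ := σ) (K := K) (A := A) 0 q.1 q.2).bound
  set F' := 49 * ∑ q, F q with hF'
  obtain ⟨κ, hκ0, hκ⟩ := exists_pos_le_of_continuous (F := fun κ => C * (9 * κ)) (by fun_prop)
    (by simp) (half_pos hη)
  have hκ2 : 0 < κ ^ 2 / 2 := half_pos (pow_pos hκ0 2)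
  obtain ⟨ε', hε'0, hε'⟩ := exists_pos_le_of_continuous (F := fun ε => ε * (A + A) ^ 2)
    (by fun_prop) (by simp) hκ2
  obtain ⟨D, hD⟩ := sq_nrm_der_der_le hσ hε'0
  obtain ⟨ε, hε0, hε⟩ := exists_pos_le_of_continuous
    (F := fun ε => D * (ε * A) ^ 2 + C₀ * (E * ε + NNReal.sqrt (3 * (E * ε) * (B + B)) + ε * F'))
    (η := min (κ ^ 2 / 2) (η / 2)) (by fun_prop) (by simp) (lt_min hκ2 (half_pos hη))
  have hε1 : D * (ε * A) ^ 2 ≤ κ ^ 2 / 2 := le_self_add.trans (hε.trans (min_le_left _ _))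
  have hε2 := (le_add_of_nonneg_left zero_le).trans (hε.trans (min_le_right _ _))
  refine ⟨ε, hε0, fun z hz => ?_⟩
  have htε : ENNReal.ofReal (z.t - 0) ≤ ε := by
    rw [sub_zero]; exact z.ofReal_t_le_action.trans hz
  have hW : ∀ c, nrm (fun x => z.divHessian c x - z.init.divHessian c x) ≤ κ := by
    intro c
    have hu := z.hyp.goodφ.div
    have hF1 := hu.isHinf z.mem
    have hF0 : IsHinf (slice 0 (div z.φ)) := hu.isHinf z.init.mem
    have e : (fun x => z.divHessian c x - z.init.divHessian c x) = der c.1 (der c.2 fun x =>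
        slice z.t (div z.φ) x - slice 0 (div z.φ) x) := by
      rw [der_sub hF1.contDiff hF0.contDiff, der_sub (hF1.der c.2).contDiff (hF0.der c.2).contDiff,
        der_slice hu.smooth, der_slice hu.smooth, der_slice (hu.sd c.2).smooth,
        der_slice (hu.sd c.2).smooth]
      rfl
    rw [e]
    refine le_of_sq_le_sq ((hD _ c.1 c.2 (hF1.sub hF0)).trans ?_)
    have h1 : sobolevNorm (2 + σ) (fun x => slice z.t (div z.φ) x - slice 0 (div z.φ) x) ≤
        (A + A : ℝ≥0) := by
      rw [ENNReal.coe_add]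
      exact (sobolevNorm_sub_le hF1.memLp hF0.memLp _).trans
        (add_le_add (z.hyp.div_le _ z.mem) (z.hyp.div_le _ z.init.mem))
    have h2 : nrm (fun x => slice z.t (div z.φ) x - slice 0 (div z.φ) x) ≤ (ε * A : ℝ≥0) := by
      rw [ENNReal.coe_mul]
      refine (Good.nrm_sub_le (T := z.T) hu z.mem.1 (M := A) fun τ hτ => ?_).trans
        (mul_le_mul' htε le_rfl)
      have hτ' : τ ∈ Icc 0 z.T := ⟨hτ.1, hτ.2.trans z.mem.2⟩
      exact (nrm_le_sobolevNorm ((hu.pd 0).isHinf hτ').memLp (by linarith)).trans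
        (z.hyp.dt_div_le τ hτ')
    refine (add_le_add (mul_le_mul' le_rfl (pow_le_pow_left' h1 2))
      (mul_le_mul' le_rfl (pow_le_pow_left' h2 2))).trans ?_
    have h3 := add_le_add hε' hε1
    rw [add_halves] at h3
    exact_mod_cast h3
  have hr : ∀ c, nrm (fun x => (z.hessians c x - z.init.hessians c x) ^ 2) ≤
      (NNReal.sqrt (3 * (E * ε) * (B + B)) ^ 2 : ℝ≥0) := by
    intro c
    have hP := z.isHinf_grads c.2
    have hP0 := z.init.isHinf_grads c.2
    have e : (fun x => (z.hessians c x - z.init.hessians c x) ^ 2) = fun x =>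
        der c.1 (fun x => z.grads c.2 x - z.init.grads c.2 x) x ^ 2 := by
      rw [der_sub hP.contDiff hP0.contDiff, hessians_eq, hessians_eq]
    rw [e]
    refine (nrm_sq_der_le (hP.sub hP0) (hE z ε hz c.2) c.1).trans ?_
    rw [der_sub hP.contDiff hP0.contDiff, der_sub (hP.der c.1).contDiff (hP0.der c.1).contDiff]
    have h1 := (nrm_sub_le ((hP.der c.1).der c.1).continuous
      ((hP0.der c.1).der c.1).continuous).trans
      (add_le_add ((hB z).2.2.2.2 c.2 c.1) ((hB z.init).2.2.2.2 c.2 c.1))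
    refine (mul_le_mul' le_rfl h1).trans (le_of_eq ?_)
    rw [NNReal.sq_sqrt]
    push_cast
    ring
  have hf : ∀ c, nrm (fun x => z.thirds c x - z.init.thirds c x) ≤ (ε * F' : ℝ≥0) := by
    intro c
    have hg := z.hyp.goodψ.good c.2.2.1 c.2.2.2
    rw [ENNReal.coe_mul]
    refine (Good.nrm_sub_le (T := z.T) ((hg.sd c.2.1).sd c.1) z.mem.1 (M := F') fun τ hτ => ?_).trans
      (mul_le_mul' htε le_rfl)
    have hτ' : τ ∈ Icc 0 z.T := ⟨hτ.1, hτ.2.trans z.mem.2⟩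
    have e : pd 0 (sd c.1 (sd c.2.1 (sd c.2.2.1 (z.ψ c.2.2.2)))) =
        sd c.1 (sd c.2.1 (pd 0 (sd c.2.2.1 (z.ψ c.2.2.2)))) := by
      have e1 : pd 0 (sd c.2.1 (sd c.2.2.1 (z.ψ c.2.2.2))) =
        sd c.2.1 (pd 0 (sd c.2.2.1 (z.ψ c.2.2.2))) := pd_comm hg.smooth _ _
      rw [← e1]
      exact pd_comm (hg.sd c.2.1).smooth _ _
    rw [e]
    refine ((hg.pd 0).nrm_sd_sd_le hτ' c.1 c.2.1 (s := 2 + σ) (by linarith)).trans ?_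
    have h1 := hF (c.2.2.1, c.2.2.2) ⟨z.T, z.φ, z.ψ, τ, z.hyp, hτ'⟩
    refine (mul_le_mul' le_rfl (h1.trans (ENNReal.coe_le_coe.2 (le_sum_nnreal F _)))).trans ?_
    rw [hF', ENNReal.coe_mul]
    exact le_rfl
  have key := hC₀ C (E * ε) (NNReal.sqrt (3 * (E * ε) * (B + B))) (ε * F') z.grads z.init.grads
    z.hessians z.init.hessians z.divHessian z.init.divHessian z.thirds z.init.thirds
    (fun a => (z.isHinf_grads a).continuous) (fun a => (z.init.isHinf_grads a).continuous)
    (fun a => (z.isHinf_hessians a).continuous) (fun a => (z.init.isHinf_hessians a).continuous)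
    (fun a => (z.isHinf_divHessian a).continuous) (fun a => (z.init.isHinf_divHessian a).continuous)
    (fun a => (z.isHinf_thirds a).continuous) (fun a => (z.init.isHinf_thirds a).continuous)
    (hB z).1 (hB z.init).1 (hE z ε hz) (fun c x => abs_gCoef_le hK z.init c x)
    (hB z).2.1 (hB z).2.2.1 (hB z).2.2.2.1 (hB z.init).2.2.2.1 hr hf
  rw [dttDiv_eq, dttDiv_eq]
  refine key.trans ?_
  have h1 : (C : ℝ≥0∞) * ∑ c, nrm (fun x => z.divHessian c x - z.init.divHessian c x) ≤
      (η / 2 : ℝ≥0) := by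
    refine (mul_le_mul' le_rfl (Finset.sum_le_sum fun c _ => hW c)).trans ?_
    refine le_trans (le_of_eq ?_) (ENNReal.coe_le_coe.2 hκ)
    simp
  refine (add_le_add h1 (ENNReal.coe_le_coe.2 hε2)).trans (le_of_eq ?_)
  rw [← ENNReal.coe_add, add_halves]

end Sit

end

section

lemma exists_rpN_le {β : ℝ} (hβ : 0 < β) {M : ℝ≥0} : ∃ m, M * rpN β m ≤ 1 := by
  have h1 : Filter.Tendsto (fun m : ℕ => (M : ℝ) * (rad m) ^ β) Filter.atTop (nhds ((M : ℝ) * 0)) := by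
    refine Filter.Tendsto.const_mul _ ?_
    have h : ∀ m : ℕ, rad m ^ β = ((1 / 2 : ℝ) ^ β) ^ m := fun m => by
      rw [rad, ← Real.rpow_natCast, ← Real.rpow_natCast, ← Real.rpow_mul (by norm_num),
        ← Real.rpow_mul (by norm_num), mul_comm]
    simp only [h]
    exact tendsto_pow_atTop_nhds_zero_of_lt_one (by positivity)
      (Real.rpow_lt_one (by norm_num) (by norm_num) hβ)
  rw [mul_zero] at h1
  obtain ⟨m, hm⟩ := (h1.eventually (gt_mem_nhds one_pos)).exists
  refine ⟨m, ?_⟩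
  rw [← NNReal.coe_le_coe]
  push_cast
  rw [coe_rpN]
  exact hm.le

lemma rpN_anti {β : ℝ} (hβ : 0 ≤ β) {m n : ℕ} (h : m ≤ n) : rpN β n ≤ rpN β m := by
  rw [← NNReal.coe_le_coe, coe_rpN, coe_rpN]
  refine Real.rpow_le_rpow (rad_pos n).le ?_ hβ
  exact pow_le_pow_of_le_one (by norm_num) (by norm_num) h

lemma rpN_pos (β : ℝ) (n : ℕ) : 0 < rpN β n := by
  rw [← NNReal.coe_pos, coe_rpN]
  exact Real.rpow_pos_of_pos (rad_pos n) _

namespace Sit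

/-- The estimate of the second time derivative of the divergence. -/
lemma sq_sobolevNorm_dttDiv_le {σ : ℝ} (hσ : 0 < σ) (hσ' : σ < 1 / 2) (C : ℝ≥0) :
    ∃ C₂ : ℝ≥0, ∀ (S : WaveSystem) (K : Set (Grad × Grad)) (A c : ℝ≥0), Elliptic S c C K →
      ∃ ε : ℝ≥0, 0 < ε ∧ ∀ z : Sit S σ K A, z.action ≤ ε →
        sobolevNorm σ z.dttDiv ^ 2 ≤ C₂ * (sobolevNorm (2 + σ) (slice z.t (div z.φ)) ^ 2 +
          sobolevNorm σ z.init.dttDiv ^ 2 + 1) := by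
  set β : ℝ := 1 / 4 + σ / 2 with hβ
  set γ : ℝ := (β + σ) / 2 with hγ
  have hβσ : σ < β := by rw [hβ]; linarith
  have hγσ : σ < γ := by rw [hγ]; linarith
  obtain ⟨C₃, hC₃⟩ := wsum_le_of_le_rpN hγσ
  obtain ⟨C₄, hC₄⟩ := wsum_dif_le hσ (m := 1) (by push_cast; linarith)
  set E : ℝ≥0 := (8 ^ σ : ℝ).toNNReal
  refine ⟨E * (2 + 3 * (2 * (2 * (C ^ 2 * (9 * (9 * (C₄ * 49 ^ 2))) + C₄) + C₃ * 2 ^ 2))),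
    fun S K A c hK => ?_⟩
  obtain ⟨M, hM⟩ := nrm_dif_dttDiv_le (S := S) (K := K) (A := A) hσ hσ' hK
  obtain ⟨m, hm⟩ := exists_rpN_le (β := (β - σ) / 2) (by linarith) (M := M)
  obtain ⟨η, hη0, hη⟩ := exists_pos_le_of_continuous (F := fun η => 2 * η + η) (by fun_prop)
    (by simp) (η := min 1 (rpN γ m)) (lt_min one_pos (rpN_pos γ m))
  have hη1 : η ≤ 1 := (le_add_of_nonneg_left zero_le).trans (hη.trans (min_le_left _ _))
  have hη2 : 2 * η ≤ rpN γ m := le_self_add.trans (hη.trans (min_le_right _ _))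
  obtain ⟨ε, hε0, hε⟩ := nrm_dttDiv_sub_le (S := S) (K := K) (A := A) hσ hK hη0
  refine ⟨ε, hε0, fun z hz => ?_⟩
  have hQ := z.isHinf_dttDiv
  have hQ0 := z.init.isHinf_dttDiv
  have hd := hε z hz
  set X := sobolevNorm (2 + σ) (slice z.t (div z.φ)) ^ 2
  set Y := sobolevNorm σ z.init.dttDiv ^ 2
  have eQ : z.dttDiv = fun x => z.init.dttDiv x + (z.dttDiv x - z.init.dttDiv x) := by
    ext x; ring
  have h0 : nrm z.dttDiv ^ 2 ≤ 2 * (Y + 1) := by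
    have h1 : nrm z.dttDiv ≤ nrm z.init.dttDiv + 1 := by
      conv_lhs => rw [eQ]
      refine (nrm_add_le hQ0.continuous (hQ.sub hQ0).continuous).trans (add_le_add le_rfl ?_)
      exact hd.trans (by exact_mod_cast hη1)
    refine (pow_le_pow_left' h1 2).trans ((ennreal_add_sq_le _ _).trans ?_)
    rw [one_pow]
    exact mul_le_mul' le_rfl (add_le_add
      (pow_le_pow_left' (nrm_le_sobolevNorm hQ0.memLp hσ.le) 2) le_rfl)
  have hk : ∀ k, wsum σ (fun n => nrm (dif (step n k) z.dttDiv)) ≤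
      2 * (2 * (C ^ 2 * (9 * (9 * (C₄ * 49 ^ 2 * X))) + C₄ * Y) + C₃ * 2 ^ 2) := by
    intro k
    have hpt : ∀ n, nrm (dif (step n k) z.dttDiv) ≤
        (C * ∑ c, nrm (dif (step n k) (z.divHessian c)) + nrm (dif (step n k) z.init.dttDiv)) +
          (2 * rpN γ n : ℝ≥0) := by
      intro n
      rcases le_or_gt m n with hmn | hmn
      · refine (hM z k n).trans (add_le_add le_self_add (ENNReal.coe_le_coe.2 ?_))
        have e : rpN β n = rpN ((β - σ) / 2) n * rpN γ n := by
          rw [rpN_mul]; congr 1; rw [hγ]; ring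
        rw [e, ← mul_assoc]
        refine mul_le_mul' ?_ le_rfl
        exact ((mul_le_mul' le_rfl (rpN_anti (by linarith) hmn)).trans hm).trans one_le_two
      · have h1 : nrm (dif (step n k) z.dttDiv) ≤ nrm (dif (step n k) z.init.dttDiv) + 2 * η := by
          have e : dif (step n k) z.dttDiv = fun x => dif (step n k) z.init.dttDiv x +
              dif (step n k) (fun x => z.dttDiv x - z.init.dttDiv x) x := by
            ext x; simp only [dif]; ring
          rw [e]
          refine (nrm_add_le (continuous_dif hQ0.continuous _)
            (continuous_dif (hQ.sub hQ0).continuous _)).trans (add_le_add le_rfl ?_)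
          exact (nrm_dif_le_two (hQ.sub hQ0).continuous _).trans (mul_le_mul' le_rfl hd)
        refine h1.trans (add_le_add (le_add_of_nonneg_left zero_le) ?_)
        have h2 : 2 * η ≤ 2 * rpN γ n := (hη2.trans (rpN_anti (by linarith) hmn.le)).trans
          (le_mul_of_one_le_left zero_le one_le_two)
        exact_mod_cast h2
    refine (wsum_mono hpt).trans ((wsum_add_le _ _ _).trans (mul_le_mul' le_rfl
      (add_le_add ((wsum_add_le _ _ _).trans (mul_le_mul' le_rfl (add_le_add ?_ ?_))) ?_)))
    · rw [wsum_const_mul]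
      refine mul_le_mul' le_rfl ((wsum_sum_le _ _ _).trans ?_)
      have h1 : ∀ c, wsum σ (fun n => nrm (dif (step n k) (z.divHessian c))) ≤
          C₄ * 49 ^ 2 * X := by
        intro c
        refine (hC₄ k _ (z.isHinf_divHessian c).memLp).trans ?_
        rw [mul_assoc, ← mul_pow]
        refine mul_le_mul' le_rfl (pow_le_pow_left' ?_ 2)
        have hu := z.hyp.goodφ.div
        have hu' := hu.isHinf z.mem
        have e : z.divHessian c = der c.1 (der c.2 (slice z.t (div z.φ))) := by
          rw [der_slice hu.smooth, der_slice (hu.sd c.2).smooth]; rfl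
        rw [e]
        refine (sobolevNorm_der_le (hu'.der c.2) c.1 σ).trans ?_
        refine (mul_le_mul' le_rfl (sobolevNorm_der_le hu' c.2 (σ + 1))).trans (le_of_eq ?_)
        rw [← mul_assoc, show σ + 1 + 1 = 2 + σ by ring]
        norm_num
      refine (mul_le_mul' le_rfl (Finset.sum_le_sum fun c _ => h1 c)).trans (le_of_eq ?_)
      simp
    · exact hC₄ k _ hQ0.memLp
    · exact hC₃ 2 _ fun n => le_rfl
  refine (sq_sobolevNorm_le hσ.le 1 hQ.memLp).trans ?_
  refine (mul_le_mul' le_rfl (add_le_add h0 (Finset.sum_le_sum fun k _ => hk k))).trans ?_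
  have e1 : ENNReal.ofReal (8 ^ σ) = (E : ℝ≥0∞) := rfl
  rw [e1]
  push_cast
  rw [mul_assoc (E : ℝ≥0∞), Finset.sum_const, Finset.card_univ, Fintype.card_fin, nsmul_eq_mul]
  refine mul_le_mul' le_rfl ?_
  rw [add_mul]
  refine add_le_add (mul_le_mul' le_rfl (add_le_add (le_add_of_nonneg_left zero_le) le_rfl)) ?_
  push_cast
  rw [mul_assoc (3 : ℝ≥0∞), mul_assoc (2 : ℝ≥0∞)]
  refine mul_le_mul' le_rfl (mul_le_mul' le_rfl ?_)
  rw [add_mul, mul_assoc (2 : ℝ≥0∞), add_mul]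
  refine add_le_add (mul_le_mul' le_rfl (add_le_add ?_ (mul_le_mul' le_rfl ?_))) ?_
  · have : (C : ℝ≥0∞) ^ 2 * (9 * (9 * (C₄ * 49 ^ 2 * X))) = C ^ 2 * (9 * (9 * (C₄ * 49 ^ 2))) * X := by
      ring
    rw [this, add_assoc]
    exact mul_le_mul' le_rfl le_self_add
  · exact (le_add_of_nonneg_left zero_le).trans le_self_add
  · exact le_mul_of_one_le_right zero_le (le_add_of_nonneg_left zero_le)

end Sit

end

section

/-! ### Uniform hyperbolicity on compact sets -/

lemma exists_ellipticity {X : Type*} [TopologicalSpace X] {K : Set X} (hK : IsCompact K)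
    {a : X → Matrix (Fin 3) (Fin 3) ℝ} (ha : ∀ j k, Continuous fun P => a P j k)
    (hpos : ∀ P ∈ K, (a P).PosDef) :
    ∃ c C : ℝ≥0, 0 < c ∧ ∀ P ∈ K, (∀ j k, |a P j k| ≤ C) ∧ (c : ℝ) ≤ (a P).det ∧
      ∀ ξ : Fin 3 → ℝ, c * ∑ j, ξ j ^ 2 ≤ ∑ j, ∑ k, a P j k * (ξ j * ξ k) ∧
        ∑ j, ∑ k, a P j k * (ξ j * ξ k) ≤ C * ∑ j, ξ j ^ 2 := by
  have hdet : Continuous fun P => (a P).det := by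
    have ha' := ha
    simp only [Matrix.det_fin_three]
    fun_prop
  obtain ⟨d, hd0, hd⟩ := hK.exists_forall_le' hdet.continuousOn (a := 0)
    fun P hP => (hpos P hP).det_pos
  choose B hB using fun q : Fin 3 × Fin 3 =>
    hK.exists_bound_of_continuousOn (ha q.1 q.2).continuousOn
  set B' : ℝ≥0 := ∑ q, (B q).toNNReal with hB'
  have hBle : ∀ P ∈ K, ∀ j k, |a P j k| ≤ B' := fun P hP j k =>
    (hB (j, k) P hP).trans ((Real.le_coe_toNNReal _).trans
      (by exact_mod_cast le_sum_nnreal (fun q => (B q).toNNReal) (j, k)))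
  have hQc : Continuous fun q : X × (Fin 3 → ℝ) => ∑ j, ∑ k, a q.1 j k * (q.2 j * q.2 k) := by
    refine continuous_finsetSum _ fun j _ => continuous_finsetSum _ fun k _ =>
      ((ha j k).comp continuous_fst).mul (by fun_prop)
  have hQe : ∀ P (ξ : Fin 3 → ℝ), ∑ j, ∑ k, a P j k * (ξ j * ξ k) =
      star ξ ⬝ᵥ (a P).mulVec ξ := by
    intro P ξ
    simp only [dotProduct, Matrix.mulVec, star_trivial, Finset.mul_sum]
    exact Finset.sum_congr rfl fun j _ => Finset.sum_congr rfl fun k _ => by ring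
  obtain ⟨m, hm0, hm⟩ := (hK.prod (isCompact_sphere (0 : Fin 3 → ℝ) 1)).exists_forall_le'
    hQc.continuousOn (a := 0) fun q hq => by
      rw [hQe]
      refine (hpos q.1 hq.1).dotProduct_mulVec_pos fun h => ?_
      have h1 := hq.2
      rw [h] at h1
      simp at h1
  refine ⟨min d.toNNReal (m / 3).toNNReal, 3 * B', lt_min (by simpa using hd0)
    (by simpa using hm0), fun P hP => ⟨fun j k => ?_, ?_, fun ξ => ⟨?_, ?_⟩⟩⟩
  · refine (hBle P hP j k).trans ?_
    exact_mod_cast le_mul_of_one_le_left zero_le (by norm_num)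
  · refine le_trans ?_ (hd P hP)
    have : (min d.toNNReal (m / 3).toNNReal : ℝ≥0) ≤ d.toNNReal := min_le_left _ _
    exact (NNReal.coe_le_coe.2 this).trans (le_of_eq (Real.coe_toNNReal _ hd0.le))
  · have h1 : ((min d.toNNReal (m / 3).toNNReal : ℝ≥0) : ℝ) ≤ m / 3 :=
      (NNReal.coe_le_coe.2 (min_le_right _ _)).trans (le_of_eq (Real.coe_toNNReal _ (by positivity)))
    have h2 : ∑ j, ξ j ^ 2 ≤ 3 * ‖ξ‖ ^ 2 := by
      refine (Finset.sum_le_sum fun j _ => ?_ : _ ≤ ∑ _j : Fin 3, ‖ξ‖ ^ 2).trans (by simp)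
      exact sq_le_sq' (by have := norm_le_pi_norm ξ j; rw [Real.norm_eq_abs, abs_le] at this; linarith)
        ((le_abs_self _).trans (norm_le_pi_norm ξ j))
    have h3 : m * ‖ξ‖ ^ 2 ≤ ∑ j, ∑ k, a P j k * (ξ j * ξ k) := by
      rcases eq_or_ne ξ 0 with rfl | hξ
      · simp
      have hn : 0 < ‖ξ‖ := norm_pos_iff.2 hξ
      have h4 := hm (P, ‖ξ‖⁻¹ • ξ) ⟨hP, by simp [norm_smul, hn.ne']⟩
      have h5 : ∑ j, ∑ k, a P j k * ((‖ξ‖⁻¹ • ξ) j * (‖ξ‖⁻¹ • ξ) k) =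
          (‖ξ‖ ^ 2)⁻¹ * ∑ j, ∑ k, a P j k * (ξ j * ξ k) := by
        simp only [Finset.mul_sum, Pi.smul_apply, smul_eq_mul]
        refine Finset.sum_congr rfl fun j _ => Finset.sum_congr rfl fun k _ => ?_
        rw [sq, mul_inv]; ring
      rw [h5, le_inv_mul_iff₀ (by positivity)] at h4
      linarith
    have h0 : 0 ≤ ∑ j, ξ j ^ 2 := Finset.sum_nonneg fun _ _ => sq_nonneg _
    nlinarith [mul_le_mul_of_nonneg_right h1 h0]
  · refine (Finset.sum_le_sum fun j _ => Finset.sum_le_sum fun k _ =>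
      (?_ : _ ≤ (B' : ℝ) * ((ξ j ^ 2 + ξ k ^ 2) / 2))).trans (le_of_eq ?_)
    · refine (le_abs_self _).trans ?_
      rw [abs_mul]
      refine mul_le_mul (hBle P hP j k) ?_ (abs_nonneg _) (NNReal.coe_nonneg _)
      rw [abs_le]
      constructor <;> nlinarith [sq_nonneg (ξ j + ξ k), sq_nonneg (ξ j - ξ k)]
    · simp only [Fin.sum_univ_three]
      push_cast
      ring

lemma exists_elliptic (S : WaveSystem) {K : Set (Grad × Grad)} (hK : IsCompact K)
    (hKR : K ⊆ S.regime) : ∃ c C : ℝ≥0, Elliptic S c C K := by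
  have hg : ∀ j k, Continuous fun P => S.gInv P j k := fun j k => by
    have h := S.fg_smooth.continuous
    simp only [WaveSystem.gInv, Matrix.of_apply]
    fun_prop
  have hh : ∀ j k, Continuous fun P : Grad × Grad => S.hInv P.2 j k := fun j k => by
    have h := S.fh_smooth.continuous
    simp only [WaveSystem.hInv, Matrix.of_apply]
    fun_prop
  obtain ⟨c, C, hc0, h1⟩ := exists_ellipticity hK hg fun P hP => (hKR hP).1
  obtain ⟨c', C', hc0', h2⟩ := exists_ellipticity hK hh fun P hP => (hKR hP).2.1
  have m1 : ((min c c' : ℝ≥0) : ℝ) ≤ c := NNReal.coe_le_coe.2 (min_le_left _ _)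
  have m2 : ((min c c' : ℝ≥0) : ℝ) ≤ c' := NNReal.coe_le_coe.2 (min_le_right _ _)
  have m3 : (C : ℝ) ≤ (max C C' : ℝ≥0) := NNReal.coe_le_coe.2 (le_max_left _ _)
  have m4 : (C' : ℝ) ≤ (max C C' : ℝ≥0) := NNReal.coe_le_coe.2 (le_max_right _ _)
  have h0 : ∀ ξ : Fin 3 → ℝ, 0 ≤ ∑ j, ξ j ^ 2 := fun ξ => Finset.sum_nonneg fun _ _ => sq_nonneg _
  exact ⟨min c c', max C C', lt_min hc0 hc0',
    fun P hP ξ => ⟨(mul_le_mul_of_nonneg_right m1 (h0 ξ)).trans ((h1 P hP).2.2 ξ).1,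
      ((h1 P hP).2.2 ξ).2.trans (mul_le_mul_of_nonneg_right m3 (h0 ξ))⟩,
    fun P hP ξ => ⟨(mul_le_mul_of_nonneg_right m2 (h0 ξ)).trans ((h2 P hP).2.2 ξ).1,
      ((h2 P hP).2.2 ξ).2.trans (mul_le_mul_of_nonneg_right m4 (h0 ξ))⟩,
    fun P hP => m2.trans (h2 P hP).2.1, fun P hP j k => ((h1 P hP).1 j k).trans m3⟩

/-! ### The time integral of the supremum -/

lemma le_one_of_strichartz {S : WaveSystem} {X : LPCutoff} {N T : ℝ} {φ ψ : Field}
    (h : BootstrapAssumptions S X N T φ ψ) (hφ : GoodField T φ) (α : Fin 4) (j i : Fin 3) :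
    ∫⁻ τ in Icc 0 T, supN (pd α (sd j (φ i))) τ ^ 2 ≤ 1 := by
  have h1 := le_self_add.trans h.strichartz
  set F : Fin 4 → Fin 3 → Fin 3 → ℝ≥0∞ := fun α j i =>
    normL2Linf T (fun τ => slice τ (pd α (sd j (φ i))))
  have h2 : F α j i ≤ ∑ α, ∑ j, ∑ i, F α j i :=
    (Finset.single_le_sum (f := F α j) (fun _ _ => zero_le) (Finset.mem_univ i)).trans
      ((Finset.single_le_sum (f := fun j => ∑ i, F α j i) (fun _ _ => zero_le)
        (Finset.mem_univ j)).trans (Finset.single_le_sum (f := fun α => ∑ j, ∑ i, F α j i)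
          (fun _ _ => zero_le) (Finset.mem_univ α)))
  have h3 : F α j i ^ 2 ≤ 1 := (pow_le_pow_left' h2 2).trans h1
  simp only [F, normL2Linf] at h3
  rw [← ENNReal.rpow_natCast, ← ENNReal.rpow_mul] at h3
  norm_num at h3
  refine le_trans (lintegral_mono fun τ => ?_) h3
  exact pow_le_pow_left' (supN_le_eLpNorm ((hφ.good j i).pd α).continuous τ) 2

lemma exists_lintegral_lam_le {ε : ℝ≥0} (hε : 0 < ε) : ∃ T₀ : ℝ, 0 < T₀ ∧ T₀ ≤ 1 ∧
    ∀ (S : WaveSystem) (X : LPCutoff) (N T : ℝ) (φ ψ : Field), 0 < T → T ≤ T₀ →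
      BootstrapAssumptions S X N T φ ψ → GoodField T φ → ∫⁻ τ in Icc 0 T, lam φ τ ≤ ε := by
  set δ : ℝ := min 1 (ε / 37) with hδ
  have hδ0 : 0 < δ := lt_min one_pos (by positivity)
  have hδ1 : δ ≤ 1 := min_le_left _ _
  refine ⟨δ ^ 2, by positivity, pow_le_one₀ hδ0.le hδ1, fun S X N T φ ψ hT hT0 h hφ => ?_⟩
  have hm : ∀ α j i, Measurable (supN (pd α (sd j (φ i)))) := fun α j i =>
    measurable_supN ((hφ.good j i).pd α).continuous
  have h1 : ∀ α j i, ∫⁻ τ in Icc 0 T, supN (pd α (sd j (φ i))) τ ≤ ENNReal.ofReal δ := by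
    intro α j i
    refine le_of_sq_le_sq ((lintegral_sq_le 0 T _ (hm α j i)).trans ?_)
    refine (mul_le_mul' le_rfl (le_one_of_strichartz h hφ α j i)).trans ?_
    rw [mul_one, sub_zero, ← ENNReal.ofReal_pow hδ0.le]
    exact ENNReal.ofReal_le_ofReal hT0
  have h2 : ∫⁻ τ in Icc 0 T, lam φ τ ≤
      ∫⁻ τ in Icc 0 T, (1 + ∑ α, ∑ j, ∑ i, supN (pd α (sd j (φ i))) τ) := by
    refine lintegral_mono fun τ => ?_
    rw [lam, ENNReal.coe_add, ENNReal.coe_one]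
    exact add_le_add le_rfl ENNReal.coe_toNNReal_le_self
  refine h2.trans ?_
  rw [lintegral_add_left measurable_const, lintegral_finsetSum _ fun α _ =>
    Finset.measurable_sum _ fun j _ => Finset.measurable_sum _ fun i _ => hm α j i]
  have h3 : ∀ α, ∫⁻ τ in Icc 0 T, ∑ j, ∑ i, supN (pd α (sd j (φ i))) τ ≤ 9 * ENNReal.ofReal δ := by
    intro α
    rw [lintegral_finsetSum _ fun j _ => Finset.measurable_sum _ fun i _ => hm α j i]
    simp only [lintegral_finsetSum _ fun i _ => hm _ _ i]
    refine (Finset.sum_le_sum fun j _ => Finset.sum_le_sum fun i _ => h1 α j i).trans (le_of_eq ?_)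
    simp only [Finset.sum_const, Finset.card_univ, Fintype.card_fin, nsmul_eq_mul]
    rw [← mul_assoc]; norm_num
  have h4 : ∫⁻ _ in Icc 0 T, (1 : ℝ≥0∞) ≤ ENNReal.ofReal δ := by
    rw [lintegral_one, Measure.restrict_apply_univ, Real.volume_Icc, sub_zero]
    exact ENNReal.ofReal_le_ofReal (hT0.trans (by nlinarith))
  refine (add_le_add h4 (Finset.sum_le_sum fun α _ => h3 α)).trans ?_
  simp only [Finset.sum_const, Finset.card_univ, Fintype.card_fin, nsmul_eq_mul]
  have e : ENNReal.ofReal δ + (4 : ℕ) * (9 * ENNReal.ofReal δ) = ENNReal.ofReal (37 * δ) := by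
    rw [ENNReal.ofReal_mul (by norm_num)]
    norm_num
    ring
  rw [e]
  refine ENNReal.ofReal_le_of_le_toReal ?_
  have : δ ≤ ε / 37 := min_le_right _ _
  rw [ENNReal.coe_toReal]
  linarith

/-- The continuity method. -/
lemma le_of_continuity_method {M : ℝ → ℝ} {T A : ℝ} (hM : ContinuousOn M (Icc 0 T))
    (h0 : M 0 < A) (h : ∀ t ∈ Icc 0 T, 0 < t → (∀ τ ∈ Icc 0 t, M τ ≤ A) → M t < A) :
    ∀ t ∈ Icc 0 T, M t ≤ A := by
  intro t ht
  by_contra! hlt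
  have hIVT : ∀ s ∈ Icc 0 T, A < M s → ∃ r ∈ Icc 0 s, M r = A := fun s hs hlt => by
    obtain ⟨r, hr, e⟩ := intermediate_value_Icc hs.1
      (hM.mono (Icc_subset_Icc le_rfl hs.2)) ⟨h0.le, hlt.le⟩
    exact ⟨r, hr, e⟩
  obtain ⟨r, hr, hrA⟩ := hIVT t ht hlt
  have hcl : IsClosed (Icc 0 T ∩ M ⁻¹' {A}) := hM.preimage_isClosed_of_isClosed isClosed_Icc
    isClosed_singleton
  obtain ⟨s, ⟨hs, hsA⟩, hmin⟩ := (isCompact_Icc.of_isClosed_subset hcl inter_subset_left).exists_isLeast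
    ⟨r, ⟨hr.1, hr.2.trans ht.2⟩, hrA⟩
  have hsA : M s = A := hsA
  have hs0 : 0 < s := lt_of_le_of_ne hs.1 fun e => by rw [← e] at hsA; exact h0.ne hsA
  refine (h s hs hs0 fun τ hτ => ?_).ne hsA
  by_contra! hτA
  have hτT : τ ∈ Icc 0 T := ⟨hτ.1, hτ.2.trans hs.2⟩
  obtain ⟨q, hq, hqA⟩ := hIVT τ hτT hτA
  have h1 : s ≤ q := hmin ⟨⟨hq.1, hq.2.trans hτT.2⟩, hqA⟩
  have h2 : τ = s := le_antisymm hτ.2 (h1.trans hq.2)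
  rw [h2, hsA] at hτA
  exact lt_irrefl _ hτA

end

section

lemma IsSmoothField.mono {T T' : ℝ} {V : Field} (h : IsSmoothField T V) (hT : T' ≤ T) :
    IsSmoothField T' V :=
  ⟨h.1, fun k α j i => (h.2 k α j i).imp fun _ hM t ht => hM t ⟨ht.1, ht.2.trans hT⟩⟩

lemma IsSolution.mono {S : WaveSystem} {T T' : ℝ} {φ ψ : Field} (h : IsSolution S T φ ψ)
    (hT : T' ≤ T) : IsSolution S T' φ ψ where
  smooth_div := h.smooth_div.mono hT
  smooth_curl := h.smooth_curl.mono hT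
  faster p hp := h.faster p ⟨hp.1, hp.2.trans hT⟩
  curl_eq_zero p hp := h.curl_eq_zero p ⟨hp.1, hp.2.trans hT⟩
  slower p hp := h.slower p ⟨hp.1, hp.2.trans hT⟩
  div_eq_zero p hp := h.div_eq_zero p ⟨hp.1, hp.2.trans hT⟩

/-- The Sobolev norms of the unknowns `div φ`, `curl ψ` and of their time derivatives. -/
def unknownNorm (σ : ℝ) (φ ψ : Field) : Option (Fin 3) × Bool → ℝ → ℝ≥0∞
  | (none, false), t => sobolevNorm (2 + σ) (slice t (div φ))
  | (none, true), t => sobolevNorm (1 + σ) (slice t (pd 0 (div φ)))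
  | (some i, false), t => sobolevNorm (3 + σ) (slice t (curl ψ i))
  | (some i, true), t => sobolevNorm (2 + σ) (slice t (pd 0 (curl ψ i)))

lemma unknownNorm_lt_top {T : ℝ} {φ ψ : Field} (hφ : GoodField T φ) (hψ : GoodField T ψ) (σ : ℝ)
    (c : Option (Fin 3) × Bool) {t : ℝ} (ht : t ∈ Icc 0 T) : unknownNorm σ φ ψ c t < ⊤ := by
  rcases c with ⟨_ | i, _ | _⟩
  · exact sobolevNorm_lt_top (hφ.div.isHinf ht) _
  · exact sobolevNorm_lt_top ((hφ.div.pd 0).isHinf ht) _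
  · exact sobolevNorm_lt_top ((hψ.curl i).isHinf ht) _
  · exact sobolevNorm_lt_top (((hψ.curl i).pd 0).isHinf ht) _

lemma continuousOn_unknownNorm {T : ℝ} {φ ψ : Field} (hφ : GoodField T φ) (hψ : GoodField T ψ)
    (σ : ℝ) (c : Option (Fin 3) × Bool) :
    ContinuousOn (fun t => (unknownNorm σ φ ψ c t).toReal) (Icc 0 T) := by
  rcases c with ⟨_ | i, _ | _⟩
  · exact hφ.div.continuousOn_sobolevNorm _
  · exact (hφ.div.pd 0).continuousOn_sobolevNorm _
  · exact (hψ.curl i).continuousOn_sobolevNorm _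
  · exact ((hψ.curl i).pd 0).continuousOn_sobolevNorm _

lemma Hyp.of_unknownNorm {S : WaveSystem} {σ : ℝ} {K : Set (Grad × Grad)} {A : ℝ≥0} {T : ℝ}
    {φ ψ : Field} (h0 : 0 < T) (h1 : T ≤ 1) (h : IsSolution S T φ ψ)
    (hK : ∀ p : Spacetime, p.1 ∈ Icc 0 T → (grad φ p, grad ψ p) ∈ K)
    (hA : ∀ t ∈ Icc 0 T, ∀ c, unknownNorm σ φ ψ c t ≤ A) : Hyp S σ K A T φ ψ :=
  ⟨h0, h1, h, hK, fun t ht => hA t ht (none, false), fun t ht => hA t ht (none, true),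
    fun t ht i => hA t ht (some i, false), fun t ht i => hA t ht (some i, true)⟩

lemma le_of_energy_le {x y a b I : ℝ≥0∞} {C M D E : ℝ≥0} (h : x ^ 2 + y ^ 2 ≤
    C * (a ^ 2 + b ^ 2) + M * I) (ha : a ≤ D) (hb : b ≤ D) (hI : M * I ≤ 1) (hE : 2 * C + 1 ≤ E) :
    x ≤ (E * (D + 1) : ℝ≥0) ∧ y ≤ (E * (D + 1) : ℝ≥0) := by
  have h1 : x ^ 2 + y ^ 2 ≤ ((E * (D + 1) : ℝ≥0) : ℝ≥0∞) ^ 2 := by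
    refine (h.trans (add_le_add (mul_le_mul' le_rfl (add_le_add (pow_le_pow_left' ha 2)
      (pow_le_pow_left' hb 2))) hI)).trans ?_
    have h2 : C * (D ^ 2 + D ^ 2) + 1 ≤ (E * (D + 1)) ^ 2 := by
      have h3 : ((2 * C + 1) * (D + 1)) ^ 2 ≤ (E * (D + 1)) ^ 2 := by gcongr
      refine le_trans ?_ h3
      have : ((2 * C + 1) * (D + 1)) ^ 2 = (C * (D ^ 2 + D ^ 2) + 1) +
        (4 * C ^ 2 * (D + 1) ^ 2 + 2 * C * D ^ 2 + 8 * C * D + 4 * C + D ^ 2 + 2 * D) := by ring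
      rw [this]
      exact le_self_add
    exact_mod_cast h2
  exact ⟨le_of_sq_le_sq (le_self_add.trans h1),
    le_of_sq_le_sq ((le_add_of_nonneg_left zero_le).trans h1)⟩

/-- The a priori estimate for the unknowns. -/
lemma exists_apriori {σ : ℝ} (hσ : 0 < σ) (hσ' : σ < 1 / 2) (S : WaveSystem)
    {K : Set (Grad × Grad)} (hK : IsCompact K) (hKR : K ⊆ interior S.regime) :
    ∃ C : ℝ≥0, ∀ D : ℝ≥0, ∃ T₀ : ℝ, 0 < T₀ ∧ ∀ (X : LPCutoff) (N T : ℝ) (φ ψ : Field), 0 < T →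
      T ≤ T₀ → IsSolution S T φ ψ → (∀ x, (grad φ (0, x), grad ψ (0, x)) ∈ K) →
      BootstrapAssumptions S X N T φ ψ → (∀ c, unknownNorm σ φ ψ c 0 ≤ D) →
      sobolevNorm σ (slice 0 (pd 0 (pd 0 (div φ)))) ≤ D → ∀ t ∈ Icc 0 T,
        sobolevNorm (2 + σ) (slice t (div φ)) ≤ (C * (D + 1) : ℝ≥0) ∧
        sobolevNorm (1 + σ) (slice t (pd 0 (div φ))) ≤ (C * (D + 1) : ℝ≥0) ∧
        sobolevNorm σ (slice t (pd 0 (pd 0 (div φ)))) ≤ (C * (D + 1) : ℝ≥0) := by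
  obtain ⟨δ, hδ0, hδ⟩ := hK.exists_cthickening_subset_open isOpen_interior hKR
  set K' := Metric.cthickening δ K with hK'
  obtain ⟨c, C, hell⟩ := exists_elliptic S (hK.cthickening (r := δ)) (hδ.trans interior_subset)
  obtain ⟨C₁, hC₁⟩ := Hyp.energy_div_le hσ hσ' (C := C) hell.pos
  obtain ⟨C₁', hC₁'⟩ := Hyp.energy_curl_le hσ hσ' (C := C) hell.pos
  obtain ⟨C₂, hC₂⟩ := Sit.sq_sobolevNorm_dttDiv_le hσ hσ' C
  set E : ℝ≥0 := 2 * (C₁ + C₁') + 1 with hE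
  have hE1 : 2 * C₁ + 1 ≤ E := by
    rw [hE]; exact add_le_add (mul_le_mul' le_rfl le_self_add) le_rfl
  have hE2 : 2 * C₁' + 1 ≤ E := by
    rw [hE]; exact add_le_add (mul_le_mul' le_rfl (le_add_of_nonneg_left zero_le)) le_rfl
  refine ⟨(C₂ + 1) * (E + 1), fun D => ?_⟩
  set A : ℝ≥0 := 8 * (E * (D + 1)) + 1 with hA
  obtain ⟨M₁, hM₁⟩ := hC₁ S K' A hell
  choose M₂ hM₂ using hC₁' S K' A hell
  obtain ⟨ε₁, hε₁0, hε₁⟩ := hC₂ S K' A c hell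
  obtain ⟨G, hG⟩ := Sit.abs_grads_sub_le (S := S) (σ := σ) (K := univ) (A := A) hσ
  obtain ⟨ε, hε0, hε⟩ := exists_pos_le_of_continuous
    (F := fun ε => G * ε + (M₁ * ε + ((∑ i, M₂ i) * ε + ε)))
    (η := min (min 1 δ.toNNReal) ε₁) (by fun_prop) (by simp)
    (lt_min (lt_min one_pos (by simpa using hδ0)) hε₁0)
  have e1 : G * ε ≤ δ.toNNReal := le_self_add.trans
    (hε.trans ((min_le_left _ _).trans (min_le_right _ _)))
  have e2 : M₁ * ε ≤ 1 := (le_self_add.trans (le_add_of_nonneg_left zero_le)).trans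
    (hε.trans ((min_le_left _ _).trans (min_le_left _ _)))
  have e3 : (∑ i, M₂ i) * ε ≤ 1 :=
    ((le_self_add.trans (le_add_of_nonneg_left zero_le)).trans (le_add_of_nonneg_left zero_le)).trans
      (hε.trans ((min_le_left _ _).trans (min_le_left _ _)))
  have e4 : ε ≤ ε₁ := (((le_add_of_nonneg_left zero_le).trans (le_add_of_nonneg_left zero_le)).trans
    (le_add_of_nonneg_left zero_le)).trans (hε.trans (min_le_right _ _))
  obtain ⟨T₀, hT₀0, hT₀1, hT₀⟩ := exists_lintegral_lam_le hε0
  refine ⟨T₀, hT₀0, fun X N T φ ψ hT hTT₀ hsol hinit hboot hD hD2 => ?_⟩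
  have hφ := hsol.smooth_div.goodField
  have hψ := hsol.smooth_curl.goodField
  have hI := hT₀ S X N T φ ψ hT hTT₀ hboot hφ
  have hIt : ∀ t ≤ T, ∫⁻ τ in Icc 0 t, lam φ τ ≤ ε := fun t ht =>
    (lintegral_mono_set (Icc_subset_Icc le_rfl ht)).trans hI
  have hyp : ∀ t₁ ∈ Icc 0 T, 0 < t₁ → (∀ t ∈ Icc 0 t₁, ∀ c, unknownNorm σ φ ψ c t ≤ A) →
      Hyp S σ K' A t₁ φ ψ := by
    intro t₁ ht₁ h0 hA
    have hs := hsol.mono ht₁.2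
    have h1 := ht₁.2.trans (hTT₀.trans hT₀1)
    have hu : Hyp S σ univ A t₁ φ ψ := Hyp.of_unknownNorm h0 h1 hs (fun _ _ => mem_univ _) hA
    refine Hyp.of_unknownNorm h0 h1 hs (fun p hp => ?_) hA
    have h2 := hG ⟨t₁, φ, ψ, p.1, hu, hp⟩ ε (hIt t₁ ht₁.2)
    have h3 : ∀ a, |comp φ ψ a p - comp φ ψ a (0, p.2)| ≤ δ := fun a => (h2 a p.2).trans
      ((NNReal.coe_le_coe.2 e1).trans (le_of_eq (Real.coe_toNNReal _ hδ0.le)))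
    refine Metric.mem_cthickening_of_dist_le _ _ δ K (hinit p.2) ?_
    rw [Prod.dist_eq]
    refine max_le ?_ ?_
    · exact (dist_pi_le_iff hδ0.le).2 fun j => (dist_pi_le_iff hδ0.le).2 fun i =>
        h3 (Sum.inl (j, i))
    · exact (dist_pi_le_iff hδ0.le).2 fun j => (dist_pi_le_iff hδ0.le).2 fun i =>
        h3 (Sum.inr (j, i))
  have improve : ∀ t₁ ∈ Icc 0 T, 0 < t₁ → Hyp S σ K' A t₁ φ ψ → ∀ t ∈ Icc 0 t₁, ∀ c,
      unknownNorm σ φ ψ c t ≤ (E * (D + 1) : ℝ≥0) := by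
    intro t₁ ht₁ h0 h t ht c
    have hle : ∀ {M : ℝ≥0}, M * ε ≤ 1 → (M : ℝ≥0∞) * ∫⁻ τ in Icc 0 t, lam φ τ ≤ 1 := fun hM =>
      (mul_le_mul' le_rfl (hIt t (ht.2.trans ht₁.2))).trans (by exact_mod_cast hM)
    have r1 := le_of_energy_le (hM₁ t₁ φ ψ h t ht) (hD (none, false)) (hD (none, true)) (hle e2) hE1
    have r2 := fun i => le_of_energy_le (hM₂ i t₁ φ ψ h t ht) (hD (some i, false))
      (hD (some i, true)) (hle ((mul_le_mul' (le_sum_nnreal M₂ i) le_rfl).trans e3)) hE2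
    rcases c with ⟨_ | i, _ | _⟩
    exacts [r1.1, r1.2, (r2 i).1, (r2 i).2]
  have hsum : ∀ t ∈ Icc 0 T, (∀ c, unknownNorm σ φ ψ c t ≤ (E * (D + 1) : ℝ≥0)) →
      ∑ c, (unknownNorm σ φ ψ c t).toReal < A := by
    intro t ht h
    have h1 : ∑ c, (unknownNorm σ φ ψ c t).toReal ≤ ∑ _c : Option (Fin 3) × Bool,
        ((E * (D + 1) : ℝ≥0) : ℝ) := Finset.sum_le_sum fun c _ =>
      ENNReal.toReal_le_coe_of_le_coe (h c)
    refine h1.trans_lt ?_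
    rw [hA, Finset.sum_const, Finset.card_univ, Fintype.card_prod, Fintype.card_option,
      Fintype.card_fin, Fintype.card_bool]
    push_cast
    rw [nsmul_eq_mul]
    push_cast
    linarith
  have hle : ∀ t ∈ Icc 0 T, ∑ c, (unknownNorm σ φ ψ c t).toReal ≤ A →
      ∀ c, unknownNorm σ φ ψ c t ≤ A := by
    intro t ht h c
    have h1 := (Finset.single_le_sum (f := fun c => (unknownNorm σ φ ψ c t).toReal)
      (fun _ _ => ENNReal.toReal_nonneg) (Finset.mem_univ c)).trans h
    rw [← ENNReal.ofReal_toReal (unknownNorm_lt_top hφ hψ σ c ht).ne]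
    exact (ENNReal.ofReal_le_ofReal h1).trans (by simp)
  have hM := le_of_continuity_method (A := A)
    (M := fun t => ∑ c, (unknownNorm σ φ ψ c t).toReal) (T := T)
    (continuousOn_finsetSum _ fun c _ => continuousOn_unknownNorm hφ hψ σ c)
    (hsum 0 ⟨le_rfl, hT.le⟩ fun c => (hD c).trans (ENNReal.coe_le_coe.2 (by
      refine (le_self_add (b := 1)).trans (le_mul_of_one_le_left zero_le ?_)
      rw [hE]; exact le_add_of_nonneg_left zero_le)))
    (fun t₁ ht₁ h0 h => hsum t₁ ht₁ (improve t₁ ht₁ h0 (hyp t₁ ht₁ h0 fun t ht =>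
      hle t ⟨ht.1, ht.2.trans ht₁.2⟩ (h t ht)) t₁ ⟨ht₁.1, le_rfl⟩))
  have hTT : T ∈ Icc 0 T := ⟨hT.le, le_rfl⟩
  have hfull := hyp T hTT hT fun t ht => hle t ht (hM t ht)
  intro t ht
  have him := improve T hTT hT hfull t ht
  have hEC : E * (D + 1) ≤ (C₂ + 1) * (E + 1) * (D + 1) :=
    mul_le_mul' (le_self_add.trans (le_mul_of_one_le_left zero_le (le_add_of_nonneg_left zero_le)))
      le_rfl
  refine ⟨(him (none, false)).trans (ENNReal.coe_le_coe.2 hEC),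
    (him (none, true)).trans (ENNReal.coe_le_coe.2 hEC), ?_⟩
  have h1 := hε₁ ⟨T, φ, ψ, t, hfull, ht⟩ (hI.trans (ENNReal.coe_le_coe.2 e4))
  refine le_of_sq_le_sq (h1.trans ?_)
  refine (mul_le_mul' le_rfl (add_le_add (add_le_add (pow_le_pow_left' (him (none, false)) 2)
    (pow_le_pow_left' hD2 2)) le_rfl)).trans ?_
  have h2 : C₂ * ((E * (D + 1)) ^ 2 + D ^ 2 + 1) ≤ ((C₂ + 1) * (E + 1) * (D + 1)) ^ 2 := by
    have : ((C₂ + 1) * (E + 1) * (D + 1)) ^ 2 = C₂ * ((E * (D + 1)) ^ 2 + D ^ 2 + 1) +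
      (C₂ * (2 * D) + (C₂ ^ 2 + C₂ + 1) * ((E + 1) * (D + 1)) ^ 2 +
        C₂ * (2 * E) * (D + 1) ^ 2) := by ring
    rw [this]
    exact le_self_add
  exact_mod_cast h2

end

section

/-! ### The norms of the data and of the solution -/

lemma pdIter_zero (α : Fin 0 → Fin 4) (w : Spacetime → ℝ) : pdIter α w = w := by
  simp [pdIter]

lemma pdIter_one (α : Fin 1 → Fin 4) (w : Spacetime → ℝ) : pdIter α w = pd (α 0) w := by
  simp [pdIter, List.ofFn_succ]

lemma pdIter_two (α : Fin 2 → Fin 4) (w : Spacetime → ℝ) :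
    pdIter α w = pd (α 0) (pd (α 1) w) := by
  simp [pdIter, List.ofFn_succ]

lemma sobolevNorm_le_derivSobolev {k : ℕ} (α : Fin k → Fin 4) (j : Fin 3) (s : ℝ)
    (u : Spacetime → ℝ) (t : ℝ) :
    sobolevNorm s (slice t (pdIter α (sd j u))) ≤ derivSobolev k s u t :=
  (Finset.single_le_sum (f := fun j => sobolevNorm s (slice t (pdIter α (sd j u))))
    (fun _ _ => zero_le) (Finset.mem_univ j)).trans
    (Finset.single_le_sum (f := fun α : Fin k → Fin 4 => ∑ j, sobolevNorm s
      (slice t (pdIter α (sd j u)))) (fun _ _ => zero_le) (Finset.mem_univ α))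

lemma derivSobolev_le_divNorm {k : ℕ} (hk : k < 3) (N : ℝ) (u : Spacetime → ℝ) (t : ℝ) :
    derivSobolev k (N - k - 1) u t ≤ divNorm N u t :=
  Finset.single_le_sum (f := fun k : ℕ => derivSobolev k (N - k - 1) u t) (fun _ _ => zero_le)
    (Finset.mem_range.2 hk)

lemma derivSobolev_le_curlNorm {k : ℕ} (hk : k < 4) (N : ℝ) (u : Spacetime → ℝ) (t : ℝ) :
    derivSobolev k (N - k) u t ≤ curlNorm N u t :=
  Finset.single_le_sum (f := fun k : ℕ => derivSobolev k (N - k) u t) (fun _ _ => zero_le)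
    (Finset.mem_range.2 hk)

lemma derivSobolev_le {k : ℕ} {s : ℝ} {u : Spacetime → ℝ} {t : ℝ} {B : ℝ≥0∞}
    (h : ∀ (α : Fin k → Fin 4) j, sobolevNorm s (slice t (pdIter α (sd j u))) ≤ B) :
    derivSobolev k s u t ≤ 4 ^ k * 3 * B := by
  refine (Finset.sum_le_sum fun α _ => Finset.sum_le_sum fun j _ => h α j).trans (le_of_eq ?_)
  simp [mul_assoc]

namespace GoodField

variable {T : ℝ} {V : Field}

lemma sobolevNorm_div_le (hV : GoodField T V) {t : ℝ} (ht : t ∈ Icc 0 T) {s : ℝ} {B : ℝ≥0}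
    (h : ∀ i, sobolevNorm s (slice t (sd i (V i))) ≤ B) :
    sobolevNorm s (slice t (ElasticWave.div V)) ≤ (3 * B : ℝ≥0) := by
  refine (sobolevNorm_sum_le Finset.univ (F := fun i => slice t (sd i (V i)))
    (fun i => ((hV.good i i).isHinf ht).memLp) s).trans ((Finset.sum_le_sum fun i _ => h i).trans ?_)
  simp

lemma sobolevNorm_curl_le (hV : GoodField T V) {t : ℝ} (ht : t ∈ Icc 0 T) {s : ℝ} {B : ℝ≥0}
    (h : ∀ j i, sobolevNorm s (slice t (sd j (V i))) ≤ B) (l : Fin 3) :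
    sobolevNorm s (slice t (ElasticWave.curl V l)) ≤ (3 * B : ℝ≥0) := by
  refine (sobolevNorm_sub_le (F := slice t (sd (l + 1) (V (l + 2))))
    (G := slice t (sd (l + 2) (V (l + 1)))) ((hV.good _ _).isHinf ht).memLp
    ((hV.good _ _).isHinf ht).memLp s).trans ((add_le_add (h _ _) (h _ _)).trans ?_)
  rw [← ENNReal.coe_add, ← two_mul]
  exact ENNReal.coe_le_coe.2 (mul_le_mul' (by norm_num) le_rfl)

end GoodField

lemma Good.sobolevNorm_sd_le {T : ℝ} {w : Spacetime → ℝ} (hw : Good T w) {t : ℝ}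
    (ht : t ∈ Icc 0 T) (k : Fin 3) (s : ℝ) :
    sobolevNorm s (slice t (ElasticWave.sd k w)) ≤ 7 * sobolevNorm (s + 1) (slice t w) := by
  rw [← der_slice hw.smooth]
  exact sobolevNorm_der_le (hw.isHinf ht) k s

/-- The norm in the conclusion is controlled by the norms of the divergence. -/
lemma divNorm_le {T : ℝ} (hT : 0 < T) {φ : Field} (hφ : GoodField T φ)
    (hcurl : ∀ p : Spacetime, p.1 ∈ Icc 0 T → ∀ l, curl φ l p = 0) {σ t : ℝ} (ht : t ∈ Icc 0 T)
    {Y : ℝ≥0∞} (h0 : sobolevNorm (2 + σ) (slice t (div φ)) ≤ Y)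
    (h1 : sobolevNorm (1 + σ) (slice t (pd 0 (div φ))) ≤ Y)
    (h2 : sobolevNorm σ (slice t (pd 0 (pd 0 (div φ)))) ≤ Y) (i : Fin 3) :
    divNorm (3 + σ) (φ i) t ≤ 63 * (49 * Y) := by
  have hc1 := hφ.curl_dt_eq_zero hT hcurl
  have hc2 := hφ.dt.curl_dt_eq_zero hT hc1
  have s0 : ∀ j, sobolevNorm (2 + σ) (slice t (sd j (φ i))) ≤ Y := fun j =>
    (hφ.sobolevNorm_sd_of_curl hcurl ht _ j i).trans h0
  have s1 : ∀ j, sobolevNorm (1 + σ) (slice t (pd 0 (sd j (φ i)))) ≤ Y := fun j => by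
    rw [← hφ.sd_dt]
    refine (hφ.dt.sobolevNorm_sd_of_curl hc1 ht _ j i).trans ?_
    rwa [hφ.div_dt]
  have s2 : ∀ j, sobolevNorm σ (slice t (pd 0 (pd 0 (sd j (φ i))))) ≤ Y := fun j => by
    rw [← hφ.sd_dt, ← hφ.dt.sd_dt]
    refine (hφ.dt.dt.sobolevNorm_sd_of_curl hc2 ht _ j i).trans ?_
    rwa [hφ.dt.div_dt, hφ.div_dt]
  have le7 : Y ≤ 7 * Y := le_mul_of_one_le_left zero_le (by norm_num)
  have le49 : 7 * Y ≤ 49 * Y := mul_le_mul' (by norm_num) le_rfl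
  have e49 : 7 * (7 * Y) = 49 * Y := by rw [← mul_assoc]; norm_num
  have r1 : ∀ (α : Fin 4) j, sobolevNorm (1 + σ) (slice t (pd α (sd j (φ i)))) ≤ 7 * Y := by
    intro α j
    refine Fin.cases ((s1 j).trans le7) (fun k => ?_) α
    refine ((hφ.good j i).sobolevNorm_sd_le ht k _).trans (mul_le_mul' le_rfl ?_)
    rw [show 1 + σ + 1 = 2 + σ by ring]
    exact s0 j
  have r2 : ∀ (α β : Fin 4) j, sobolevNorm σ (slice t (pd α (pd β (sd j (φ i))))) ≤ 49 * Y := by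
    intro α β j
    have hs : ∀ (k : Fin 3) (β : Fin 4),
        sobolevNorm σ (slice t (pd k.succ (pd β (sd j (φ i))))) ≤ 49 * Y := fun k β => by
      refine (((hφ.good j i).pd β).sobolevNorm_sd_le ht k _).trans ?_
      rw [add_comm σ 1, ← e49]
      exact mul_le_mul' le_rfl (r1 β j)
    refine Fin.cases ?_ (fun k => hs k β) α
    refine Fin.cases ((s2 j).trans (le7.trans le49)) (fun k => ?_) β
    rw [pd_comm (hφ.good j i).smooth]
    exact hs k 0
  have d0 : derivSobolev 0 (3 + σ - (0 : ℕ) - 1) (φ i) t ≤ 4 ^ 0 * 3 * (49 * Y) :=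
    derivSobolev_le fun α j => by
      rw [pdIter_zero, show 3 + σ - (0 : ℕ) - 1 = 2 + σ by push_cast; ring]
      exact (s0 j).trans (le7.trans le49)
  have d1 : derivSobolev 1 (3 + σ - (1 : ℕ) - 1) (φ i) t ≤ 4 ^ 1 * 3 * (49 * Y) :=
    derivSobolev_le fun α j => by
      rw [pdIter_one, show 3 + σ - (1 : ℕ) - 1 = 1 + σ by push_cast; ring]
      exact (r1 _ j).trans le49
  have d2 : derivSobolev 2 (3 + σ - (2 : ℕ) - 1) (φ i) t ≤ 4 ^ 2 * 3 * (49 * Y) :=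
    derivSobolev_le fun α j => by
      rw [pdIter_two, show 3 + σ - (2 : ℕ) - 1 = σ by push_cast; ring]
      exact r2 _ _ j
  rw [divNorm, Finset.sum_range_succ, Finset.sum_range_succ, Finset.sum_range_one]
  refine (add_le_add (add_le_add d0 d1) d2).trans (le_of_eq ?_)
  rw [← add_mul, ← add_mul]
  norm_num

/-- The norms of the data control the norms of the unknowns at the initial time. -/
lemma DataAssumptions.unknownNorm_le {σ D T : ℝ} (hT : 0 ≤ T) {K : Set (Grad × Grad)} {φ ψ : Field}
    (h : DataAssumptions (3 + σ) D K φ ψ) (hφ : GoodField T φ) (hψ : GoodField T ψ) :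
    (∀ c, unknownNorm σ φ ψ c 0 ≤ (3 * D.toNNReal : ℝ≥0)) ∧
      sobolevNorm σ (slice 0 (pd 0 (pd 0 (div φ)))) ≤ (3 * D.toNNReal : ℝ≥0) := by
  have h0 : (0 : ℝ) ∈ Icc 0 T := ⟨le_rfl, hT⟩
  have hd : ∀ {k : ℕ} (_ : k < 3) (α : Fin k → Fin 4) j i,
      sobolevNorm (3 + σ - k - 1) (slice 0 (pdIter α (sd j (φ i)))) ≤ D.toNNReal :=
    fun hk α j i => (sobolevNorm_le_derivSobolev α j _ _ _).trans
      ((derivSobolev_le_divNorm hk _ _ _).trans (h.div_le i))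
  have hc : ∀ {k : ℕ} (_ : k < 4) (α : Fin k → Fin 4) j i,
      sobolevNorm (3 + σ - k) (slice 0 (pdIter α (sd j (ψ i)))) ≤ D.toNNReal :=
    fun hk α j i => (sobolevNorm_le_derivSobolev α j _ _ _).trans
      ((derivSobolev_le_curlNorm hk _ _ _).trans (h.curl_le i))
  have d0 : ∀ j i, sobolevNorm (2 + σ) (slice 0 (sd j (φ i))) ≤ D.toNNReal := fun j i => by
    have := hd (k := 0) (by norm_num) (fun _ => 0) j i
    rwa [pdIter_zero, show 3 + σ - (0 : ℕ) - 1 = 2 + σ by push_cast; ring] at this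
  have d1 : ∀ j i, sobolevNorm (1 + σ) (slice 0 (sd j (dt φ i))) ≤ D.toNNReal := fun j i => by
    have := hd (k := 1) (by norm_num) (fun _ => 0) j i
    rwa [pdIter_one, show 3 + σ - (1 : ℕ) - 1 = 1 + σ by push_cast; ring, ← hφ.sd_dt] at this
  have d2 : ∀ j i, sobolevNorm σ (slice 0 (sd j (dt (dt φ) i))) ≤ D.toNNReal := fun j i => by
    have := hd (k := 2) (by norm_num) (fun _ => 0) j i
    rwa [pdIter_two, show 3 + σ - (2 : ℕ) - 1 = σ by push_cast; ring, ← hφ.sd_dt,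
      ← hφ.dt.sd_dt] at this
  have c0 : ∀ j i, sobolevNorm (3 + σ) (slice 0 (sd j (ψ i))) ≤ D.toNNReal := fun j i => by
    have := hc (k := 0) (by norm_num) (fun _ => 0) j i
    rwa [pdIter_zero, show 3 + σ - (0 : ℕ) = 3 + σ by push_cast; ring] at this
  have c1 : ∀ j i, sobolevNorm (2 + σ) (slice 0 (sd j (dt ψ i))) ≤ D.toNNReal := fun j i => by
    have := hc (k := 1) (by norm_num) (fun _ => 0) j i
    rwa [pdIter_one, show 3 + σ - (1 : ℕ) = 2 + σ by push_cast; ring, ← hψ.sd_dt] at this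
  refine ⟨fun c => ?_, ?_⟩
  · rcases c with ⟨_ | i, _ | _⟩
    · exact hφ.sobolevNorm_div_le h0 fun i => d0 i i
    · have := hφ.dt.sobolevNorm_div_le h0 fun i => d1 i i
      rwa [hφ.div_dt] at this
    · exact hψ.sobolevNorm_curl_le h0 c0 i
    · have := hψ.dt.sobolevNorm_curl_le h0 c1 i
      rwa [hψ.curl_dt] at this
  · have := hφ.dt.dt.sobolevNorm_div_le h0 fun i => d2 i i
    rwa [hφ.dt.div_dt, hφ.div_dt] at this

end

end ElasticWave

end

theorem proposition1p3 (S : ElasticWave.WaveSystem) (X : ElasticWave.LPCutoff)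
    (N : ℝ) (hN : 3 < N) (hN' : N < 7 / 2)
    (K : Set (ElasticWave.Grad × ElasticWave.Grad)) (hK : IsCompact K)
    (hKR : K ⊆ interior S.regime) :
    ∃ C : ℝ, 0 < C ∧ ∀ D : ℝ, 0 < D → ∃ T₀ : ℝ, 0 < T₀ ∧
      ∀ T : ℝ, 0 < T → T ≤ T₀ → ∀ φ ψ : ElasticWave.Field,
        ElasticWave.IsSolution S T φ ψ →
        ElasticWave.DataAssumptions N D K φ ψ →
        ElasticWave.BootstrapAssumptions S X N T φ ψ →
        ∀ t ∈ Set.Icc 0 T,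
          ∑ i, ElasticWave.divNorm N (φ i) t ≤ ENNReal.ofReal (C * (D + 1)) := by
  obtain ⟨C, hC⟩ := ElasticWave.exists_apriori (σ := N - 3) (by linarith) (by linarith) S hK hKR
  refine ⟨3 * (63 * (49 * (3 * (C + 1)))), by positivity, fun D hD => ?_⟩
  obtain ⟨T₀, hT₀, h⟩ := hC (3 * D.toNNReal)
  refine ⟨T₀, hT₀, fun T hT hTT₀ φ ψ hsol hdata hboot t ht => ?_⟩
  have hφ := hsol.smooth_div.goodField
  obtain ⟨h1, h2⟩ := ElasticWave.DataAssumptions.unknownNorm_le (σ := N - 3) hT.le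
    (by rwa [add_sub_cancel]) hφ hsol.smooth_curl.goodField
  obtain ⟨r0, r1, r2⟩ := h X N T φ ψ hT hTT₀ hsol (fun x => interior_subset (hdata.mem x)) hboot
    h1 h2 t ht
  refine (Finset.sum_le_sum fun i _ =>
    ElasticWave.divNorm_le hT hφ hsol.curl_eq_zero ht r0 r1 r2 i |>.trans_eq' ?_).trans ?_
  · rw [add_sub_cancel]
  rw [Finset.sum_const, Finset.card_univ, Fintype.card_fin, nsmul_eq_mul]
  refine ENNReal.le_ofReal_iff_toReal_le ?_ (by positivity) |>.2 ?_
  · finiteness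
  · simp only [ENNReal.toReal_mul, ENNReal.coe_toReal, ENNReal.toReal_natCast,
      ENNReal.toReal_ofNat, NNReal.coe_mul, NNReal.coe_add, NNReal.coe_one, NNReal.coe_ofNat,
      Real.coe_toNNReal _ hD.le]
    push_cast
    have := C.coe_nonneg
    nlinarith [mul_nonneg this hD.le]
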